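/- Let $k$ be a field with $\operatorname{char} k\ne 2$ and let $B$ be a smooth integral $k$-scheme of dimension $n$ (any $n$), with line bundles $\mathscr L,\mathscr D$ and a section $\sigma$ of $\mathscr D$ whose zero locus is a non-empty smooth divisor. A Weierstrass model $y^2+a_1xy+a_3y=x^3+a_2x^2+a_4x+a_6$, with $a_p\in H^0(B,\mathscr L^p)$, is in a Tate form over $\sigma=0$ if $a_p=\sigma^{m_p}a_{p,m_p}$ with $a_{p,m_p}\in H^0(B,\mathscr L^p\otimes\mathscr D^{-m_p})$, where $(m_1,m_2,m_3,m_4,m_6)$ is one of the rows of the Tate table: $I_0:(0,0,0,0,0)$; $I_1:(0,0,1,1,1)$; $I_2:(0,0,1,1,2)$; $I_{2r}^{ns}:(0,0,r,r,2r)$ and $I_{2r+1}^{ns}:(0,0,r+1,r+1,2r+1)$, $r\ge1$; $I_{2r}^{s}:(0,1,r,r,2r)$, $r\ge 2$; $I_{2r+1}^{s}:(0,1,r,r+1,2r+1)$, $r\ge1$; $II:(1,1,1,1,1)$; $III:(1,1,1,1,2)$; $IV^{ns}:(1,1,1,2,2)$; $IV^{s}:(1,1,1,2,3)$; $I_0^{*ns}:(1,1,2,2,3)$;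 $I_0^{*ss},I_0^{*s}:(1,1,2,2,4)$; $I_{2r-3}^{*ns}:(1,1,r,r+1,2r)$, $I_{2r-3}^{*s}:(1,1,r,r+1,2r+1)$, $I_{2r-2}^{*ns},I_{2r-2}^{*s}:(1,1,r+1,r+1,2r+1)$, $r\ge2$; $IV^{*ns}:(1,2,2,3,4)$; $IV^{*s}:(1,2,2,3,5)$; $III^*:(1,2,3,3,5)$; $II^*:(1,2,3,4,5)$; non-minimal: $(1,2,3,4,6)$. The unitary forms are $I_N^{s}$, $N\ge3$ (group $SU(N)$). These are exactly the rows with $m_1=0$ and $m_2\ge1$. The Donagi–Wijnholt (DW) family is $(a_1,a_2,\epsilon a_3,\epsilon a_4,\epsilon^2a_6)$; the orthogonal family is $(\epsilon a_1,a_2,\epsilon a_3,\epsilon a_4,\epsilon^2a_6)$. With $b_2=a_1^2+4a_2$, $b_4=a_1a_3+2a_4$, $b_6=a_3^2+4a_6$, a family is a weak coupling limit with limiting data $(h,\eta,\chi)$ if $b_2=h+O(\epsilon)$, $b_4=\epsilon\eta+O(\epsilon^2)$, $b_6=\epsilon^2\chi+O(\epsilon^3)$; its orientifold is the double cover $\xi^2=h$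 of $B$, with involution $\xi\mapsto-\xi$. (1) For every Tate form, the DW family has limiting data $(a_1^2+4a_2,\ a_1a_3+2a_4,\ a_3^2+4a_6)$ and the orthogonal family has limiting data $(4a_2,\ 2a_4,\ a_3^2+4a_6)$; for the orthogonal family the discriminant satisfies $4\Delta=-\epsilon^2h^2(h\chi-\eta^2)+O(\epsilon^3)$ with $h=4a_2$, $\eta=2a_4$, $\chi=a_3^2+4a_6$. (2) (Comparison.) For each type of Tate form, the limiting data of every orthogonal limit are those of the DW limit of some Tate form of the same type. The limiting data of the DW limit of a given Tate form are those of the orthogonal limit of some Tate form of the same type, except when the type is unitary and $\sigma\nmid a_1$. Thus the two limits differ only for the $SU(N)$ forms $I_N^s$. For these, $\sigma$ divides the DW branch section $h$ if and only if $\sigma\mid a_1$. (3) (Unitary forms.) Let the type be unitary, so $a_2=\sigma a_{2,1}$. The DW and orthogonal double covers are $\xi^2=a_1^2+4\sigma a_{2,1}$ and $\xi^2=4\sigma a_{2,1}$; both exist. (a) If $a_1,\sigma,a_{2,1}$ have linearly independent differentials at all their common zeros, then every point of the DW cover over $a_1=\sigma=a_{2,1}=0$ is a conifold point, i.e. the cover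 is locally the hypersurface $t^2=y^2+xz$ in a smooth variety with $t,y,x,z$ part of a system of local coordinates. (b) Suppose that $a_{2,1}=0$ is a smooth divisor and meets $\sigma=0$ transversally. Let $X$ be the orthogonal double cover $\xi^2=4\sigma a_{2,1}$. Then $X$ is integral, its non-smooth locus is exactly $\xi=\sigma=a_{2,1}=0$, and each point of it is a quadric cone singularity, i.e. $X$ is locally the hypersurface $t^2=xy$ in a smooth variety with $t,x,y$ part of a system of local coordinates. (c) In the situation of (b), let $\pi:\tilde B\to B$ be the blow-up of $B$ along $\{\sigma=a_{2,1}=0\}$. There is a crepant resolution $\mu:\tilde X\to X$ (proper, $\tilde X$ smooth and integral, $\mu$ an isomorphism over the smooth locus of $X$, the canonical sheaf of $X$ invertible and $K_{\tilde X}=\mu^*K_X$), an involution of $\tilde X$ that $\mu$ carries to $\xi\mapsto-\xi$, and an invariant morphism $\tilde\rho:\tilde X\to\tilde B$ lying over $X\to B$. The morphism $\tilde\rho$ is the double cover $\tilde\xi^2=4sa$ branched along the proper transform of the branch divisor, where locally $\sigma=ws$, $a_{2,1}=wa$, $\xi=w\tilde\xi$, with $w$ an equation of the exceptional divisor and $s,a$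 without common zero; the involution is $\tilde\xi\mapsto-\tilde\xi$. Moreover $\tilde X$ is the normalization of $X\times_B\tilde B$. -/

import Mathlib

open CategoryTheory CategoryTheory.Limits AlgebraicGeometry TopologicalSpace
open scoped TensorProduct

universe u

noncomputable section

namespace WeakCoupling

/-! ### Local notions on schemes over a field -/

/-- Restriction of sections of the structure sheaf. -/
def res {X : Scheme.{u}} {V W : X.Opens} (h : W ≤ V) : Γ(X, V) →+* Γ(X, W) :=
  (X.presheaf.map (homOfLE h).op).hom

/-- The constants: for a scheme over `Spec k`, the structure map `k → Γ(X, V)`. -/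
def constants {k : Type u} [Field k] {X : Scheme.{u}} (f : X ⟶ Spec (.of k)) (V : X.Opens) :
    k →+* Γ(X, V) :=
  (f.appLE ⊤ V le_top).hom.comp (Scheme.ΓSpecIso (.of k)).inv.hom

/-- The `k`-algebra structure on sections of a scheme over `Spec k`. -/
@[reducible]
def sectionsAlgebra {k : Type u} [Field k] {X : Scheme.{u}} (f : X ⟶ Spec (.of k))
    (V : X.Opens) : Algebra k Γ(X, V) :=
  (constants f V).toAlgebra

/-- The functions `s 0, …, s (m-1)` all vanish at the prime `q` and their differentials
are linearly independent in the fibre `κ(q) ⊗ Ω_{S/k}` of the cotangent module at `q`. For `S` smooth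
over `k` this says that they are part of a system of local coordinates centred at `q`. -/
def IsPartOfCoordinates (k : Type u) [Field k] {S : Type u} [CommRing S] [Algebra k S]
    (q : Ideal S) [q.IsPrime] {m : ℕ} (s : Fin m → S) : Prop :=
  (∀ j, s j ∈ q) ∧
    LinearIndependent q.ResidueField
      (fun j => (1 : q.ResidueField) ⊗ₜ[S] (KaehlerDifferential.D k S (s j) : Ω[S⁄k]))

/-- The scheme `X` over `k` is smooth at `x`. -/
def SmoothAt {k : Type u} [Field k] {X : Scheme.{u}} (f : X ⟶ Spec (.of k)) (x : X) : Prop :=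
  ∃ V : X.Opens, x ∈ V ∧ Smooth (V.ι ≫ f)

/-- Near `x` the scheme `X` is the hypersurface `F = 0` in a smooth affine `k`-scheme `Spec S`, where
`F` is the value of the polynomial expression `eqn` at functions `s 0, …, s (m-1)` on `Spec S` which
are part of a system of local coordinates centred at `x`. -/
def HasHypersurfaceForm {k : Type u} [Field k] {X : Scheme.{u}} (f : X ⟶ Spec (.of k)) (x : X)
    {m : ℕ} (eqn : ∀ (S : Type u) [CommRing S], (Fin m → S) → S) : Prop :=
  ∃ (V : X.Opens) (hV : IsAffineOpen V) (hx : x ∈ V)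
    (S : Type u) (_ : CommRing S) (_ : Algebra k S) (φ : S →+* Γ(X, V)) (s : Fin m → S),
    Algebra.Smooth k S ∧
    φ.comp (algebraMap k S) = constants f V ∧
    Function.Surjective φ ∧
    RingHom.ker φ = Ideal.span {eqn S s} ∧
    IsPartOfCoordinates k ((hV.primeIdealOf ⟨x, hx⟩).asIdeal.comap φ) s

/-- Quadric cone singularity: `t ^ 2 = x y` in local coordinates `t, x, y, …`. -/
def IsQuadricCone {k : Type u} [Field k] {X : Scheme.{u}} (f : X ⟶ Spec (.of k)) (x : X) : Prop :=
  HasHypersurfaceForm f x (m := 3) (fun _ _ s => s 0 ^ 2 - s 1 * s 2)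

/-- Conifold singularity: `t ^ 2 = y ^ 2 + x z` in local coordinates `t, y, x, z, …`. -/
def IsConifold {k : Type u} [Field k] {X : Scheme.{u}} (f : X ⟶ Spec (.of k)) (x : X) : Prop :=
  HasHypersurfaceForm f x (m := 4) (fun _ _ s => s 0 ^ 2 - (s 1 ^ 2 + s 2 * s 3))

/-! ### Resolutions, canonical sheaves and crepancy -/

/-- `μ : Y ⟶ X` is a resolution of singularities of the `k`-scheme `X`: it is proper, `Y` is smooth, and
`μ` is an isomorphism over the smooth locus of `X`, which is dense. -/
def IsResolution {k : Type u} [Field k] {X Y : Scheme.{u}} (f : X ⟶ Spec (.of k))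
    (μ : Y ⟶ X) : Prop :=
  IsProper μ ∧ Smooth (μ ≫ f) ∧
    ∃ W : X.Opens, (∀ x, x ∈ W ↔ SmoothAt f x) ∧ Dense (W : Set X) ∧ IsIso (μ ∣_ W)

/-- The `k`-algebra structure on the function field of an integral scheme over `Spec k`. -/
@[reducible]
def functionFieldAlgebra {k : Type u} [Field k] {Y : Scheme.{u}} [IsIntegral Y]
    (f : Y ⟶ Spec (.of k)) : Algebra k Y.functionField :=
  ((Y.presheaf.germ ⊤ (genericPoint Y) trivial).hom.comp (constants f ⊤)).toAlgebra

/-- The rational differential forms of degree `n` on an integral scheme over `Spec k`. -/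
abbrev RationalForms {k : Type u} [Field k] (n : ℕ) {Y : Scheme.{u}} [IsIntegral Y]
    (f : Y ⟶ Spec (.of k)) : Type u :=
  letI := functionFieldAlgebra f
  ⋀[Y.functionField]^n Ω[Y.functionField⁄k]

/-- For `μ : Y ⟶ X` with `Y` integral and a point `z` of `X` that is a specialization of the image of the
generic point of `Y`: the image of the local ring of `X` at `z` in the function field of `Y`. -/
def localRingIn {X Y : Scheme.{u}} [IsIntegral Y] (μ : Y ⟶ X) (z : X)
    (h : μ (genericPoint Y) ⤳ z) : Subring Y.functionField :=
  ((μ.stalkMap (genericPoint Y)).hom.comp (X.presheaf.stalkSpecializes h).hom).range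

/-- For a subring `A` of the function field: the rational `n`-forms that are `A`-linear combinations of
forms `da₁ ∧ … ∧ daₙ` with all `aⱼ` in `A`, i.e. the image of `⋀ⁿ Ω_{A/k}`. -/
def formLattice {k : Type u} [Field k] (n : ℕ) {Y : Scheme.{u}} [IsIntegral Y]
    (f : Y ⟶ Spec (.of k)) (A : Subring Y.functionField) :
    Submodule A (RationalForms n f) :=
  letI := functionFieldAlgebra f
  Submodule.span A
    {ω | ∃ a : Fin n → Y.functionField, (∀ j, a j ∈ A) ∧
      ω = exteriorPower.ιMulti Y.functionField n
        (fun j => (KaehlerDifferential.D k Y.functionField (a j) : Ω[Y.functionField⁄k]))}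

/-- The stalk at `x` of the canonical sheaf of `X` (the push-forward to `X` of the sheaf of `n`-forms on the
smooth locus of `X`), for `μ : Y ⟶ X` dominant, seen inside the rational `n`-forms on `Y` by pulling back:
the forms that are regular at all smooth generizations `z` of `x`. -/
def canonicalStalk {k : Type u} [Field k] (n : ℕ) {X Y : Scheme.{u}} [IsIntegral Y]
    (f : X ⟶ Spec (.of k)) (μ : Y ⟶ X) (hμ : ∀ z, μ (genericPoint Y) ⤳ z) (x : X) :
    Set (RationalForms n (μ ≫ f)) :=
  {ω | ∀ z : X, z ⤳ x → SmoothAt f z → ω ∈ formLattice n (μ ≫ f) (localRingIn μ z (hμ z))}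

/-- `μ : Y ⟶ X`, a dominant (in practice birational) morphism of `n`-dimensional `k`-schemes, is crepant:
near every point of `Y` the canonical sheaf of `X` is generated by one form `θ` whose pull-back
generates the canonical sheaf of `Y`. That is, the canonical sheaf of `X` is invertible and
`K_Y = μ^* K_X`. -/
def IsCrepant {k : Type u} [Field k] (n : ℕ) {X Y : Scheme.{u}} [IsIntegral Y]
    (f : X ⟶ Spec (.of k)) (μ : Y ⟶ X) : Prop :=
  ∃ hμ : ∀ z, μ (genericPoint Y) ⤳ z,
    ∀ y : Y, ∃ θ : RationalForms n (μ ≫ f),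
      (∀ ω, ω ∈ canonicalStalk n f μ hμ (μ y) ↔
        ∃ c ∈ localRingIn μ (μ y) (hμ _), ω = c • θ) ∧
      (∀ ω : RationalForms n (μ ≫ f),
        (∀ z : Y, z ⤳ y → SmoothAt (μ ≫ f) z →
          ω ∈ formLattice n (μ ≫ f)
            (localRingIn (𝟙 Y) z (genericPoint_specializes z))) ↔
        ∃ c ∈ localRingIn (𝟙 Y) y (genericPoint_specializes y), ω = c • θ)

/-! ### Blow-ups -/

/-- For a closed subscheme of `B` given by ideals `J i` on the members `U i` of an affine open cover, the
inverse image ideal under `f : T ⟶ B` is invertible (locally generated by one non-zero-divisor). -/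
def InvertsIdeal {B T : Scheme.{u}} {I : Type u} {U : I → B.Opens}
    (J : ∀ i, Ideal Γ(B, U i)) (f : T ⟶ B) : Prop :=
  ∀ t : T, ∃ (i : I) (V : T.Opens) (e : V ≤ f ⁻¹ᵁ U i), t ∈ V ∧ IsAffineOpen V ∧
    ∃ w ∈ nonZeroDivisors Γ(T, V), (J i).map (f.appLE (U i) V e).hom = Ideal.span {w}

/-- `π : B' ⟶ B` is the blow-up of `B` along the closed subscheme given locally by the ideals `J i`. -/
def IsBlowup {B B' : Scheme.{u}} {I : Type u} {U : I → B.Opens}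
    (J : ∀ i, Ideal Γ(B, U i)) (π : B' ⟶ B) : Prop :=
  InvertsIdeal J π ∧
    ∀ (T : Scheme.{u}) (f : T ⟶ B), InvertsIdeal J f → ∃! g : T ⟶ B', g ≫ π = f

/-! ### The base, its line bundles and sections -/

/-- A line bundle trivialized on the cover `U`, given by its transition functions. -/
structure Cocycle {B : Scheme.{u}} {I : Type u} (U : I → B.Opens) where
  /-- The transition functions. -/
  tr : ∀ i j, (Γ(B, U i ⊓ U j))ˣ
  cocycle : ∀ i j l,
    res (W := U i ⊓ U j ⊓ U l) inf_le_left (tr i j : Γ(B, U i ⊓ U j)) *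
      res (W := U i ⊓ U j ⊓ U l) (inf_le_inf_right _ inf_le_right)
        (tr j l : Γ(B, U j ⊓ U l)) =
    res (W := U i ⊓ U j ⊓ U l) (inf_le_inf_right _ inf_le_left) (tr i l : Γ(B, U i ⊓ U l))

/-- The local functions `s i` form a section of `L ^ p ⊗ M ^ q`. -/
def IsSection {B : Scheme.{u}} {I : Type u} {U : I → B.Opens} (L M : Cocycle U) (p q : ℤ)
    (s : ∀ i, Γ(B, U i)) : Prop :=
  ∀ i j, res (W := U i ⊓ U j) inf_le_left (s i) =
    ((L.tr i j ^ p * M.tr i j ^ q : (Γ(B, U i ⊓ U j))ˣ) : Γ(B, U i ⊓ U j)) *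
      res (W := U i ⊓ U j) inf_le_right (s j)

/-- At every common zero of the functions `s 0, …, s (m-1)` on the affine open `U`, they are part of a
system of local coordinates: for `m = 1` the divisor `s 0 = 0` is smooth, for `m = 2` the divisors
`s 0 = 0` and `s 1 = 0` meet transversally, and so on. -/
def IsTransversal {k : Type u} [Field k] {B : Scheme.{u}} (f : B ⟶ Spec (.of k)) (U : B.Opens)
    {m : ℕ} (s : Fin m → Γ(B, U)) : Prop :=
  letI := sectionsAlgebra f U
  ∀ (q : Ideal Γ(B, U)) [q.IsPrime], (∀ j, s j ∈ q) → IsPartOfCoordinates k q s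

/-- A smooth `n`-dimensional base `B` over `k` with two line bundles `L` (of the Weierstrass model) and
`D`, trivialized on a common affine open cover `U`, and a section `σ` of `D` that defines a non-empty smooth
divisor. -/
structure Base (k : Type u) [Field k] (n : ℕ) where
  /-- The base. -/
  B : Scheme.{u}
  /-- Its structure morphism. -/
  str : B ⟶ Spec (.of k)
  integral : IsIntegral B
  smooth : SmoothOfRelativeDimension n str
  /-- The index set of the cover. -/
  I : Type u
  /-- The cover. -/
  U : I → B.Opens
  affine : ∀ i, IsAffineOpen (U i)
  covers : ⨆ i, U i = ⊤
  /-- The line bundle of the Weierstrass model. -/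
  L : Cocycle U
  /-- The line bundle of the divisor. -/
  D : Cocycle U
  /-- The equation of the divisor. -/
  σ : ∀ i, Γ(B, U i)
  σ_section : IsSection L D 0 1 σ
  σ_smooth : ∀ i, IsTransversal str (U i) ![σ i]
  σ_nonempty : ∃ i, ∃ p ∈ U i, p ∉ B.basicOpen (σ i)

/-! ### Tate forms -/

/-- The Tate forms, labelled by the Kodaira type of the generic fibre over `σ = 0`
(`s`/`ns`/`ss` for split, non-split, semi-split). -/
inductive TateType
  | I0 | I1 | I2
  | InsEven (k : ℕ) (hk : 1 ≤ k)
  | IsEven (k : ℕ) (hk : 2 ≤ k)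
  | InsOdd (k : ℕ) (hk : 1 ≤ k)
  | IsOdd (k : ℕ) (hk : 1 ≤ k)
  | II | III | IVns | IVs
  | I0Starns | I0Starss | I0Stars
  | IStarOddns (k : ℕ) (hk : 2 ≤ k)
  | IStarOdds (k : ℕ) (hk : 2 ≤ k)
  | IStarEvenns (k : ℕ) (hk : 2 ≤ k)
  | IStarEvens (k : ℕ) (hk : 2 ≤ k)
  | IVStarns | IVStars | IIIStar | IIStar
  | nonMin

/-- Vanishing multiplicities along `σ = 0` of the Weierstrass coefficients `a₁, a₂, a₃, a₄, a₆`. -/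
structure Multiplicities where
  /-- multiplicity of `a₁` -/
  m1 : ℕ
  /-- multiplicity of `a₂` -/
  m2 : ℕ
  /-- multiplicity of `a₃` -/
  m3 : ℕ
  /-- multiplicity of `a₄` -/
  m4 : ℕ
  /-- multiplicity of `a₆` -/
  m6 : ℕ

/-- The table of Tate forms. -/
def TateType.mult : TateType → Multiplicities
  | .I0 => ⟨0, 0, 0, 0, 0⟩
  | .I1 => ⟨0, 0, 1, 1, 1⟩
  | .I2 => ⟨0, 0, 1, 1, 2⟩
  | .InsEven k _ => ⟨0, 0, k, k, 2 * k⟩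
  | .IsEven k _ => ⟨0, 1, k, k, 2 * k⟩
  | .InsOdd k _ => ⟨0, 0, k + 1, k + 1, 2 * k + 1⟩
  | .IsOdd k _ => ⟨0, 1, k, k + 1, 2 * k + 1⟩
  | .II => ⟨1, 1, 1, 1, 1⟩
  | .III => ⟨1, 1, 1, 1, 2⟩
  | .IVns => ⟨1, 1, 1, 2, 2⟩
  | .IVs => ⟨1, 1, 1, 2, 3⟩
  | .I0Starns => ⟨1, 1, 2, 2, 3⟩
  | .I0Starss => ⟨1, 1, 2, 2, 4⟩
  | .I0Stars => ⟨1, 1, 2, 2, 4⟩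
  | .IStarOddns k _ => ⟨1, 1, k, k + 1, 2 * k⟩
  | .IStarOdds k _ => ⟨1, 1, k, k + 1, 2 * k + 1⟩
  | .IStarEvenns k _ => ⟨1, 1, k + 1, k + 1, 2 * k + 1⟩
  | .IStarEvens k _ => ⟨1, 1, k + 1, k + 1, 2 * k + 1⟩
  | .IVStarns => ⟨1, 2, 2, 3, 4⟩
  | .IVStars => ⟨1, 2, 2, 3, 5⟩
  | .IIIStar => ⟨1, 2, 3, 3, 5⟩
  | .IIStar => ⟨1, 2, 3, 4, 5⟩
  | .nonMin => ⟨1, 2, 3, 4, 6⟩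

/-- The unitary Tate forms: split fibres `I_N`, `N ≥ 3`, with gauge group `SU(N)`. -/
def TateType.IsUnitary : TateType → Prop
  | .IsEven _ _ => True
  | .IsOdd _ _ => True
  | _ => False

/-- A Weierstrass model over the base in the Tate form of type `T`: the coefficient `a_p`, a section of
`L ^ p`, is `σ ^ {m_p} c_p` with `c_p = a_{p,m_p}` a section of `L ^ p ⊗ D ^ {-m_p}`. -/
structure TateForm {k : Type u} [Field k] {n : ℕ} (S : Base k n) (T : TateType) where
  /-- `a_{1,m₁}` -/
  c1 : ∀ i, Γ(S.B, S.U i)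
  /-- `a_{2,m₂}` -/
  c2 : ∀ i, Γ(S.B, S.U i)
  /-- `a_{3,m₃}` -/
  c3 : ∀ i, Γ(S.B, S.U i)
  /-- `a_{4,m₄}` -/
  c4 : ∀ i, Γ(S.B, S.U i)
  /-- `a_{6,m₆}` -/
  c6 : ∀ i, Γ(S.B, S.U i)
  sec1 : IsSection S.L S.D 1 (-(T.mult.m1 : ℤ)) c1
  sec2 : IsSection S.L S.D 2 (-(T.mult.m2 : ℤ)) c2
  sec3 : IsSection S.L S.D 3 (-(T.mult.m3 : ℤ)) c3
  sec4 : IsSection S.L S.D 4 (-(T.mult.m4 : ℤ)) c4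
  sec6 : IsSection S.L S.D 6 (-(T.mult.m6 : ℤ)) c6

namespace TateForm

variable {k : Type u} [Field k] {n : ℕ} {S : Base k n} {T : TateType} (F : TateForm S T)

/-- The Weierstrass coefficient `a₁`. -/
def a1 (i : S.I) : Γ(S.B, S.U i) := S.σ i ^ T.mult.m1 * F.c1 i
/-- The Weierstrass coefficient `a₂`. -/
def a2 (i : S.I) : Γ(S.B, S.U i) := S.σ i ^ T.mult.m2 * F.c2 i
/-- The Weierstrass coefficient `a₃`. -/
def a3 (i : S.I) : Γ(S.B, S.U i) := S.σ i ^ T.mult.m3 * F.c3 i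
/-- The Weierstrass coefficient `a₄`. -/
def a4 (i : S.I) : Γ(S.B, S.U i) := S.σ i ^ T.mult.m4 * F.c4 i
/-- The Weierstrass coefficient `a₆`. -/
def a6 (i : S.I) : Γ(S.B, S.U i) := S.σ i ^ T.mult.m6 * F.c6 i

open Polynomial in
/-- The Donagi–Wijnholt family `a₃ → ε a₃, a₄ → ε a₄, a₆ → ε² a₆`; the variable `X` is `ε`. -/
def dwFamily (i : S.I) : WeierstrassCurve (Polynomial Γ(S.B, S.U i)) where
  a₁ := C (F.a1 i)
  a₂ := C (F.a2 i)
  a₃ := X * C (F.a3 i)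
  a₄ := X * C (F.a4 i)
  a₆ := X ^ 2 * C (F.a6 i)

open Polynomial in
/-- The orthogonal family: the Donagi–Wijnholt family with, in addition, `a₁ → ε a₁`. -/
def orthFamily (i : S.I) : WeierstrassCurve (Polynomial Γ(S.B, S.U i)) where
  a₁ := X * C (F.a1 i)
  a₂ := C (F.a2 i)
  a₃ := X * C (F.a3 i)
  a₄ := X * C (F.a4 i)
  a₆ := X ^ 2 * C (F.a6 i)

end TateForm

/-- A family of Weierstrass curves with parameter `ε` is in Sen's weak coupling form, with limiting data
`(h, η, χ)`: `b₂ = h + O(ε)`, `b₄ = ε η + O(ε²)`, `b₆ = ε² χ + O(ε³)`. -/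
def IsSenLimit {R : Type u} [CommRing R] (W : WeierstrassCurve (Polynomial R)) (h η χ : R) : Prop :=
  W.b₂.coeff 0 = h ∧
  W.b₄.coeff 0 = 0 ∧ W.b₄.coeff 1 = η ∧
  W.b₆.coeff 0 = 0 ∧ W.b₆.coeff 1 = 0 ∧ W.b₆.coeff 2 = χ

/-- Two families over the base have the same weak coupling limit: they have the same limiting data. -/
def SameLimit {k : Type u} [Field k] {n : ℕ} {S : Base k n}
    (W W' : ∀ i, WeierstrassCurve (Polynomial Γ(S.B, S.U i))) : Prop :=
  ∀ i, ∃ h η χ, IsSenLimit (W i) h η χ ∧ IsSenLimit (W' i) h η χ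

/-! ### Double covers -/

/-- Over the affine open `V`, the morphism `ρ` is the double cover `ξ ^ 2 = h`: it is affine, and the
functions upstairs are free over those downstairs with basis `1, ξ`. -/
def IsLocalDoubleCover {X B : Scheme.{u}} (ρ : X ⟶ B) (V : B.Opens) (h : Γ(B, V))
    (ξ : Γ(X, ρ ⁻¹ᵁ V)) : Prop :=
  IsAffineOpen V ∧ IsAffineOpen (ρ ⁻¹ᵁ V) ∧ ξ ^ 2 = ρ.app V h ∧
    ∀ y : Γ(X, ρ ⁻¹ᵁ V), ∃! p : Γ(B, V) × Γ(B, V), y = ρ.app V p.1 + ρ.app V p.2 * ξ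

/-- The double cover `ξ ^ 2 = h` of the base, `ξ` a section of `L`, `h` a section of `L ^ 2`, with its
involution `ξ ↦ -ξ`. -/
structure DoubleCover {k : Type u} [Field k] {n : ℕ} (S : Base k n)
    (h : ∀ i, Γ(S.B, S.U i)) where
  /-- The total space. -/
  X : Scheme.{u}
  /-- The covering map. -/
  ρ : X ⟶ S.B
  /-- The coordinate. -/
  ξ : ∀ i, Γ(X, ρ ⁻¹ᵁ S.U i)
  isLocal : ∀ i, IsLocalDoubleCover ρ (S.U i) (h i) (ξ i)
  glue : ∀ i j, res (W := ρ ⁻¹ᵁ (S.U i ⊓ S.U j)) (ρ.preimage_mono inf_le_left) (ξ i) =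
    ρ.app _ (S.L.tr i j : Γ(S.B, S.U i ⊓ S.U j)) *
      res (W := ρ ⁻¹ᵁ (S.U i ⊓ S.U j)) (ρ.preimage_mono inf_le_right) (ξ j)
  /-- The involution. -/
  inv : X ⟶ X
  inv_ρ : inv ≫ ρ = ρ
  inv_ξ : ∀ i, ∃ e : ρ ⁻¹ᵁ S.U i ≤ inv ⁻¹ᵁ (ρ ⁻¹ᵁ S.U i),
    inv.appLE (ρ ⁻¹ᵁ S.U i) (ρ ⁻¹ᵁ S.U i) e (ξ i) = -ξ i

/-- The double cover as a scheme over `Spec k`. -/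
def DoubleCover.str {k : Type u} [Field k] {n : ℕ} {S : Base k n} {h : ∀ i, Γ(S.B, S.U i)}
    (C : DoubleCover S h) : C.X ⟶ Spec (.of k) :=
  C.ρ ≫ S.str

/-- The double cover `C` of the base, given by `ξ ^ 2 = 4 σ a`, has a crepant resolution compatible with
the involution and obtained by blowing up the base along `σ = a = 0`. -/
def HasAdmissibleCrepantResolution {k : Type u} [Field k] {n : ℕ} (S : Base k n)
    (a : ∀ i, Γ(S.B, S.U i)) (C : DoubleCover S (fun i => 4 * S.σ i * a i)) : Prop :=
  ∃ (B' X' : Scheme.{u}) (π : B' ⟶ S.B) (μ : X' ⟶ C.X) (ρ' : X' ⟶ B') (inv' : X' ⟶ X')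
    (_ : IsIntegral X') (sq : μ ≫ C.ρ = ρ' ≫ π),
    -- `π` is the blow-up of the base along `σ = a = 0`
    IsBlowup (fun i => Ideal.span {S.σ i, a i}) π ∧
    -- `μ` is a crepant resolution
    IsResolution C.str μ ∧
    IsCrepant n C.str μ ∧
    -- it is compatible with the involutions and the double cover structure
    inv' ≫ inv' = 𝟙 X' ∧ inv' ≫ μ = μ ≫ C.inv ∧ inv' ≫ ρ' = ρ' ∧
    -- `X'` is the double cover `ξ' ^ 2 = 4 s' a'` of `B'` branched along the proper transform
    -- of the branch divisor, where `σ = w s'`, `a = w a'`, `ξ = w ξ'`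
    -- with `w` an equation of the exceptional divisor
    (∀ b : B', ∃ (i : S.I) (V : B'.Opens) (e : V ≤ π ⁻¹ᵁ S.U i) (w s' a' : Γ(B', V))
      (ξ' : Γ(X', ρ' ⁻¹ᵁ V)), b ∈ V ∧ w ∈ nonZeroDivisors Γ(B', V) ∧
        π.appLE (S.U i) V e (S.σ i) = w * s' ∧ π.appLE (S.U i) V e (a i) = w * a' ∧
        Ideal.span {s', a'} = ⊤ ∧
        IsLocalDoubleCover ρ' V (4 * s' * a') ξ' ∧
        (∃ e' : ρ' ⁻¹ᵁ V ≤ μ ⁻¹ᵁ (C.ρ ⁻¹ᵁ S.U i),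
          μ.appLE (C.ρ ⁻¹ᵁ S.U i) (ρ' ⁻¹ᵁ V) e' (C.ξ i) = ρ'.app V w * ξ') ∧
        (∃ e' : ρ' ⁻¹ᵁ V ≤ inv' ⁻¹ᵁ (ρ' ⁻¹ᵁ V),
          inv'.appLE (ρ' ⁻¹ᵁ V) (ρ' ⁻¹ᵁ V) e' ξ' = -ξ')) ∧
    -- `X'` is the normalization of the fibre product (it is normal, being smooth): finite over
    -- it and isomorphic to it over a dense open subset
    IsFinite (pullback.lift μ ρ' sq) ∧
    ∃ W : (pullback C.ρ π).Opens, Dense (W : Set ↥(pullback C.ρ π)) ∧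
      IsIso (pullback.lift μ ρ' sq ∣_ W)

end WeakCoupling

end

noncomputable section

namespace WeakCoupling

/-! ### Smooth algebras over a field -/

/-! The limits are read off from `b₂`, `b₄`, `b₆` as polynomials in `ε`. Orthogonal data are the
Donagi–Wijnholt data of the same form with `a₁ = 0`. Conversely, completing the square (`a₂ +
a₁²/4`, `a₄ + a₁a₃/2`) turns Donagi–Wijnholt data into orthogonal data, provided `σ ^ m₂` divides
`a₁²` and `σ ^ m₄` divides `a₁a₃` (`exists_sameLimit_dw`). The table gives `m₂ ≤ 2m₁` and `m₄ ≤ m₁ +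
m₃` in every non-unitary row. In a unitary row both divisibilities follow from `σ ∣ a₁`. This
condition is also necessary there: an orthogonal `h` is divisible by `σ`, so `σ ∣ a₁²`, and the
smooth divisor `σ = 0` is reduced.

For the geometry write `a` for `a_{2,1}`. The resolution of `ξ² = 4σa` is the scheme of square roots
`t` of the rational section `a/σ`, with charts `σt² = a` (near `0`) and `σ = at²` (near `∞`), and
with `ξ = 2σt` or `ξ = 2at`. The blow-up of `B` along `σ = a = 0` is the same construction for first
roots `r = a/σ`, and `r = t²` is the double cover between the two. Both are models of
`TransversalSection.atlas`, glued once and for all by `exists_model`; morphisms into a model are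
given by local coordinates (`IsModel.exists_hom`). The maps `ρ'` and `μ`, the involution, the lift
over the smooth locus and the universal property of the blow-up all come from this description.

Smoothness is the Jacobian criterion `smooth_of_differential_ne_zero` applied to `2σt dt + t² dσ -
da`. Integrality needs `αX^e - β` to be prime: `(σ, a)` is a regular sequence, which replaces
Gauss's lemma, and `σa` is not a square because it has odd order along a component of `σ = 0`
(`sq_ne`). Properness is the valuative criterion: over a valuation ring either `t` or `1/t` is
integral. Away from `σ = a = 0` the coordinate is recovered as `t = ξ/2σ` or `t = ξ/2a` up to
inversion, so `μ` is an isomorphism there. Over `σ = a = 0` the differential of the equation of `X`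
vanishes, and `not_formallySmooth_of_differential_mem` excludes smoothness.

Crepancy rests on the form `θ = ξ⁻¹ dσ ∧ da ∧ dx₁ ∧ …`. It equals `dσ ∧ dt ∧ dx₁ ∧ …` in one chart
and `dt ∧ da ∧ dx₁ ∧ …` in the other, so it generates the canonical sheaf upstairs
(`exists_generator_of_singular`). It also generates at the smooth points of `X`, and a coefficient
regular at all smooth generizations of a point is regular at the point, since `σ, a` is a regular
sequence on `X` (`exists_mul_eq_of_forall_le`). -/

theorem isIntegral_tmul_of_pow_eq_zero {R A B : Type*} [CommRing R] [CommRing A] [CommRing B]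
    [Algebra R A] [Algebra R B] {a : A} (b : B) {n : ℕ} (h : a ^ n = 0) :
    _root_.IsIntegral A (a ⊗ₜ[R] b) := by
  refine IsIntegral.of_pow (n := n + 1) (Nat.succ_pos n) ?_
  rw [pow_succ, Algebra.TensorProduct.tmul_pow, h, TensorProduct.zero_tmul, zero_mul]
  exact isIntegral_zero

/-- This is the specialization at `X = 0`, by which a constant divisible by `X` in `S[X]` is seen to
be zero. -/
theorem polynomial_smul_tensor {k S : Type*} [CommRing k] [CommRing S] [Algebra k S]
    (f : Polynomial k ⊗[k] S →ₐ[k] S) (hf : ∀ (p : Polynomial k) (s : S), f (p ⊗ₜ s) =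
      p.eval 0 • s) (w : Polynomial k ⊗[k] S) :
    f ((Polynomial.X : Polynomial k) • w) = 0 := by
  induction w with
  | zero => simp
  | tmul p s => rw [TensorProduct.smul_tmul', hf]; simp
  | add x y hx hy => rw [smul_add, map_add, hx, hy, add_zero]

/-- A smooth algebra over a field is reduced. -/
theorem isReduced_of_smooth (k : Type*) [Field k] (S : Type*) [CommRing S] [Algebra k S]
    [Algebra.Smooth k S] : IsReduced S := by
  refine ⟨fun s hs ↦ ?_⟩
  -- After base change to `k[X]`, the nilpotent `s` divided by `X` is integral over `S[X]`. Integral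
  -- closure commutes with smooth base change and `k[X]` is integrally closed, so `s/X` lies in
  -- `S[X]`. Hence `s` is a multiple of `X`, and `X = 0` gives `s = 0`.
  let R := Polynomial k
  let S' := TensorProduct k R S
  let K := FractionRing R
  obtain ⟨n, hn⟩ := hs
  let x : K := algebraMap R K Polynomial.X
  have hx : x ≠ 0 := by
    simpa [x] using (IsFractionRing.injective R K).ne (Polynomial.X_ne_zero (R := k))
  let s' : S' := 1 ⊗ₜ s
  have hs' : s' ^ n = 0 := by
    change (Algebra.TensorProduct.includeRight (R := k) (A := R) s) ^ n = 0
    rw [← map_pow, hn, map_zero]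
  let y : TensorProduct R S' K := s' ⊗ₜ x⁻¹
  have hy : _root_.IsIntegral S' y := isIntegral_tmul_of_pow_eq_zero _ hs'
  obtain ⟨z, hz⟩ := (TensorProduct.toIntegralClosure_bijective_of_smooth
    (R := R) (S := S') (B := K)).2 ⟨y, hy⟩
  have hz' : ∃ w : S', w ⊗ₜ[R] (1 : K) = y := by
    have : ∀ z, ∃ w : S', w ⊗ₜ[R] (1 : K) =
        ((TensorProduct.toIntegralClosure R S' K z : integralClosure S' (S' ⊗[R] K)) :
          S' ⊗[R] K) := by
      intro z
      induction z with
      | zero => exact ⟨0, by simp⟩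
      | tmul w c =>
        obtain ⟨r, hr⟩ := (IsIntegrallyClosed.isIntegral_iff (R := R) (K := K)).mp c.2
        refine ⟨r • w, ?_⟩
        simp [TensorProduct.toIntegralClosure, TensorProduct.smul_tmul, ← hr,
          Algebra.smul_def]
      | add a b ha hb =>
        obtain ⟨w, hw⟩ := ha
        obtain ⟨w', hw'⟩ := hb
        exact ⟨w + w', by rw [map_add, TensorProduct.add_tmul, hw, hw']; rfl⟩
    obtain ⟨w, hw⟩ := this z
    exact ⟨w, by rw [hw, hz]⟩
  obtain ⟨w, hw⟩ := hz'
  have key : (Polynomial.X (R := k) • w) ⊗ₜ[R] (1 : K) = s' ⊗ₜ[R] (1 : K) := by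
    have := congrArg (fun t ↦ (Polynomial.X : R) • t) hw
    simp only [y, TensorProduct.smul_tmul', ] at this
    rw [this, TensorProduct.smul_tmul]
    congr 1
    rw [Algebra.smul_def]
    exact mul_inv_cancel₀ hx
  have hinj : Function.Injective (fun t : S' ↦ t ⊗ₜ[R] (1 : K)) :=
    Algebra.TensorProduct.includeLeft_injective (S := R) (IsFractionRing.injective R K)
  have h2 := hinj key
  have h3 : ∀ (p : Polynomial k) (t : S), (Algebra.TensorProduct.lift
      ((Algebra.ofId k S).comp (Polynomial.aeval (0 : k))) (AlgHom.id k S) (fun _ _ ↦ .all _ _))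
      (p ⊗ₜ t) = p.eval 0 • t := fun p t ↦ by
    simp [Algebra.smul_def, Algebra.ofId_apply, Polynomial.coe_aeval_eq_eval]
  have h4 := polynomial_smul_tensor _ h3 w
  have h5 : (Polynomial.X : Polynomial k) • w = (1 : Polynomial k) ⊗ₜ[k] s := h2
  rw [h5, h3] at h4
  simpa using h4

/-- A linear functional on the differentials with value `1` modulo `F` on `dF`. -/
theorem exists_functional_of_differential_ne_zero {k S : Type*} [CommRing k] [CommRing S]
    [Algebra k S] [Module.Projective S Ω[S⁄k]] [Module.Finite S Ω[S⁄k]] (F : S)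
    (hF : ∀ (Q : Ideal S) [Q.IsPrime], F ∈ Q →
      (1 : Q.ResidueField) ⊗ₜ[S] (KaehlerDifferential.D k S F : Ω[S⁄k]) ≠ 0) :
    ∃ (l : Ω[S⁄k] →ₗ[S] S) (c : S), l (KaehlerDifferential.D k S F) = 1 + F * c := by
  let ev : Module.Dual S Ω[S⁄k] →ₗ[S] S := Module.Dual.eval S _ (KaehlerDifferential.D k S F)
  -- Otherwise some maximal ideal `Q` contains `F` and all values of functionals at `dF`. Expanding
  -- `dF` in a dual basis of the finite projective module `Ω` puts it in `QΩ`, so it dies in the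
  -- fibre.
  have htop : LinearMap.range ev ⊔ Ideal.span {F} = ⊤ := by
    by_contra hne
    obtain ⟨Q, hQ, hle⟩ := Ideal.exists_le_maximal _ hne
    have := hQ.isPrime
    refine hF Q (hle (Ideal.mem_sup_right (Ideal.mem_span_singleton_self F))) ?_
    obtain ⟨n, f, g, -, -, hfg⟩ := Module.Finite.exists_comp_eq_id_of_projective S Ω[S⁄k]
    have hd : KaehlerDifferential.D k S F =
        ∑ i, (g (KaehlerDifferential.D k S F) i) • f (Pi.single i 1) := by
      conv_lhs => rw [← LinearMap.id_apply (R := S) (KaehlerDifferential.D k S F), ← hfg]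
      rw [LinearMap.comp_apply]
      conv_lhs => rw [pi_eq_sum_univ' (g (KaehlerDifferential.D k S F))]
      simp [map_sum]
    rw [hd, TensorProduct.tmul_sum]
    refine Finset.sum_eq_zero fun i _ ↦ ?_
    rw [← TensorProduct.smul_tmul, Algebra.smul_def, mul_one]
    have : g (KaehlerDifferential.D k S F) i ∈ Q :=
      hle (Ideal.mem_sup_left ⟨(LinearMap.proj i).comp g, rfl⟩)
    rw [Ideal.algebraMap_residueField_eq_zero.mpr this, TensorProduct.zero_tmul]
  obtain ⟨_, ⟨l, rfl⟩, y, hy, h⟩ := Submodule.mem_sup.mp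
    (htop ▸ Submodule.mem_top : (1 : S) ∈ LinearMap.range ev ⊔ Ideal.span {F})
  obtain ⟨c, rfl⟩ := Ideal.mem_span_singleton'.mp hy
  exact ⟨l, -c, by rw [← h]; change l _ = l _ + _ + _; ring⟩

/-- **Jacobian criterion** for a hypersurface `F = 0` in a smooth algebra. -/
theorem smooth_of_differential_ne_zero {k S R : Type*} [CommRing k] [CommRing S] [CommRing R]
    [Algebra k S] [Algebra k R] [Algebra S R] [IsScalarTower k S R] [Algebra.Smooth k S]
    (hsurj : Function.Surjective (algebraMap S R)) (F : S)
    (hker : RingHom.ker (algebraMap S R) = Ideal.span {F})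
    (hF : ∀ (Q : Ideal S) [Q.IsPrime], F ∈ Q →
      (1 : Q.ResidueField) ⊗ₜ[S] (KaehlerDifferential.D k S F : Ω[S⁄k]) ≠ 0) :
    Algebra.Smooth k R := by
  have hfp : Algebra.FinitePresentation k R :=
    Algebra.FinitePresentation.of_surjective (f := IsScalarTower.toAlgHom k S R) hsurj
      (by
        change (RingHom.ker (algebraMap S R)).FG
        rw [hker]; exact ⟨{F}, by simp⟩)
  refine ⟨?_, hfp⟩
  rw [Algebra.FormallySmooth.iff_split_injection hsurj]
  obtain ⟨l, c, hl⟩ := exists_functional_of_differential_ne_zero F hF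
  have hFm : F ∈ RingHom.ker (algebraMap S R) := by
    rw [hker]; exact Ideal.mem_span_singleton_self F
  let e : (RingHom.ker (algebraMap S R)).Cotangent :=
    (RingHom.ker (algebraMap S R)).toCotangent ⟨F, hFm⟩
  have hkill : ∀ s ∈ RingHom.ker (algebraMap S R), s • e = 0 := by
    intro s hs
    rw [← map_smul, Ideal.toCotangent_eq_zero]
    change s * F ∈ _
    rw [pow_two]
    exact Ideal.mul_mem_mul hs hFm
  let b : R →ₗ[S] (RingHom.ker (algebraMap S R)).Cotangent :=
    ((RingHom.ker (algebraMap S R)).liftQ (LinearMap.toSpanSingleton S _ e) hkill).comp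
      (LinearEquiv.symm (LinearEquiv.ofBijective
        ((RingHom.ker (algebraMap S R)).liftQ (Algebra.linearMap S R) (fun _ h ↦ h))
        ⟨by
          rw [← LinearMap.ker_eq_bot]
          exact Submodule.ker_liftQ_eq_bot _ _ _ (fun _ h ↦ h),
        fun r ↦ by
          obtain ⟨s, rfl⟩ := hsurj r
          exact ⟨Submodule.Quotient.mk s, rfl⟩⟩)).toLinearMap
  have hb : ∀ s, b (algebraMap S R s) = s • e := by
    intro s
    have : (LinearEquiv.symm (LinearEquiv.ofBijective
        ((RingHom.ker (algebraMap S R)).liftQ (Algebra.linearMap S R) (fun _ h ↦ h))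
        ⟨by
          rw [← LinearMap.ker_eq_bot]
          exact Submodule.ker_liftQ_eq_bot _ _ _ (fun _ h ↦ h),
        fun r ↦ by
          obtain ⟨s, rfl⟩ := hsurj r
          exact ⟨Submodule.Quotient.mk s, rfl⟩⟩)) (algebraMap S R s) =
          Submodule.Quotient.mk s := by
      rw [LinearEquiv.symm_apply_eq]
      rfl
    change (Submodule.liftQ _ _ hkill) (LinearEquiv.symm _ (algebraMap S R s)) = _
    rw [this]
    rfl
  -- This is the retraction of the conormal sequence. The conormal module is generated by the class
  -- `e` of `F`, and `l(dF) = 1 + Fc` acts as `1` on it because `F` kills `e`.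
  let L : R ⊗[S] Ω[S⁄k] →ₗ[S] (RingHom.ker (algebraMap S R)).Cotangent :=
    b.comp ((TensorProduct.rid S R).toLinearMap.comp (l.lTensor R))
  refine ⟨L, ?_⟩
  refine LinearMap.ext fun x ↦ ?_
  obtain ⟨⟨y, hy⟩, rfl⟩ := Ideal.toCotangent_surjective _ x
  obtain ⟨d, rfl⟩ := Ideal.mem_span_singleton'.mp (hker ▸ hy)
  have hx : (RingHom.ker (algebraMap S R)).toCotangent ⟨d * F, hy⟩ = d • e := by
    rw [← map_smul]; rfl
  rw [hx, map_smul, map_smul]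
  congr 1
  change L (KaehlerDifferential.kerCotangentToTensor k S R
    ((RingHom.ker (algebraMap S R)).toCotangent ⟨F, hFm⟩)) = e
  rw [KaehlerDifferential.kerCotangentToTensor_toCotangent]
  have : L (1 ⊗ₜ[S] KaehlerDifferential.D k S F) = b (algebraMap S R (1 + F * c)) := by
    change b (TensorProduct.rid S R (1 ⊗ₜ l _)) = _
    rw [hl, TensorProduct.rid_tmul, Algebra.smul_def, mul_one]
  rw [this, hb, add_smul, one_smul, mul_comm, mul_smul, hkill F hFm, smul_zero, add_zero]

/-- If a hypersurface `F = 0` in a smooth algebra is smooth and `dF` vanishes at a point of it, then `F`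
vanishes near this point. -/
theorem exists_mul_eq_zero_of_smooth {k S R : Type*} [CommRing k] [CommRing S] [CommRing R]
    [Algebra k S] [Algebra k R] [Algebra S R] [IsScalarTower k S R] [Algebra.FormallySmooth k S]
    [Algebra.FormallySmooth k R]
    (hsurj : Function.Surjective (algebraMap S R)) (F : S)
    (hker : RingHom.ker (algebraMap S R) = Ideal.span {F}) (Q : Ideal S) [Q.IsPrime]
    (hFQ : F ∈ Q) (hF : KaehlerDifferential.D k S F ∈ Q • (⊤ : Submodule S Ω[S⁄k])) :
    ∃ w ∉ Q, w * F = 0 := by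
  obtain ⟨l, hl⟩ := (Algebra.FormallySmooth.iff_split_injection (R := k) hsurj).mp inferInstance
  have hFm : F ∈ RingHom.ker (algebraMap S R) := by
    rw [hker]; exact Ideal.mem_span_singleton_self F
  let e : (RingHom.ker (algebraMap S R)).Cotangent :=
    (RingHom.ker (algebraMap S R)).toCotangent ⟨F, hFm⟩
  have hgen : ∀ x : (RingHom.ker (algebraMap S R)).Cotangent, ∃ d : S, x = d • e := by
    intro x
    obtain ⟨⟨y, hy⟩, rfl⟩ := Ideal.toCotangent_surjective _ x
    obtain ⟨d, rfl⟩ := Ideal.mem_span_singleton'.mp (hker ▸ hy)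
    exact ⟨d, by rw [← map_smul]; rfl⟩
  have he : l (1 ⊗ₜ KaehlerDifferential.D k S F) = e := by
    have := LinearMap.congr_fun hl e
    rwa [LinearMap.comp_apply, KaehlerDifferential.kerCotangentToTensor_toCotangent] at this
  -- The retraction sends `QΩ` into `Qe`, so `dF ∈ QΩ` gives `e = qe` with `q ∈ Q`, that is, `(1 -
  -- q)F ∈ (F²)`.
  have hq : ∀ ω ∈ Q • (⊤ : Submodule S Ω[S⁄k]), ∃ q ∈ Q, l (1 ⊗ₜ ω) = q • e := by
    intro ω hω
    induction hω using Submodule.smul_induction_on' with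
    | smul r hr n _ =>
      obtain ⟨d, hd⟩ := hgen (l (1 ⊗ₜ n))
      exact ⟨r * d, Q.mul_mem_right _ hr, by
        rw [TensorProduct.tmul_smul, map_smul, hd, mul_smul]⟩
    | add x _ y _ hx hy =>
      obtain ⟨q, hq, h⟩ := hx
      obtain ⟨q', hq', h'⟩ := hy
      exact ⟨q + q', Q.add_mem hq hq', by rw [TensorProduct.tmul_add, map_add, h, h', add_smul]⟩
  obtain ⟨q, hqQ, hqe⟩ := hq _ hF
  rw [he] at hqe
  have h0 : (1 - q) • e = 0 := by rw [sub_smul, one_smul, ← hqe, sub_self]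
  rw [← map_smul, Ideal.toCotangent_eq_zero] at h0
  have h0 : (1 - q) * F ∈ (RingHom.ker (algebraMap S R)) ^ 2 := h0
  rw [hker, Ideal.span_singleton_pow] at h0
  obtain ⟨c, hc⟩ := Ideal.mem_span_singleton'.mp h0
  -- Here `(1 - q)F = cF²`, and the witness is congruent to `1` modulo `Q` because `q` and `F` lie
  -- in `Q`.
  refine ⟨1 - q - c * F, fun hw ↦ ?_, by linear_combination -hc⟩
  refine (Ideal.ne_top_iff_one Q).mp Ideal.IsPrime.ne_top' ?_
  have := Q.add_mem hw (Q.add_mem hqQ (Q.mul_mem_left c hFQ))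
  ring_nf at this
  simpa using this

/-! ### Linear independence of differentials -/

theorem tmul_smul_residueField {S : Type*} [CommRing S] {Q : Ideal S} [Q.IsPrime] {M : Type*}
    [AddCommGroup M] [Module S M] (s : S) (ω : M) :
    (1 : Q.ResidueField) ⊗ₜ[S] (s • ω) = algebraMap S Q.ResidueField s • (1 ⊗ₜ[S] ω) := by
  rw [TensorProduct.tmul_smul, TensorProduct.smul_tmul', TensorProduct.smul_tmul',
    Algebra.smul_def, smul_eq_mul]

/-- In a reduced quotient `A / σ`, elements of a minimal prime of `σ` are locally multiples of `σ`. -/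
theorem exists_mul_mem_span_of_mem_minimalPrimes {A : Type*} [CommRing A] (σ : A)
    [IsReduced (A ⧸ Ideal.span {σ})] {P : Ideal A} (hP : P ∈ (Ideal.span {σ}).minimalPrimes)
    {c : A} (hc : c ∈ P) : ∃ v ∉ P, σ ∣ v * c := by
  have := hP.1.1
  -- In the local ring at a minimal prime of `σ` the radical of `(σ)` is the maximal ideal, so some
  -- `v c ^ n` is a multiple of `σ` with `v ∉ P`. Then `v c` is nilpotent modulo `σ`, and
  -- reducedness removes the exponent.
  have h := IsLocalization.AtPrime.radical_map_of_mem_minimalPrimes (Localization.AtPrime P) P _ hP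
  have hcm : algebraMap A (Localization.AtPrime P) c ∈
      ((Ideal.span {σ}).map (algebraMap A (Localization.AtPrime P))).radical := by
    rw [h]
    exact Ideal.mem_map_of_mem _ hc
  obtain ⟨n, hn⟩ := hcm
  rw [← map_pow, IsLocalization.algebraMap_mem_map_algebraMap_iff P.primeCompl] at hn
  obtain ⟨v, hv, hvc⟩ := hn
  refine ⟨v, hv, ?_⟩
  rw [← Ideal.mem_span_singleton, ← Ideal.Quotient.eq_zero_iff_mem]
  refine IsReduced.eq_zero _ ⟨n + 1, ?_⟩
  rw [← map_pow, Ideal.Quotient.eq_zero_iff_mem, mul_pow,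
    show v ^ (n + 1) * c ^ (n + 1) = (v ^ n * c) * (v * c ^ n) by ring]
  exact Ideal.mul_mem_left _ _ hvc

/-- Two functions with independent differentials have no common factor at a point. -/
theorem not_dvd_of_linearIndependent {k A : Type*} [CommRing k] [CommRing A] [Algebra k A]
    (P : Ideal A) [P.IsPrime] {σ a : A} (hσ : σ ∈ P) (ha : a ∈ P)
    (hli : LinearIndependent P.ResidueField
      (fun j ↦ (1 : P.ResidueField) ⊗ₜ[A] (KaehlerDifferential.D k A (![σ, a] j) : Ω[A⁄k])))
    {v : A} (hv : v ∉ P) : ¬ σ ∣ v * a := by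
  rintro ⟨u, hu⟩
  -- Differentiating `va = σu` at `P`, where `σ` and `a` vanish, gives the linear relation `v da = u
  -- dσ`.
  have h1 := congrArg (fun x ↦ (1 : P.ResidueField) ⊗ₜ[A] (KaehlerDifferential.D k A x : Ω[A⁄k])) hu
  simp only [Derivation.leibniz, TensorProduct.tmul_add, tmul_smul_residueField] at h1
  rw [Ideal.algebraMap_residueField_eq_zero.mpr ha, Ideal.algebraMap_residueField_eq_zero.mpr hσ,
    zero_smul, zero_smul, add_zero, zero_add] at h1
  have h2 := Fintype.linearIndependent_iff.mp hli
    ![algebraMap A P.ResidueField u, - algebraMap A P.ResidueField v]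
    (by simp [Fin.sum_univ_two, h1]) 1
  simp only [Matrix.cons_val_one, Matrix.cons_val_fin_one, neg_eq_zero] at h2
  exact hv (Ideal.algebraMap_residueField_eq_zero.mp h2)

/-- Two functions which define transversal smooth divisors form a regular sequence. -/
theorem dvd_of_dvd_mul_of_transversal {A : Type*} [CommRing A] {σ a : A}
    [IsReduced (A ⧸ Ideal.span {σ})]
    (hP : ∀ P ∈ (Ideal.span {σ}).minimalPrimes, a ∉ P) {b : A} (h : σ ∣ a * b) : σ ∣ b := by
  -- `b` lies in every minimal prime of `σ` since `a` lies in none, and `(σ)` is the intersection of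
  -- its minimal primes because it is radical.
  have hb : b ∈ (Ideal.span {σ}).radical := by
    rw [← Ideal.sInf_minimalPrimes, Ideal.mem_sInf]
    intro P hPm
    have := hPm.1.1
    exact (this.mem_or_mem (hPm.1.2 (Ideal.mem_span_singleton.mpr h))).resolve_left (hP P hPm)
  have hrad : (Ideal.span {σ}).IsRadical :=
    (Ideal.isRadical_iff_quotient_reduced _).mpr inferInstance
  exact Ideal.mem_span_singleton.mp (hrad hb)

/-- If `σ` is a local equation of a reduced divisor near its generic point `P` and `a` is
invertible there, then `σ a` is not a square in the field of fractions. -/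
theorem not_square_of_uniformizer {A : Type*} [CommRing A] [IsDomain A] [IsNoetherianRing A]
    (P : Ideal A) [P.IsPrime] {σ a : A} (hσ0 : σ ≠ 0) (hσ : σ ∈ P) (ha : a ∉ P)
    (hP : ∀ c ∈ P, ∃ v ∉ P, σ ∣ v * c) {x y : A} (hy : y ≠ 0) : x ^ 2 ≠ σ * a * y ^ 2 := by
  intro hxy
  let L := Localization.AtPrime P
  have hinj : Function.Injective (algebraMap A L) :=
    IsLocalization.injective L P.primeCompl_le_nonZeroDivisors
  have : IsDomain L := IsLocalization.isDomain_localization P.primeCompl_le_nonZeroDivisors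
  have : IsNoetherianRing L := IsLocalization.isNoetherianRing P.primeCompl L inferInstance
  -- The local ring at `P` has uniformizer `σ`. The multiplicity of `σ` is even in `x²` and odd in
  -- `σay²`, since `a` is a unit there.
  have hmax : IsLocalRing.maximalIdeal L = Ideal.span {algebraMap A L σ} := by
    refine le_antisymm ?_ ?_
    · rw [← Localization.AtPrime.map_eq_maximalIdeal, Ideal.map_le_iff_le_comap]
      intro c hc
      obtain ⟨v, hv, u, hu⟩ := hP c hc
      rw [Ideal.mem_comap, Ideal.mem_span_singleton]
      have hvu : IsUnit (algebraMap A L v) := IsLocalization.map_units L (⟨v, hv⟩ : P.primeCompl)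
      rw [← hvu.dvd_mul_left, ← map_mul, hu, map_mul]
      exact dvd_mul_right _ _
    · rw [Ideal.span_singleton_le_iff_mem, ← Localization.AtPrime.map_eq_maximalIdeal]
      exact Ideal.mem_map_of_mem _ hσ
  have hprime : Prime (algebraMap A L σ) := by
    rw [← Ideal.span_singleton_prime (by simpa using hinj.ne hσ0), ← hmax]
    infer_instance
  have hau : IsUnit (algebraMap A L a) := IsLocalization.map_units L (⟨a, ha⟩ : P.primeCompl)
  have hfin : ∀ {z : L}, z ≠ 0 → FiniteMultiplicity (algebraMap A L σ) z := fun hz ↦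
    FiniteMultiplicity.of_prime_left hprime hz
  have hy' : algebraMap A L y ≠ 0 := by simpa using hinj.ne hy
  have hσ' := hprime.ne_zero
  have hx' : algebraMap A L x ≠ 0 := by
    intro h0
    have := congrArg (algebraMap A L) hxy
    simp [h0, hy', hσ', hau.ne_zero] at this
  have h := congrArg (fun z ↦ multiplicity (algebraMap A L σ) (algebraMap A L z)) hxy
  simp only [map_mul, map_pow] at h
  rw [multiplicity_mul hprime (hfin (mul_ne_zero (mul_ne_zero hσ' hau.ne_zero) (pow_ne_zero _ hy'))),
    multiplicity_mul hprime (hfin (mul_ne_zero hσ' hau.ne_zero)),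
    FiniteMultiplicity.multiplicity_pow hprime (hfin hx'),
    FiniteMultiplicity.multiplicity_pow hprime (hfin hy'),
    multiplicity_self, multiplicity_eq_zero.mpr (fun hd ↦ hprime.not_isUnit
      (isUnit_of_dvd_unit hd hau))] at h
  omega

/-- Functions with independent differentials at a prime can be completed to a system of functions
whose differentials generate all differentials near this prime. -/
theorem exists_generating_differentials {k S : Type*} [CommRing k] [CommRing S] [Algebra k S]
    [Module.Finite S Ω[S⁄k]] (Q : Ideal S) [Q.IsPrime] {N m : ℕ}
    (hN : Module.finrank Q.ResidueField (Q.ResidueField ⊗[S] Ω[S⁄k]) = N) (f : Fin m → S)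
    (hf : LinearIndependent Q.ResidueField
      (fun j ↦ (1 : Q.ResidueField) ⊗ₜ[S] (KaehlerDifferential.D k S (f j) : Ω[S⁄k]))) :
    ∃ (r : ℕ) (_ : m + r = N) (g : Fin r → S), ∀ s : S, ∃ v ∉ Q,
      v • (KaehlerDifferential.D k S s : Ω[S⁄k]) ∈ Submodule.span S
        (Set.range (fun j ↦ KaehlerDifferential.D k S (f j)) ∪
          Set.range (fun j ↦ KaehlerDifferential.D k S (g j))) := by
  classical
  let K := Q.ResidueField
  let V := K ⊗[S] Ω[S⁄k]
  let d : S → V := fun s ↦ 1 ⊗ₜ KaehlerDifferential.D k S s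
  have hspan : Submodule.span K (Set.range d) = ⊤ := by
    rw [eq_top_iff]
    rintro x -
    induction x using TensorProduct.induction_on with
    | zero => exact zero_mem _
    | add x y hx hy => exact add_mem (hx) (hy)
    | tmul c ω =>
      have : c ⊗ₜ[S] ω = c • ((1 : K) ⊗ₜ[S] ω) := by simp [TensorProduct.smul_tmul']
      rw [this]
      refine Submodule.smul_mem _ _ ?_
      have hω : ω ∈ Submodule.span S (Set.range (KaehlerDifferential.D k S)) := by
        rw [KaehlerDifferential.span_range_derivation]; trivial
      induction hω using Submodule.span_induction with
      | mem x hx =>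
        obtain ⟨s, rfl⟩ := hx
        exact Submodule.subset_span ⟨s, rfl⟩
      | zero => simp
      | add x y _ _ hx hy =>
        rw [TensorProduct.tmul_add]
        exact add_mem (hx (by simp [TensorProduct.smul_tmul'])) (hy (by simp [TensorProduct.smul_tmul']))
      | smul s x _ hx =>
        rw [tmul_smul_residueField]
        exact Submodule.smul_mem _ _ (hx (by simp [TensorProduct.smul_tmul']))
  -- The fibre is spanned by exact differentials, so the given independent ones extend to a basis
  -- consisting of exact differentials. Its cardinality is `N`.
  obtain ⟨b, hb1, hb2, hb3, hb4⟩ := exists_linearIndepOn_id_extension hf.linearIndepOn_id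
    (t := Set.range d) (by rintro _ ⟨j, rfl⟩; exact ⟨f j, rfl⟩)
  have hfinb : b.Finite := hb4.setFinite
  have hbasis : Module.finrank K V = hfinb.toFinset.card := by
    have htop : Submodule.span K b = ⊤ := by
      rw [eq_top_iff, ← hspan]; exact Submodule.span_le.mpr hb3
    have : Fintype b := hfinb.fintype
    rw [← finrank_top, ← htop, finrank_span_set_eq_card hb4]
    congr 1
    ext; simp
  have hfinj : Function.Injective (fun j ↦ d (f j)) := hf.injective
  let c : Finset V := hfinb.toFinset \ Finset.univ.image (fun j ↦ d (f j))
  have hcard : c.card + m = N := by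
    have h1 : (Finset.univ.image (fun j ↦ d (f j))) ⊆ hfinb.toFinset := by
      intro x hx
      obtain ⟨j, -, rfl⟩ := Finset.mem_image.mp hx
      exact hfinb.mem_toFinset.mpr (hb2 ⟨j, rfl⟩)
    have h2 := Finset.card_sdiff_add_card_eq_card h1
    rw [Finset.card_image_of_injective _ hfinj, Finset.card_univ, Fintype.card_fin] at h2
    rw [h2, ← hbasis, hN]
  have hg : ∀ j : Fin c.card, ∃ s, d s = (c.equivFin.symm j : V) := by
    intro j
    have := (c.equivFin.symm j).2
    exact hb1 (hfinb.mem_toFinset.mp (Finset.mem_sdiff.mp this).1)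
  choose g hg using hg
  refine ⟨c.card, by omega, g, ?_⟩
  let W := Submodule.span S
        (Set.range (fun j ↦ KaehlerDifferential.D k S (f j)) ∪
          Set.range (fun j ↦ KaehlerDifferential.D k S (g j)))
  -- Nakayama: the quotient of `Ω` by the span `W` has zero fibre at `Q`, so `Q` is not in its
  -- support and every class is killed by some function outside `Q`.
  have hsub : Subsingleton (K ⊗[S] (Ω[S⁄k] ⧸ W)) := by
    have hlin : ∀ x : V, W.mkQ.baseChange K x = 0 := by
      intro x
      have hx : x ∈ Submodule.span K b := hb3.trans_eq rfl |>.trans (le_refl _) |> fun h ↦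
        (hspan ▸ Submodule.span_le.mpr h : (⊤ : Submodule K V) ≤ _) trivial
      induction hx using Submodule.span_induction with
      | mem x hx =>
        by_cases hxc : x ∈ c
        · have := hg (c.equivFin ⟨x, hxc⟩)
          rw [Equiv.symm_apply_apply] at this
          change d _ = x at this
          rw [← this]
          simp only [d, LinearMap.baseChange_tmul, Submodule.mkQ_apply]
          rw [(Submodule.Quotient.mk_eq_zero W).mpr (Submodule.subset_span (Or.inr ⟨_, rfl⟩)),
            TensorProduct.tmul_zero]
        · have : x ∈ Finset.univ.image (fun j ↦ d (f j)) := by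
            by_contra hn
            exact hxc (Finset.mem_sdiff.mpr ⟨hfinb.mem_toFinset.mpr hx, hn⟩)
          obtain ⟨j, -, rfl⟩ := Finset.mem_image.mp this
          simp only [d, LinearMap.baseChange_tmul, Submodule.mkQ_apply]
          rw [(Submodule.Quotient.mk_eq_zero W).mpr (Submodule.subset_span (Or.inl ⟨_, rfl⟩)),
            TensorProduct.tmul_zero]
      | zero => simp
      | add x y _ _ hx hy => rw [map_add, hx, hy, add_zero]
      | smul s x _ hx => rw [map_smul, hx, smul_zero]
    refine ⟨fun x y ↦ ?_⟩
    have hs : Function.Surjective (W.mkQ.baseChange K) :=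
      LinearMap.lTensor_surjective K W.mkQ_surjective
    obtain ⟨x, rfl⟩ := hs x
    obtain ⟨y, rfl⟩ := hs y
    rw [hlin, hlin]
  intro s
  have hns : (⟨Q, inferInstance⟩ : PrimeSpectrum S) ∉ Module.support S (Ω[S⁄k] ⧸ W) := by
    rw [Module.mem_support_iff_nontrivial_residueField_tensorProduct, not_nontrivial_iff_subsingleton]
    exact hsub
  obtain ⟨v, hv, hv0⟩ := Module.notMem_support_iff'.mp hns
    (Submodule.Quotient.mk (KaehlerDifferential.D k S s))
  refine ⟨v, hv, ?_⟩
  rwa [← Submodule.Quotient.mk_smul, Submodule.Quotient.mk_eq_zero] at hv0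

/-! ### Differentials of a polynomial ring -/

open Polynomial in
/-- A derivation of `A` and a value at `X` define a derivation of `A[X]`. -/
theorem exists_derivation_polynomial {k A M : Type*} [CommRing k] [CommRing A] [Algebra k A]
    [AddCommGroup M] [Module A[X] M] [Module A M] [IsScalarTower A A[X] M] [Module k M]
    [IsScalarTower k A M] [IsScalarTower k A[X] M] (d : Derivation k A M) (m : M) :
    ∃ D : Derivation k A[X] M, (∀ a, D (C a) = d a) ∧ D X = m := by
  -- `L` applies `d` to the coefficients. The required derivation is the sum of `L` and `m` times
  -- the formal derivative.
  let L : A[X] →ₗ[k] M :=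
    { toFun := fun p ↦ p.sum (fun n a ↦ (X : A[X]) ^ n • d a)
      map_add' := fun p q ↦ Polynomial.sum_add_index p q _ (by simp) (by simp)
      map_smul' := fun c p ↦ by
        induction p using Polynomial.induction_on' with
        | add p q hp hq =>
          rw [smul_add, Polynomial.sum_add_index _ _ _ (by simp) (by simp), hp, hq,
            Polynomial.sum_add_index _ _ _ (by simp) (by simp), smul_add]
        | monomial n a =>
          rw [smul_monomial, sum_monomial_index _ _ (by simp), sum_monomial_index _ _ (by simp)]
          rw [RingHom.id_apply, d.map_smul, smul_comm] }
  have hL : ∀ n a, L (monomial n a) = (X : A[X]) ^ n • d a := fun n a ↦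
    sum_monomial_index (f := fun n a ↦ (X : A[X]) ^ n • d a) a (by simp)
  have hlin : ∀ (a : A) (p : A[X]) (x : M), (C a * p) • x = p • a • x := fun a p x ↦ by
    rw [mul_comm, mul_smul, ← algebraMap_eq, algebraMap_smul]
  have hLeib : ∀ p q : A[X], L (p * q) = p • L q + q • L p := by
    intro p q
    induction p using Polynomial.induction_on' with
    | add p₁ p₂ h₁ h₂ => rw [add_mul, map_add, h₁, h₂, map_add, smul_add, add_smul]; abel
    | monomial n a =>
      induction q using Polynomial.induction_on' with
      | add q₁ q₂ h₁ h₂ => rw [mul_add, map_add, h₁, h₂, map_add, smul_add, add_smul]; abel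
      | monomial j b =>
        rw [monomial_mul_monomial, hL, hL, hL, d.leibniz, ← C_mul_X_pow_eq_monomial,
          ← C_mul_X_pow_eq_monomial, smul_smul, smul_smul, mul_assoc, mul_assoc, hlin, hlin,
          ← pow_add, ← pow_add, smul_add, add_comm j n]
  let D₁ : Derivation k A[X] M := Derivation.mk' L hLeib
  let D₂ : Derivation k A[X] M := Derivation.mk'
    (((LinearMap.toSpanSingleton A[X] M m).restrictScalars k).comp
      ((derivative (R := A)).restrictScalars k)) (fun p q ↦ by
        simp only [LinearMap.comp_apply, LinearMap.restrictScalars_apply, derivative_mul,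
          LinearMap.toSpanSingleton_apply, add_smul, mul_smul]
        rw [smul_comm, add_comm])
  refine ⟨D₁ + D₂, fun a ↦ ?_, ?_⟩
  · have h1 : D₁ (C a) = d a := by
      change L (C a) = _
      rw [← monomial_zero_left, hL, pow_zero, one_smul]
    have h2 : D₂ (C a) = 0 := by
      change (derivative (C a)) • m = 0
      simp
    rw [Derivation.add_apply, h1, h2, add_zero]
  · have h1 : D₁ X = 0 := by
      change L X = _
      rw [← monomial_one_one_eq_X, hL]; simp
    have h2 : D₂ X = m := by
      change (derivative (X : A[X])) • m = m
      simp
    rw [Derivation.add_apply, h1, h2, zero_add]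

section

variable {k A : Type*} [CommRing k] [CommRing A] [Algebra k A]
  (Q : Ideal (Polynomial A)) [Q.IsPrime]

/-- Linear maps on a fibre of the differentials are determined on exact differentials. -/
theorem differentials_fibre_ext {k R κ N : Type*} [CommRing k] [CommRing R] [Algebra k R]
    [CommRing κ] [Algebra R κ] [AddCommGroup N] [Module κ N]
    {f g : κ ⊗[R] Ω[R⁄k] →ₗ[κ] N}
    (h : ∀ s, f (1 ⊗ₜ KaehlerDifferential.D k R s) = g (1 ⊗ₜ KaehlerDifferential.D k R s)) :
    f = g := by
  refine LinearMap.ext fun x ↦ ?_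
  induction x with
  | zero => simp
  | add x y hx hy => rw [map_add, map_add, hx, hy]
  | tmul c ω =>
    have : c ⊗ₜ[R] ω = c • ((1 : κ) ⊗ₜ[R] ω) := by simp [TensorProduct.smul_tmul']
    rw [this, map_smul, map_smul]
    congr 1
    have hω : ω ∈ Submodule.span R (Set.range (KaehlerDifferential.D k R)) := by
      rw [KaehlerDifferential.span_range_derivation]; trivial
    clear this
    induction hω using Submodule.span_induction with
    | mem x hx => obtain ⟨s, rfl⟩ := hx; exact h s
    | zero => simp
    | add x y _ _ hx hy => rw [TensorProduct.tmul_add, map_add, map_add, hx, hy]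
    | smul s x _ hx =>
      have : (1 : κ) ⊗ₜ[R] (s • x) = algebraMap R κ s • ((1 : κ) ⊗ₜ[R] x) := by
        rw [TensorProduct.tmul_smul, algebraMap_smul]
      rw [this, map_smul, map_smul, hx]

/-- The fibre of the differentials of `A[X]`, split into differentials of `A` and `dX`. -/
theorem exists_polynomial_differentials_equiv :
    ∃ Φ : Q.ResidueField ⊗[Polynomial A] Ω[Polynomial A⁄k] ≃ₗ[Q.ResidueField]
        (Q.ResidueField ⊗[A] Ω[A⁄k]) × Q.ResidueField,
      (∀ a, Φ (1 ⊗ₜ KaehlerDifferential.D k _ (Polynomial.C a)) =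
        (1 ⊗ₜ KaehlerDifferential.D k A a, 0)) ∧
      Φ (1 ⊗ₜ KaehlerDifferential.D k _ Polynomial.X) = (0, 1) := by
  let κ := Q.ResidueField
  let W := (κ ⊗[A] Ω[A⁄k]) × κ
  let d : Derivation k A W :=
    ((LinearMap.inl A (κ ⊗[A] Ω[A⁄k]) κ).comp (TensorProduct.mk A κ Ω[A⁄k] 1)).compDer
      (KaehlerDifferential.D k A)
  obtain ⟨D, hD, hDX⟩ := exists_derivation_polynomial d ((0, 1) : W)
  let Φ : κ ⊗[Polynomial A] Ω[Polynomial A⁄k] →ₗ[κ] W :=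
    TensorProduct.AlgebraTensorModule.lift
      ((LinearMap.toSpanSingleton κ _ D.liftKaehlerDifferential))
  have hΦ : ∀ s, Φ (1 ⊗ₜ KaehlerDifferential.D k _ s) = D s := by
    intro s
    simp [Φ]
  let Ψ₁ : κ ⊗[A] Ω[A⁄k] →ₗ[κ] κ ⊗[Polynomial A] Ω[Polynomial A⁄k] :=
    TensorProduct.AlgebraTensorModule.lift
      (LinearMap.toSpanSingleton κ _
        ((TensorProduct.mk (Polynomial A) κ Ω[Polynomial A⁄k] 1).restrictScalars A ∘ₗ
          KaehlerDifferential.map k k A (Polynomial A)))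
  have hΨ₁ : ∀ a, Ψ₁ (1 ⊗ₜ KaehlerDifferential.D k A a) =
      1 ⊗ₜ KaehlerDifferential.D k _ (Polynomial.C a) := by
    intro a
    simp [Ψ₁]
  let Ψ : W →ₗ[κ] κ ⊗[Polynomial A] Ω[Polynomial A⁄k] :=
    Ψ₁.coprod (LinearMap.toSpanSingleton κ _ (1 ⊗ₜ KaehlerDifferential.D k _ Polynomial.X))
  have hΨ : ∀ x b, Ψ (x, b) = Ψ₁ x +
      b • (1 ⊗ₜ[Polynomial A] KaehlerDifferential.D k _ Polynomial.X) := fun x b ↦ rfl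
  have h1 : Φ ∘ₗ Ψ = LinearMap.id := by
    refine LinearMap.prod_ext ?_ ?_
    · refine differentials_fibre_ext fun a ↦ ?_
      rw [LinearMap.comp_apply, LinearMap.comp_apply, LinearMap.comp_apply, LinearMap.inl_apply,
        LinearMap.id_apply]
      rw [hΨ, zero_smul, add_zero, hΨ₁, hΦ, hD]
      rfl
    · refine LinearMap.ext_ring ?_
      change Φ (Ψ (0, 1)) = (0, 1)
      rw [hΨ, map_zero, zero_add, one_smul, hΦ, hDX]
  have h2 : Ψ ∘ₗ Φ = LinearMap.id := by
    refine differentials_fibre_ext fun p ↦ ?_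
    rw [LinearMap.comp_apply, hΦ, LinearMap.id_apply]
    have hC : ∀ a, Ψ (D (Polynomial.C a)) =
        1 ⊗ₜ KaehlerDifferential.D k _ (Polynomial.C a) := by
      intro a
      rw [hD]
      change Ψ (_, 0) = _
      rw [hΨ, zero_smul, add_zero]
      exact hΨ₁ a
    have hX : Ψ (D Polynomial.X) = 1 ⊗ₜ KaehlerDifferential.D k _ Polynomial.X := by
      rw [hDX, hΨ, map_zero, zero_add, one_smul]
    have hsm : ∀ (p : Polynomial A) (w : W), Ψ (p • w) = p • Ψ w := fun p w ↦ by
      rw [← algebraMap_smul κ p w, map_smul, algebraMap_smul]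
    induction p using Polynomial.induction_on with
    | C a => exact hC a
    | add p q hp hq => rw [map_add, map_add, hp, hq, map_add, TensorProduct.tmul_add]
    | monomial n a h =>
      rw [pow_succ, ← mul_assoc, D.leibniz (Polynomial.C a * Polynomial.X ^ n), map_add, hsm, hsm,
        h, hX, (KaehlerDifferential.D k _).leibniz (Polynomial.C a * Polynomial.X ^ n),
        TensorProduct.tmul_add, TensorProduct.tmul_smul, TensorProduct.tmul_smul]
  refine ⟨LinearEquiv.ofLinearMap Φ Ψ h1 h2, fun a ↦ ?_, ?_⟩
  · change Φ _ = _
    rw [hΦ, hD]; rfl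
  · change Φ _ = _
    rw [hΦ, hDX]

variable {Q} in
-- Extension of scalars along the residue field extension from a point of the base to a point of the
-- affine line over it preserves independence. Transversality on the base is thereby available at
-- the points of a chart.
theorem linearIndependent_residueField_map {m : ℕ} {f : Fin m → A}
    (hf : LinearIndependent (Q.comap Polynomial.C).ResidueField (fun j ↦
      (1 : (Q.comap Polynomial.C).ResidueField) ⊗ₜ[A] (KaehlerDifferential.D k A (f j) : Ω[A⁄k]))) :
    LinearIndependent Q.ResidueField (fun j ↦
      (1 : Q.ResidueField) ⊗ₜ[A] (KaehlerDifferential.D k A (f j) : Ω[A⁄k])) := by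
  let q := Q.comap (Polynomial.C (R := A))
  let i : q.ResidueField →+* Q.ResidueField := Ideal.ResidueField.map q Q Polynomial.C rfl
  let _ := i.toAlgebra
  have : IsScalarTower A q.ResidueField Q.ResidueField := by
    refine IsScalarTower.of_algebraMap_eq fun a ↦ ?_
    exact (Ideal.ResidueField.map_algebraMap q Q Polynomial.C rfl a).symm
  have h1 := Module.Flat.linearIndependent_one_tmul (S := Q.ResidueField) hf
  have h2 := h1.map' (TensorProduct.AlgebraTensorModule.cancelBaseChange A q.ResidueField
    Q.ResidueField Q.ResidueField Ω[A⁄k]).toLinearMap (LinearEquiv.ker _)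
  have h3 : (⇑(TensorProduct.AlgebraTensorModule.cancelBaseChange A q.ResidueField
      Q.ResidueField Q.ResidueField Ω[A⁄k]).toLinearMap ∘
      fun j ↦ (1 : Q.ResidueField) ⊗ₜ[q.ResidueField] ((1 : q.ResidueField) ⊗ₜ[A]
        (KaehlerDifferential.D k A (f j) : Ω[A⁄k]))) =
      fun j ↦ (1 : Q.ResidueField) ⊗ₜ[A] (KaehlerDifferential.D k A (f j) : Ω[A⁄k]) := by
    ext j
    simp
  exact h3 ▸ h2

theorem finrank_polynomial_differentials {n : ℕ} [Module.Finite A Ω[A⁄k]]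
    (hn : Module.finrank (Q.comap Polynomial.C).ResidueField
      ((Q.comap Polynomial.C).ResidueField ⊗[A] Ω[A⁄k]) = n) :
    Module.finrank Q.ResidueField (Q.ResidueField ⊗[Polynomial A] Ω[Polynomial A⁄k]) = n + 1 := by
  obtain ⟨Φ, -, -⟩ := exists_polynomial_differentials_equiv (k := k) Q
  let q := Q.comap (Polynomial.C (R := A))
  let i : q.ResidueField →+* Q.ResidueField := Ideal.ResidueField.map q Q Polynomial.C rfl
  let _ := i.toAlgebra
  have : IsScalarTower A q.ResidueField Q.ResidueField := by
    refine IsScalarTower.of_algebraMap_eq fun a ↦ ?_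
    exact (Ideal.ResidueField.map_algebraMap q Q Polynomial.C rfl a).symm
  rw [Φ.finrank_eq, Module.finrank_prod, Module.finrank_self, ← hn,
    ← (TensorProduct.AlgebraTensorModule.cancelBaseChange A q.ResidueField
    Q.ResidueField Q.ResidueField Ω[A⁄k]).finrank_eq, Module.finrank_baseChange]

end

section

variable {k A : Type*} [CommRing k] [CommRing A] [Algebra k A]

/-- Independent differentials on `A` stay independent on `A[X]`, together with `dX`. -/
theorem linearIndependent_polynomial_differentials {Q : Ideal (Polynomial A)} [Q.IsPrime]
    {m : ℕ} {f : Fin m → A}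
    (hf : LinearIndependent (Q.comap Polynomial.C).ResidueField (fun j ↦
      (1 : (Q.comap Polynomial.C).ResidueField) ⊗ₜ[A] (KaehlerDifferential.D k A (f j) : Ω[A⁄k]))) :
    LinearIndependent Q.ResidueField (fun j ↦ (1 : Q.ResidueField) ⊗ₜ[Polynomial A]
      (KaehlerDifferential.D k (Polynomial A)
        ((Fin.cons Polynomial.X (fun j ↦ Polynomial.C (f j)) : Fin (m + 1) → Polynomial A) j) :
          Ω[Polynomial A⁄k])) := by
  obtain ⟨Φ, hC, hX⟩ := exists_polynomial_differentials_equiv (k := k) Q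
  have h := linearIndependent_residueField_map hf
  have h1 : LinearIndependent Q.ResidueField
      (Fin.cons (1 ⊗ₜ[Polynomial A] KaehlerDifferential.D k _ Polynomial.X)
        (fun j ↦ (1 : Q.ResidueField) ⊗ₜ[Polynomial A]
          (KaehlerDifferential.D k _ (Polynomial.C (f j)) : Ω[Polynomial A⁄k])) :
        Fin (m + 1) → Q.ResidueField ⊗[Polynomial A] Ω[Polynomial A⁄k]) := by
    refine linearIndependent_finCons.mpr ⟨?_, fun hmem ↦ ?_⟩
    · refine LinearIndependent.of_comp Φ.toLinearMap ?_
      have h2 := h.map' (LinearMap.inl Q.ResidueField _ Q.ResidueField)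
        (LinearMap.ker_eq_bot.mpr LinearMap.inl_injective)
      have h3 : (⇑Φ.toLinearMap ∘ fun j ↦ (1 : Q.ResidueField) ⊗ₜ[Polynomial A]
            (KaehlerDifferential.D k _ (Polynomial.C (f j)) : Ω[Polynomial A⁄k])) =
          ⇑(LinearMap.inl Q.ResidueField (Q.ResidueField ⊗[A] Ω[A⁄k]) Q.ResidueField) ∘
            fun j ↦ 1 ⊗ₜ[A] (KaehlerDifferential.D k A) (f j) := funext fun j ↦ hC (f j)
      rw [h3]
      exact h2
    · have h3 := Submodule.mem_map_of_mem (f := LinearMap.snd _ _ _ ∘ₗ Φ.toLinearMap) hmem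
      rw [Submodule.map_span, ← Set.range_comp] at h3
      have h4 : (⇑(LinearMap.snd Q.ResidueField (Q.ResidueField ⊗[A] Ω[A⁄k]) Q.ResidueField ∘ₗ
          Φ.toLinearMap) ∘ fun j ↦ (1 : Q.ResidueField) ⊗ₜ[Polynomial A]
            (KaehlerDifferential.D k _ (Polynomial.C (f j)) : Ω[Polynomial A⁄k])) =
          fun _ ↦ 0 := by
        funext j
        exact congrArg Prod.snd (hC (f j))
      rw [h4] at h3
      have h5 : Submodule.span Q.ResidueField (Set.range fun _ : Fin m ↦ (0 : Q.ResidueField)) = ⊥ :=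
        Submodule.span_eq_bot.mpr (by rintro _ ⟨_, rfl⟩; rfl)
      rw [h5, Submodule.mem_bot] at h3
      have h6 : (Φ (1 ⊗ₜ[Polynomial A] KaehlerDifferential.D k _ Polynomial.X)).2 = 0 := h3
      rw [hX] at h6
      exact one_ne_zero h6
  have h2 : (fun j ↦ (1 : Q.ResidueField) ⊗ₜ[Polynomial A]
      (KaehlerDifferential.D k (Polynomial A)
        ((Fin.cons Polynomial.X (fun j ↦ Polynomial.C (f j)) : Fin (m + 1) → Polynomial A) j) :
          Ω[Polynomial A⁄k])) =
      (Fin.cons (1 ⊗ₜ[Polynomial A] KaehlerDifferential.D k _ Polynomial.X)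
        (fun j ↦ (1 : Q.ResidueField) ⊗ₜ[Polynomial A]
          (KaehlerDifferential.D k _ (Polynomial.C (f j)) : Ω[Polynomial A⁄k])) :
        Fin (m + 1) → Q.ResidueField ⊗[Polynomial A] Ω[Polynomial A⁄k]) :=
    funext fun j ↦ by refine Fin.cases ?_ (fun j ↦ ?_) j <;> rfl
  rw [h2]
  exact h1

/-- The Leibniz rule in a fibre of the differentials. -/
theorem one_tmul_D_mul {κ : Type*} [CommRing κ] [Algebra A κ] (a b : A) :
    (1 : κ) ⊗ₜ[A] (KaehlerDifferential.D k A (a * b) : Ω[A⁄k]) =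
      algebraMap A κ a • (1 ⊗ₜ[A] KaehlerDifferential.D k A b) +
      algebraMap A κ b • (1 ⊗ₜ[A] KaehlerDifferential.D k A a) := by
  rw [Derivation.leibniz, TensorProduct.tmul_add, TensorProduct.tmul_smul, TensorProduct.tmul_smul,
    algebraMap_smul, algebraMap_smul]

/-- The fibres of the differentials of an algebra that is locally standard smooth of relative
dimension `n` have dimension `n`. -/
theorem finrank_differentials_of_locally {k A : Type u} [CommRing k] [CommRing A] [Algebra k A]
    {n : ℕ} (h : RingHom.Locally (RingHom.IsStandardSmoothOfRelativeDimension n) (algebraMap k A))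
    (q : Ideal A) [q.IsPrime] :
    Module.finrank q.ResidueField (q.ResidueField ⊗[A] Ω[A⁄k]) = n := by
  obtain ⟨s, hs, h⟩ := h
  obtain ⟨t, ht, htq⟩ : ∃ t ∈ s, t ∉ q := by
    by_contra! hc
    exact (inferInstance : q.IsPrime).ne_top (top_le_iff.mp (hs ▸ Ideal.span_le.mpr hc))
  let At := Localization.Away t
  have h1 : Algebra.IsStandardSmoothOfRelativeDimension n k At :=
    (RingHom.isStandardSmoothOfRelativeDimension_algebraMap n).mp (h t ht)
  have hu : IsUnit (algebraMap A q.ResidueField t) := by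
    rw [isUnit_iff_ne_zero]
    exact fun h0 ↦ htq (Ideal.algebraMap_residueField_eq_zero.mp h0)
  -- Since `t ∉ q`, the residue field of `q` is an algebra over `A_t`, where the differentials are
  -- free of rank `n`.
  let i : At →+* q.ResidueField := IsLocalization.Away.lift t hu
  let _ := i.toAlgebra
  have : IsScalarTower A At q.ResidueField :=
    IsScalarTower.of_algebraMap_eq fun a ↦ (IsLocalization.Away.lift_eq t hu a).symm
  have : Nontrivial At := i.domain_nontrivial
  have := Algebra.FormallyEtale.of_isLocalization (Rₘ := At) (Submonoid.powers t)
  have : Algebra.IsStandardSmooth k At :=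
    Algebra.IsStandardSmoothOfRelativeDimension.isStandardSmooth n
  have e : (q.ResidueField ⊗[A] Ω[A⁄k]) ≃ₗ[q.ResidueField] q.ResidueField ⊗[At] Ω[At⁄k] :=
    (TensorProduct.AlgebraTensorModule.cancelBaseChange A At
      q.ResidueField q.ResidueField Ω[A⁄k]).symm.trans
      (TensorProduct.AlgebraTensorModule.congr (LinearEquiv.refl _ _)
        (KaehlerDifferential.tensorKaehlerEquivOfFormallyEtale k A At))
  rw [e.finrank_eq, Module.finrank_baseChange, Module.finrank,
    Algebra.IsStandardSmoothOfRelativeDimension.rank_kaehlerDifferential (R := k) (S := At) n]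
  simp

end

/-! ### Smooth bases and their rings of functions -/

section

variable {k : Type u} [Field k] {B : Scheme.{u}} (f : B ⟶ Spec (.of k)) {V : B.Opens}

theorem constants_smooth [Smooth f] (hV : IsAffineOpen V) : (constants f V).Smooth := by
  have h := HasRingHomProperty.appLE (P := @Smooth) f ‹_› ⟨⊤, isAffineOpen_top _⟩ ⟨V, hV⟩ le_top
  have h2 := RingHom.Smooth.respectsIso.2 (f.appLE ⊤ V le_top).hom
    (Scheme.ΓSpecIso (.of k)).symm.commRingCatIsoToRingEquiv h
  exact h2

theorem constants_locally {n : ℕ} [SmoothOfRelativeDimension n f] (hV : IsAffineOpen V) :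
    (constants f V).Locally (RingHom.IsStandardSmoothOfRelativeDimension n) := by
  have h := HasRingHomProperty.appLE (P := @SmoothOfRelativeDimension n) f ‹_›
    ⟨⊤, isAffineOpen_top _⟩ ⟨V, hV⟩ le_top
  exact (RingHom.locally_respectsIso
    (RingHom.isStandardSmoothOfRelativeDimension_respectsIso (n := n))).2 (f.appLE ⊤ V le_top).hom
    (Scheme.ΓSpecIso (.of k)).symm.commRingCatIsoToRingEquiv h

end

/-! ### Nonvanishing of the differentials of the chart equations -/

section

open Polynomial

variable {k A : Type u} [Field k] [CommRing A] [Algebra k A] (h2 : (2 : k) ≠ 0)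
  {Q : Ideal A[X]} [Q.IsPrime] {σ a : A}

/-- A nonzero constant of `k` does not lie in a prime ideal. -/
theorem natCast_notMem_of_ne_zero {S : Type*} [CommRing S] [Algebra k S] (P : Ideal S) [hP : P.IsPrime]
    {m : ℕ} (hm : (m : k) ≠ 0) : (m : S) ∉ P := fun h ↦ hP.ne_top <| by
  refine Ideal.eq_top_of_isUnit_mem _ h ?_
  have := (isUnit_iff_ne_zero.mpr hm).map (algebraMap k S)
  simpa using this

include h2 in
theorem two_ne_zero_residueField : (2 : Q.ResidueField) ≠ 0 := by
  have : (2 : A[X]) ∉ Q := natCast_notMem_of_ne_zero (k := k) Q (m := 2) (by simpa using h2)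
  intro h
  exact this (Ideal.algebraMap_residueField_eq_zero.mp (by rw [map_ofNat]; exact h))

theorem algebraMap_residueField_C (s : A) :
    algebraMap A[X] Q.ResidueField (C s) = algebraMap A Q.ResidueField s := by
  rw [IsScalarTower.algebraMap_apply A A[X] Q.ResidueField, Polynomial.algebraMap_eq]

theorem residueField_C_eq_zero {s : A} :
    algebraMap A Q.ResidueField s = 0 ↔ s ∈ Q.comap C := by
  rw [← algebraMap_residueField_C]; exact Ideal.algebraMap_residueField_eq_zero

/-- The data of a fibre of `Ω_{A[X]}` used to see that a differential does not vanish. -/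
theorem differential_ne_zero_of {F : A[X]} (s : A) (t : A) (c₀ c₁ c₂ : Q.ResidueField)
    (hF : (1 : Q.ResidueField) ⊗ₜ[A[X]] (KaehlerDifferential.D k A[X] F : Ω[A[X]⁄k]) =
      c₀ • ((1 : Q.ResidueField) ⊗ₜ[A[X]] (KaehlerDifferential.D k A[X] X : Ω[A[X]⁄k])) + c₁ • (1 ⊗ₜ KaehlerDifferential.D k A[X] (C s))
       + c₂ • (1 ⊗ₜ KaehlerDifferential.D k A[X] (C t)))
    (hs : c₂ = 0 → s ∈ Q.comap C → LinearIndependent (Q.comap C).ResidueField (fun j ↦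
      (1 : (Q.comap C).ResidueField) ⊗ₜ[A] (KaehlerDifferential.D k A (![s] j) : Ω[A⁄k])))
    (ht : c₁ = 0 → t ∈ Q.comap C → LinearIndependent (Q.comap C).ResidueField (fun j ↦
      (1 : (Q.comap C).ResidueField) ⊗ₜ[A] (KaehlerDifferential.D k A (![t] j) : Ω[A⁄k])))
    (hst : s ∈ Q.comap C → t ∈ Q.comap C → LinearIndependent (Q.comap C).ResidueField (fun j ↦
      (1 : (Q.comap C).ResidueField) ⊗ₜ[A] (KaehlerDifferential.D k A (![s, t] j) : Ω[A⁄k])))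
    (h : c₀ ≠ 0 ∨ (c₁ ≠ 0 ∧ c₂ = 0 ∧ s ∈ Q.comap C) ∨ (c₂ ≠ 0 ∧ c₁ = 0 ∧ t ∈ Q.comap C) ∨
      ((c₁ ≠ 0 ∨ c₂ ≠ 0) ∧ s ∈ Q.comap C ∧ t ∈ Q.comap C)) :
    (1 : Q.ResidueField) ⊗ₜ[A[X]] (KaehlerDifferential.D k A[X] F : Ω[A[X]⁄k]) ≠ 0 := by
  obtain ⟨Φ, hC, hX⟩ := exists_polynomial_differentials_equiv (k := k) Q
  intro h0
  have h3 := congrArg Φ hF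
  rw [h0, map_zero, map_add, map_add, map_smul, map_smul, map_smul, hC, hC, hX] at h3
  have h4 := congrArg Prod.fst h3
  have h5 := congrArg Prod.snd h3
  simp only [Prod.fst_zero, Prod.snd_zero, Prod.smul_mk, Prod.mk_add_mk, smul_zero, zero_add,
    smul_eq_mul, mul_one, add_zero, mul_zero] at h4 h5
  rcases h with h | ⟨h, h', hm⟩ | ⟨h, h', hm⟩ | ⟨h, hm, hm'⟩
  · exact h h5.symm
  · have := (linearIndependent_residueField_map (hs h' hm)).ne_zero 0
    rw [h', zero_smul, add_zero] at h4
    exact (smul_ne_zero h this) h4.symm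
  · have := (linearIndependent_residueField_map (ht h' hm)).ne_zero 0
    rw [h', zero_smul, zero_add] at h4
    exact (smul_ne_zero h this) h4.symm
  · have := linearIndependent_residueField_map (hst hm hm')
    have h6 := Fintype.linearIndependent_iff.mp this ![c₁, c₂] (by
      rw [Fin.sum_univ_two]; simpa using h4.symm)
    rcases h with h | h
    · exact h (h6 0)
    · exact h (h6 1)

variable (hσ : σ ∈ Q.comap C → LinearIndependent (Q.comap C).ResidueField (fun j ↦
      (1 : (Q.comap C).ResidueField) ⊗ₜ[A] (KaehlerDifferential.D k A (![σ] j) : Ω[A⁄k])))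
  (ha : a ∈ Q.comap C → LinearIndependent (Q.comap C).ResidueField (fun j ↦
      (1 : (Q.comap C).ResidueField) ⊗ₜ[A] (KaehlerDifferential.D k A (![a] j) : Ω[A⁄k])))
  (hσa : σ ∈ Q.comap C → a ∈ Q.comap C → LinearIndependent (Q.comap C).ResidueField (fun j ↦
      (1 : (Q.comap C).ResidueField) ⊗ₜ[A] (KaehlerDifferential.D k A (![σ, a] j) : Ω[A⁄k])))

/-- The differential of `σ X ^ 2 - a`. -/
theorem one_tmul_D_chart₀ {κ : Type*} [CommRing κ] [Algebra A[X] κ] :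
    (1 : κ) ⊗ₜ[A[X]] (KaehlerDifferential.D k A[X] (C σ * X ^ 2 - C a : A[X]) : Ω[A[X]⁄k]) =
      (2 * algebraMap A[X] κ (C σ) * algebraMap A[X] κ X) • ((1 : κ) ⊗ₜ[A[X]] (KaehlerDifferential.D k A[X] X : Ω[A[X]⁄k])) +
      (algebraMap A[X] κ X ^ 2) • ((1 : κ) ⊗ₜ[A[X]] (KaehlerDifferential.D k A[X] (C σ) : Ω[A[X]⁄k])) +
      (-1 : κ) • ((1 : κ) ⊗ₜ[A[X]] KaehlerDifferential.D k A[X] (C a)) := by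
  rw [map_sub, TensorProduct.tmul_sub, pow_two, one_tmul_D_mul, one_tmul_D_mul]
  simp only [map_mul]
  module

include h2 hσ ha hσa

/-- The differential is `2σX dX + X² dσ - da`. Where `σ = 0`, the equation forces `a = 0`, and `dσ`,
`da` are independent. Where `σ ≠ 0` and `X = 0`, again `a = 0`, and `-da ≠ 0` remains. Elsewhere the
coefficient `2σX` of `dX` is invertible, as the characteristic is not `2`. -/
theorem differential_chart₀_ne_zero (hF : C σ * X ^ 2 - C a ∈ Q) :
    (1 : Q.ResidueField) ⊗ₜ[A[X]]
      (KaehlerDifferential.D k A[X] (C σ * X ^ 2 - C a) : Ω[A[X]⁄k]) ≠ 0 := by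
  have h2' := two_ne_zero_residueField h2 (Q := Q)
  have hF' := Ideal.algebraMap_residueField_eq_zero.mpr hF
  simp only [map_sub, map_mul, map_pow, algebraMap_residueField_C] at hF'
  refine differential_ne_zero_of σ a _ _ _ one_tmul_D_chart₀ (fun _ ↦ hσ) (fun _ ↦ ha) hσa ?_
  simp only [algebraMap_residueField_C, ← residueField_C_eq_zero (Q := Q)]
  by_cases hs : algebraMap A Q.ResidueField σ = 0
  · right; right; right
    rw [hs] at hF'
    simp_all
  · by_cases hx : algebraMap A[X] Q.ResidueField X = 0
    · right; right; left
      rw [hx] at hF' ⊢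
      simp_all
    · left
      exact mul_ne_zero (mul_ne_zero h2' hs) hx

theorem differential_chart₁_ne_zero (hF : C σ - C a * X ^ 2 ∈ Q) :
    (1 : Q.ResidueField) ⊗ₜ[A[X]]
      (KaehlerDifferential.D k A[X] (C σ - C a * X ^ 2) : Ω[A[X]⁄k]) ≠ 0 := by
  have hF' : C a * X ^ 2 - C σ ∈ Q := by
    rw [← neg_sub]; exact Q.neg_mem hF
  rw [← neg_sub (C a * X ^ 2), map_neg, TensorProduct.tmul_neg, neg_ne_zero]
  refine differential_chart₀_ne_zero h2 ha hσ (fun h h' ↦ ?_) hF'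
  have h3 := (hσa h' h).comp (Equiv.swap 0 1) (Equiv.injective _)
  convert h3 using 2 with j
  fin_cases j <;> rfl

end

/-! ### Gluing schemes over a base -/

/-- The glued scheme of a glueing datum over `B`. -/
theorem exists_glued_of_glueData {B : Scheme.{u}} (D : Scheme.GlueData.{u}) (f : ∀ i, D.U i ⟶ B)
    (hf : ∀ i j, D.f i j ≫ f i = D.t i j ≫ D.f j i ≫ f j) :
    ∃ (X : Scheme.{u}) (ι : ∀ i, D.U i ⟶ X) (F : X ⟶ B), (∀ i, IsOpenImmersion (ι i)) ∧
      (∀ x, ∃ i y, ι i y = x) ∧ (∀ i, ι i ≫ F = f i) ∧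
      (∀ i j, D.f i j ≫ ι i = D.t i j ≫ D.f j i ≫ ι j) ∧
      (∀ i j y z, ι i y = ι j z → ∃ w, D.f i j w = y) := by
  refine ⟨D.glued, D.ι, Multicoequalizer.desc _ _ f ?_, fun i ↦ inferInstance, fun x ↦ ?_,
    fun i ↦ ?_, fun i j ↦ ?_, fun i j y z h ↦ ?_⟩
  · rintro ⟨i, j⟩
    exact (hf i j).trans (Category.assoc _ _ _).symm
  · obtain ⟨i, y, hy⟩ := D.ι_jointly_surjective x
    exact ⟨i, y, hy⟩
  · exact Multicoequalizer.π_desc _ _ _ _ _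
  · exact (D.glue_condition i j).symm
  · obtain ⟨w, hw, -⟩ := (D.ι_eq_iff i j y z).mp h
    exact ⟨w, hw⟩

section

variable {B : Scheme.{u}} {J : Type u} (Y : J → Scheme.{u}) (f : ∀ i, Y i ⟶ B)
  (V : ∀ i, J → (Y i).Opens) (φ : ∀ i j, (V i j).toScheme ⟶ Y j)

/-- Gluing schemes over `B` along open subschemes. -/
theorem exists_glued (hV : ∀ i, V i i = ⊤) (hφ : ∀ i, φ i i = (V i i).ι)
    (hf : ∀ i j, φ i j ≫ f j = (V i j).ι ≫ f i)
    (hmem : ∀ i j k (x : (V i j).toScheme), (V i j).ι x ∈ V i k → φ i j x ∈ V j k)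
    (hcomp : ∀ i j k (T : Scheme.{u}) (p : T ⟶ V i j) (q : T ⟶ V j k) (r : T ⟶ V i k),
      p ≫ φ i j = q ≫ (V j k).ι → p ≫ (V i j).ι = r ≫ (V i k).ι → q ≫ φ j k = r ≫ φ i k) :
    ∃ (X : Scheme.{u}) (ι : ∀ i, Y i ⟶ X) (F : X ⟶ B), (∀ i, IsOpenImmersion (ι i)) ∧
      (∀ x, ∃ i y, ι i y = x) ∧ (∀ i, ι i ≫ F = f i) ∧
      (∀ i j, (V i j).ι ≫ ι i = φ i j ≫ ι j) ∧
      (∀ i j y z, ι i y = ι j z → y ∈ V i j) := by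
  let t : ∀ i j, (V i j).toScheme ⟶ (V j i).toScheme := fun i j ↦
    IsOpenImmersion.lift (V j i).ι (φ i j) (by
      rintro _ ⟨x, rfl⟩
      rw [Scheme.Opens.range_ι]
      exact hmem i j i x (by rw [hV]; trivial))
  have ht : ∀ i j, t i j ≫ (V j i).ι = φ i j := fun i j ↦ IsOpenImmersion.lift_fac _ _ _
  have hrange : ∀ i j k, Set.range (pullback.fst (V i j).ι (V i k).ι ≫ φ i j) ⊆
      Set.range (V j k).ι := by
    rintro i j k _ ⟨x, rfl⟩
    rw [Scheme.Opens.range_ι, Scheme.Hom.comp_apply]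
    refine hmem i j k _ ?_
    rw [← Scheme.Hom.comp_apply, pullback.condition, Scheme.Hom.comp_apply]
    exact (pullback.snd (V i j).ι (V i k).ι x).2
  -- The restriction of `φ i j` to the triple overlap, which lands in `V j k` by `hmem`.
  let l : ∀ i j k, pullback (V i j).ι (V i k).ι ⟶ (V j k).toScheme := fun i j k ↦
    IsOpenImmersion.lift (V j k).ι (pullback.fst _ _ ≫ φ i j) (hrange i j k)
  have hl : ∀ i j k, l i j k ≫ (V j k).ι = pullback.fst _ _ ≫ φ i j := fun i j k ↦
    IsOpenImmersion.lift_fac _ _ _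
  let t' : ∀ i j k, pullback (V i j).ι (V i k).ι ⟶ pullback (V j k).ι (V j i).ι := fun i j k ↦
    pullback.lift (l i j k) (pullback.fst _ _ ≫ t i j) (by rw [hl, Category.assoc, ht])
  have ht'1 : ∀ i j k, t' i j k ≫ pullback.fst _ _ = l i j k := fun i j k ↦ pullback.lift_fst _ _ _
  have ht'2 : ∀ i j k, t' i j k ≫ pullback.snd _ _ = pullback.fst _ _ ≫ t i j :=
    fun i j k ↦ pullback.lift_snd _ _ _
  have hiso : ∀ i, IsIso (V i i).ι := fun i ↦ by
    rw [hV i]; exact (Scheme.topIso _).isIso_hom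
  let G : Scheme.GlueData :=
    { J := J
      U := Y
      V := fun ij ↦ (V ij.1 ij.2).toScheme
      f := fun i j ↦ (V i j).ι
      f_id := hiso
      f_hasPullback := inferInstance
      f_open := inferInstance
      t := t
      t_id := fun i ↦ by
        rw [← cancel_mono (V i i).ι, ht, hφ, Category.id_comp]
      t' := t'
      t_fac := fun i j k ↦ ht'2 i j k
      -- Two uses of `hcomp` contract the path `i → j → k → i`: first to `i → k → i`, then to `φ i
      -- i`, which is the inclusion.
      cocycle := fun i j k ↦ by
        rw [← cancel_mono (pullback.snd _ _), ← cancel_mono (V i k).ι, Category.id_comp]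
        simp only [Category.assoc]
        rw [reassoc_of% (ht'2 k i j), ht, reassoc_of% (ht'1 j k i)]
        have h1 : l i j k ≫ φ j k = pullback.snd (V i j).ι (V i k).ι ≫ φ i k :=
          hcomp i j k _ (pullback.fst _ _) (l i j k) (pullback.snd _ _) (hl i j k).symm
            pullback.condition
        have h2 : (t' i j k ≫ l j k i) ≫ (V k i).ι = pullback.snd (V i j).ι (V i k).ι ≫ φ i k := by
          rw [Category.assoc, hl, reassoc_of% (ht'1 i j k), h1]
        have h3 := hcomp i k i _ (pullback.snd (V i j).ι (V i k).ι) (t' i j k ≫ l j k i)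
          (pullback.snd (V i j).ι (V i k).ι ≫ (V i k).ι ≫ inv (V i i).ι) h2.symm (by simp)
        rw [Category.assoc] at h3
        rw [h3, hφ]
        simp }
  obtain ⟨X, ι, F, h1, h2, h3, h4, h5⟩ := exists_glued_of_glueData G f fun i j ↦ by
    change (V i j).ι ≫ f i = t i j ≫ (V j i).ι ≫ f j
    rw [reassoc_of% (ht i j), hf]
  refine ⟨X, ι, F, h1, h2, h3, fun i j ↦ ?_, fun i j y z h ↦ ?_⟩
  · have : (V i j).ι ≫ ι i = t i j ≫ (V j i).ι ≫ ι j := h4 i j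
    rw [this, reassoc_of% (ht i j)]
  · obtain ⟨w, hw⟩ := h5 i j y z h
    rw [← hw]
    exact w.2

end

/-! ### Morphisms to affine opens -/

section

variable {T Y B : Scheme.{u}}

theorem ι_comp_eq (φ : T ⟶ Y) {W : Y.Opens} (hW : IsAffineOpen W) {O : T.Opens}
    (e : O ≤ φ ⁻¹ᵁ W) : O.ι ≫ φ = O.toSpecΓ ≫ Spec.map (φ.appLE W O e) ≫ hW.fromSpec := by
  rw [Scheme.Opens.toSpecΓ_SpecMap_appLE_assoc, hW.toSpecΓ_fromSpec, Scheme.Hom.resLE_comp_ι]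

/-- Morphisms to an affine open subscheme are determined by their effect on functions. -/
theorem ι_comp_ext {φ ψ : T ⟶ Y} {W : Y.Opens} (hW : IsAffineOpen W) {O : T.Opens}
    (e : O ≤ φ ⁻¹ᵁ W) (e' : O ≤ ψ ⁻¹ᵁ W) (h : φ.appLE W O e = ψ.appLE W O e') :
    O.ι ≫ φ = O.ι ≫ ψ := by
  rw [ι_comp_eq φ hW e, ι_comp_eq ψ hW e', h]

theorem hom_ext_of_appLE {φ ψ : T ⟶ Y} {W : Y.Opens} (hW : IsAffineOpen W)
    (e : ⊤ ≤ φ ⁻¹ᵁ W) (e' : ⊤ ≤ ψ ⁻¹ᵁ W) (h : φ.appLE W ⊤ e = ψ.appLE W ⊤ e') : φ = ψ := by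
  have := ι_comp_ext hW e e' h
  have hi : IsIso (⊤ : T.Opens).ι := (Scheme.topIso _).isIso_hom
  exact (cancel_epi (⊤ : T.Opens).ι).mp this

/-- A ring homomorphism from the functions on an affine open subscheme defines a morphism. -/
theorem exists_hom_of_ringHom {W : Y.Opens} (hW : IsAffineOpen W) (r : Γ(Y, W) ⟶ Γ(T, ⊤)) :
    ∃ (φ : T ⟶ Y) (e : ⊤ ≤ φ ⁻¹ᵁ W), φ.appLE W ⊤ e = r := by
  have e : ⊤ ≤ (T.toSpecΓ ≫ Spec.map r ≫ hW.fromSpec) ⁻¹ᵁ W := by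
    intro x _
    change hW.fromSpec _ ∈ W
    have := hW.range_fromSpec
    exact this.le ⟨_, rfl⟩
  refine ⟨T.toSpecΓ ≫ Spec.map r ≫ hW.fromSpec, e, ?_⟩
  rw [← Scheme.Hom.appLE_comp_appLE _ _ W ⊤ ⊤ (by rw [Scheme.Hom.comp_preimage, hW.fromSpec_preimage_self]; rfl) le_top,
    ← Scheme.Hom.appLE_comp_appLE _ _ W ⊤ ⊤ (by rw [hW.fromSpec_preimage_self]) le_top]
  have h1 : hW.fromSpec.appLE W ⊤ (by rw [hW.fromSpec_preimage_self]) =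
      (Scheme.ΓSpecIso Γ(Y, W)).inv := by
    rw [Scheme.Hom.appLE, hW.fromSpec_app_self, Category.assoc, ← Functor.map_comp]
    exact (congrArg (_ ≫ ·) ((Spec Γ(Y, W)).presheaf.map_id _)).trans (Category.comp_id _)
  have h2 : (Spec.map r).appLE ⊤ ⊤ le_top = (Spec.map r).appTop := by
    rw [Scheme.Hom.appTop, Scheme.Hom.app_eq_appLE]; rfl
  have h3 : T.toSpecΓ.appLE ⊤ ⊤ le_top = T.toSpecΓ.appTop := by
    rw [Scheme.Hom.appTop, Scheme.Hom.app_eq_appLE]; rfl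
  rw [h1, h2, h3, ← Scheme.ΓSpecIso_inv_naturality, Category.assoc, Scheme.toSpecΓ_appTop, Iso.inv_hom_id,
    Category.comp_id]

/-- Sections on an open subset are the functions on it as a scheme. -/
theorem isIso_ι_appLE (O : T.Opens) : IsIso (O.ι.appLE O ⊤ (by rw [Scheme.Opens.ι_preimage_self])) := by
  have : O.ι.appLE O ⊤ (by rw [Scheme.Opens.ι_preimage_self]) = O.topIso.inv := by
    rw [Scheme.Opens.ι_appLE]
    rfl
  rw [this]
  infer_instance

end

/-! ### Charts `A[X] / (P)` -/

open Polynomial in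
/-- The map from polynomials to functions on `W`, for a coordinate `t` on `W`. -/
def chartMap {Y B : Scheme.{u}} (f : Y ⟶ B) (U : B.Opens) (W : Y.Opens) (e : W ≤ f ⁻¹ᵁ U)
    (t : Γ(Y, W)) : Γ(B, U)[X] →+* Γ(Y, W) :=
  eval₂RingHom (f.appLE U W e).hom t

open Polynomial in
/-- The open subscheme `W` of `Y` is the spectrum of `Γ(B, U)[t] / (P)`. -/
structure IsChart {Y B : Scheme.{u}} (f : Y ⟶ B) (U : B.Opens) (W : Y.Opens) (P : Γ(B, U)[X])
    (t : Γ(Y, W)) : Prop where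
  affine : IsAffineOpen W
  le : W ≤ f ⁻¹ᵁ U
  surjective : Function.Surjective (chartMap f U W le t)
  ker : RingHom.ker (chartMap f U W le t) = Ideal.span {P}

namespace IsChart

open Polynomial

variable {Y B T : Scheme.{u}} {f : Y ⟶ B} {U : B.Opens} {W : Y.Opens} {P : Γ(B, U)[X]} {t : Γ(Y, W)}

theorem eval_eq_zero (hc : IsChart f U W P t) : P.eval₂ (f.appLE U W hc.le).hom t = 0 := by
  have : P ∈ RingHom.ker (chartMap f U W hc.le t) := by
    rw [hc.ker]; exact Ideal.mem_span_singleton_self P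
  exact this

/-- Morphisms into a chart are determined by the coordinate and the composition to the base. -/
theorem ι_comp_ext (hc : IsChart f U W P t) {φ ψ : T ⟶ Y} {O : T.Opens} (e : O ≤ φ ⁻¹ᵁ W)
    (e' : O ≤ ψ ⁻¹ᵁ W) (h : O.ι ≫ φ ≫ f = O.ι ≫ ψ ≫ f)
    (ht : φ.appLE W O e t = ψ.appLE W O e' t) : O.ι ≫ φ = O.ι ≫ ψ := by
  refine WeakCoupling.ι_comp_ext hc.affine e e' ?_
  have hO := isIso_ι_appLE O
  rw [← cancel_mono (O.ι.appLE O ⊤ (by rw [Scheme.Opens.ι_preimage_self]))]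
  ext s
  obtain ⟨p, rfl⟩ := hc.surjective s
  have h1 : f.appLE U W hc.le ≫ φ.appLE W O e ≫ O.ι.appLE O ⊤ (by rw [Scheme.Opens.ι_preimage_self]) =
      f.appLE U W hc.le ≫ ψ.appLE W O e' ≫ O.ι.appLE O ⊤ (by rw [Scheme.Opens.ι_preimage_self]) := by
    rw [Scheme.Hom.appLE_comp_appLE_assoc, Scheme.Hom.appLE_comp_appLE_assoc,
      Scheme.Hom.appLE_comp_appLE, Scheme.Hom.appLE_comp_appLE]
    congr 1
  simp only [chartMap, coe_eval₂RingHom, hom_eval₂]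
  rw [← CommRingCat.hom_comp, h1]
  simp only [CommRingCat.hom_comp, RingHom.comp_apply, ht]

theorem hom_ext (hc : IsChart f U W P t) {φ ψ : T ⟶ Y} (e : ⊤ ≤ φ ⁻¹ᵁ W)
    (e' : ⊤ ≤ ψ ⁻¹ᵁ W) (h : φ ≫ f = ψ ≫ f)
    (ht : φ.appLE W ⊤ e t = ψ.appLE W ⊤ e' t) : φ = ψ := by
  have := hc.ι_comp_ext e e' (by rw [h]) ht
  have hi : IsIso (⊤ : T.Opens).ι := (Scheme.topIso _).isIso_hom
  exact (cancel_epi (⊤ : T.Opens).ι).mp this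

/-- A root of the equation of a chart defines a morphism into it. -/
theorem exists_hom (hc : IsChart f U W P t) (hU : IsAffineOpen U) (h : T ⟶ B) (e : ⊤ ≤ h ⁻¹ᵁ U)
    (τ : Γ(T, ⊤)) (hτ : P.eval₂ (h.appLE U ⊤ e).hom τ = 0) :
    ∃ (φ : T ⟶ Y) (e' : ⊤ ≤ φ ⁻¹ᵁ W), φ ≫ f = h ∧ φ.appLE W ⊤ e' t = τ := by
  let r₀ : Γ(B, U)[X] →+* Γ(T, ⊤) := eval₂RingHom (h.appLE U ⊤ e).hom τ
  have hr₀ : RingHom.ker (chartMap f U W hc.le t) ≤ RingHom.ker r₀ := by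
    rw [hc.ker, Ideal.span_le, Set.singleton_subset_iff]
    exact hτ
  let r : Γ(Y, W) →+* Γ(T, ⊤) :=
    (chartMap f U W hc.le t).liftOfRightInverse _ (Function.rightInverse_surjInv hc.surjective)
      ⟨r₀, hr₀⟩
  have hr : ∀ p, r (chartMap f U W hc.le t p) = r₀ p := fun p ↦
    RingHom.liftOfRightInverse_comp_apply _ _ (Function.rightInverse_surjInv hc.surjective) ⟨r₀, hr₀⟩ p
  obtain ⟨φ, e', hφ⟩ := exists_hom_of_ringHom hc.affine (CommRingCat.ofHom r)
  refine ⟨φ, e', ?_, ?_⟩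
  · refine hom_ext_of_appLE hU (e'.trans (φ.preimage_mono hc.le)) e ?_
    have := Scheme.Hom.appLE_comp_appLE φ f U W ⊤ hc.le e'
    rw [← this, hφ]
    ext s
    have := hr (C s)
    simpa [chartMap, r₀] using this
  · rw [hφ]
    have := hr X
    simpa [chartMap, r₀] using this

end IsChart

/-! ### Pull-back of sections -/

section

variable {X Y Z : Scheme.{u}}

theorem appLE_comp (f : X ⟶ Y) (g : Y ⟶ Z) {U : Z.Opens} {V : Y.Opens} {W : X.Opens}
    (e₁ : V ≤ g ⁻¹ᵁ U) (e₂ : W ≤ f ⁻¹ᵁ V) (e₃ : W ≤ (f ≫ g) ⁻¹ᵁ U) (s : Γ(Z, U)) :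
    (f ≫ g).appLE U W e₃ s = f.appLE V W e₂ (g.appLE U V e₁ s) := by
  rw [← CommRingCat.comp_apply, Scheme.Hom.appLE_comp_appLE]

theorem appLE_res (f : X ⟶ Y) {U U' : Y.Opens} {W : X.Opens} (h : U ≤ U') (e : W ≤ f ⁻¹ᵁ U)
    (e' : W ≤ f ⁻¹ᵁ U') (s : Γ(Y, U')) : f.appLE U W e (res h s) = f.appLE U' W e' s := by
  change (Y.presheaf.map _ ≫ f.appLE U W e) s = _
  rw [Scheme.Hom.map_appLE]

theorem res_appLE (f : X ⟶ Y) {U : Y.Opens} {W W' : X.Opens} (h : W ≤ W') (e : W' ≤ f ⁻¹ᵁ U)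
    (e' : W ≤ f ⁻¹ᵁ U) (s : Γ(Y, U)) : res h (f.appLE U W' e s) = f.appLE U W e' s := by
  change (f.appLE U W' e ≫ X.presheaf.map _) s = _
  rw [Scheme.Hom.appLE_map]

theorem res_res {U V W : X.Opens} (h : U ≤ V) (h' : V ≤ W) (s : Γ(X, W)) :
    res h (res h' s) = res (h.trans h') s := by
  change (X.presheaf.map _ ≫ X.presheaf.map _) s = _
  rw [← Functor.map_comp]
  rfl

theorem res_self {U : X.Opens} (h : U ≤ U) (s : Γ(X, U)) : res h s = s := by
  change X.presheaf.map (𝟙 _) s = _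
  simp

theorem appLE_congr_hom {f g : X ⟶ Y} (h : f = g) {U : Y.Opens} {W : X.Opens} (e : W ≤ f ⁻¹ᵁ U)
    (e' : W ≤ g ⁻¹ᵁ U) (s : Γ(Y, U)) : f.appLE U W e s = g.appLE U W e' s := by
  subst h; rfl

end

/-! ### Coordinates up to inversion -/

/-- The coordinates `x` and `y` correspond under the transition function `g`. The kinds `e` and `e'` tell
whether they are coordinates near `0` (`true`) or near `∞` (`false`) of the projective line. -/
def Linked {R : Type*} [CommRing R] (e e' : Bool) (g x y : R) : Prop :=
  -- All cases express `u = g v` with denominators cleared, where `u` is `x` or `1/x` and `v` is `y`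
  -- or `1/y` according to the kinds.
  match e, e' with
  | true, true => x = g * y
  | false, false => y = g * x
  | true, false => x * y = g
  | false, true => g * x * y = 1

namespace Linked

variable {R S : Type*} [CommRing R] [CommRing S] {e e' e'' : Bool} {g g' x y y' z : R}

theorem map (φ : R →+* S) (h : Linked e e' g x y) : Linked e e' (φ g) (φ x) (φ y) := by
  cases e <;> cases e' <;> simp only [Linked] at h ⊢ <;> simp only [← map_mul, h, map_one]

theorem of_map {φ : R →+* S} (hφ : Function.Injective φ) (h : Linked e e' (φ g) (φ x) (φ y)) :
    Linked e e' g x y := by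
  cases e <;> cases e' <;> simp only [Linked] at h ⊢ <;> apply hφ <;>
    simpa only [map_mul, map_one] using h

theorem unique (hg : IsUnit g) (h : Linked e e' g x y) (h' : Linked e e' g x y') : y = y' := by
  cases e <;> cases e' <;> simp only [Linked] at h h'
  · rw [h, h']
  · have : IsUnit (g * x) := .of_mul_eq_one _ h
    exact this.mul_left_cancel (h.trans h'.symm)
  · have : IsUnit x := isUnit_of_mul_isUnit_left (h ▸ hg)
    exact this.mul_left_cancel (h.trans h'.symm)
  · exact hg.mul_left_cancel (h.symm.trans h')

theorem trans (h : Linked e e' g x y) (h' : Linked e' e'' g' y z) : Linked e e'' (g * g') x z := by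
  cases e <;> cases e' <;> cases e'' <;> simp only [Linked] at h h' ⊢
  · rw [h', h]; ring
  · rw [h] at h'; linear_combination h'
  · linear_combination (-z) * h + g * x * h'
  · rw [h'] at h; linear_combination h
  · rw [h', ← h]; ring
  · linear_combination (-x) * h' + g' * z * h
  · rw [h]; linear_combination g * h'
  · rw [h, h']; ring

theorem eq_of_self (h : Linked e e 1 x y) : x = y := by
  cases e <;> simp only [Linked] at h
  · simpa using h.symm
  · simpa using h

theorem exists_of_isUnit (hg : IsUnit g) (h : e = e' ∨ IsUnit x) : ∃ y, Linked e e' g x y := by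
  cases e <;> cases e' <;> simp only [Linked, reduceCtorEq, false_or, true_or] at h ⊢
  · exact ⟨_, rfl⟩
  · obtain ⟨y, hy⟩ := (hg.mul h).exists_right_inv
    exact ⟨y, hy⟩
  · obtain ⟨y, hy⟩ := h.exists_right_inv
    exact ⟨y * g, by rw [← mul_assoc, hy, one_mul]⟩
  · obtain ⟨y, hy⟩ := hg.exists_right_inv
    exact ⟨y * x, by rw [← mul_assoc, hy, one_mul]⟩

/-- A product of the two coordinates, up to the unit `g`, is a unit. So charts of different kinds
can meet only where the coordinates are invertible. -/
theorem isUnit_of_ne (hg : IsUnit g) (h : Linked e e' g x y) (he : e ≠ e') :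
    IsUnit x ∧ IsUnit y := by
  cases e <;> cases e' <;> simp only [Linked, ne_eq, not_true_eq_false] at h he
  · exact ⟨isUnit_of_mul_isUnit_right (IsUnit.of_mul_eq_one _ h),
      IsUnit.of_mul_eq_one _ ((mul_comm _ _).trans h)⟩
  · exact ⟨isUnit_of_mul_isUnit_left (h ▸ hg), isUnit_of_mul_isUnit_right (h ▸ hg)⟩

theorem isUnit_of_eq (hg : IsUnit g) (h : Linked e e' g x y) (he : e = e') (hx : IsUnit x) :
    IsUnit y := by
  cases e <;> cases e' <;> simp only [Linked, reduceCtorEq] at h he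
  · exact h ▸ hg.mul hx
  · exact isUnit_of_mul_isUnit_right (h ▸ hx)

end Linked

/-! ### Atlases of curves on the projective line over a base -/

open Polynomial in
/-- Charts `Γ(U j)[t] / (P j)` over affine open subsets of `B`, with coordinates that correspond under
the transition functions of a line bundle. -/
structure LineAtlas (B : Scheme.{u}) where
  /-- The index set. -/
  J : Type u
  /-- The bases of the charts. -/
  U : J → B.Opens
  affine : ∀ j, IsAffineOpen (U j)
  /-- Whether the coordinate is one near `0` or near `∞`. -/
  kind : J → Bool
  /-- The equations. -/
  P : ∀ j, Γ(B, U j)[X]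
  /-- The transition functions. -/
  g : Cocycle U
  -- In terms of points with values in `R`: a point of chart `i` has a partner in chart `j` that
  -- satisfies the equation of chart `j`.
  compat : ∀ i j (R : Type u) [CommRing R] (ψ : Γ(B, U i ⊓ U j) →+* R) (x y : R),
    Linked (kind i) (kind j) (ψ (g.tr i j)) x y →
    (P i).eval₂ (ψ.comp (res inf_le_left)) x = 0 → (P j).eval₂ (ψ.comp (res inf_le_right)) y = 0

/-- The cocycle condition with equal indices reads `g · g = g` for a unit `g`. It holds on the
triple intersection, which is the same open set written differently, so restriction to it must be
shown to be injective. -/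
theorem Cocycle.tr_self {B : Scheme.{u}} {I : Type u} {U : I → B.Opens} (L : Cocycle U) (i : I) :
    (L.tr i i : Γ(B, U i ⊓ U i)) = 1 := by
  have h := L.cocycle i i i
  have hu := (L.tr i i).isUnit.map (res (W := U i ⊓ U i ⊓ U i) (V := U i ⊓ U i)
    (inf_le_inf_right _ inf_le_right))
  have h1 : res (W := U i ⊓ U i ⊓ U i) (inf_le_left) (L.tr i i : Γ(B, U i ⊓ U i)) =
      res (W := U i ⊓ U i ⊓ U i) (inf_le_inf_right _ inf_le_right) (L.tr i i : Γ(B, U i ⊓ U i)) := rfl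
  have h3 : res (W := U i ⊓ U i ⊓ U i) (inf_le_inf_right _ inf_le_left)
      (L.tr i i : Γ(B, U i ⊓ U i)) =
      res (W := U i ⊓ U i ⊓ U i) (inf_le_inf_right _ inf_le_right) (L.tr i i : Γ(B, U i ⊓ U i)) := rfl
  rw [h1, h3] at h
  have h2 : res (W := U i ⊓ U i ⊓ U i) (V := U i ⊓ U i) (inf_le_inf_right _ inf_le_right)
      (L.tr i i : Γ(B, U i ⊓ U i)) = 1 := hu.mul_left_cancel (h.trans (mul_one _).symm)
  have hinj : Function.Injective (res (W := U i ⊓ U i ⊓ U i) (V := U i ⊓ U i)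
      (inf_le_inf_right _ inf_le_right)) := by
    have hle : U i ⊓ U i ≤ U i ⊓ U i ⊓ U i := le_inf le_rfl inf_le_right
    intro a b hab
    have := congrArg (res (W := U i ⊓ U i) hle) hab
    simp only [res, ← CommRingCat.comp_apply, ← Functor.map_comp] at this
    have hid : (homOfLE (inf_le_inf_right (U i) (inf_le_right : U i ⊓ U i ≤ U i))).op ≫
      (homOfLE hle).op = 𝟙 _ := rfl
    simpa [hid] using this
  exact hinj (h2.trans (map_one _).symm)

/-- The scheme `f : Y ⟶ B` is glued from the charts of the atlas. -/
structure IsModel {B Y : Scheme.{u}} (A : LineAtlas B) (f : Y ⟶ B) (W : A.J → Y.Opens)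
    (t : ∀ j, Γ(Y, W j)) : Prop where
  chart : ∀ j, IsChart f (A.U j) (W j) (A.P j) (t j)
  cover : ∀ y, ∃ j, y ∈ W j
  -- Over the common part of their bases, charts of equal kind coincide, while a point of a chart of
  -- the other kind is only required to be shared when its coordinate is invertible.
  overlap : ∀ i j y, y ∈ W i → f y ∈ A.U j → (A.kind i = A.kind j ∨ y ∈ Y.basicOpen (t i)) → y ∈ W j
  linked : ∀ i j (e : W i ⊓ W j ≤ f ⁻¹ᵁ (A.U i ⊓ A.U j)), Linked (A.kind i) (A.kind j)
    (f.appLE (A.U i ⊓ A.U j) (W i ⊓ W j) e (A.g.tr i j : Γ(B, A.U i ⊓ A.U j)))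
    (res inf_le_left (t i)) (res inf_le_right (t j))

namespace IsModel

variable {B Y T : Scheme.{u}} {A : LineAtlas B} {f : Y ⟶ B} {W : A.J → Y.Opens}
  {t : ∀ j, Γ(Y, W j)}

theorem hom_ext (M : IsModel A f W t) {φ ψ : T ⟶ Y} (h : φ ≫ f = ψ ≫ f)
    (H : ∀ x, ∃ (O : T.Opens) (j : A.J) (e : O ≤ φ ⁻¹ᵁ W j) (e' : O ≤ ψ ⁻¹ᵁ W j), x ∈ O ∧
      φ.appLE (W j) O e (t j) = ψ.appLE (W j) O e' (t j)) : φ = ψ := by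
  refine Scheme.hom_ext_of_forall _ _ fun x ↦ ?_
  obtain ⟨O, j, e, e', hx, ht⟩ := H x
  exact ⟨O, hx, (M.chart j).ι_comp_ext e e' (by rw [h]) ht⟩

theorem le_inf (M : IsModel A f W t) (i j : A.J) : W i ⊓ W j ≤ f ⁻¹ᵁ (A.U i ⊓ A.U j) :=
  inf_le_inf (M.chart i).le (M.chart j).le

/-- Local coordinates that correspond under the transition functions define a morphism. -/
theorem exists_hom (M : IsModel A f W t) (h : T ⟶ B) {K : Type u} (κ : K → A.J) (O : K → T.Opens)
    (hO : ∀ k, O k ≤ h ⁻¹ᵁ A.U (κ k)) (hcov : ∀ x, ∃ k, x ∈ O k) (τ : ∀ k, Γ(T, O k))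
    (hP : ∀ k, (A.P (κ k)).eval₂ (h.appLE _ _ (hO k)).hom (τ k) = 0)
    (hL : ∀ k l (e : O k ⊓ O l ≤ h ⁻¹ᵁ (A.U (κ k) ⊓ A.U (κ l))),
      Linked (A.kind (κ k)) (A.kind (κ l))
        (h.appLE _ _ e (A.g.tr (κ k) (κ l) : Γ(B, A.U (κ k) ⊓ A.U (κ l))))
        (res inf_le_left (τ k)) (res inf_le_right (τ l))) :
    ∃ φ : T ⟶ Y, φ ≫ f = h ∧ ∀ k, ∃ e : O k ≤ φ ⁻¹ᵁ W (κ k),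
      φ.appLE _ _ e (t (κ k)) = τ k := by
  have he : ∀ k, (⊤ : (O k).toScheme.Opens) ≤ ((O k).ι ≫ h) ⁻¹ᵁ A.U (κ k) := fun k ↦ by
    rw [Scheme.Hom.comp_preimage]
    exact (Scheme.Opens.ι_preimage_self (O k)).symm.le.trans ((O k).ι.preimage_mono (hO k))
  have hs : ∀ k, (⊤ : (O k).toScheme.Opens) ≤ (O k).ι ⁻¹ᵁ (O k) := fun k ↦
    (Scheme.Opens.ι_preimage_self (O k)).symm.le
  have H : ∀ k, ∃ (φ : (O k).toScheme ⟶ Y) (e' : ⊤ ≤ φ ⁻¹ᵁ W (κ k)), φ ≫ f = (O k).ι ≫ h ∧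
      φ.appLE (W (κ k)) ⊤ e' (t (κ k)) = (O k).ι.appLE (O k) ⊤ (hs k) (τ k) := fun k ↦ by
    refine (M.chart (κ k)).exists_hom (A.affine _) _ (he k) _ ?_
    rw [← Scheme.Hom.appLE_comp_appLE _ _ _ (O k) ⊤ (hO k) (hs k), CommRingCat.hom_comp]
    have := congrArg ((O k).ι.appLE (O k) ⊤ (hs k)).hom (hP k)
    rwa [Polynomial.hom_eval₂, map_zero] at this
  choose φ hφW hφf hφt using H
  have hcover : IsOpenCover O := by
    rw [IsOpenCover, eq_top_iff]
    intro x _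
    obtain ⟨k, hk⟩ := hcov x
    exact Opens.mem_iSup.mpr ⟨k, hk⟩
  let 𝒰 := T.openCoverOfIsOpenCover O hcover
  -- On an overlap `φ k` also lands in the chart of `φ l`: for different kinds the link makes its
  -- coordinate a unit, and `overlap` applies. Both morphisms then have coordinates linked to the
  -- same `τ k`, hence equal coordinates.
  have hglue : ∀ k l, pullback.fst (O k).ι (O l).ι ≫ φ k = pullback.snd (O k).ι (O l).ι ≫ φ l := by
    intro k l
    let p := pullback.fst (O k).ι (O l).ι
    let q := pullback.snd (O k).ι (O l).ι
    have hpq : p ≫ (O k).ι = q ≫ (O l).ι := pullback.condition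
    have hb : (p ≫ φ k) ≫ f = (q ≫ φ l) ≫ f := by
      rw [Category.assoc, Category.assoc, hφf, hφf, reassoc_of% hpq]
    have hp : ⊤ ≤ (p ≫ (O k).ι) ⁻¹ᵁ (O k ⊓ O l) := by
      intro x _
      refine ⟨(p x).2, ?_⟩
      have : (p ≫ (O k).ι) x = (q ≫ (O l).ι) x := by rw [hpq]
      change (p ≫ (O k).ι) x ∈ O l
      rw [this]
      exact (q x).2
    have hinf : O k ⊓ O l ≤ h ⁻¹ᵁ (A.U (κ k) ⊓ A.U (κ l)) := inf_le_inf (hO k) (hO l)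
    have hl := (hL k l hinf).map ((p ≫ (O k).ι).appLE (O k ⊓ O l) ⊤ hp).hom
    have hk1 : ⊤ ≤ (p ≫ φ k) ⁻¹ᵁ W (κ k) := fun x _ ↦ hφW k (by trivial : p x ∈ ⊤)
    have hl1 : ⊤ ≤ (q ≫ φ l) ⁻¹ᵁ W (κ l) := fun x _ ↦ hφW l (by trivial : q x ∈ ⊤)
    have hpt : (⊤ : (pullback (O k).ι (O l).ι).Opens) ≤ p ⁻¹ᵁ ⊤ := fun _ _ ↦ trivial
    have hqt : (⊤ : (pullback (O k).ι (O l).ι).Opens) ≤ q ⁻¹ᵁ ⊤ := fun _ _ ↦ trivial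
    have hp1 : ⊤ ≤ (p ≫ (O k).ι) ⁻¹ᵁ O k := fun x _ ↦ (p x).2
    have hq1 : ⊤ ≤ (q ≫ (O l).ι) ⁻¹ᵁ O l := fun x _ ↦ (q x).2
    have hτk : (p ≫ φ k).appLE (W (κ k)) ⊤ hk1 (t (κ k)) =
        (p ≫ (O k).ι).appLE (O k ⊓ O l) ⊤ hp (res inf_le_left (τ k)) := by
      rw [appLE_comp p (φ k) (hφW k) hpt, hφt, appLE_res _ _ _ hp1,
        appLE_comp p (O k).ι (hs k) hpt]
    have hτl : (q ≫ φ l).appLE (W (κ l)) ⊤ hl1 (t (κ l)) =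
        (p ≫ (O k).ι).appLE (O k ⊓ O l) ⊤ hp (res inf_le_right (τ l)) := by
      rw [appLE_comp q (φ l) (hφW l) hqt, hφt, appLE_res _ _ _ (fun x hx ↦ (hp hx).2),
        appLE_congr_hom hpq (fun x hx ↦ (hp hx).2) hq1, appLE_comp q (O l).ι (hs l) hqt]
    have hg : IsUnit ((p ≫ (O k).ι).appLE (O k ⊓ O l) ⊤ hp
        (h.appLE _ _ hinf (A.g.tr (κ k) (κ l) : Γ(B, A.U (κ k) ⊓ A.U (κ l))))) :=
      (((A.g.tr (κ k) (κ l)).isUnit.map (h.appLE _ _ hinf).hom).map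
        ((p ≫ (O k).ι).appLE (O k ⊓ O l) ⊤ hp).hom)
    have hk2 : ⊤ ≤ (p ≫ φ k) ⁻¹ᵁ W (κ l) := by
      intro x _
      refine M.overlap (κ k) (κ l) _ (hk1 (by trivial : x ∈ ⊤)) ?_ ?_
      · have : f ((p ≫ φ k) x) = f ((q ≫ φ l) x) := by
          rw [← Scheme.Hom.comp_apply, hb]; rfl
        rw [this]
        exact (M.chart (κ l)).le (hl1 (by trivial : x ∈ ⊤))
      · by_cases hkind : A.kind (κ k) = A.kind (κ l)
        · exact Or.inl hkind
        · right
          have hu := (hl.isUnit_of_ne hg hkind).1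
          have hu' : IsUnit ((p ≫ φ k).appLE (W (κ k)) ⊤ hk1 (t (κ k))) := hτk ▸ hu
          have hbo := (pullback (O k).ι (O l).ι).basicOpen_of_isUnit hu'
          rw [Scheme.basicOpen_appLE] at hbo
          have hx : x ∈ (⊤ : (pullback (O k).ι (O l).ι).Opens) := trivial
          rw [← hbo] at hx
          exact hx.2
    have hk3 : ⊤ ≤ (p ≫ φ k) ⁻¹ᵁ (W (κ k) ⊓ W (κ l)) := fun x hx ↦ ⟨hk1 hx, hk2 hx⟩
    refine (M.chart (κ l)).hom_ext hk2 hl1 hb ?_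
    have h3 := (M.linked (κ k) (κ l) (M.le_inf _ _)).map ((p ≫ φ k).appLE _ ⊤ hk3).hom
    refine Linked.unique hg (e := A.kind (κ k)) (e' := A.kind (κ l)) ?_ (hτl ▸ hl)
    have hgg : (p ≫ φ k).appLE (W (κ k) ⊓ W (κ l)) ⊤ hk3 (f.appLE _ _ (M.le_inf _ _)
        (A.g.tr (κ k) (κ l) : Γ(B, A.U (κ k) ⊓ A.U (κ l)))) =
        (p ≫ (O k).ι).appLE (O k ⊓ O l) ⊤ hp
        (h.appLE _ _ hinf (A.g.tr (κ k) (κ l) : Γ(B, A.U (κ k) ⊓ A.U (κ l)))) := by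
      have e3 : ⊤ ≤ ((p ≫ φ k) ≫ f) ⁻¹ᵁ (A.U (κ k) ⊓ A.U (κ l)) := fun x hx ↦ M.le_inf _ _ (hk3 hx)
      have e4 : ⊤ ≤ ((p ≫ (O k).ι) ≫ h) ⁻¹ᵁ (A.U (κ k) ⊓ A.U (κ l)) := fun x hx ↦ hinf (hp hx)
      rw [← appLE_comp _ _ _ _ e3, ← appLE_comp _ _ _ _ e4]
      exact appLE_congr_hom (by rw [Category.assoc, hφf, Category.assoc]) _ _ _
    have hk4 := appLE_res (p ≫ φ k) (inf_le_left) hk3 hk1 (t (κ k))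
    have hl4 := appLE_res (p ≫ φ k) (inf_le_right) hk3 hk2 (t (κ l))
    have h5 : Linked (A.kind (κ k)) (A.kind (κ l)) _ _ _ := h3
    exact hgg ▸ (hk4.trans hτk) ▸ hl4 ▸ h5
  let Φ : T ⟶ Y := 𝒰.glueMorphisms φ hglue
  have hΦ : ∀ k, (O k).ι ≫ Φ = φ k := fun k ↦ 𝒰.ι_glueMorphisms φ hglue k
  refine ⟨Φ, ?_, fun k ↦ ?_⟩
  · refine Scheme.hom_ext_of_forall _ _ fun x ↦ ?_
    obtain ⟨k, hk⟩ := hcov x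
    exact ⟨O k, hk, by rw [reassoc_of% (hΦ k), hφf]⟩
  · have e : O k ≤ Φ ⁻¹ᵁ W (κ k) := fun x hx ↦ by
      have h1 : (⟨x, hx⟩ : (O k).toScheme) ∈ φ k ⁻¹ᵁ W (κ k) := hφW k trivial
      rw [← hΦ k] at h1
      exact h1
    refine ⟨e, ?_⟩
    have hiso := isIso_ι_appLE (O k)
    have hinj : Function.Injective ((O k).ι.appLE (O k) ⊤ (hs k)) :=
      ((ConcreteCategory.isIso_iff_bijective _).mp hiso).1
    apply hinj
    rw [← hφt k, ← CommRingCat.comp_apply, Scheme.Hom.appLE_comp_appLE]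
    simp only [hΦ k]

end IsModel

open Polynomial in
theorem exists_chart {B : Scheme.{u}} {U : B.Opens} (hU : IsAffineOpen U) (P : Γ(B, U)[X]) :
    ∃ (Y : Scheme.{u}) (f : Y ⟶ B) (t : Γ(Y, ⊤)), IsChart f U ⊤ P t := by
  let R := CommRingCat.of (AdjoinRoot P)
  let c : Γ(B, U) ⟶ R := CommRingCat.ofHom (AdjoinRoot.of P)
  let f : Spec R ⟶ B := Spec.map c ≫ hU.fromSpec
  have e : ⊤ ≤ f ⁻¹ᵁ U := fun x _ ↦ hU.range_fromSpec.le ⟨_, rfl⟩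
  let t : Γ(Spec R, ⊤) := (Scheme.ΓSpecIso R).inv (AdjoinRoot.root P)
  have hf : f.appLE U ⊤ e = c ≫ (Scheme.ΓSpecIso R).inv := by
    have h1 : (⊤ : (Spec Γ(B, U)).Opens) ≤ hU.fromSpec ⁻¹ᵁ U := by rw [hU.fromSpec_preimage_self]
    rw [← Scheme.Hom.appLE_comp_appLE _ _ U ⊤ ⊤ h1 (fun _ _ ↦ trivial)]
    have h2 : hU.fromSpec.appLE U ⊤ h1 = (Scheme.ΓSpecIso Γ(B, U)).inv := by
      rw [Scheme.Hom.appLE, hU.fromSpec_app_self, Category.assoc, ← Functor.map_comp]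
      exact (congrArg (_ ≫ ·) ((Spec Γ(B, U)).presheaf.map_id _)).trans (Category.comp_id _)
    have h3 : (Spec.map c).appLE ⊤ ⊤ (fun _ _ ↦ trivial) = (Spec.map c).appTop := by
      rw [Scheme.Hom.appTop, Scheme.Hom.app_eq_appLE]; rfl
    rw [h2, h3, ← Scheme.ΓSpecIso_inv_naturality]
  have hmap : chartMap f U ⊤ e t = (Scheme.ΓSpecIso R).inv.hom.comp (AdjoinRoot.mk P) := by
    refine Polynomial.ringHom_ext (fun a ↦ ?_) ?_
    · have := congrArg (fun m ↦ m.hom a) hf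
      rw [chartMap, coe_eval₂RingHom, eval₂_C]
      exact this
    · rw [chartMap, coe_eval₂RingHom, eval₂_X]
      rfl
  have hbij : Function.Bijective (Scheme.ΓSpecIso R).inv.hom :=
    (ConcreteCategory.isIso_iff_bijective _).mp inferInstance
  refine ⟨Spec R, f, t, isAffineOpen_top _, e, ?_, ?_⟩
  · rw [hmap]
    exact hbij.2.comp AdjoinRoot.mk_surjective
  · rw [hmap]
    ext p
    rw [RingHom.mem_ker, RingHom.comp_apply, map_eq_zero_iff _ hbij.1, AdjoinRoot.mk_eq_zero,
      Ideal.mem_span_singleton]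

/-- Charts are preserved by open immersions. -/
theorem IsChart.of_isOpenImmersion {Y Y' B : Scheme.{u}} {f : Y ⟶ B} {U : B.Opens}
    {P : Polynomial Γ(B, U)} {t : Γ(Y, ⊤)} (hc : IsChart f U ⊤ P t) (ι : Y ⟶ Y')
    [IsOpenImmersion ι] (F : Y' ⟶ B) (hF : ι ≫ F = f) :
    ∃ (t' : Γ(Y', ι.opensRange)) (e : ⊤ ≤ ι ⁻¹ᵁ ι.opensRange),
      ι.appLE ι.opensRange ⊤ e t' = t ∧ IsChart F U ι.opensRange P t' := by
  have e : ⊤ ≤ ι ⁻¹ᵁ ι.opensRange := fun x _ ↦ ⟨x, rfl⟩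
  have hiso' : ∀ (V : Y'.Opens) (_ : V = ι ''ᵁ ⊤) (e : ⊤ ≤ ι ⁻¹ᵁ V), IsIso (ι.appLE V ⊤ e) := by
    rintro _ rfl e
    rw [← ι.appIso_hom' ⊤]
    infer_instance
  have hiso := hiso' ι.opensRange ι.image_top_eq_opensRange.symm e
  have hbij := (ConcreteCategory.isIso_iff_bijective _).mp hiso
  obtain ⟨t', ht'⟩ := hbij.2 t
  have hle : ι.opensRange ≤ F ⁻¹ᵁ U := by
    rintro _ ⟨x, rfl⟩
    have : F (ι x) = f x := by rw [← hF]; rfl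
    change F (ι x) ∈ U
    rw [this]
    exact hc.le trivial
  have haff : IsAffineOpen ι.opensRange := by
    rw [← Scheme.Hom.image_top_eq_opensRange]
    exact hc.affine.image_of_isOpenImmersion ι
  have hmap : (ι.appLE ι.opensRange ⊤ e).hom.comp (chartMap F U ι.opensRange hle t') =
      chartMap f U ⊤ hc.le t := by
    refine Polynomial.ringHom_ext (fun a ↦ ?_) ?_
    · have h1 := appLE_comp ι F hle e (by rw [hF]; exact hc.le) a
      have h2 := appLE_congr_hom hF (by rw [hF]; exact hc.le) hc.le a
      simpa [chartMap] using h1.symm.trans h2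
    · simpa [chartMap] using ht'
  refine ⟨t', e, ht', haff, hle, ?_, ?_⟩
  · have h := hc.surjective
    rw [← hmap] at h
    intro s
    obtain ⟨p, hp⟩ := h (ι.appLE ι.opensRange ⊤ e s)
    exact ⟨p, hbij.1 hp⟩
  · rw [← hc.ker, ← hmap]
    ext p
    rw [RingHom.mem_ker, RingHom.mem_ker, RingHom.comp_apply]
    exact (map_eq_zero_iff (ι.appLE ι.opensRange ⊤ e).hom hbij.1).symm

theorem isUnit_appLE {X Y : Scheme.{u}} (f : X ⟶ Y) {U : Y.Opens} {W : X.Opens}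
    (e : W ≤ f ⁻¹ᵁ U) {s : Γ(Y, U)} (hs : IsUnit s) : IsUnit (f.appLE U W e s) :=
  hs.map (f.appLE U W e).hom

theorem isUnit_of_le_basicOpen {X : Scheme.{u}} {U : X.Opens} {s : Γ(X, U)}
    (h : U ≤ X.basicOpen s) : IsUnit s := by
  have h1 := X.toRingedSpace.isUnit_res_basicOpen s
  have h2 : IsUnit (res (X.basicOpen_le s) s) := h1
  have h3 := h2.map (res h)
  rwa [res_res, res_self] at h3

/-- The cocycle condition, pulled back. -/
theorem Cocycle.appLE_mul {B T : Scheme.{u}} {I : Type u} {U : I → B.Opens} (L : Cocycle U)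
    (h : T ⟶ B) (O : T.Opens) (i j l : I) (e₁ : O ≤ h ⁻¹ᵁ (U i ⊓ U j)) (e₂ : O ≤ h ⁻¹ᵁ (U j ⊓ U l))
    (e₃ : O ≤ h ⁻¹ᵁ (U i ⊓ U l)) :
    h.appLE _ O e₁ (L.tr i j : Γ(B, U i ⊓ U j)) * h.appLE _ O e₂ (L.tr j l : Γ(B, U j ⊓ U l)) =
      h.appLE _ O e₃ (L.tr i l : Γ(B, U i ⊓ U l)) := by
  have e : O ≤ h ⁻¹ᵁ (U i ⊓ U j ⊓ U l) := fun x hx ↦ ⟨e₁ hx, (e₂ hx).2⟩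
  have := congrArg (h.appLE _ O e) (L.cocycle i j l)
  rw [map_mul, appLE_res h _ e e₁, appLE_res h _ e e₂, appLE_res h _ e e₃] at this
  exact this

section

variable {B : Scheme.{u}} (A : LineAtlas B) {Y : A.J → Scheme.{u}} {f : ∀ j, Y j ⟶ B}
  (t : ∀ j, Γ(Y j, ⊤))

/-- The part of one chart that meets another. -/
def LineAtlas.overlapOpen (i j : A.J) (f : Y i ⟶ B) : (Y i).Opens :=
  f ⁻¹ᵁ A.U j ⊓ (if A.kind i = A.kind j then ⊤ else (Y i).basicOpen (t i))

theorem LineAtlas.mem_overlapOpen {i j : A.J} {f : Y i ⟶ B} {x : Y i} :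
    x ∈ A.overlapOpen t i j f ↔
      f x ∈ A.U j ∧ (A.kind i = A.kind j ∨ x ∈ (Y i).basicOpen (t i)) := by
  unfold LineAtlas.overlapOpen
  split_ifs with h
  · simp [h]
  · simp [h]

end

theorem top_le_preimage {X Y : Scheme.{u}} (f : X ⟶ Y) : ⊤ ≤ f ⁻¹ᵁ ⊤ := fun _ _ ↦ trivial

theorem top_le_comp_preimage_opensRange {X Y Z : Scheme.{u}} (f : X ⟶ Y) (g : Y ⟶ Z)
    [IsOpenImmersion g] : ⊤ ≤ (f ≫ g) ⁻¹ᵁ g.opensRange :=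
  fun x _ ↦ ⟨f x, (Scheme.Hom.comp_apply f g x).symm⟩

theorem appLE_injective_of_image_eq {X Y : Scheme.{u}} (f : X ⟶ Y) [IsOpenImmersion f]
    {W : Y.Opens} (hW : W = f ''ᵁ ⊤) (e : ⊤ ≤ f ⁻¹ᵁ W) : Function.Injective (f.appLE W ⊤ e) := by
  have : IsIso (f.appLE W ⊤ e) := by
    subst hW
    rw [← f.appIso_hom' ⊤]
    infer_instance
  exact ((ConcreteCategory.isIso_iff_bijective _).mp this).1

set_option maxHeartbeats 1000000 in
/-- Every atlas has a model. -/
theorem exists_model {B : Scheme.{u}} (A : LineAtlas B) :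
    ∃ (Y : Scheme.{u}) (f : Y ⟶ B) (W : A.J → Y.Opens) (t : ∀ j, Γ(Y, W j)), IsModel A f W t := by
  choose Y f t hc using fun j ↦ exists_chart (A.affine j) (A.P j)
  let V : ∀ i, A.J → (Y i).Opens := fun i j ↦ A.overlapOpen t i j (f i)
  have hV : ∀ i j, (⊤ : (V i j).toScheme.Opens) ≤ ((V i j).ι ≫ f i) ⁻¹ᵁ (A.U i ⊓ A.U j) :=
    fun i j x _ ↦ ⟨(hc i).le trivial, ((A.mem_overlapOpen t).mp x.2).1⟩
  have hVj : ∀ i j, (⊤ : (V i j).toScheme.Opens) ≤ ((V i j).ι ≫ f i) ⁻¹ᵁ A.U j :=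
    fun i j x hx ↦ (hV i j hx).2
  have hVt : ∀ i j, (⊤ : (V i j).toScheme.Opens) ≤ (V i j).ι ⁻¹ᵁ ⊤ := fun i j x _ ↦ trivial
  let g : ∀ i j, Γ(V i j, ⊤) := fun i j ↦ ((V i j).ι ≫ f i).appLE _ ⊤ (hV i j)
    (A.g.tr i j : Γ(B, A.U i ⊓ A.U j))
  have hg : ∀ i j, IsUnit (g i j) := fun i j ↦ isUnit_appLE _ _ (A.g.tr i j).isUnit
  -- `τ i j` is the coordinate of chart `j` expressed on the part of chart `i` that is to be glued
  -- to it.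
  have hτ : ∀ i j, ∃ τ, Linked (A.kind i) (A.kind j) (g i j)
      ((V i j).ι.appLE ⊤ ⊤ (hVt i j) (t i)) τ := fun i j ↦ by
    refine Linked.exists_of_isUnit (hg i j) ?_
    by_cases hk : A.kind i = A.kind j
    · exact Or.inl hk
    · right
      refine isUnit_of_le_basicOpen ?_
      rw [Scheme.basicOpen_appLE]
      intro x _
      exact ⟨trivial, (((A.mem_overlapOpen t).mp x.2).2).resolve_left hk⟩
  choose τ hτ using hτ
  have hφ : ∀ i j, ∃ (φ : (V i j).toScheme ⟶ Y j) (e : ⊤ ≤ φ ⁻¹ᵁ ⊤),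
      φ ≫ f j = (V i j).ι ≫ f i ∧ φ.appLE ⊤ ⊤ e (t j) = τ i j := fun i j ↦ by
    refine (hc j).exists_hom (A.affine j) _ (hVj i j) _ ?_
    have h1 := A.compat i j Γ(V i j, ⊤) (((V i j).ι ≫ f i).appLE _ ⊤ (hV i j)).hom _ _ (hτ i j) ?_
    · refine Eq.trans ?_ h1
      congr 1
      ext s
      exact (appLE_res ((V i j).ι ≫ f i) inf_le_right (hV i j) (hVj i j) s).symm
    · have h2 := congrArg ((V i j).ι.appLE ⊤ ⊤ (hVt i j)).hom (hc i).eval_eq_zero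
      rw [Polynomial.hom_eval₂, map_zero] at h2
      refine Eq.trans ?_ h2
      congr 1
      ext s
      refine (appLE_res ((V i j).ι ≫ f i) inf_le_left (hV i j) (fun x hx ↦ (hV i j hx).1) s).trans ?_
      exact appLE_comp _ _ _ _ _ _
  choose φ hφt hφf hφτ using hφ
  -- on a further overlap, coordinates compose
  have hmem : ∀ i j k (x : (V i j).toScheme), (V i j).ι x ∈ V i k → φ i j x ∈ V j k := by
    intro i j k x hx
    have hx' := (A.mem_overlapOpen t).mp hx
    refine (A.mem_overlapOpen t).mpr ⟨?_, ?_⟩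
    · have : f j (φ i j x) = f i ((V i j).ι x) := by
        rw [← Scheme.Hom.comp_apply, hφf]; rfl
      rw [this]
      exact hx'.1
    · by_cases hjk : A.kind j = A.kind k
      · exact Or.inl hjk
      · right
        have hb : x ∈ (V i j).toScheme.basicOpen (τ i j) := by
          rw [Scheme.mem_basicOpen _ _ _ (by trivial : x ∈ ⊤)]
          have hl := (hτ i j).map ((V i j).toScheme.presheaf.germ ⊤ x trivial).hom
          have hgu := (hg i j).map ((V i j).toScheme.presheaf.germ ⊤ x trivial).hom
          by_cases hij : A.kind i = A.kind j
          · refine hl.isUnit_of_eq hgu hij ?_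
            have hx2 := hx'.2.resolve_left (hij ▸ hjk)
            have : x ∈ (V i j).toScheme.basicOpen ((V i j).ι.appLE ⊤ ⊤ (hVt i j) (t i)) := by
              rw [Scheme.basicOpen_appLE]
              exact ⟨trivial, hx2⟩
            exact (Scheme.mem_basicOpen _ _ _ (by trivial : x ∈ ⊤)).mp this
          · exact (hl.isUnit_of_ne hgu hij).2
        rw [← hφτ, Scheme.basicOpen_appLE] at hb
        exact hb.2
  have hcomp : ∀ i j k (T : Scheme.{u}) (p : T ⟶ V i j) (q : T ⟶ V j k) (r : T ⟶ V i k),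
      p ≫ φ i j = q ≫ (V j k).ι → p ≫ (V i j).ι = r ≫ (V i k).ι → q ≫ φ j k = r ≫ φ i k := by
    intro i j k T p q r hpq hpr
    have hpt : (⊤ : T.Opens) ≤ p ⁻¹ᵁ ⊤ := fun _ _ ↦ trivial
    have hqt : (⊤ : T.Opens) ≤ q ⁻¹ᵁ ⊤ := fun _ _ ↦ trivial
    have hrt : (⊤ : T.Opens) ≤ r ⁻¹ᵁ ⊤ := fun _ _ ↦ trivial
    have hb1 : p ≫ (V i j).ι ≫ f i = q ≫ (V j k).ι ≫ f j := by
      rw [← hφf, reassoc_of% hpq]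
    have hb2 : p ≫ (V i j).ι ≫ f i = r ≫ (V i k).ι ≫ f i := by
      rw [reassoc_of% hpr]
    have e1 : ⊤ ≤ (p ≫ (V i j).ι ≫ f i) ⁻¹ᵁ (A.U i ⊓ A.U j) := fun x _ ↦ hV i j (by trivial : p x ∈ ⊤)
    have e2 : ⊤ ≤ (q ≫ (V j k).ι ≫ f j) ⁻¹ᵁ (A.U j ⊓ A.U k) := fun x _ ↦ hV j k (by trivial : q x ∈ ⊤)
    have e3 : ⊤ ≤ (r ≫ (V i k).ι ≫ f i) ⁻¹ᵁ (A.U i ⊓ A.U k) := fun x _ ↦ hV i k (by trivial : r x ∈ ⊤)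
    refine (hc k).hom_ext (top_le_preimage _) (top_le_preimage _) ?_ ?_
    · rw [Category.assoc, Category.assoc, hφf, hφf, ← hb1, ← hb2]
    · rw [appLE_comp q (φ j k) (hφt j k) hqt, appLE_comp r (φ i k) (hφt i k) hrt, hφτ, hφτ]
      have l1 := (hτ i j).map (p.appLE ⊤ ⊤ hpt).hom
      have l2 := (hτ j k).map (q.appLE ⊤ ⊤ hqt).hom
      have l3 := (hτ i k).map (r.appLE ⊤ ⊤ hrt).hom
      have g1 : p.appLE ⊤ ⊤ hpt (g i j) = (p ≫ (V i j).ι ≫ f i).appLE _ ⊤ e1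
        (A.g.tr i j : Γ(B, A.U i ⊓ A.U j)) := (appLE_comp _ _ _ _ _ _).symm
      have g2 : q.appLE ⊤ ⊤ hqt (g j k) = (p ≫ (V i j).ι ≫ f i).appLE _ ⊤ (by rw [hb1]; exact e2)
        (A.g.tr j k : Γ(B, A.U j ⊓ A.U k)) :=
        (appLE_comp _ _ _ _ e2 _).symm.trans (appLE_congr_hom hb1.symm _ _ _)
      have g3 : r.appLE ⊤ ⊤ hrt (g i k) = (p ≫ (V i j).ι ≫ f i).appLE _ ⊤ (by rw [hb2]; exact e3)
        (A.g.tr i k : Γ(B, A.U i ⊓ A.U k)) :=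
        (appLE_comp _ _ _ _ e3 _).symm.trans (appLE_congr_hom hb2.symm _ _ _)
      have t1 : q.appLE ⊤ ⊤ hqt ((V j k).ι.appLE ⊤ ⊤ (hVt j k) (t j)) =
          p.appLE ⊤ ⊤ hpt (τ i j) := by
        rw [← hφτ i j, ← appLE_comp _ _ _ _ (top_le_preimage _),
          ← appLE_comp _ _ _ _ (top_le_preimage _)]
        exact appLE_congr_hom hpq.symm _ _ _
      have t2 : r.appLE ⊤ ⊤ hrt ((V i k).ι.appLE ⊤ ⊤ (hVt i k) (t i)) =
          p.appLE ⊤ ⊤ hpt ((V i j).ι.appLE ⊤ ⊤ (hVt i j) (t i)) := by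
        rw [← appLE_comp _ _ _ _ (top_le_preimage _),
          ← appLE_comp _ _ _ _ (top_le_preimage _)]
        exact appLE_congr_hom hpr.symm _ _ _
      have l2' : Linked (A.kind j) (A.kind k) (q.appLE ⊤ ⊤ hqt (g j k))
        (p.appLE ⊤ ⊤ hpt (τ i j)) (q.appLE ⊤ ⊤ hqt (τ j k)) := t1 ▸ l2
      have l3' : Linked (A.kind i) (A.kind k) (r.appLE ⊤ ⊤ hrt (g i k))
        (p.appLE ⊤ ⊤ hpt ((V i j).ι.appLE ⊤ ⊤ (hVt i j) (t i))) (r.appLE ⊤ ⊤ hrt (τ i k)) := t2 ▸ l3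
      have l4 := Linked.trans l1 l2'
      have hgg : p.appLE ⊤ ⊤ hpt (g i j) * q.appLE ⊤ ⊤ hqt (g j k) = r.appLE ⊤ ⊤ hrt (g i k) := by
        rw [g1, g2, g3]
        exact A.g.appLE_mul _ _ _ _ _ _ _ _
      have l5 : Linked (A.kind i) (A.kind k) (r.appLE ⊤ ⊤ hrt (g i k))
        (p.appLE ⊤ ⊤ hpt ((V i j).ι.appLE ⊤ ⊤ (hVt i j) (t i))) (q.appLE ⊤ ⊤ hqt (τ j k)) :=
        hgg ▸ l4
      exact Linked.unique (isUnit_appLE _ _ (hg i k)) l5 l3'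
  -- The transition function of a chart with itself is `1`, so `τ i i` is the coordinate `t i`.
  have hφself : ∀ i, φ i i = (V i i).ι := by
    intro i
    refine (hc i).hom_ext (hφt i i) (hVt i i) (hφf i i) ?_
    rw [hφτ]
    have h1 : g i i = 1 := by
      have := A.g.tr_self i
      simp only [g]
      rw [this, map_one]
    have := hτ i i
    rw [h1] at this
    exact this.eq_of_self.symm
  obtain ⟨X, ι, F, h1, h2, h3, h4, h5⟩ := exists_glued Y f V φ (fun i ↦ by
    rw [eq_top_iff]
    intro x _
    exact (A.mem_overlapOpen t).mpr ⟨(hc i).le trivial, Or.inl rfl⟩) hφself hφf hmem hcomp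
  have H := fun i ↦ (hc i).of_isOpenImmersion (ι i) F (h3 i)
  choose t' ht'e ht' hchart using H
  refine ⟨X, F, fun i ↦ (ι i).opensRange, t', hchart, fun x ↦ ?_, ?_, ?_⟩
  · obtain ⟨i, y, hy⟩ := h2 x
    exact ⟨i, y, hy⟩
  · rintro i j _ ⟨y, rfl⟩ hF hk
    have hy : y ∈ V i j := by
      refine (A.mem_overlapOpen t).mpr ⟨?_, ?_⟩
      · rw [← h3 i]; exact hF
      · refine hk.imp id fun hb ↦ ?_
        rw [← ht' i, Scheme.basicOpen_appLE]
        exact ⟨trivial, hb⟩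
    have := congrArg (fun m ↦ m ⟨y, hy⟩) (h4 i j)
    refine ⟨φ i j ⟨y, hy⟩, ?_⟩
    exact this.symm
  · intro i j e
    have hle : ⊤ ≤ ((V i j).ι ≫ ι i) ⁻¹ᵁ ((ι i).opensRange ⊓ (ι j).opensRange) := fun x _ ↦
      ⟨top_le_comp_preimage_opensRange _ _ trivial,
        by rw [h4 i j]; exact top_le_comp_preimage_opensRange _ _ trivial⟩
    have hli : ⊤ ≤ ((V i j).ι ≫ ι i) ⁻¹ᵁ (ι i).opensRange := fun x hx ↦ (hle hx).1
    have hlj : ⊤ ≤ ((V i j).ι ≫ ι i) ⁻¹ᵁ (ι j).opensRange := fun x hx ↦ (hle hx).2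
    have hinj : Function.Injective (((V i j).ι ≫ ι i).appLE _ ⊤ hle) := by
      have him : ((V i j).ι ≫ ι i) ''ᵁ ⊤ = (ι i).opensRange ⊓ (ι j).opensRange := by
        ext x
        constructor
        · rintro ⟨y, -, rfl⟩
          exact hle trivial
        · rintro ⟨⟨y, rfl⟩, ⟨z, hz⟩⟩
          exact ⟨⟨y, h5 i j y z hz.symm⟩, trivial, rfl⟩
      exact appLE_injective_of_image_eq _ him.symm hle
    -- The link may be checked after pulling back to `V i j`, which is mapped isomorphically onto
    -- the intersection of the two charts.
    refine Linked.of_map (φ := (((V i j).ι ≫ ι i).appLE _ ⊤ hle).hom) hinj ?_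
    have ea : ((V i j).ι ≫ ι i).appLE _ ⊤ hle (F.appLE _ _ e (A.g.tr i j : Γ(B, A.U i ⊓ A.U j))) =
        g i j := by
      have hF : ⊤ ≤ (((V i j).ι ≫ ι i) ≫ F) ⁻¹ᵁ (A.U i ⊓ A.U j) :=
        hle.trans (((V i j).ι ≫ ι i).preimage_mono e)
      exact (appLE_comp ((V i j).ι ≫ ι i) F e hle hF _).symm.trans
        (appLE_congr_hom (by rw [Category.assoc, h3]) _ _ _)
    have eb : ((V i j).ι ≫ ι i).appLE _ ⊤ hle (res inf_le_left (t' i)) =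
        (V i j).ι.appLE ⊤ ⊤ (hVt i j) (t i) := by
      rw [appLE_res _ _ _ hli, appLE_comp _ _ (ht'e i) (hVt i j), ht']
    have ec : ((V i j).ι ≫ ι i).appLE _ ⊤ hle (res inf_le_right (t' j)) = τ i j := by
      have hlj' := top_le_comp_preimage_opensRange (φ i j) (ι j)
      refine (appLE_res _ _ hle hlj _).trans ((appLE_congr_hom (h4 i j) hlj hlj' _).trans ?_)
      rw [appLE_comp (φ i j) (ι j) (ht'e j) (hφt i j) hlj' (t' j), ht', hφτ]
    have := hτ i j
    rw [← ea, ← eb, ← ec] at this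
    exact this

/-! ### The limits of the two families -/

namespace TateForm

variable {k : Type u} [Field k] {n : ℕ} {S : Base k n} {T : TateType} (F : TateForm S T)

open Polynomial

theorem dwFamily_isSenLimit (i : S.I) :
    IsSenLimit (F.dwFamily i) (F.a1 i ^ 2 + 4 * F.a2 i)
      (F.a1 i * F.a3 i + 2 * F.a4 i) (F.a3 i ^ 2 + 4 * F.a6 i) := by
  have h2 : (F.dwFamily i).b₂ = C (F.a1 i ^ 2 + 4 * F.a2 i) := by
    simp [WeierstrassCurve.b₂, dwFamily, map_ofNat C]
  have h4 : (F.dwFamily i).b₄ = X * C (F.a1 i * F.a3 i + 2 * F.a4 i) := by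
    simp [WeierstrassCurve.b₄, dwFamily, map_ofNat C]; ring
  have h6 : (F.dwFamily i).b₆ = X ^ 2 * C (F.a3 i ^ 2 + 4 * F.a6 i) := by
    simp [WeierstrassCurve.b₆, dwFamily, map_ofNat C]; ring
  rw [IsSenLimit, h2, h4, h6]
  refine ⟨coeff_C_zero, coeff_X_mul_zero _, ?_, ?_, ?_, ?_⟩
  · rw [coeff_X_mul, coeff_C_zero]
  · rw [coeff_X_pow_mul', if_neg (by norm_num)]
  · rw [coeff_X_pow_mul', if_neg (by norm_num)]
  · rw [coeff_X_pow_mul', if_pos le_rfl, Nat.sub_self, coeff_C_zero]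

theorem orthFamily_isSenLimit (i : S.I) :
    IsSenLimit (F.orthFamily i) (4 * F.a2 i) (2 * F.a4 i) (F.a3 i ^ 2 + 4 * F.a6 i) := by
  have h2 : (F.orthFamily i).b₂ = C (4 * F.a2 i) + X ^ 2 * C (F.a1 i ^ 2) := by
    simp [WeierstrassCurve.b₂, orthFamily, map_ofNat C]; ring
  have h4 : (F.orthFamily i).b₄ = X * C (2 * F.a4 i) + X ^ 2 * C (F.a1 i * F.a3 i) := by
    simp [WeierstrassCurve.b₄, orthFamily, map_ofNat C]; ring
  have h6 : (F.orthFamily i).b₆ = X ^ 2 * C (F.a3 i ^ 2 + 4 * F.a6 i) := by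
    simp [WeierstrassCurve.b₆, orthFamily, map_ofNat C]; ring
  rw [IsSenLimit, h2, h4, h6]
  refine ⟨?_, ?_, ?_, ?_, ?_, ?_⟩ <;>
    simp only [coeff_add, coeff_X_pow_mul', coeff_X_mul_zero, coeff_C_zero] <;>
    simp [-map_add, -map_mul]

/-- `ε²` divides `b₈`, and the terms in `b₄³`, `b₆²`, `b₂b₄b₆` have order at least `3`. Thus only
`-b₂²b₈` contributes in order `2`. The factor `4` comes from `4b₈ = b₂b₆ - b₄²`. -/
theorem orthFamily_discriminant (i : S.I) :
    (F.orthFamily i).Δ.coeff 0 = 0 ∧ (F.orthFamily i).Δ.coeff 1 = 0 ∧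
      4 * (F.orthFamily i).Δ.coeff 2 = -((4 * F.a2 i) ^ 2 *
        (4 * F.a2 i * (F.a3 i ^ 2 + 4 * F.a6 i) - (2 * F.a4 i) ^ 2)) := by
  let A₁ := C (F.a1 i)
  let A₂ := C (F.a2 i)
  let A₃ := C (F.a3 i)
  let A₄ := C (F.a4 i)
  let A₆ := C (F.a6 i)
  have h : (F.orthFamily i).Δ = X ^ 2 *
      (-(4 * A₂ + X ^ 2 * A₁ ^ 2) ^ 2 * (X ^ 2 * A₁ ^ 2 * A₆ + 4 * A₂ * A₆ - X * A₁ * A₃ * A₄ +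
        A₂ * A₃ ^ 2 - A₄ ^ 2) - 8 * X * (2 * A₄ + X * A₁ * A₃) ^ 3 - 27 * X ^ 2 * (A₃ ^ 2 + 4 * A₆) ^ 2 +
        9 * X * (4 * A₂ + X ^ 2 * A₁ ^ 2) * (2 * A₄ + X * A₁ * A₃) * (A₃ ^ 2 + 4 * A₆)) := by
    simp only [WeierstrassCurve.Δ, WeierstrassCurve.b₂, WeierstrassCurve.b₄, WeierstrassCurve.b₆,
      WeierstrassCurve.b₈, orthFamily, A₁, A₂, A₃, A₄, A₆]
    ring
  rw [h]
  refine ⟨?_, ?_, ?_⟩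
  · rw [coeff_X_pow_mul', if_neg (by norm_num)]
  · rw [coeff_X_pow_mul', if_neg (by norm_num)]
  · rw [coeff_X_pow_mul', if_pos le_rfl, Nat.sub_self, coeff_zero_eq_eval_zero]
    simp [A₁, A₂, A₃, A₄, A₆]
    ring

end TateForm

theorem TateType.isUnitary_iff (T : TateType) : (T.mult.m1 = 0 ∧ 1 ≤ T.mult.m2) ↔ T.IsUnitary := by
  cases T <;> simp [TateType.mult, TateType.IsUnitary]

/-- The inequality says that the additional factor `σ` in `a₁a₃`, present when `σ ∣ a₁`, suffices
for the multiplicity of `a₄`. -/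
theorem TateType.IsUnitary.mult_eq {T : TateType} (h : T.IsUnitary) :
    T.mult.m1 = 0 ∧ T.mult.m2 = 1 ∧ T.mult.m4 ≤ T.mult.m3 + 1 := by
  cases T <;> simp_all [TateType.mult, TateType.IsUnitary]

/-- These inequalities make `a₁²` and `a₁a₃` as divisible by `σ` as `a₂` and `a₄` must be.
Non-unitary rows with `m₁ = 0` have `m₂ = 0` and `m₃ = m₄`; the rows with `m₁ = 1` have `m₂ ≤ 2` and
`m₄ ≤ m₃ + 1`. -/
theorem TateType.mult_le_of_not_isUnitary {T : TateType} (h : ¬ T.IsUnitary) :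
    T.mult.m2 ≤ 2 * T.mult.m1 ∧ T.mult.m4 ≤ T.mult.m1 + T.mult.m3 := by
  cases T <;> simp_all [TateType.mult, TateType.IsUnitary]

/-! ### Sections of line bundles -/

namespace IsSection

variable {B : Scheme.{u}} {I : Type u} {U : I → B.Opens} {L M : Cocycle U} {p q p' q' : ℤ}
  {s s' : ∀ i, Γ(B, U i)}

theorem mul (h : IsSection L M p q s) (h' : IsSection L M p' q' s') :
    IsSection L M (p + p') (q + q') (fun i ↦ s i * s' i) := fun i j ↦ by
  rw [map_mul, h i j, h' i j, map_mul, zpow_add, zpow_add]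
  push_cast
  ring

theorem add (h : IsSection L M p q s) (h' : IsSection L M p q s') :
    IsSection L M p q (fun i ↦ s i + s' i) := fun i j ↦ by
  rw [map_add, h i j, h' i j, map_add, mul_add]

theorem zero : IsSection L M p q (fun _ ↦ 0) := fun i j ↦ by
  rw [map_zero, map_zero, mul_zero]

theorem one : IsSection L M 0 0 (fun _ ↦ 1) := fun i j ↦ by
  simp

theorem pow (h : IsSection L M p q s) (m : ℕ) :
    IsSection L M (m * p) (m * q) (fun i ↦ s i ^ m) := by
  induction m with
  | zero => simpa using one
  | succ m ih =>
    have := ih.mul h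
    simp only [pow_succ]
    convert this using 1 <;> push_cast <;> ring

theorem congr (h : IsSection L M p q s) (hp : p = p') (hq : q = q') : IsSection L M p' q' s :=
  hp ▸ hq ▸ h

end IsSection

section

variable {k : Type u} [Field k] {X : Scheme.{u}} (f : X ⟶ Spec (.of k))

theorem res_constants {V W : X.Opens} (h : W ≤ V) (c : k) :
    res h (constants f V c) = constants f W c := by
  simp only [constants, RingHom.comp_apply]
  exact res_appLE f h _ _ _

theorem IsSection.const_mul {I : Type u} {U : I → X.Opens} {L M : Cocycle U} {p q : ℤ}
    {s : ∀ i, Γ(X, U i)} (h : IsSection L M p q s) (c : k) :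
    IsSection L M p q (fun i ↦ constants f (U i) c * s i) := fun i j ↦ by
  rw [map_mul, h i j, map_mul, res_constants, res_constants]
  ring

end

/-! ### Reduced divisors and division by `σ` -/

section

variable {k : Type u} [Field k] {B : Scheme.{u}} (f : B ⟶ Spec (.of k)) {U : B.Opens}

/-- A function with nonvanishing differential along its zeros defines a reduced divisor. -/
theorem isReduced_quotient_of_isTransversal [Smooth f] (hU : IsAffineOpen U) {σ : Γ(B, U)}
    (h : IsTransversal f U ![σ]) : IsReduced (Γ(B, U) ⧸ Ideal.span {σ}) := by
  let _ := sectionsAlgebra f U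
  have : Algebra.Smooth k Γ(B, U) := constants_smooth f hU
  have := smooth_of_differential_ne_zero (k := k) (S := Γ(B, U)) (R := Γ(B, U) ⧸ Ideal.span {σ})
    Ideal.Quotient.mk_surjective σ Ideal.mk_ker (fun Q hQ hσ ↦ by
      exact (h Q (fun j ↦ by fin_cases j; exact hσ)).2.ne_zero 0)
  exact isReduced_of_smooth k _

theorem dvd_of_dvd_sq_of_isReduced {A : Type*} [CommRing A] {σ x : A}
    [IsReduced (A ⧸ Ideal.span {σ})] (h : σ ∣ x ^ 2) : σ ∣ x := by
  rw [← Ideal.mem_span_singleton, ← Ideal.Quotient.eq_zero_iff_mem] at h ⊢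
  rw [map_pow] at h
  exact pow_eq_zero_iff two_ne_zero |>.mp h

/-- The zero function vanishes at every maximal ideal and has zero differential there, against
independence. -/
theorem ne_zero_of_isTransversal {σ : Γ(B, U)} {m : ℕ} {s : Fin m → Γ(B, U)} (h : IsTransversal f U s)
    [Nontrivial Γ(B, U)] (hs : ∀ j, s j = σ) (j : Fin m) : σ ≠ 0 := by
  rintro rfl
  let _ := sectionsAlgebra f U
  obtain ⟨q, hq⟩ := Ideal.exists_maximal Γ(B, U)
  have := (h q (fun j ↦ by rw [hs]; exact zero_mem _)).2.ne_zero j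
  rw [hs, map_zero, TensorProduct.tmul_zero] at this
  exact this rfl

end

/-- Restriction of functions on an integral scheme to a nonempty open subset is injective. -/
theorem res_injective {X : Scheme.{u}} [IsIntegral X] {V W : X.Opens} (h : W ≤ V)
    (hW : (W : Set X).Nonempty) : Function.Injective (res h) := by
  have : Nonempty W := hW.to_subtype
  have : Nonempty V := (hW.mono h).to_subtype
  intro a b hab
  have h1 := congrArg (X.germToFunctionField W) hab
  apply X.germToFunctionField_injective V
  have h3 : ∀ s, X.germToFunctionField W (res h s) = X.germToFunctionField V s := fun s ↦
    X.presheaf.germ_res_apply (homOfLE h) (genericPoint X) _ s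
  rwa [h3, h3] at h1

section

variable {k : Type u} [Field k] {n : ℕ} (S : Base k n)

theorem Base.σ_ne_zero (i : S.I) (h : (S.U i : Set S.B).Nonempty) : S.σ i ≠ 0 := by
  have := S.integral
  have : Nonempty (S.U i) := h.to_subtype
  exact ne_zero_of_isTransversal S.str (S.σ_smooth i) (fun j ↦ by fin_cases j; rfl) 0

/-- A section divisible by the equation of the divisor. -/
theorem Base.isSection_of_eq_mul {p q : ℤ} {s d : ∀ i, Γ(S.B, S.U i)}
    (hs : IsSection S.L S.D p (q + 1) s) (h : ∀ i, s i = S.σ i * d i) :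
    IsSection S.L S.D p q d := fun i j ↦ by
  have := S.integral
  -- On a nonempty overlap the functions form a domain and `σ` can be cancelled; on an empty one
  -- they form the zero ring.
  by_cases hne : ((S.U i ⊓ S.U j : S.B.Opens) : Set S.B).Nonempty
  · have : Nonempty (S.U i ⊓ S.U j : S.B.Opens) := hne.to_subtype
    have hσ : res (W := S.U i ⊓ S.U j) inf_le_right (S.σ j) ≠ 0 := fun h0 ↦
      S.σ_ne_zero j (hne.mono inf_le_right) (res_injective inf_le_right hne (h0.trans (map_zero _).symm))
    have h1 := hs i j
    have h2 := S.σ_section i j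
    rw [zpow_zero, one_mul, zpow_one] at h2
    rw [h i, h j, map_mul, map_mul, h2, zpow_add, zpow_one] at h1
    have hu : ((S.D.tr i j : Γ(S.B, S.U i ⊓ S.U j)) * res (W := S.U i ⊓ S.U j) inf_le_right (S.σ j)) ≠ 0 :=
      mul_ne_zero (S.D.tr i j).ne_zero hσ
    refine mul_left_cancel₀ hu (h1.trans ?_)
    push_cast
    ring
  · rw [Set.not_nonempty_iff_eq_empty] at hne
    have hbot : S.U i ⊓ S.U j = ⊥ := Opens.ext hne
    have : Subsingleton Γ(S.B, S.U i ⊓ S.U j) := by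
      rw [hbot]; infer_instance
    exact Subsingleton.elim _ _

end

/-! ### Comparison of the two limits -/

namespace TateForm

variable {k : Type u} [Field k] {n : ℕ} {S : Base k n} {T : TateType} (F : TateForm S T)

/-- Zero is a section of every line bundle, so `a₁` may be replaced by `0` without leaving the type.
The Donagi–Wijnholt data then lose exactly the terms in `a₁`. -/
theorem exists_sameLimit_orth :
    ∃ F' : TateForm S T, SameLimit (F'.dwFamily) (F.orthFamily) := by
  refine ⟨{ F with c1 := fun _ ↦ 0, sec1 := IsSection.zero }, fun i ↦ ?_⟩
  have h := dwFamily_isSenLimit { F with c1 := fun _ ↦ 0, sec1 := IsSection.zero } i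
  refine ⟨_, _, _, h, ?_⟩
  have h' := F.orthFamily_isSenLimit i
  convert h' using 1
  · simp [a1, a2]
  · simp [a1, a4]
  · rfl

/-- If `a₁²` and `a₁ a₃` are divisible as `a₂` and `a₄`, completing the square gives a Tate form. -/
theorem exists_sameLimit_dw (h2 : (2 : k) ≠ 0) {e2 e4 : ∀ i, Γ(S.B, S.U i)}
    (hs2 : IsSection S.L S.D 2 (-(T.mult.m2 : ℤ)) e2)
    (hs4 : IsSection S.L S.D 4 (-(T.mult.m4 : ℤ)) e4)
    (he2 : ∀ i, S.σ i ^ T.mult.m2 * e2 i = F.a1 i ^ 2)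
    (he4 : ∀ i, S.σ i ^ T.mult.m4 * e4 i = F.a1 i * F.a3 i) :
    ∃ F' : TateForm S T, SameLimit (F'.orthFamily) (F.dwFamily) := by
  have hc2 : ∀ i, 2 * constants S.str (S.U i) (2 : k)⁻¹ = 1 := fun i ↦ by
    have := congrArg (constants S.str (S.U i)) (mul_inv_cancel₀ h2)
    rwa [map_mul, map_ofNat, map_one] at this
  have hc4 : ∀ i, 4 * constants S.str (S.U i) ((2 : k)⁻¹ * 2⁻¹) = 1 := fun i ↦ by
    rw [map_mul]; linear_combination (2 * constants S.str (S.U i) (2 : k)⁻¹ + 1) * hc2 i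
  -- The new coefficients are `a₂ + a₁²/4` and `a₄ + a₁a₃/2`, so that `4a₂'` and `2a₄'` are the
  -- Donagi–Wijnholt `h` and `η`.
  let F' : TateForm S T :=
    { F with
      c2 := fun i ↦ F.c2 i + constants S.str (S.U i) ((2 : k)⁻¹ * 2⁻¹) * e2 i
      c4 := fun i ↦ F.c4 i + constants S.str (S.U i) (2 : k)⁻¹ * e4 i
      sec2 := F.sec2.add (hs2.const_mul S.str _)
      sec4 := F.sec4.add (hs4.const_mul S.str _) }
  refine ⟨F', fun i ↦ ⟨_, _, _, ?_, F.dwFamily_isSenLimit i⟩⟩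
  have h := F'.orthFamily_isSenLimit i
  convert h using 1
  · change _ = 4 * (S.σ i ^ T.mult.m2 * (F.c2 i + constants S.str (S.U i) ((2 : k)⁻¹ * 2⁻¹) * e2 i))
    rw [← he2 i, a2]
    linear_combination (-S.σ i ^ T.mult.m2 * e2 i) * hc4 i
  · change _ = 2 * (S.σ i ^ T.mult.m4 * (F.c4 i + constants S.str (S.U i) (2 : k)⁻¹ * e4 i))
    rw [← he4 i, a4]
    linear_combination (-S.σ i ^ T.mult.m4 * e4 i) * hc2 i
  · rfl

/-- In a unitary form `σ ∣ a₂`, so the hypothesis gives `σ ∣ a₁²`. The divisor `σ = 0` is smooth,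
hence reduced. -/
theorem dvd_a1_of_dvd (hT : T.IsUnitary) (i : S.I) (h : S.σ i ∣ F.a1 i ^ 2 + 4 * F.a2 i) :
    S.σ i ∣ F.a1 i := by
  have := S.smooth
  have := SmoothOfRelativeDimension.smooth n S.str
  have := isReduced_quotient_of_isTransversal S.str (S.affine i) (S.σ_smooth i)
  refine dvd_of_dvd_sq_of_isReduced ?_
  refine (dvd_add_left ?_).mp h
  rw [a2, hT.mult_eq.2.1, pow_one]
  exact (dvd_mul_right _ _).mul_left 4

theorem dvd_b₂_iff (hT : T.IsUnitary) :
    (∀ i, S.σ i ∣ (F.dwFamily i).b₂.coeff 0) ↔ ∀ i, S.σ i ∣ F.a1 i := by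
  have h : ∀ i, (F.dwFamily i).b₂.coeff 0 = F.a1 i ^ 2 + 4 * F.a2 i := fun i ↦
    (F.dwFamily_isSenLimit i).1
  refine ⟨fun H i ↦ F.dvd_a1_of_dvd hT i (h i ▸ H i), fun H i ↦ ?_⟩
  rw [h i, a2, hT.mult_eq.2.1, pow_one]
  exact dvd_add ((H i).trans (dvd_pow_self _ two_ne_zero)) ((dvd_mul_right _ _).mul_left 4)

/-- An orthogonal `h` of unitary type is a multiple of `σ`, which by `dvd_a1_of_dvd` forces `σ ∣
a₁`. In all remaining cases the completed square has the right divisibility. -/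
theorem exists_sameLimit_dw_iff (h2 : (2 : k) ≠ 0) :
    (∃ F' : TateForm S T, SameLimit (F'.orthFamily) (F.dwFamily)) ↔
      ¬ (T.IsUnitary ∧ ¬ ∀ i, S.σ i ∣ F.a1 i) := by
  constructor
  · rintro ⟨F', hF'⟩ ⟨hT, hn⟩
    refine hn fun i ↦ F.dvd_a1_of_dvd hT i ?_
    obtain ⟨h, η, χ, h1, h2⟩ := hF' i
    have h3 := h1.1.symm.trans (F'.orthFamily_isSenLimit i).1
    have h4 := h2.1.symm.trans (F.dwFamily_isSenLimit i).1
    rw [← h4, h3, a2, hT.mult_eq.2.1, pow_one]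
    exact (dvd_mul_right _ _).mul_left 4
  · intro hn
    by_cases hT : T.IsUnitary
    · obtain ⟨hm1, hm2, hm4⟩ := hT.mult_eq
      have hd : ∀ i, S.σ i ∣ F.a1 i := by
        by_contra hd
        exact hn ⟨hT, hd⟩
      choose d hd using hd
      have hsd : IsSection S.L S.D 1 (-1) d := by
        refine S.isSection_of_eq_mul (s := F.a1) ?_ hd
        have h := F.sec1
        have ha : F.a1 = F.c1 := funext fun i ↦ by rw [a1, hm1, pow_zero, one_mul]
        rw [hm1] at h
        rw [ha]
        exact h.congr rfl (by norm_num)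
      -- With `a₁ = σd`, one has `a₁² = σ · c₁d` and `a₁a₃ = σ ^ (m₃ + 1) · dc₃`, from which `σ ^
      -- m₄` is split off.
      refine F.exists_sameLimit_dw h2 (e2 := fun i ↦ F.c1 i * d i)
        (e4 := fun i ↦ S.σ i ^ (T.mult.m3 + 1 - T.mult.m4) * (d i * F.c3 i))
        ((F.sec1.mul hsd).congr rfl (by rw [hm1, hm2]; rfl))
        (((S.σ_section.pow _).mul (hsd.mul F.sec3)).congr (by norm_num) ?_) (fun i ↦ ?_) (fun i ↦ ?_)
      · rw [Nat.cast_sub hm4]; push_cast; ring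
      · rw [hm2, a1, hm1]
        have := hd i
        rw [a1, hm1] at this
        linear_combination (-F.c1 i) * this
      · rw [← mul_assoc, ← pow_add, Nat.add_sub_cancel' hm4, hd i, a3, pow_succ]
        ring
    · obtain ⟨h1, h3⟩ := TateType.mult_le_of_not_isUnitary hT
      -- The natural-number differences in the exponents are genuine by the two inequalities `h1`
      -- and `h3`.
      refine F.exists_sameLimit_dw h2 (e2 := fun i ↦ S.σ i ^ (2 * T.mult.m1 - T.mult.m2) * F.c1 i ^ 2)
        (e4 := fun i ↦ S.σ i ^ (T.mult.m1 + T.mult.m3 - T.mult.m4) * (F.c1 i * F.c3 i))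
        (((S.σ_section.pow _).mul (F.sec1.pow 2)).congr (by norm_num) ?_)
        (((S.σ_section.pow _).mul (F.sec1.mul F.sec3)).congr (by norm_num) ?_)
        (fun i ↦ ?_) (fun i ↦ ?_)
      · rw [Nat.cast_sub h1]; push_cast; ring
      · rw [Nat.cast_sub h3]; push_cast; ring
      · rw [← mul_assoc, ← pow_add, Nat.add_sub_cancel' h1, a1, mul_pow, ← pow_mul, mul_comm 2]
      · rw [← mul_assoc, ← pow_add, Nat.add_sub_cancel' h3, a1, a3, pow_add]
        ring

end TateForm

/-! ### Double covers as models of an atlas -/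

section

open Polynomial

theorem exists_eq_add_mul_X_sq_sub {A : Type*} [CommRing A] (h : A) (p : A[X]) :
    ∃ c d q, p = C c + C d * X + (X ^ 2 - C h) * q := by
  induction p using Polynomial.induction_on with
  | C a => exact ⟨a, 0, 0, by simp⟩
  | add p p' hp hp' =>
    obtain ⟨c, d, q, rfl⟩ := hp
    obtain ⟨c', d', q', rfl⟩ := hp'
    exact ⟨c + c', d + d', q + q', by simp only [map_add]; ring⟩
  | monomial m a hp =>
    obtain ⟨c, d, q, hp⟩ := hp
    exact ⟨d * h, c, q * X + C d, by rw [pow_succ, ← mul_assoc, hp, C_mul]; ring⟩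

theorem eq_zero_of_X_sq_sub_dvd {A : Type*} [CommRing A] {h c d : A}
    (hd : X ^ 2 - C h ∣ C c + C d * X) : c = 0 ∧ d = 0 := by
  have h0 : C c + C d * X = 0 := by
    by_contra hne
    have : Nontrivial A := by
      rw [← not_subsingleton_iff_nontrivial]
      intro hs
      exact hne (Subsingleton.elim _ _)
    refine (monic_X_pow_sub_C h two_ne_zero).not_dvd_of_degree_lt hne ?_ hd
    rw [degree_X_pow_sub_C (by norm_num)]
    rw [add_comm]
    refine degree_linear_le.trans_lt ?_
    norm_num
  have h1 := congrArg (coeff · 0) h0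
  have h2 := congrArg (coeff · 1) h0
  simp only [coeff_add, coeff_C_zero, coeff_C_mul, coeff_X_zero, coeff_zero, coeff_C_succ,
    coeff_X_one] at h1 h2
  exact ⟨by simpa using h1, by simpa using h2⟩

theorem eval₂_X_sq_sub_neg {A R : Type*} [CommRing A] [CommRing R] (h : A) (φ : A →+* R) (x : R) :
    (X ^ 2 - C h).eval₂ φ (-x) = (X ^ 2 - C h).eval₂ φ x := by
  simp only [eval₂_sub, eval₂_pow, eval₂_X, eval₂_C, neg_sq]

variable {Y B : Scheme.{u}} {ρ : Y ⟶ B} {V : B.Opens} {h : Γ(B, V)} {ξ : Γ(Y, ρ ⁻¹ᵁ V)}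

theorem chartMap_linear (c d : Γ(B, V)) : chartMap ρ V (ρ ⁻¹ᵁ V) le_rfl ξ (C c + C d * X) =
    ρ.app V c + ρ.app V d * ξ := by
  simp only [chartMap, coe_eval₂RingHom, eval₂_add, eval₂_C, eval₂_mul, eval₂_X, Scheme.Hom.app_eq_appLE]

theorem chartMap_quadratic : chartMap ρ V (ρ ⁻¹ᵁ V) le_rfl ξ (X ^ 2 - C h) =
    ξ ^ 2 - ρ.app V h := by
  simp only [chartMap, coe_eval₂RingHom, eval₂_sub, eval₂_C, eval₂_pow, eval₂_X, Scheme.Hom.app_eq_appLE]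

/-- A local double cover is a chart with equation `X ^ 2 - h`. -/
theorem isLocalDoubleCover_iff : IsLocalDoubleCover ρ V h ξ ↔
    IsAffineOpen V ∧ IsChart ρ V (ρ ⁻¹ᵁ V) (X ^ 2 - C h) ξ := by
  constructor
  · rintro ⟨h1, h2, h3, h4⟩
    refine ⟨h1, h2, le_rfl, fun y ↦ ?_, ?_⟩
    · obtain ⟨p, hp, -⟩ := h4 y
      exact ⟨C p.1 + C p.2 * X, by rw [chartMap_linear]; exact hp.symm⟩
    · refine le_antisymm (fun p hp ↦ ?_) ?_
      · obtain ⟨c, d, q, rfl⟩ := exists_eq_add_mul_X_sq_sub h p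
        rw [RingHom.mem_ker, map_add, map_mul, chartMap_linear, chartMap_quadratic, h3, sub_self,
          zero_mul, add_zero] at hp
        obtain ⟨p', -, hu⟩ := h4 0
        have e1 := hu (c, d) hp.symm
        have e2 := hu (0, 0) (by simp)
        have e3 := e1.trans e2.symm
        rw [Prod.mk.injEq] at e3
        rw [e3.1, e3.2]
        simp [Ideal.mem_span_singleton]
      · rw [Ideal.span_le, Set.singleton_subset_iff]
        change chartMap ρ V (ρ ⁻¹ᵁ V) le_rfl ξ _ = 0
        rw [chartMap_quadratic, h3, sub_self]
  · rintro ⟨h1, hc⟩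
    have h3 : ξ ^ 2 = ρ.app V h := by
      rw [← sub_eq_zero, ← chartMap_quadratic]
      exact hc.eval_eq_zero
    refine ⟨h1, hc.affine, h3, fun y ↦ ?_⟩
    obtain ⟨p, rfl⟩ := hc.surjective y
    obtain ⟨c, d, q, rfl⟩ := exists_eq_add_mul_X_sq_sub h p
    refine ⟨(c, d), ?_, ?_⟩
    · change chartMap ρ V (ρ ⁻¹ᵁ V) le_rfl ξ _ = _
      rw [map_add, map_mul, chartMap_linear, chartMap_quadratic, h3, sub_self, zero_mul, add_zero]
    · rintro ⟨c', d'⟩ hp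
      have : C (c' - c) + C (d' - d) * X ∈ RingHom.ker (chartMap ρ V (ρ ⁻¹ᵁ V) le_rfl ξ) := by
        rw [RingHom.mem_ker, chartMap_linear, map_sub, map_sub]
        change chartMap ρ V (ρ ⁻¹ᵁ V) le_rfl ξ _ = _ at hp
        rw [map_add, map_mul, chartMap_linear, chartMap_quadratic, h3, sub_self, zero_mul,
          add_zero] at hp
        rw [sub_mul]
        linear_combination -hp
      rw [hc.ker, Ideal.mem_span_singleton] at this
      obtain ⟨e1, e2⟩ := eq_zero_of_X_sq_sub_dvd this
      exact Prod.ext (sub_eq_zero.mp e1) (sub_eq_zero.mp e2)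

end

section

open Polynomial

variable {k : Type u} [Field k] {n : ℕ} (S : Base k n) {h : ∀ i, Γ(S.B, S.U i)}

/-- The atlas of the double cover `ξ ^ 2 = h`. -/
def coverAtlas (hs : IsSection S.L S.D 2 0 h) : LineAtlas S.B where
  J := S.I
  U := S.U
  affine := S.affine
  -- A double cover is affine over the base, so no charts at infinity are needed.
  kind _ := true
  P i := X ^ 2 - C (h i)
  g := S.L
  compat i j R _ ψ x y hl hx := by
    simp only [Linked] at hl
    simp only [eval₂_sub, eval₂_pow, eval₂_X, eval₂_C, RingHom.comp_apply] at hx ⊢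
    have hij := hs i j
    rw [zpow_zero, mul_one] at hij
    have hL : IsUnit (ψ (S.L.tr i j : Γ(S.B, S.U i ⊓ S.U j)) ^ 2) :=
      ((S.L.tr i j).isUnit.map ψ).pow 2
    have h2 : ((S.L.tr i j ^ (2 : ℤ) : (Γ(S.B, S.U i ⊓ S.U j))ˣ) : Γ(S.B, S.U i ⊓ S.U j)) =
        (S.L.tr i j : Γ(S.B, S.U i ⊓ S.U j)) ^ 2 := by
      rw [show (2 : ℤ) = (2 : ℕ) from rfl, zpow_natCast, Units.val_pow_eq_pow_val]
    rw [hij, map_mul, hl, h2, map_pow, mul_pow, ← mul_sub] at hx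
    exact (hL.mul_right_eq_zero).mp hx

/-- A double cover is a model of its atlas. -/
theorem DoubleCover.isModel (hs : IsSection S.L S.D 2 0 h) (D : DoubleCover S h) :
    IsModel (coverAtlas S hs) D.ρ (fun i ↦ D.ρ ⁻¹ᵁ S.U i) D.ξ where
  chart j := (isLocalDoubleCover_iff.mp (D.isLocal j)).2
  cover y := by
    have : D.ρ y ∈ ⨆ i, S.U i := by rw [S.covers]; trivial
    obtain ⟨i, hi⟩ := Opens.mem_iSup.mp this
    exact ⟨i, hi⟩
  overlap _ _ _ _ hy _ := hy
  linked i j e := by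
    have := D.glue i j
    simp only [Linked, coverAtlas]
    refine this.trans ?_
    rw [Scheme.Hom.app_eq_appLE]
    rfl

/-- Double covers exist. -/
theorem nonempty_doubleCover (hs : IsSection S.L S.D 2 0 h) : Nonempty (DoubleCover S h) := by
  obtain ⟨Y, f, W, t, M⟩ := exists_model (coverAtlas S hs)
  -- All charts have the same kind, so `overlap` makes each chart the full preimage of its base.
  have hW : W = fun i ↦ f ⁻¹ᵁ S.U i := by
    funext j
    refine le_antisymm (M.chart j).le fun y hy ↦ ?_
    obtain ⟨i, hi⟩ := M.cover y
    exact M.overlap i j y hi hy (Or.inl rfl)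
  subst hW
  obtain ⟨inv, hinv, hτ⟩ := M.exists_hom f (K := S.I) (fun i ↦ i) (fun i ↦ f ⁻¹ᵁ S.U i) (fun _ ↦ le_rfl)
    M.cover (fun i ↦ - t i) (fun i ↦ by
      exact (eval₂_X_sq_sub_neg (h i) _ (t i)).trans (M.chart i).eval_eq_zero) (fun i j e ↦ by
      have := M.linked i j e
      simp only [Linked, coverAtlas] at this ⊢
      rw [map_neg, map_neg, this, mul_neg])
  exact ⟨{
    X := Y
    ρ := f
    ξ := t
    isLocal := fun i ↦ isLocalDoubleCover_iff.mpr ⟨S.affine i, M.chart i⟩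
    glue := fun i j ↦ by
      have := M.linked i j le_rfl
      simp only [Linked, coverAtlas] at this
      refine this.trans ?_
      rw [Scheme.Hom.app_eq_appLE]
      rfl
    inv := inv
    inv_ρ := hinv
    inv_ξ := hτ }⟩

end

/-! ### The polynomials `α X ^ e - β` -/

section

open Polynomial

variable {A : Type*} [CommRing A] {α β : A} {e : ℕ}

/-- Pseudo-division: the leading coefficient `α` need not be invertible, so a power of it is
multiplied in. -/
theorem exists_pow_mul_eq_add (α β : A) (he : e ≠ 0) (p : A[X]) :
    ∃ (m : ℕ) (q r : A[X]), r.degree < e ∧ C (α ^ m) * p = (C α * X ^ e - C β) * q + r := by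
  simp only [degree_lt_iff_coeff_zero]
  induction p using Polynomial.induction_on with
  | C a =>
    refine ⟨0, 0, C a, fun m hm ↦ ?_, by simp⟩
    rw [coeff_C, if_neg (by omega)]
  | add p p' hp hp' =>
    obtain ⟨m, q, r, hr, h⟩ := hp
    obtain ⟨m', q', r', hr', h'⟩ := hp'
    refine ⟨m + m', C (α ^ m') * q + C (α ^ m) * q', C (α ^ m') * r + C (α ^ m) * r',
      fun l hl ↦ ?_, ?_⟩
    · rw [coeff_add, coeff_C_mul, coeff_C_mul, hr l hl, hr' l hl, mul_zero, mul_zero, add_zero]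
    · rw [pow_add, C_mul]
      linear_combination C (α ^ m') * h + C (α ^ m) * h'
  | monomial d a hp =>
    obtain ⟨m, q, r, hr, h⟩ := hp
    -- Multiplication by `X` can raise the degree of `r` to `e`. After a further factor `α`, its top
    -- coefficient `r.coeff (e - 1)` is cancelled by that multiple of `αX^e - β`.
    refine ⟨m + 1, C α * X * q + C (r.coeff (e - 1)),
      C α * (X * r) - C (r.coeff (e - 1)) * (C α * X ^ e - C β), fun l hl ↦ ?_, ?_⟩
    · obtain ⟨l, rfl⟩ := Nat.exists_eq_succ_of_ne_zero (show l ≠ 0 by omega)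
      rw [coeff_sub, coeff_C_mul, coeff_C_mul, coeff_sub, coeff_C_mul, coeff_X_mul, coeff_X_pow,
        coeff_C_succ, sub_zero]
      split_ifs with hle
      · rw [← hle, Nat.succ_sub_one]; ring
      · rw [hr l (by omega)]; ring
    · rw [pow_succ, pow_succ X, C_mul]
      linear_combination C α * X * h

/-- Modulo `α` the first factor is `-β`, which by `hreg` is not a zero divisor modulo `α`. -/
theorem C_dvd_of_C_dvd_mul (hreg : ∀ c, α ∣ β * c → α ∣ c) {q : A[X]}
    (h : C α ∣ (C α * X ^ e - C β) * q) : C α ∣ q := by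
  have h1 : C α ∣ C β * q := by
    have := (dvd_mul_right (C α) (X ^ e * q)).sub h
    convert this using 1
    ring
  rw [C_dvd_iff_dvd_coeff] at h1 ⊢
  intro i
  have := h1 i
  rw [coeff_C_mul] at this
  exact hreg _ this

variable [IsDomain A] {K : Type*} [Field K] [Algebra A K] [IsFractionRing A K]

/-- A Gauss lemma without unique factorization, the regularity of `α, β` playing the role of
primitivity. The remainder of the pseudo-division vanishes over `K` for reasons of degree, and then
the power of `α` is cancelled one factor at a time. -/
theorem dvd_of_map_dvd_map (he : e ≠ 0) (hα : α ≠ 0) (hreg : ∀ c, α ∣ β * c → α ∣ c) {p : A[X]}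
    (h : (C α * X ^ e - C β).map (algebraMap A K) ∣ p.map (algebraMap A K)) :
    C α * X ^ e - C β ∣ p := by
  have hinj := IsFractionRing.injective A K
  obtain ⟨m, q, r, hr, hm⟩ := exists_pow_mul_eq_add α β he p
  have hdeg : ((C α * X ^ e - C β).map (algebraMap A K)).degree = (e : WithBot ℕ) := by
    rw [degree_map_eq_of_injective hinj, degree_sub_C, degree_C_mul_X_pow _ hα]
    rw [degree_C_mul_X_pow _ hα]
    exact_mod_cast Nat.pos_of_ne_zero he
  have hr0 : r = 0 := by
    have h1 : (C α * X ^ e - C β).map (algebraMap A K) ∣ r.map (algebraMap A K) := by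
      have h2 : r.map (algebraMap A K) = (C (α ^ m)).map (algebraMap A K) * p.map (algebraMap A K) -
          (C α * X ^ e - C β).map (algebraMap A K) * q.map (algebraMap A K) := by
        rw [← Polynomial.map_mul, ← Polynomial.map_mul, ← Polynomial.map_sub, hm, add_sub_cancel_left]
      rw [h2]
      exact (h.mul_left _).sub (dvd_mul_right _ _)
    have h3 := eq_zero_of_dvd_of_degree_lt h1 (by
      rw [hdeg, degree_map_eq_of_injective hinj]; exact hr)
    exact (Polynomial.map_eq_zero_iff hinj).mp h3
  rw [hr0, add_zero] at hm
  clear hr hr0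
  induction m generalizing q with
  | zero => exact ⟨q, by simpa using hm⟩
  | succ m ih =>
    have h1 : C α ∣ (C α * X ^ e - C β) * q := by
      rw [← hm, pow_succ', C_mul, mul_assoc]; exact dvd_mul_right _ _
    obtain ⟨q', rfl⟩ := C_dvd_of_C_dvd_mul hreg h1
    refine ih q' (mul_left_cancel₀ (C_ne_zero.mpr hα) ?_)
    rw [pow_succ', C_mul] at hm
    linear_combination hm

theorem prime_of_irreducible_map (he : e ≠ 0) (hα : α ≠ 0) (hreg : ∀ c, α ∣ β * c → α ∣ c)
    (h : Irreducible ((C α * X ^ e - C β).map (algebraMap A K))) : Prime (C α * X ^ e - C β) := by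
  refine ⟨fun h0 ↦ h.ne_zero (by rw [h0, Polynomial.map_zero]), fun hu ↦ h.not_isUnit
    (hu.map (mapRingHom (algebraMap A K))), fun p q hpq ↦ ?_⟩
  have h1 := Polynomial.map_dvd (algebraMap A K) hpq
  rw [Polynomial.map_mul] at h1
  exact (h.prime.dvd_or_dvd h1).imp (dvd_of_map_dvd_map he hα hreg) (dvd_of_map_dvd_map he hα hreg)

theorem prime_linear (hα : α ≠ 0) (hreg : ∀ c, α ∣ β * c → α ∣ c) :
    Prime (C α * X ^ 1 - C β) := by
  refine prime_of_irreducible_map (K := FractionRing A) one_ne_zero hα hreg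
    (irreducible_of_degree_eq_one ?_)
  rw [degree_map_eq_of_injective (IsFractionRing.injective A _), degree_sub_C,
    degree_C_mul_X_pow _ hα, Nat.cast_one]
  rw [degree_C_mul_X_pow _ hα]
  norm_num

/-- Over the fraction field the polynomial is, up to a unit, `X² - β/α`. It is reducible only if
`β/α` is a square, equivalently if `αβ` is. -/
theorem prime_quadratic (hα : α ≠ 0) (hreg : ∀ c, α ∣ β * c → α ∣ c)
    (hsq : ∀ x y, y ≠ 0 → x ^ 2 ≠ α * β * y ^ 2) : Prime (C α * X ^ 2 - C β) := by
  have hinj := IsFractionRing.injective A (FractionRing A)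
  refine prime_of_irreducible_map (K := FractionRing A) two_ne_zero hα hreg ?_
  have hα' : algebraMap A (FractionRing A) α ≠ 0 := (map_ne_zero_iff _ hinj).mpr hα
  have h1 : (C α * X ^ 2 - C β).map (algebraMap A (FractionRing A)) =
      C (algebraMap A (FractionRing A) α) *
      (X ^ 2 - C (algebraMap A (FractionRing A) β / algebraMap A (FractionRing A) α)) := by
    rw [mul_sub, ← C_mul, mul_div_cancel₀ _ hα']
    simp
  rw [h1, irreducible_isUnit_mul (isUnit_C.mpr (isUnit_iff_ne_zero.mpr hα'))]
  refine X_pow_sub_C_irreducible_of_prime Nat.prime_two fun b hb ↦ ?_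
  obtain ⟨x, y, hy, rfl⟩ := IsFractionRing.div_surjective (A := A) b
  have hy0 := nonZeroDivisors.ne_zero hy
  have hy' : algebraMap A (FractionRing A) y ≠ 0 := (map_ne_zero_iff _ hinj).mpr hy0
  refine hsq (α * x) y hy0 (hinj ?_)
  rw [div_pow, div_eq_div_iff (pow_ne_zero _ hy') hα'] at hb
  simp only [map_mul, map_pow]
  linear_combination algebraMap A (FractionRing A) α * hb

theorem not_dvd_C (he : e ≠ 0) (hα : α ≠ 0) {c : A} (hc : c ≠ 0) :
    ¬ C α * X ^ e - C β ∣ C c := fun h ↦ by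
  refine C_ne_zero.mpr hc (eq_zero_of_dvd_of_degree_lt h ?_)
  rw [degree_C hc, degree_sub_C, degree_C_mul_X_pow _ hα]
  · exact_mod_cast Nat.pos_of_ne_zero he
  · rw [degree_C_mul_X_pow _ hα]
    exact_mod_cast Nat.pos_of_ne_zero he

/-- If `X = Pq`, then evaluating at `0` gives `q(0) = 0`, so `q = Xq'` and `Pq' = 1`. This keeps the
coordinate of a chart from vanishing identically, so that charts of different kinds meet. -/
theorem not_dvd_X_of_prime {P : A[X]} (hP : Prime P) (h0 : P.coeff 0 ≠ 0) : ¬ P ∣ X := by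
  rintro ⟨q, hq⟩
  have h1 := congrArg (coeff · 0) hq
  simp only [coeff_X_zero, mul_coeff_zero] at h1
  obtain ⟨q', rfl⟩ := X_dvd_iff.mpr ((mul_eq_zero.mp h1.symm).resolve_left h0)
  refine hP.not_isUnit (.of_mul_eq_one q' (mul_left_cancel₀ (X_ne_zero (R := A)) ?_))
  rw [mul_one]
  linear_combination -hq

end

/-! ### Integral models -/

theorem IsChart.isDomain {Y B : Scheme.{u}} {f : Y ⟶ B} {U : B.Opens} {W : Y.Opens}
    {P : Polynomial Γ(B, U)} {t : Γ(Y, W)} (hc : IsChart f U W P t) (hP : Prime P) :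
    IsDomain Γ(Y, W) := by
  have : (RingHom.ker (chartMap f U W hc.le t)).IsPrime := by
    rw [hc.ker]
    exact (Ideal.span_singleton_prime hP.ne_zero).mpr hP
  exact (RingHom.quotientKerEquivOfSurjective hc.surjective).symm.toMulEquiv.isDomain _

theorem exists_mem_basicOpen_of_ne_zero {Y : Scheme.{u}} {W : Y.Opens} (hW : IsAffineOpen W)
    [IsDomain Γ(Y, W)] {s : Γ(Y, W)} (hs : s ≠ 0) : ∃ y, y ∈ Y.basicOpen s := by
  let p : Spec Γ(Y, W) := ⟨⊥, Ideal.isPrime_bot⟩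
  refine ⟨hW.fromSpec p, ?_⟩
  change p ∈ hW.fromSpec ⁻¹ᵁ Y.basicOpen s
  rw [hW.fromSpec_preimage_basicOpen]
  exact hs

/-- A scheme with a cover by affine open subsets that are spectra of domains and meet pairwise is
integral. -/
theorem isIntegral_of_cover {Y : Scheme.{u}} {J : Type*} (W : J → Y.Opens) (s : Set J)
    (hW : ∀ y, ∃ j ∈ s, y ∈ W j) (haff : ∀ j ∈ s, IsAffineOpen (W j))
    (hdom : ∀ j ∈ s, IsDomain Γ(Y, W j)) (hmeet : ∀ i ∈ s, ∀ j ∈ s, ∃ y, y ∈ W i ∧ y ∈ W j)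
    (hs : s.Nonempty) : IsIntegral Y := by
  have hint : ∀ j ∈ s, IsIntegral (W j).toScheme := fun j hj ↦ by
    have := hdom j hj
    have : IsAffine (W j).toScheme := haff j hj
    have : Nonempty (W j).toScheme := by
      obtain ⟨y, hy, -⟩ := hmeet j hj j hj
      exact ⟨⟨y, hy⟩⟩
    exact isIntegral_of_isOpenImmersion (haff j hj).isoSpec.hom
  have hirr : ∀ j ∈ s, IsPreirreducible (W j : Set Y) := fun j hj ↦ by
    have := hint j hj
    have h1 : IsPreirreducible (Set.univ : Set (W j).toScheme) := PreirreducibleSpace.isPreirreducible_univ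
    have h2 := h1.image (W j).ι (W j).ι.continuous.continuousOn
    rwa [Set.image_univ, Scheme.Opens.range_ι] at h2
  have : Nonempty Y := by
    obtain ⟨j, hj⟩ := hs
    obtain ⟨y, -⟩ := hmeet j hj j hj
    exact ⟨y⟩
  have : PreirreducibleSpace Y := ⟨by
    rintro O₁ O₂ ho₁ ho₂ ⟨y₁, -, hy₁⟩ ⟨y₂, -, hy₂⟩
    obtain ⟨i, hi, hyi⟩ := hW y₁
    obtain ⟨j, hj, hyj⟩ := hW y₂
    obtain ⟨z, hzi, hzj⟩ := hmeet i hi j hj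
    obtain ⟨y₃, h3i, h3, h3j⟩ := hirr i hi O₁ (W j) ho₁ (W j).isOpen ⟨y₁, hyi, hy₁⟩ ⟨z, hzi, hzj⟩
    obtain ⟨y₄, -, h4⟩ := hirr j hj O₁ O₂ ho₁ ho₂ ⟨y₃, h3j, h3⟩ ⟨y₂, hyj, hy₂⟩
    exact ⟨y₄, trivial, h4⟩⟩
  have : IrreducibleSpace Y := ⟨inferInstance⟩
  have : IsReduced Y := by
    have hred : ∀ x : Y, _root_.IsReduced (Y.presheaf.stalk x) := fun x ↦ by
      obtain ⟨j, hj, hx⟩ := hW x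
      have := hdom j hj
      let _ := TopCat.Presheaf.algebra_section_stalk Y.presheaf (⟨x, hx⟩ : W j)
      have hl := (haff j hj).isLocalization_stalk ⟨x, hx⟩
      have : IsDomain (Y.presheaf.stalk x) := IsLocalization.isDomain_of_le_nonZeroDivisors _
        (Ideal.primeCompl_le_nonZeroDivisors ((haff j hj).primeIdealOf ⟨x, hx⟩).asIdeal)
      infer_instance
    exact isReduced_of_isReduced_stalk Y
  exact isIntegral_of_irreducibleSpace_of_isReduced Y

open Polynomial in
/-- A model is integral if its charts are, and the base dominates. -/
theorem IsModel.isIntegral {B Y : Scheme.{u}} [IsIntegral B] {A : LineAtlas B} {f : Y ⟶ B}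
    {W : A.J → Y.Opens} {t : ∀ j, Γ(Y, W j)} (M : IsModel A f W t)
    (hP : ∀ j, (A.U j : Set B).Nonempty → Prime (A.P j))
    (hC : ∀ j c, c ≠ 0 → ¬ A.P j ∣ C c) (hX : ∀ j, (A.U j : Set B).Nonempty → ¬ A.P j ∣ X)
    (hne : ∃ j, (A.U j : Set B).Nonempty) : IsIntegral Y := by
  refine isIntegral_of_cover W {j | (A.U j : Set B).Nonempty} (fun y ↦ ?_)
    (fun j _ ↦ (M.chart j).affine) (fun j hj ↦ (M.chart j).isDomain (hP j hj)) (fun i hi j hj ↦ ?_) hne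
  · obtain ⟨j, hj⟩ := M.cover y
    exact ⟨j, ⟨f y, (M.chart j).le hj⟩, hj⟩
  · have : Nonempty (A.U i) := hi.to_subtype
    have := (M.chart i).isDomain (hP i hi)
    obtain ⟨b, hbi, hbj⟩ := nonempty_preirreducible_inter (A.U i).isOpen (A.U j).isOpen hi hj
    obtain ⟨s, hs, hbs⟩ := (A.affine i).exists_basicOpen_le ⟨b, hbj⟩ hbi
    have hs0 : s ≠ 0 := by
      rintro rfl
      rw [Scheme.basicOpen_zero] at hbs
      exact hbs
    have h1 : ∀ p, ¬ A.P i ∣ p → chartMap f (A.U i) (W i) (M.chart i).le (t i) p ≠ 0 := fun p hp h0 ↦ by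
      have : p ∈ RingHom.ker (chartMap f (A.U i) (W i) (M.chart i).le (t i)) := h0
      rw [(M.chart i).ker, Ideal.mem_span_singleton] at this
      exact hp this
    have h2 := h1 _ (hC i s hs0)
    have h3 := h1 _ (hX i hi)
    -- Chart `i` is the spectrum of a domain, so it has a point where both `s` and the coordinate
    -- are nonzero. This point lies over `U j` and has invertible coordinate, hence lies in chart
    -- `j` whatever its kind.
    have h4 := mul_ne_zero h2 h3
    have h5 := exists_mem_basicOpen_of_ne_zero (M.chart i).affine h4
    rw [Scheme.basicOpen_mul] at h5
    obtain ⟨y, hy, hyt⟩ := h5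
    have hyi := Y.basicOpen_le _ hy
    refine ⟨y, hyi, M.overlap i j y hyi ?_ (Or.inr ?_)⟩
    · simp only [chartMap, coe_eval₂RingHom, eval₂_C] at hy
      have hy' : y ∈ Y.basicOpen (f.appLE (A.U i) (W i) (M.chart i).le s) := hy
      rw [Scheme.basicOpen_appLE] at hy'
      exact hs hy'.2
    · simp only [chartMap, coe_eval₂RingHom, eval₂_X] at hyt
      exact hyt

/-! ### Roots of the ratio of two sections -/

section

open Polynomial

/-- The equation of the coordinate `x` with `x ^ e = b / s` (near `0`) or `x ^ e = s / b` (near `∞`). -/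
def rootPoly {A : Type*} [CommRing A] (κ : Bool) (e : ℕ) (s b : A) : A[X] :=
  match κ with
  | true => C s * X ^ e - C b
  | false => C s - C b * X ^ e

theorem rootPoly_false {A : Type*} [CommRing A] (e : ℕ) (s b : A) :
    rootPoly false e s b = -rootPoly true e b s := by
  simp [rootPoly]

theorem eval₂_rootPoly_true {A R : Type*} [CommRing A] [CommRing R] (φ : A →+* R) (e : ℕ) (s b : A)
    (x : R) : (rootPoly true e s b).eval₂ φ x = φ s * x ^ e - φ b := by
  simp [rootPoly]

theorem eval₂_rootPoly_false {A R : Type*} [CommRing A] [CommRing R] (φ : A →+* R) (e : ℕ) (s b : A)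
    (x : R) : (rootPoly false e s b).eval₂ φ x = φ s - φ b * x ^ e := by
  simp [rootPoly]

/-- The equations correspond under the transition functions. -/
theorem Linked.rootPoly_eq_zero {R : Type*} [CommRing R] {κ κ' : Bool} {e : ℕ} {g d x y s s' b b' : R}
    (hd : IsUnit d) (hg : IsUnit g) (hs : s = d * s') (hb : b = d * g ^ e * b')
    (h : Linked κ κ' g x y) (hx : (rootPoly κ e s b).eval₂ (RingHom.id R) x = 0) :
    (rootPoly κ' e s' b').eval₂ (RingHom.id R) y = 0 := by
  subst hs hb
  have hge := hg.pow e
  cases κ <;> cases κ' <;> simp only [Linked, eval₂_rootPoly_true, eval₂_rootPoly_false,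
    RingHom.id_apply] at h hx ⊢
  · subst h
    refine (hd.mul_right_eq_zero).mp ?_
    linear_combination hx
  · have h1 : g ^ e * x ^ e * y ^ e = 1 := by rw [← mul_pow, ← mul_pow, h, one_pow]
    refine (hd.mul_right_eq_zero).mp ?_
    linear_combination y ^ e * hx + d * b' * h1
  · have h1 : x ^ e * y ^ e = g ^ e := by rw [← mul_pow, h]
    refine ((hd.mul (isUnit_of_mul_isUnit_left (h1 ▸ hge))).mul_right_eq_zero).mp ?_
    linear_combination hx - d * b' * h1
  · subst h
    refine ((hd.mul hge).mul_right_eq_zero).mp ?_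
    linear_combination hx

end

/-- The line bundle `L ^ p ⊗ M ^ q`. -/
def Cocycle.zpowMul {B : Scheme.{u}} {I : Type u} {U : I → B.Opens} (L M : Cocycle U) (p q : ℤ) :
    Cocycle U where
  tr i j := L.tr i j ^ p * M.tr i j ^ q
  cocycle i j l := by
    have h1 : ∀ (N : Cocycle U), Units.map (res (W := U i ⊓ U j ⊓ U l) inf_le_left).toMonoidHom (N.tr i j) *
        Units.map (res (W := U i ⊓ U j ⊓ U l) (inf_le_inf_right _ inf_le_right)).toMonoidHom (N.tr j l) =
        Units.map (res (W := U i ⊓ U j ⊓ U l) (inf_le_inf_right _ inf_le_left)).toMonoidHom (N.tr i l) :=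
      fun N ↦ Units.ext (N.cocycle i j l)
    have h2 : Units.map (res (W := U i ⊓ U j ⊓ U l) inf_le_left).toMonoidHom (L.tr i j ^ p * M.tr i j ^ q) *
        Units.map (res (W := U i ⊓ U j ⊓ U l) (inf_le_inf_right _ inf_le_right)).toMonoidHom
          (L.tr j l ^ p * M.tr j l ^ q) =
        Units.map (res (W := U i ⊓ U j ⊓ U l) (inf_le_inf_right _ inf_le_left)).toMonoidHom
          (L.tr i l ^ p * M.tr i l ^ q) := by
      simp only [map_mul, map_zpow, ← h1, mul_zpow]
      exact mul_mul_mul_comm _ _ _ _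
    exact congrArg Units.val h2

/-- A line bundle on a refinement of the cover. -/
def Cocycle.comp {B : Scheme.{u}} {I J : Type u} {U : I → B.Opens} (L : Cocycle U) (r : J → I) :
    Cocycle (fun j ↦ U (r j)) where
  tr i j := L.tr (r i) (r j)
  cocycle i j l := L.cocycle (r i) (r j) (r l)

/-- A section `a` of `L ^ 2 ⊗ D⁻¹` that defines a smooth divisor meeting `σ = 0` transversally. -/
structure TransversalSection {k : Type u} [Field k] {n : ℕ} (S : Base k n) where
  /-- The section. -/
  a : ∀ i, Γ(S.B, S.U i)
  isSection : IsSection S.L S.D 2 (-1) a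
  smooth : ∀ i, IsTransversal S.str (S.U i) ![a i]
  transversal : ∀ i, IsTransversal S.str (S.U i) ![S.σ i, a i]

namespace TransversalSection

open Polynomial

variable {k : Type u} [Field k] {n : ℕ} {S : Base k n} (E : TransversalSection S)

/-- The atlas of the scheme of `e`-th roots of `a / σ`. For `e = 1` this is the blow-up of `B` along
`σ = a = 0`, for `e = 2` the resolution of the double cover. -/
def atlas (e : ℕ) (p : ℤ) (h : p * e = 2) : LineAtlas S.B where
  J := S.I × Bool
  U j := S.U j.1
  affine j := S.affine j.1
  kind j := j.2
  P j := rootPoly j.2 e (S.σ j.1) (E.a j.1)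
  -- The ratio `a/σ` is a section of `L² ⊗ D⁻²`, so its `e`-th root is a section of `Lᵖ ⊗ D⁻ᵖ` with
  -- `pe = 2`.
  g := (S.L.zpowMul S.D p (-p)).comp Prod.fst
  compat := by
    rintro ⟨i, κ⟩ ⟨j, κ'⟩ R _ ψ x y hl hx
    have hσ := S.σ_section i j
    have ha := E.isSection i j
    rw [zpow_zero, one_mul, zpow_one] at hσ
    have hD : IsUnit (ψ (S.D.tr i j : Γ(S.B, S.U i ⊓ S.U j))) := (S.D.tr i j).isUnit.map ψ
    have hg : IsUnit (ψ (((S.L.zpowMul S.D p (-p)).comp (Prod.fst : S.I × Bool → S.I)).tr (i, κ) (j, κ') :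
      Γ(S.B, S.U i ⊓ S.U j))) := Units.isUnit _ |>.map ψ
    have hge : S.L.tr i j ^ (2 : ℤ) * S.D.tr i j ^ (-1 : ℤ) =
        S.D.tr i j * (S.L.tr i j ^ p * S.D.tr i j ^ (-p)) ^ e := by
      rw [← zpow_natCast, mul_zpow, ← zpow_mul, ← zpow_mul, h, neg_mul, h, mul_left_comm,
        mul_left_cancel_iff]
      rw [show (-1 : ℤ) = 1 + -2 by norm_num, zpow_add, zpow_one]
    have key : ∀ (κ : Bool) (i : S.I) (V : S.B.Opens) (φ : Γ(S.B, S.U i) →+* R) (z : R),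
        (rootPoly κ e (S.σ i) (E.a i)).eval₂ φ z =
        (rootPoly κ e (φ (S.σ i)) (φ (E.a i))).eval₂ (RingHom.id R) z := by
      intro κ i V φ z
      cases κ <;> simp [rootPoly]
    dsimp only at hl hx ⊢
    rw [key _ _ ⊤] at hx ⊢
    refine hl.rootPoly_eq_zero hD hg ?_ ?_ hx
    · simp only [RingHom.comp_apply]
      rw [hσ, map_mul]
    · simp only [RingHom.comp_apply]
      rw [ha, hge, map_mul]
      simp only [Cocycle.comp, Cocycle.zpowMul, Units.val_mul, map_mul, Units.val_pow_eq_pow_val, map_pow]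

end TransversalSection

/-! ### Arithmetic of a transversal pair -/

section

variable {k : Type u} [Field k] {B : Scheme.{u}} (f : B ⟶ Spec (.of k)) {U : B.Opens}

theorem IsTransversal.swap {σ a : Γ(B, U)} (h : IsTransversal f U ![σ, a]) :
    IsTransversal f U ![a, σ] := by
  intro q _ hq
  let _ := sectionsAlgebra f U
  obtain ⟨-, h2⟩ := h q (fun j ↦ by fin_cases j; exacts [hq 1, hq 0])
  refine ⟨hq, ?_⟩
  have h3 := h2.comp (Equiv.swap 0 1) (Equiv.injective _)
  convert h3 using 2 with j
  fin_cases j <;> rfl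

variable [Smooth f]

include f in
-- If `a` vanished on a component of `σ = 0`, it would be a multiple of `σ` near its generic point,
-- contradicting the independence of `dσ` and `da` there.
theorem notMem_of_mem_minimalPrimes (hU : IsAffineOpen U) {σ a : Γ(B, U)}
    (h : IsTransversal f U ![σ]) (h' : IsTransversal f U ![σ, a]) {P : Ideal Γ(B, U)}
    (hP : P ∈ (Ideal.span {σ}).minimalPrimes) : a ∉ P := by
  have := isReduced_quotient_of_isTransversal f hU h
  intro ha
  have := hP.1.1
  have hσ : σ ∈ P := hP.1.2 (Ideal.mem_span_singleton_self σ)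
  obtain ⟨v, hv, hdvd⟩ := exists_mul_mem_span_of_mem_minimalPrimes σ hP ha
  let _ := sectionsAlgebra f U
  refine not_dvd_of_linearIndependent (k := k) P hσ ha (h' P ?_).2 hv hdvd
  intro j
  fin_cases j
  · exact hσ
  · exact ha

include f in
theorem dvd_of_dvd_mul_of_isTransversal (hU : IsAffineOpen U) {σ a : Γ(B, U)}
    (h : IsTransversal f U ![σ]) (h' : IsTransversal f U ![σ, a]) {c : Γ(B, U)} (hc : σ ∣ a * c) :
    σ ∣ c := by
  have := isReduced_quotient_of_isTransversal f hU h
  exact dvd_of_dvd_mul_of_transversal (fun P hP ↦ notMem_of_mem_minimalPrimes f hU h h' hP) hc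

end

theorem germToFunctionField_res {X : Scheme.{u}} [IsIntegral X] {V W : X.Opens} [Nonempty V]
    [Nonempty W] (h : W ≤ V) (s : Γ(X, V)) :
    X.germToFunctionField W (res h s) = X.germToFunctionField V s :=
  X.presheaf.germ_res_apply (homOfLE h) _ _ s

namespace TransversalSection

variable {k : Type u} [Field k] {n : ℕ} {S : Base k n} (E : TransversalSection S)

theorem a_ne_zero (i : S.I) (h : (S.U i : Set S.B).Nonempty) : E.a i ≠ 0 := by
  have := S.integral
  have : Nonempty (S.U i) := h.to_subtype
  exact ne_zero_of_isTransversal S.str (E.smooth i) (fun j ↦ by fin_cases j; rfl) 0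

theorem σ_dvd_of_dvd_mul (i : S.I) {c : Γ(S.B, S.U i)} (hc : S.σ i ∣ E.a i * c) : S.σ i ∣ c := by
  have := S.smooth
  have := SmoothOfRelativeDimension.smooth n S.str
  exact dvd_of_dvd_mul_of_isTransversal S.str (S.affine i) (S.σ_smooth i) (E.transversal i) hc

theorem a_dvd_of_dvd_mul (i : S.I) {c : Γ(S.B, S.U i)} (hc : E.a i ∣ S.σ i * c) : E.a i ∣ c := by
  have := S.smooth
  have := SmoothOfRelativeDimension.smooth n S.str
  exact dvd_of_dvd_mul_of_isTransversal S.str (S.affine i) (E.smooth i)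
    (IsTransversal.swap _ (E.transversal i)) hc

/-- The product `σ a` is not a square in the function field. -/
theorem sq_ne (i : S.I) (h : (S.U i : Set S.B).Nonempty) {x y : Γ(S.B, S.U i)} (hy : y ≠ 0) :
    x ^ 2 ≠ S.σ i * E.a i * y ^ 2 := by
  intro hxy
  have := S.smooth
  have := SmoothOfRelativeDimension.smooth n S.str
  have := S.integral
  have : Nonempty (S.U i) := h.to_subtype
  -- The open set `U i` may miss the divisor. As `σa` is a section of `L²`, being a square in the
  -- function field does not depend on the trivialization, so the question moves to some `U j` that
  -- meets `σ = 0`.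
  obtain ⟨j, p, hp, hpσ⟩ := S.σ_nonempty
  have : Nonempty (S.U j) := ⟨⟨p, hp⟩⟩
  have hA := functionField_isFractionRing_of_isAffineOpen _ (S.U j) (S.affine j)
  obtain ⟨b, hbi, hbj⟩ := nonempty_preirreducible_inter (S.U i).isOpen (S.U j).isOpen h ⟨p, hp⟩
  have : Nonempty (S.U i ⊓ S.U j : S.B.Opens) := ⟨⟨b, hbi, hbj⟩⟩
  -- the product is the square of a rational function on `U j` too
  have hs := S.σ_section.mul E.isSection i j
  have hL : S.L.tr i j ^ (0 + 2 : ℤ) * S.D.tr i j ^ (1 + -1 : ℤ) = S.L.tr i j ^ 2 := by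
    norm_num
  rw [hL, Units.val_pow_eq_pow_val] at hs
  have hs' := congrArg (S.B.germToFunctionField (S.U i ⊓ S.U j)) hs
  dsimp only at hs'
  rw [germToFunctionField_res, map_mul, map_mul, map_pow, germToFunctionField_res, map_mul] at hs'
  have hx := congrArg (S.B.germToFunctionField (S.U i)) hxy
  rw [map_pow, map_mul, map_mul, hs', map_pow] at hx
  have hu : S.B.germToFunctionField (S.U i ⊓ S.U j) (S.L.tr i j : Γ(S.B, S.U i ⊓ S.U j)) ≠ 0 :=
    ((S.L.tr i j).isUnit.map (S.B.germToFunctionField (S.U i ⊓ S.U j)).hom).ne_zero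
  have hy' : S.B.germToFunctionField (S.U i) y ≠ 0 :=
    (map_ne_zero_iff _ (S.B.germToFunctionField_injective (S.U i))).mpr hy
  obtain ⟨x', y', hy0, hz⟩ := IsFractionRing.div_surjective (A := Γ(S.B, S.U j))
    (S.B.germToFunctionField (S.U i) x /
      (S.B.germToFunctionField (S.U i ⊓ S.U j) (S.L.tr i j : Γ(S.B, S.U i ⊓ S.U j)) *
        S.B.germToFunctionField (S.U i) y))
  have hy0' := nonZeroDivisors.ne_zero hy0
  have hinj := S.B.germToFunctionField_injective (S.U j)
  have hy1 : S.B.germToFunctionField (S.U j) y' ≠ 0 := (map_ne_zero_iff _ hinj).mpr hy0'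
  have hz' : S.B.germToFunctionField (S.U j) x' / S.B.germToFunctionField (S.U j) y' = _ := hz
  have hsq : x' ^ 2 = S.σ j * E.a j * y' ^ 2 := by
    apply hinj
    simp only [map_pow, map_mul] at hx ⊢
    rw [div_eq_div_iff hy1 (mul_ne_zero hu hy')] at hz'
    have hne := pow_ne_zero 2 (mul_ne_zero hu hy')
    refine mul_right_cancel₀ hne ?_
    rw [← mul_pow, hz', mul_pow, hx]
    ring
  have hσJ : S.σ j ∈ ((S.affine j).primeIdealOf ⟨p, hp⟩).asIdeal := by
    by_contra hn
    apply hpσ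
    have h1 : (S.affine j).fromSpec ((S.affine j).primeIdealOf ⟨p, hp⟩) ∈ S.B.basicOpen (S.σ j) := by
      change (S.affine j).primeIdealOf ⟨p, hp⟩ ∈ (S.affine j).fromSpec ⁻¹ᵁ S.B.basicOpen (S.σ j)
      rw [(S.affine j).fromSpec_preimage_basicOpen]
      exact hn
    rwa [(S.affine j).fromSpec_primeIdealOf] at h1
  -- `P` is the generic point of a component of `σ = 0` through `p`; the order of vanishing is taken
  -- along this component.
  obtain ⟨P, hP, -⟩ := Ideal.exists_minimalPrimes_le
    ((Ideal.span_singleton_le_iff_mem _).mpr hσJ)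
  have := hP.1.1
  let _ := sectionsAlgebra S.str (S.U j)
  have : Algebra.Smooth k Γ(S.B, S.U j) := constants_smooth S.str (S.affine j)
  have : IsNoetherianRing Γ(S.B, S.U j) := Algebra.FiniteType.isNoetherianRing k _
  have := isReduced_quotient_of_isTransversal S.str (S.affine j) (S.σ_smooth j)
  exact not_square_of_uniformizer P (S.σ_ne_zero j ⟨p, hp⟩) (hP.1.2 (Ideal.mem_span_singleton_self _))
    (notMem_of_mem_minimalPrimes S.str (S.affine j) (S.σ_smooth j) (E.transversal j) hP)
    (fun c hc ↦ exists_mul_mem_span_of_mem_minimalPrimes _ hP hc) hy0' hsq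

theorem prime_rootPoly {e : ℕ} (he : e = 1 ∨ e = 2) (κ : Bool) (i : S.I)
    (h : (S.U i : Set S.B).Nonempty) : Prime (rootPoly κ e (S.σ i) (E.a i)) := by
  have := S.integral
  have : Nonempty (S.U i) := h.to_subtype
  have hσ := S.σ_ne_zero i h
  have ha := E.a_ne_zero i h
  cases κ
  · rw [rootPoly_false]
    refine Prime.neg ?_
    rcases he with rfl | rfl
    · exact prime_linear ha (fun c ↦ E.a_dvd_of_dvd_mul i)
    · exact prime_quadratic ha (fun c ↦ E.a_dvd_of_dvd_mul i) fun x y hy ↦ by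
        rw [mul_comm (E.a i)]; exact E.sq_ne i h hy
  · rcases he with rfl | rfl
    · exact prime_linear hσ (fun c ↦ E.σ_dvd_of_dvd_mul i)
    · exact prime_quadratic hσ (fun c ↦ E.σ_dvd_of_dvd_mul i) fun x y hy ↦ E.sq_ne i h hy

variable {e : ℕ} {p : ℤ} {h : p * e = 2} {Y : Scheme.{u}} {f : Y ⟶ S.B}
  {W : S.I × Bool → Y.Opens} {t : ∀ j, Γ(Y, W j)}

open Polynomial in
theorem not_rootPoly_dvd_C (he : e ≠ 0) (κ : Bool) (i : S.I) {c : Γ(S.B, S.U i)} (hc : c ≠ 0) :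
    ¬ rootPoly κ e (S.σ i) (E.a i) ∣ C c := by
  have := S.integral
  have hne : (S.U i : Set S.B).Nonempty := by
    by_contra hemp
    rw [Set.not_nonempty_iff_eq_empty] at hemp
    have hbot : S.U i = ⊥ := Opens.ext hemp
    have : Subsingleton Γ(S.B, S.U i) :=
      CommRingCat.subsingleton_of_isTerminal (S.B.sheaf.isTerminalOfEqEmpty hbot)
    exact hc (Subsingleton.elim _ _)
  have : Nonempty (S.U i) := hne.to_subtype
  cases κ
  · rw [rootPoly_false, neg_dvd]
    exact not_dvd_C he (E.a_ne_zero i hne) hc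
  · exact not_dvd_C he (S.σ_ne_zero i hne) hc

theorem isIntegral_of_isModel (M : IsModel (E.atlas e p h) f W t) : IsIntegral Y := by
  have he : e = 1 ∨ e = 2 := by
    have : (e : ℤ) ∣ (2 : ℕ) := ⟨p, by rw [mul_comm]; exact_mod_cast h.symm⟩
    exact (Nat.dvd_prime Nat.prime_two).mp (Int.natCast_dvd_natCast.mp this)
  have he0 : e ≠ 0 := by omega
  have := S.integral
  refine M.isIntegral (fun j hj ↦ E.prime_rootPoly he j.2 j.1 hj)
    (fun j c hc ↦ E.not_rootPoly_dvd_C he0 j.2 j.1 hc) (fun j hj ↦ ?_) ?_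
  · have : Nonempty (S.U j.1) := Set.Nonempty.to_subtype hj
    refine not_dvd_X_of_prime (A := Γ(S.B, S.U j.1)) (E.prime_rootPoly he j.2 j.1 hj) ?_
    obtain ⟨i, κ⟩ := j
    cases κ
    · change (rootPoly false e (S.σ i) (E.a i)).coeff 0 ≠ 0
      simpa [rootPoly, he0.symm] using S.σ_ne_zero i hj
    · change (rootPoly true e (S.σ i) (E.a i)).coeff 0 ≠ 0
      simpa [rootPoly, he0.symm] using E.a_ne_zero i hj
  · obtain ⟨j, q, hq, -⟩ := S.σ_nonempty
    exact ⟨(j, true), q, hq⟩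

end TransversalSection

/-! ### Roots -/

/-- The coordinate `x` satisfies `x ^ e = b / s` (near `0`) or `x ^ e = s / b` (near `∞`). -/
def IsRatioRoot {R : Type*} [CommRing R] (κ : Bool) (e : ℕ) (s b x : R) : Prop :=
  match κ with
  | true => s * x ^ e = b
  | false => s = b * x ^ e

theorem eval₂_rootPoly_eq_zero {A R : Type*} [CommRing A] [CommRing R] {φ : A →+* R} {κ : Bool} {e : ℕ}
    {s b : A} {x : R} :
    (rootPoly κ e s b).eval₂ φ x = 0 ↔ IsRatioRoot κ e (φ s) (φ b) x := by
  cases κ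
  · rw [eval₂_rootPoly_false, sub_eq_zero]; rfl
  · rw [eval₂_rootPoly_true, sub_eq_zero]; rfl

/-- The equation `σ` or `a` of the exceptional divisor in the chart near `0` or `∞`. -/
def exceptional {R : Type*} (κ : Bool) (s b : R) : R :=
  match κ with
  | true => s
  | false => b

theorem map_exceptional {R S : Type*} [CommRing R] [CommRing S] (φ : R →+* S) (κ : Bool) (s b : R) :
    φ (exceptional κ s b) = exceptional κ (φ s) (φ b) := by
  cases κ <;> rfl

namespace Linked

variable {R : Type*} [CommRing R] {κ κ' : Bool} {g d ℓ s s' b b' x y : R}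

theorem pow (h : Linked κ κ' g x y) (m : ℕ) : Linked κ κ' (g ^ m) (x ^ m) (y ^ m) := by
  cases κ <;> cases κ' <;> simp only [Linked] at h ⊢
  · rw [h, mul_pow]
  · rw [← mul_pow, ← mul_pow, h, one_pow]
  · rw [← mul_pow, h]
  · rw [h, mul_pow]

theorem neg (h : Linked κ κ' g x y) : Linked κ κ' g (-x) (-y) := by
  cases κ <;> cases κ' <;> simp only [Linked] at h ⊢
  · rw [h]; ring
  · linear_combination h
  · linear_combination h
  · rw [h]; ring

/-- The coordinate of the double cover agrees on overlaps of charts of its resolution. -/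
theorem exceptional_mul (hs : s = d * s') (hb : b = d * g ^ 2 * b') (hℓ : ℓ = d * g)
    (hx : IsRatioRoot κ 2 s b x) (hy : IsRatioRoot κ' 2 s' b' y) (h : Linked κ κ' g x y) :
    exceptional κ s b * x = ℓ * (exceptional κ' s' b' * y) := by
  cases κ <;> cases κ' <;> simp only [Linked, IsRatioRoot, exceptional] at h hx hy ⊢
  · rw [hb, hℓ, h]; ring
  · rw [hb, ← hy, hℓ]; linear_combination d * s' * y * g * h
  · rw [hs, hy, hℓ, ← h]; ring
  · rw [hs, hℓ, h]; ring

end Linked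

section

variable {X Y Z : Scheme.{u}}

theorem appLE_appLE_of_comp_eq {φ : X ⟶ Y} {f : Y ⟶ Z} {h : X ⟶ Z} (e : φ ≫ f = h) {U : Z.Opens}
    {V : Y.Opens} {O : X.Opens} (e₁ : V ≤ f ⁻¹ᵁ U) (e₂ : O ≤ φ ⁻¹ᵁ V) (e₃ : O ≤ h ⁻¹ᵁ U)
    (s : Γ(Z, U)) : φ.appLE V O e₂ (f.appLE U V e₁ s) = h.appLE U O e₃ s := by
  subst e
  exact (appLE_comp φ f e₁ e₂ e₃ s).symm

end

/-- A converse to the field `overlap`: a common point of charts of different kinds has invertible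
coordinate. -/
theorem IsModel.mem_basicOpen_of_ne {B Y : Scheme.{u}} {A : LineAtlas B} {f : Y ⟶ B}
    {W : A.J → Y.Opens} {t : ∀ j, Γ(Y, W j)} (M : IsModel A f W t) {i j : A.J} {y : Y} (hi : y ∈ W i)
    (hj : y ∈ W j) (hne : A.kind i ≠ A.kind j) : y ∈ Y.basicOpen (t i) := by
  have h1 := (M.linked i j (M.le_inf i j)).map
    (Y.presheaf.germ (W i ⊓ W j) y ⟨hi, hj⟩).hom
  have hg : IsUnit ((Y.presheaf.germ (W i ⊓ W j) y ⟨hi, hj⟩).hom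
      (f.appLE (A.U i ⊓ A.U j) (W i ⊓ W j) (M.le_inf i j) (A.g.tr i j : Γ(B, A.U i ⊓ A.U j)))) :=
    ((A.g.tr i j).isUnit.map (f.appLE _ _ (M.le_inf i j)).hom).map _
  have h2 := (h1.isUnit_of_ne hg hne).1
  rw [Scheme.mem_basicOpen _ _ _ hi]
  have h3 := Y.presheaf.germ_res_apply (homOfLE (inf_le_left : W i ⊓ W j ≤ W i)) y ⟨hi, hj⟩ (t i)
  rw [← h3]
  exact h2

theorem DoubleCover.exists_hom {k : Type u} [Field k] {n : ℕ} {S : Base k n} {h : ∀ i, Γ(S.B, S.U i)}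
    (C : DoubleCover S h) (hs : IsSection S.L S.D 2 0 h) {T : Scheme.{u}} (q : T ⟶ S.B) {K : Type u}
    (κ : K → S.I) (O : K → T.Opens) (hO : ∀ k, O k ≤ q ⁻¹ᵁ S.U (κ k))
    (hcov : ∀ x, ∃ k, x ∈ O k) (τ : ∀ k, Γ(T, O k))
    (hP : ∀ k, τ k ^ 2 = q.appLE _ _ (hO k) (h (κ k)))
    (hL : ∀ k l (e : O k ⊓ O l ≤ q ⁻¹ᵁ (S.U (κ k) ⊓ S.U (κ l))),
      res inf_le_left (τ k) = q.appLE _ _ e (S.L.tr (κ k) (κ l) : Γ(S.B, S.U (κ k) ⊓ S.U (κ l))) *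
        res inf_le_right (τ l)) :
    ∃ φ : T ⟶ C.X, φ ≫ C.ρ = q ∧ ∀ k, ∃ e : O k ≤ φ ⁻¹ᵁ (C.ρ ⁻¹ᵁ S.U (κ k)),
      φ.appLE _ _ e (C.ξ (κ k)) = τ k := by
  refine (DoubleCover.isModel S hs C).exists_hom q κ O hO hcov τ (fun k ↦ ?_) hL
  have : (Polynomial.X ^ 2 - Polynomial.C (h (κ k))).eval₂ (q.appLE _ _ (hO k)).hom (τ k) = 0 := by
    simp only [Polynomial.eval₂_sub, Polynomial.eval₂_pow, Polynomial.eval₂_X, Polynomial.eval₂_C]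
    exact sub_eq_zero.mpr (hP k)
  exact this

namespace TransversalSection

variable {k : Type u} [Field k] {n : ℕ} {S : Base k n} (E : TransversalSection S)
  {B' X' : Scheme.{u}} {π : B' ⟶ S.B} {f : X' ⟶ S.B}
  {V : S.I × Bool → B'.Opens} {W : S.I × Bool → X'.Opens}
  {r : ∀ j, Γ(B', V j)} {t : ∀ j, Γ(X', W j)}

section

variable {E} {e : ℕ} {p : ℤ} {h : p * e = 2}

theorem le_preimage (M : IsModel (E.atlas e p h) f W t) (j : S.I × Bool) : W j ≤ f ⁻¹ᵁ S.U j.1 :=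
  (M.chart j).le

/-- The equation of the coordinate of a chart. -/
theorem isRatioRoot (M : IsModel (E.atlas e p h) f W t) (j : S.I × Bool) :
    IsRatioRoot j.2 e (f.appLE (S.U j.1) (W j) (le_preimage M j) (S.σ j.1))
      (f.appLE (S.U j.1) (W j) (le_preimage M j) (E.a j.1)) (t j) :=
  eval₂_rootPoly_eq_zero.mp (M.chart j).eval_eq_zero

/-- Morphisms to a model of the atlas of roots. -/
theorem exists_hom (M : IsModel (E.atlas e p h) f W t) {T : Scheme.{u}} (q : T ⟶ S.B) {K : Type u}
    (κ : K → S.I × Bool) (O : K → T.Opens) (hO : ∀ k, O k ≤ q ⁻¹ᵁ S.U (κ k).1)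
    (hcov : ∀ x, ∃ k, x ∈ O k) (τ : ∀ k, Γ(T, O k))
    (hP : ∀ k, IsRatioRoot (κ k).2 e (q.appLE _ _ (hO k) (S.σ (κ k).1))
      (q.appLE _ _ (hO k) (E.a (κ k).1)) (τ k))
    (hL : ∀ k l (e : O k ⊓ O l ≤ q ⁻¹ᵁ (S.U (κ k).1 ⊓ S.U (κ l).1)),
      Linked (κ k).2 (κ l).2
        (q.appLE _ _ e ((S.L.zpowMul S.D p (-p)).tr (κ k).1 (κ l).1 : Γ(S.B, S.U (κ k).1 ⊓ S.U (κ l).1)))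
        (res inf_le_left (τ k)) (res inf_le_right (τ l))) :
    ∃ φ : T ⟶ X', φ ≫ f = q ∧ ∀ k, ∃ e : O k ≤ φ ⁻¹ᵁ W (κ k),
      φ.appLE _ _ e (t (κ k)) = τ k :=
  M.exists_hom q κ O hO hcov τ (fun k ↦ eval₂_rootPoly_eq_zero.mpr (hP k)) hL

theorem linked (M : IsModel (E.atlas e p h) f W t) (i j : S.I × Bool)
    (e : W i ⊓ W j ≤ f ⁻¹ᵁ (S.U i.1 ⊓ S.U j.1)) : Linked i.2 j.2
      (f.appLE _ _ e ((S.L.zpowMul S.D p (-p)).tr i.1 j.1 : Γ(S.B, S.U i.1 ⊓ S.U j.1)))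
      (res inf_le_left (t i)) (res inf_le_right (t j)) :=
  M.linked i j e

end

theorem one_mul_two : (1 : ℤ) * (2 : ℕ) = 2 := by norm_num
theorem two_mul_one : (2 : ℤ) * (1 : ℕ) = 2 := by norm_num

variable {E} (M : IsModel (E.atlas 1 2 two_mul_one) π V r) (N : IsModel (E.atlas 2 1 one_mul_two) f W t)

include M N in
/-- The double cover of the blow-up. -/
theorem exists_cover : ∃ ρ' : X' ⟶ B', ρ' ≫ π = f ∧ ∀ j, ∃ e : W j ≤ ρ' ⁻¹ᵁ V j,
    ρ'.appLE _ _ e (r j) = t j ^ 2 := by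
  refine exists_hom M f (K := S.I × Bool) (fun j ↦ j) W (fun j ↦ le_preimage N j) N.cover
    (fun j ↦ t j ^ 2) (fun j ↦ ?_) fun i j e ↦ ?_
  · have := isRatioRoot N j
    obtain ⟨i, κ⟩ := j
    cases κ <;> simp only [IsRatioRoot, pow_one] at this ⊢ <;> exact this
  · have := (linked N i j e).pow 2
    rw [map_pow, map_pow]
    convert this using 1
    rw [← map_pow, ← Units.val_pow_eq_pow_val]
    congr 2
    simp only [Cocycle.zpowMul]
    rw [mul_pow, ← zpow_natCast, ← zpow_natCast, ← zpow_mul, ← zpow_mul]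
    norm_num

include M N in
-- If `x` lies in a chart `i` of the other kind while `ρ' x` lies in `V j`, then `r i` is invertible
-- at `ρ' x`. It pulls back to `t i ^ 2`, so `t i` is invertible at `x`, which places `x` in `W j`.
theorem preimage_cover {ρ' : X' ⟶ B'} (hρ : ρ' ≫ π = f) (hr : ∀ j, ∃ e : W j ≤ ρ' ⁻¹ᵁ V j,
    ρ'.appLE _ _ e (r j) = t j ^ 2) (j : S.I × Bool) : ρ' ⁻¹ᵁ V j = W j := by
  refine le_antisymm (fun x hx ↦ ?_) (hr j).1
  obtain ⟨i, hi⟩ := N.cover x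
  refine N.overlap i j x hi ?_ ?_
  · have h1 : f x = π (ρ' x) := by rw [← hρ]; rfl
    rw [h1]
    exact (le_preimage M j) hx
  · by_cases hk : (E.atlas 2 1 one_mul_two).kind i = (E.atlas 2 1 one_mul_two).kind j
    · exact Or.inl hk
    · right
      obtain ⟨e, he⟩ := hr i
      have h2 := M.mem_basicOpen_of_ne (e hi) hx hk
      have h3 : x ∈ X'.basicOpen (ρ'.appLE (V i) (W i) e (r i)) := by
        rw [Scheme.basicOpen_appLE]
        exact ⟨hi, h2⟩
      have hpow : ∀ i : S.I × Bool, X'.basicOpen (t i ^ 2) = X'.basicOpen (t i) := fun i ↦ by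
        rw [pow_two, Scheme.basicOpen_mul, inf_idem]
      rw [he] at h3
      exact (hpow i).le h3

include N in
/-- The involution `t ↦ -t`. -/
theorem exists_involution : ∃ ι : X' ⟶ X', ι ≫ f = f ∧ ∀ j, ∃ e : W j ≤ ι ⁻¹ᵁ W j,
    ι.appLE _ _ e (t j) = -t j := by
  refine exists_hom N f (K := S.I × Bool) (fun j ↦ j) W (fun j ↦ le_preimage N j) N.cover
    (fun j ↦ -t j) (fun j ↦ ?_) fun i j e ↦ ?_
  · have := isRatioRoot N j
    obtain ⟨i, κ⟩ := j
    cases κ <;> simp only [IsRatioRoot, neg_sq] at this ⊢ <;> exact this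
  · have := (linked N i j e).neg
    rw [map_neg, map_neg]
    exact this

theorem isSection_four_mul : IsSection S.L S.D 2 0 (fun i ↦ 4 * S.σ i * E.a i) := by
  intro i j
  have := S.σ_section.mul E.isSection i j
  norm_num at this
  change res inf_le_left (4 * S.σ i * E.a i) = _ * res inf_le_right (4 * S.σ j * E.a j)
  rw [zpow_zero, mul_one]
  simp only [map_mul, map_ofNat]
  have h2 : ((S.L.tr i j ^ (2 : ℤ) : (Γ(S.B, S.U i ⊓ S.U j))ˣ) : Γ(S.B, S.U i ⊓ S.U j)) =
      (S.L.tr i j : Γ(S.B, S.U i ⊓ S.U j)) ^ 2 := by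
    rw [show (2 : ℤ) = (2 : ℕ) from rfl, zpow_natCast, Units.val_pow_eq_pow_val]
  rw [h2]
  linear_combination 4 * this

variable (C : DoubleCover S (fun i ↦ 4 * S.σ i * E.a i))

include N in
/-- The resolution of the double cover, `ξ = 2 σ t` or `ξ = 2 a t`. -/
theorem exists_resolution : ∃ μ : X' ⟶ C.X, μ ≫ C.ρ = f ∧ ∀ j,
    ∃ e : W j ≤ μ ⁻¹ᵁ (C.ρ ⁻¹ᵁ S.U j.1), μ.appLE _ _ e (C.ξ j.1) =
      2 * f.appLE (S.U j.1) (W j) (le_preimage N j) (exceptional j.2 (S.σ j.1) (E.a j.1)) * t j := by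
  refine C.exists_hom isSection_four_mul f (K := S.I × Bool) Prod.fst W
    (fun j ↦ le_preimage N j) N.cover _ (fun j ↦ ?_) fun i j e ↦ ?_
  -- From `σt² = a` one gets `(2σt)² = 4σa`; likewise from `σ = at²` for `2at`.
  · have := isRatioRoot N j
    obtain ⟨i, κ⟩ := j
    cases κ <;> simp only [IsRatioRoot, exceptional, map_mul, map_ofNat] at this ⊢
    · linear_combination -4 * (f.appLE (S.U i) (W (i, false)) (le_preimage N (i, false)) (E.a i)) * this
    · linear_combination 4 * (f.appLE (S.U i) (W (i, true)) (le_preimage N (i, true)) (S.σ i)) * this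
  · dsimp only
    have hi : W i ⊓ W j ≤ f ⁻¹ᵁ S.U i.1 := inf_le_left.trans (le_preimage N i)
    have hj : W i ⊓ W j ≤ f ⁻¹ᵁ S.U j.1 := inf_le_right.trans (le_preimage N j)
    have h1 := isRatioRoot N i
    have h2 := isRatioRoot N j
    have h1' : IsRatioRoot i.2 2 (f.appLE _ _ hi (S.σ i.1)) (f.appLE _ _ hi (E.a i.1))
        (res inf_le_left (t i) : Γ(X', W i ⊓ W j)) := by
      rw [← eval₂_rootPoly_eq_zero (φ := (f.appLE (S.U i.1) (W i ⊓ W j) hi).hom)]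
      have := congrArg (res (inf_le_left : W i ⊓ W j ≤ W i)) (N.chart i).eval_eq_zero
      rw [Polynomial.hom_eval₂, map_zero] at this
      refine Eq.trans ?_ this
      congr 1
      ext s
      exact (res_appLE f _ _ _ s).symm
    have h2' : IsRatioRoot j.2 2 (f.appLE _ _ hj (S.σ j.1)) (f.appLE _ _ hj (E.a j.1))
        (res inf_le_right (t j) : Γ(X', W i ⊓ W j)) := by
      rw [← eval₂_rootPoly_eq_zero (φ := (f.appLE (S.U j.1) (W i ⊓ W j) hj).hom)]
      have := congrArg (res (inf_le_right : W i ⊓ W j ≤ W j)) (N.chart j).eval_eq_zero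
      rw [Polynomial.hom_eval₂, map_zero] at this
      refine Eq.trans ?_ this
      congr 1
      ext s
      exact (res_appLE f _ _ _ s).symm
    have hσ := congrArg (f.appLE _ _ e) (S.σ_section i.1 j.1)
    have ha := congrArg (f.appLE _ _ e) (E.isSection i.1 j.1)
    rw [zpow_zero, one_mul, zpow_one] at hσ
    rw [map_mul, appLE_res f _ _ hi, appLE_res f _ _ hj] at hσ ha
    have hℓ : S.L.tr i.1 j.1 = S.D.tr i.1 j.1 * (S.L.zpowMul S.D 1 (-1)).tr i.1 j.1 := by
      simp [Cocycle.zpowMul]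
    have hb : S.L.tr i.1 j.1 ^ (2 : ℤ) * S.D.tr i.1 j.1 ^ (-1 : ℤ) =
        S.D.tr i.1 j.1 * (S.L.zpowMul S.D 1 (-1)).tr i.1 j.1 ^ 2 := by
      simp only [Cocycle.zpowMul]
      rw [← zpow_natCast, mul_zpow, ← zpow_mul, ← zpow_mul, mul_left_comm, ← zpow_one_add]
      norm_num
    rw [hb, Units.val_mul, Units.val_pow_eq_pow_val, map_mul, map_pow] at ha
    have h3 := Linked.exceptional_mul hσ ha
      (congrArg (fun u : (Γ(S.B, S.U i.1 ⊓ S.U j.1))ˣ ↦ f.appLE _ _ e (u : Γ(S.B, S.U i.1 ⊓ S.U j.1))) hℓ |>.trans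
        (by simp only [Units.val_mul, map_mul])) h1' h2' (linked N i j e)
    simp only [map_mul, map_ofNat, res_appLE f _ _ hi, res_appLE f _ _ hj]
    have e1 : f.appLE _ _ hi (exceptional i.2 (S.σ i.1) (E.a i.1)) = _ :=
      map_exceptional (f.appLE _ _ hi).hom _ _ _
    have e2 : f.appLE _ _ hj (exceptional j.2 (S.σ j.1) (E.a j.1)) = _ :=
      map_exceptional (f.appLE _ _ hj).hom _ _ _
    rw [e1, e2]
    linear_combination 2 * h3

end TransversalSection

/-! ### The resolution as a double cover of the blow-up -/

namespace IsChart

open Polynomial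

variable {Y B : Scheme.{u}} {f : Y ⟶ B} {U : B.Opens} {W : Y.Opens} {P : Γ(B, U)[X]} {t : Γ(Y, W)}

theorem exists_ringHom (hc : IsChart f U W P t) {R : Type*} [CommRing R] (φ : Γ(B, U) →+* R) (x : R)
    (hx : P.eval₂ φ x = 0) : ∃ ψ : Γ(Y, W) →+* R, (∀ s, ψ (f.appLE U W hc.le s) = φ s) ∧ ψ t = x := by
  have hr₀ : RingHom.ker (chartMap f U W hc.le t) ≤ RingHom.ker (eval₂RingHom φ x) := by
    rw [hc.ker, Ideal.span_le, Set.singleton_subset_iff]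
    exact hx
  let ψ : Γ(Y, W) →+* R :=
    (chartMap f U W hc.le t).liftOfRightInverse _ (Function.rightInverse_surjInv hc.surjective)
      ⟨_, hr₀⟩
  have hψ : ∀ p, ψ (chartMap f U W hc.le t p) = eval₂RingHom φ x p := fun p ↦
    RingHom.liftOfRightInverse_comp_apply _ _ (Function.rightInverse_surjInv hc.surjective) ⟨_, hr₀⟩ p
  refine ⟨ψ, fun s ↦ ?_, ?_⟩
  · simpa [chartMap] using hψ (C s)
  · simpa [chartMap] using hψ X

theorem ringHom_ext (hc : IsChart f U W P t) {R : Type*} [CommRing R] {φ ψ : Γ(Y, W) →+* R}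
    (h : ∀ s, φ (f.appLE U W hc.le s) = ψ (f.appLE U W hc.le s)) (ht : φ t = ψ t) : φ = ψ := by
  ext y
  obtain ⟨p, rfl⟩ := hc.surjective y
  change (φ.comp (chartMap f U W hc.le t)) p = (ψ.comp (chartMap f U W hc.le t)) p
  congr 1
  refine Polynomial.ringHom_ext (fun s ↦ ?_) ?_
  · simpa [chartMap] using h s
  · simpa [chartMap] using ht

/-- A chart with coordinate `t` is a double cover of a chart with coordinate `t ^ 2`. -/
theorem of_sq {B' : Scheme.{u}} {π : B' ⟶ B} {V : B'.Opens} {Q : Γ(B, U)[X]} {r : Γ(B', V)}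
    (hc : IsChart f U W P t) (hd : IsChart π U V Q r) {ρ : Y ⟶ B'} (hρ : ρ ≫ π = f)
    (e : W ≤ ρ ⁻¹ᵁ V) (hr : ρ.appLE V W e r = t ^ 2)
    (hPQ : ∀ (R : Type u) [CommRing R] (φ : Γ(B, U) →+* R) (x : R), Q.eval₂ φ (x ^ 2) = 0 →
      P.eval₂ φ x = 0) : IsChart ρ V W (X ^ 2 - C r) t := by
  have happ : ∀ s, ρ.appLE V W e (π.appLE U V hd.le s) = f.appLE U W hc.le s := fun s ↦
    appLE_appLE_of_comp_eq hρ _ _ _ s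
  refine ⟨hc.affine, e, fun y ↦ ?_, ?_⟩
  · obtain ⟨p, rfl⟩ := hc.surjective y
    refine ⟨p.map (π.appLE U V hd.le).hom, ?_⟩
    simp only [chartMap, coe_eval₂RingHom, eval₂_map]
    congr 1
    ext s
    exact happ s
  -- To bound the kernel, an inverse is built: the root of `X² - r` satisfies `P` by `hPQ`, which
  -- defines `ψ` on the functions of `W`. Then `ψ ∘ chartMap` is the quotient map by `X² - r`.
  · let mk := AdjoinRoot.mk (X ^ 2 - C r)
    have hroot : mk X ^ 2 = mk (C r) := by
      rw [← map_pow, ← sub_eq_zero, ← map_sub]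
      exact AdjoinRoot.mk_self
    obtain ⟨ψ, hψ, hψt⟩ := hc.exists_ringHom (mk.comp (C.comp (π.appLE U V hd.le).hom)) (mk X) (by
      refine hPQ _ _ _ ?_
      rw [hroot]
      have := congrArg (mk.comp C) hd.eval_eq_zero
      rwa [hom_eval₂, map_zero] at this)
    have h1 : ψ.comp (ρ.appLE V W e).hom = mk.comp C := by
      refine hd.ringHom_ext (fun s ↦ ?_) ?_
      · change ψ (ρ.appLE V W e (π.appLE U V hd.le s)) = _
        rw [happ, hψ]
        rfl
      · change ψ (ρ.appLE V W e r) = _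
        rw [hr, map_pow, hψt, hroot]
        rfl
    have h2 : ψ.comp (chartMap ρ V W e t) = mk := by
      refine Polynomial.ringHom_ext (fun s ↦ ?_) ?_
      · have := congrArg (fun m ↦ m s) h1
        simpa [chartMap] using this
      · simpa [chartMap] using hψt
    refine le_antisymm (fun p hp ↦ ?_) ?_
    · have h3 : mk p = 0 := by
        rw [← h2, RingHom.comp_apply, hp, map_zero]
      rw [Ideal.mem_span_singleton]
      exact AdjoinRoot.mk_eq_zero.mp h3
    · rw [Ideal.span_le, Set.singleton_subset_iff]
      change chartMap ρ V W e t _ = 0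
      rw [chartMap, coe_eval₂RingHom, eval₂_sub, eval₂_pow, eval₂_X, eval₂_C, sub_eq_zero]
      exact hr.symm

theorem isLocalDoubleCover {h : Γ(B, U)} (hU : IsAffineOpen U) (hW : f ⁻¹ᵁ U = W)
    (hc : IsChart f U W (X ^ 2 - C h) t) : IsLocalDoubleCover f U h (res hW.le t) := by
  subst hW
  rw [res_self]
  exact isLocalDoubleCover_iff.mpr ⟨hU, hc⟩

end IsChart

/-- Rescaling of the coordinate of a double cover. -/
theorem IsLocalDoubleCover.two_mul {X B : Scheme.{u}} {ρ : X ⟶ B} {V : B.Opens} {h : Γ(B, V)}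
    {ξ : Γ(X, ρ ⁻¹ᵁ V)} (hd : IsLocalDoubleCover ρ V h ξ) (h2 : IsUnit (2 : Γ(B, V))) :
    IsLocalDoubleCover ρ V (4 * h) (2 * ξ) := by
  obtain ⟨c, hc⟩ := h2.exists_right_inv
  have hc' : 2 * ρ.app V c = 1 := by
    have := congrArg (ρ.app V) hc
    rwa [map_mul, map_ofNat, map_one] at this
  refine ⟨hd.1, hd.2.1, ?_, fun y ↦ ?_⟩
  · rw [mul_pow, hd.2.2.1, map_mul, map_ofNat]
    norm_num
  · obtain ⟨p, hp, hu⟩ := hd.2.2.2 y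
    refine ⟨(p.1, p.2 * c), ?_, ?_⟩
    · dsimp only
      rw [map_mul]
      linear_combination hp - ρ.app V p.2 * ξ * hc'
    · rintro ⟨q₁, q₂⟩ hq
      have := hu (q₁, q₂ * 2) (by
        dsimp only at hq ⊢
        rw [map_mul, map_ofNat, hq]
        ring)
      rw [← this, Prod.mk.injEq]
      refine ⟨rfl, ?_⟩
      dsimp only
      linear_combination -q₂ * hc

theorem id_appLE_apply {X : Scheme.{u}} {V W : X.Opens} (e : W ≤ 𝟙 X ⁻¹ᵁ V) (h : W ≤ V)
    (s : Γ(X, V)) : (𝟙 X : X ⟶ X).appLE V W e s = res h s := by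
  have h1 : (𝟙 X : X ⟶ X).appLE V W e = X.presheaf.map (homOfLE h).op := by
    rw [Scheme.Hom.appLE, Scheme.Hom.id_app]
    exact Category.id_comp _
  rw [h1]
  rfl

theorem isUnit_two {k : Type u} [Field k] (h2 : (2 : k) ≠ 0) {X : Scheme.{u}}
    (f : X ⟶ Spec (.of k)) (V : X.Opens) : IsUnit (2 : Γ(X, V)) := by
  have := (isUnit_iff_ne_zero.mpr h2).map (constants f V)
  rwa [map_ofNat] at this

namespace TransversalSection

variable {k : Type u} [Field k] {n : ℕ} {S : Base k n} {E : TransversalSection S}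
  {B' X' : Scheme.{u}} {π : B' ⟶ S.B} {f : X' ⟶ S.B}
  {V : S.I × Bool → B'.Opens} {W : S.I × Bool → X'.Opens}
  {r : ∀ j, Γ(B', V j)} {t : ∀ j, Γ(X', W j)}

open Polynomial in
theorem map_ne_zero {e : ℕ} {p : ℤ} {h : p * e = 2} (M : IsModel (E.atlas e p h) f W t)
    (j : S.I × Bool) {c : Γ(S.B, S.U j.1)} (hc : c ≠ 0) :
    f.appLE (S.U j.1) (W j) (le_preimage M j) c ≠ 0 := by
  have he : e ≠ 0 := by rintro rfl; simp at h
  intro h0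
  have h1 : C c ∈ RingHom.ker (chartMap f (S.U j.1) (W j) (le_preimage M j) (t j)) := by
    rw [RingHom.mem_ker, chartMap, coe_eval₂RingHom, eval₂_C]
    exact h0
  have h3 : (Ideal.span {rootPoly j.2 e (S.σ j.1) (E.a j.1)} : Ideal Γ(S.B, S.U j.1)[X]) =
    RingHom.ker (chartMap f (S.U j.1) (W j) (le_preimage M j) (t j)) := (M.chart j).ker.symm
  rw [← h3, Ideal.mem_span_singleton] at h1
  exact E.not_rootPoly_dvd_C he j.2 j.1 hc h1

theorem exceptional_ne_zero (j : S.I × Bool) (h : (S.U j.1 : Set S.B).Nonempty) :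
    exceptional j.2 (S.σ j.1) (E.a j.1) ≠ 0 := by
  obtain ⟨i, κ⟩ := j
  cases κ
  · exact E.a_ne_zero i h
  · exact S.σ_ne_zero i h

variable (M : IsModel (E.atlas 1 2 two_mul_one) π V r) (N : IsModel (E.atlas 2 1 one_mul_two) f W t)

include M N in
theorem isChart_cover {ρ' : X' ⟶ B'} (hρ : ρ' ≫ π = f) (hr : ∀ j, ∃ e : W j ≤ ρ' ⁻¹ᵁ V j,
    ρ'.appLE _ _ e (r j) = t j ^ 2) (j : S.I × Bool) :
    IsChart ρ' (V j) (W j) (Polynomial.X ^ 2 - Polynomial.C (r j)) (t j) := by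
  obtain ⟨e, he⟩ := hr j
  refine (N.chart j).of_sq (M.chart j) hρ e he fun R _ φ x hx ↦ ?_
  refine eval₂_rootPoly_eq_zero.mpr ?_
  have h1 := eval₂_rootPoly_eq_zero.mp hx
  obtain ⟨i, κ⟩ := j
  cases κ <;> simp only [IsRatioRoot, pow_one] at h1 ⊢ <;> exact h1

variable (C : DoubleCover S (fun i ↦ 4 * S.σ i * E.a i))

include M N in
/-- The local description of the resolution as a double cover of the blow-up. -/
theorem exists_local_cover (h2 : (2 : k) ≠ 0) {ρ' : X' ⟶ B'} (hρ : ρ' ≫ π = f)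
    (hr : ∀ j, ∃ e : W j ≤ ρ' ⁻¹ᵁ V j, ρ'.appLE _ _ e (r j) = t j ^ 2) {μ : X' ⟶ C.X}
    (hμ : ∀ j, ∃ e : W j ≤ μ ⁻¹ᵁ (C.ρ ⁻¹ᵁ S.U j.1), μ.appLE _ _ e (C.ξ j.1) =
      2 * f.appLE _ _ (le_preimage N j) (exceptional j.2 (S.σ j.1) (E.a j.1)) * t j)
    {ι : X' ⟶ X'} (hι : ∀ j, ∃ e : W j ≤ ι ⁻¹ᵁ W j, ι.appLE _ _ e (t j) = -t j) (b : B') :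
    ∃ (i : S.I) (V : B'.Opens) (e : V ≤ π ⁻¹ᵁ S.U i) (w s' a' : Γ(B', V))
      (ξ' : Γ(X', ρ' ⁻¹ᵁ V)), b ∈ V ∧ w ∈ nonZeroDivisors Γ(B', V) ∧
        π.appLE (S.U i) V e (S.σ i) = w * s' ∧ π.appLE (S.U i) V e (E.a i) = w * a' ∧
        Ideal.span {s', a'} = ⊤ ∧
        IsLocalDoubleCover ρ' V (4 * s' * a') ξ' ∧
        (∃ e' : ρ' ⁻¹ᵁ V ≤ μ ⁻¹ᵁ (C.ρ ⁻¹ᵁ S.U i),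
          μ.appLE (C.ρ ⁻¹ᵁ S.U i) (ρ' ⁻¹ᵁ V) e' (C.ξ i) = ρ'.app V w * ξ') ∧
        (∃ e' : ρ' ⁻¹ᵁ V ≤ ι ⁻¹ᵁ (ρ' ⁻¹ᵁ V),
          ι.appLE (ρ' ⁻¹ᵁ V) (ρ' ⁻¹ᵁ V) e' ξ' = -ξ') := by
  obtain ⟨j, hj⟩ := M.cover b
  have hpre := preimage_cover M N hρ hr j
  have hdc := ((isChart_cover M N hρ hr j).isLocalDoubleCover (M.chart j).affine hpre).two_mul
    (isUnit_two h2 (π ≫ S.str) (V j))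
  have hroot := isRatioRoot M j
  obtain ⟨eμ, hξ⟩ := hμ j
  obtain ⟨eι, ht⟩ := hι j
  have hint := E.isIntegral_of_isModel M
  have hne : (S.U j.1 : Set S.B).Nonempty := ⟨π b, (le_preimage M j) hj⟩
  have : Nonempty (V j) := ⟨⟨b, hj⟩⟩
  have hw : π.appLE (S.U j.1) (V j) (le_preimage M j) (exceptional j.2 (S.σ j.1) (E.a j.1)) ∈
      nonZeroDivisors Γ(B', V j) :=
    mem_nonZeroDivisors_of_ne_zero (map_ne_zero M j (exceptional_ne_zero j hne))
  have hA : ∃ e' : ρ' ⁻¹ᵁ V j ≤ μ ⁻¹ᵁ (C.ρ ⁻¹ᵁ S.U j.1),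
      μ.appLE (C.ρ ⁻¹ᵁ S.U j.1) (ρ' ⁻¹ᵁ V j) e' (C.ξ j.1) = ρ'.app (V j)
        (π.appLE (S.U j.1) (V j) (le_preimage M j) (exceptional j.2 (S.σ j.1) (E.a j.1))) *
        (2 * res hpre.le (t j)) := by
    refine ⟨hpre.le.trans eμ, ?_⟩
    rw [← res_appLE μ hpre.le eμ, hξ, map_mul, map_mul, map_ofNat, Scheme.Hom.app_eq_appLE,
      appLE_appLE_of_comp_eq hρ _ _ (hpre.le.trans (le_preimage N j)),
      res_appLE f hpre.le _ (hpre.le.trans (le_preimage N j))]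
    ring
  have hB : ∃ e' : ρ' ⁻¹ᵁ V j ≤ ι ⁻¹ᵁ (ρ' ⁻¹ᵁ V j),
      ι.appLE (ρ' ⁻¹ᵁ V j) (ρ' ⁻¹ᵁ V j) e' (2 * res hpre.le (t j)) = -(2 * res hpre.le (t j)) := by
    have e' : ρ' ⁻¹ᵁ V j ≤ ι ⁻¹ᵁ (ρ' ⁻¹ᵁ V j) := by rw [hpre]; exact eι
    refine ⟨e', ?_⟩
    rw [map_mul, map_ofNat, appLE_res ι hpre.le e' (hpre.le.trans eι), ← res_appLE ι hpre.le eι, ht,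
      map_neg]
    ring
  -- Near `∞`: `w = a`, `s' = r`, `a' = 1`. Near `0`: `w = σ`, `s' = 1`, `a' = r`. In both cases `ξ'
  -- = 2t`, which accounts for the factor `4` in `ξ'² = 4s'a'`.
  obtain ⟨i, κ⟩ := j
  cases κ
  · refine ⟨i, V (i, false), le_preimage M (i, false), _, r (i, false), 1, _, hj, hw, ?_, ?_, ?_, ?_, hA, hB⟩
    · simp only [IsRatioRoot, pow_one] at hroot
      exact hroot
    · rw [mul_one]; rfl
    · exact Ideal.eq_top_of_isUnit_mem _ (Ideal.subset_span (Or.inr rfl)) isUnit_one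
    · rw [mul_one]; exact hdc
  · refine ⟨i, V (i, true), le_preimage M (i, true), _, 1, r (i, true), _, hj, hw, ?_, ?_, ?_, ?_, hA, hB⟩
    · rw [mul_one]; rfl
    · simp only [IsRatioRoot, pow_one] at hroot
      exact hroot.symm
    · exact Ideal.eq_top_of_isUnit_mem _ (Ideal.subset_span (Or.inl rfl)) isUnit_one
    · rw [mul_one]; exact hdc

include N in
/-- The involution of the resolution is compatible with that of the double cover. -/
theorem involution_comp {μ : X' ⟶ C.X} (hμρ : μ ≫ C.ρ = f)
    (hμ : ∀ j, ∃ e : W j ≤ μ ⁻¹ᵁ (C.ρ ⁻¹ᵁ S.U j.1), μ.appLE _ _ e (C.ξ j.1) =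
      2 * f.appLE _ _ (le_preimage N j) (exceptional j.2 (S.σ j.1) (E.a j.1)) * t j)
    {ι : X' ⟶ X'} (hιf : ι ≫ f = f) (hι : ∀ j, ∃ e : W j ≤ ι ⁻¹ᵁ W j, ι.appLE _ _ e (t j) = -t j) :
    ι ≫ ι = 𝟙 X' ∧ ι ≫ μ = μ ≫ C.inv := by
  constructor
  · refine N.hom_ext (by rw [Category.assoc, hιf, hιf, Category.id_comp]) fun x ↦ ?_
    obtain ⟨j, hj⟩ := N.cover x
    obtain ⟨e, he⟩ := hι j
    refine ⟨W j, j, e.trans (ι.preimage_mono e), le_rfl, hj, ?_⟩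
    have h1 : ι.appLE (W j) (W j) e (ι.appLE (W j) (W j) e (t j)) = t j := by
      rw [he, map_neg, he, neg_neg]
    refine (appLE_comp ι ι e e _ (t j)).trans (h1.trans ?_)
    exact ((id_appLE_apply _ le_rfl (t j)).trans (res_self le_rfl (t j))).symm
  · refine (DoubleCover.isModel S isSection_four_mul C).hom_ext
      (by rw [Category.assoc, hμρ, hιf, Category.assoc, C.inv_ρ, hμρ]) fun x ↦ ?_
    obtain ⟨j, hj⟩ := N.cover x
    obtain ⟨e, he⟩ := hι j
    obtain ⟨eμ, hξ⟩ := hμ j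
    obtain ⟨ec, hc⟩ := C.inv_ξ j.1
    refine ⟨W j, j.1, e.trans (ι.preimage_mono eμ), eμ.trans (μ.preimage_mono ec), hj, ?_⟩
    have h1 : ι.appLE (W j) (W j) e (μ.appLE _ _ eμ (C.ξ j.1)) =
        μ.appLE _ _ eμ (C.inv.appLE _ _ ec (C.ξ j.1)) := by
      rw [hc, hξ, map_neg, hξ, map_mul, map_mul, he, map_ofNat,
        appLE_appLE_of_comp_eq hιf _ _ (le_preimage N j)]
      ring
    exact (appLE_comp ι μ eμ e _ _).trans (h1.trans (appLE_comp μ C.inv ec eμ _ _).symm)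

end TransversalSection

/-! ### Smoothness of charts -/

theorem smooth_of_constants_smooth {k : Type u} [Field k] {X : Scheme.{u}} (f : X ⟶ Spec (.of k))
    {J : Type*} (W : J → X.Opens) (hW : ∀ j, IsAffineOpen (W j)) (hcov : ∀ x, ∃ j, x ∈ W j)
    (h : ∀ j, (constants f (W j)).Smooth) : Smooth f := by
  refine HasRingHomProperty.of_iSup_eq_top (P := @Smooth) (fun j ↦ ⟨W j, hW j⟩) ?_ fun j ↦ ?_
  · rw [eq_top_iff]
    intro x _
    obtain ⟨j, hj⟩ := hcov x
    exact Opens.mem_iSup.mpr ⟨j, hj⟩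
  · have h2 := RingHom.Smooth.respectsIso.2 _ (Scheme.ΓSpecIso (.of k)).commRingCatIsoToRingEquiv (h j)
    convert h2 using 1
    ext x
    have h3 : (Scheme.ΓSpecIso (.of k)).inv ((Scheme.ΓSpecIso (.of k)).hom x) = x := by
      rw [← CommRingCat.comp_apply, Iso.hom_inv_id]; rfl
    exact (congrArg (f.appLE ⊤ (W j) le_top) h3).symm

theorem constants_comp {k : Type u} [Field k] {X Y : Scheme.{u}} (f : X ⟶ Y) (g : Y ⟶ Spec (.of k))
    {U : Y.Opens} {W : X.Opens} (e : W ≤ f ⁻¹ᵁ U) :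
    constants (f ≫ g) W = (f.appLE U W e).hom.comp (constants g U) := by
  ext c
  exact appLE_comp f g le_top e le_top ((Scheme.ΓSpecIso (.of k)).inv c)

open Polynomial in
theorem chartMap_comp_algebraMap {k : Type u} [Field k] {Y B : Scheme.{u}} (f : Y ⟶ B)
    (str : B ⟶ Spec (.of k)) {U : B.Opens} {W : Y.Opens} (e : W ≤ f ⁻¹ᵁ U) (t : Γ(Y, W)) :
    (chartMap f U W e t).comp (C.comp (constants str U)) = constants (f ≫ str) W := by
  rw [constants_comp f str e, ← RingHom.comp_assoc]
  congr 1
  ext s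
  simp [chartMap]

theorem smooth_polynomial (k A : Type*) [CommRing k] [CommRing A] [Algebra k A] [Algebra.Smooth k A] :
    Algebra.Smooth k (Polynomial A) := by
  have : Algebra.FinitePresentation A (Polynomial A) :=
    Algebra.FinitePresentation.equiv (MvPolynomial.uniqueAlgEquiv A PUnit.{1})
  have : Algebra.Smooth A (Polynomial A) := ⟨inferInstance, this⟩
  exact Algebra.Smooth.comp k A (Polynomial A)

open Polynomial in
/-- A chart whose equation has a nonvanishing differential is smooth. -/
theorem IsChart.constants_smooth {k : Type u} [Field k] {Y B : Scheme.{u}} {f : Y ⟶ B}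
    (str : B ⟶ Spec (.of k)) [Smooth str] {U : B.Opens} {W : Y.Opens} {P : Γ(B, U)[X]} {t : Γ(Y, W)}
    (hU : IsAffineOpen U) (hc : IsChart f U W P t)
    (hP : letI := sectionsAlgebra str U
      ∀ (Q : Ideal Γ(B, U)[X]) [Q.IsPrime], P ∈ Q → (1 : Q.ResidueField) ⊗ₜ[Γ(B, U)[X]]
        (KaehlerDifferential.D k Γ(B, U)[X] P : Ω[Γ(B, U)[X]⁄k]) ≠ 0) :
    (constants (f ≫ str) W).Smooth := by
  let _ := sectionsAlgebra str U
  let _ := sectionsAlgebra (f ≫ str) W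
  let _ := (chartMap f U W hc.le t).toAlgebra
  have : IsScalarTower k Γ(B, U)[X] Γ(Y, W) :=
    IsScalarTower.of_algebraMap_eq' (chartMap_comp_algebraMap f str hc.le t).symm
  have h1 : Algebra.Smooth k Γ(B, U) := WeakCoupling.constants_smooth str hU
  have := smooth_polynomial k Γ(B, U)
  exact smooth_of_differential_ne_zero hc.surjective P hc.ker hP

/-! ### Spectra of local rings and of valuation rings -/

theorem top_le_preimage_of_closedPoint {R : Type u} [CommRing R] [IsLocalRing R] {Y : Scheme.{u}}
    (l : Spec (.of R) ⟶ Y) {V : Y.Opens} (h : l (IsLocalRing.closedPoint R) ∈ V) : ⊤ ≤ l ⁻¹ᵁ V := by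
  intro x _
  exact (IsLocalRing.specializes_closedPoint x).mem_open (l ⁻¹ᵁ V).2 h

theorem top_le_preimage_basicOpen {T Y : Scheme.{u}} (φ : T ⟶ Y) {W : Y.Opens} (e : ⊤ ≤ φ ⁻¹ᵁ W)
    {t : Γ(Y, W)} (ht : IsUnit (φ.appLE W ⊤ e t)) : ⊤ ≤ φ ⁻¹ᵁ Y.basicOpen t := by
  have h := T.basicOpen_of_isUnit ht
  rw [Scheme.basicOpen_appLE] at h
  exact h.symm.le.trans inf_le_right

section

variable (R K : Type u) [CommRing R] [Field K] [Algebra R K]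

theorem specMap_appTop_apply (x : R) :
    (Spec.map (CommRingCat.ofHom (algebraMap R K))).appTop ((Scheme.ΓSpecIso (.of R)).inv x) =
      (Scheme.ΓSpecIso (.of K)).inv (algebraMap R K x) := by
  have := Scheme.ΓSpecIso_inv_naturality (CommRingCat.ofHom (algebraMap R K))
  exact (congrArg (fun m ↦ m x) this).symm

variable [IsFractionRing R K]

theorem specMap_appTop_injective :
    Function.Injective (Spec.map (CommRingCat.ofHom (algebraMap R K))).appTop := by
  have hR : Function.Bijective (Scheme.ΓSpecIso (.of R)).inv :=
    (ConcreteCategory.isIso_iff_bijective _).mp inferInstance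
  have hK : Function.Bijective (Scheme.ΓSpecIso (.of K)).inv :=
    (ConcreteCategory.isIso_iff_bijective _).mp inferInstance
  intro a b hab
  obtain ⟨a, rfl⟩ := hR.2 a
  obtain ⟨b, rfl⟩ := hR.2 b
  rw [specMap_appTop_apply, specMap_appTop_apply] at hab
  rw [IsFractionRing.injective R K (hK.1 hab)]

theorem mem_range_specMap_appTop_or [IsDomain R] [ValuationRing R] (x : Γ(Spec (.of K), ⊤)) :
    (∃ a, (Spec.map (CommRingCat.ofHom (algebraMap R K))).appTop a = x) ∨
      ∃ a, (Spec.map (CommRingCat.ofHom (algebraMap R K))).appTop a * x = 1 := by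
  have hK : Function.Bijective (Scheme.ΓSpecIso (.of K)).inv :=
    (ConcreteCategory.isIso_iff_bijective _).mp inferInstance
  obtain ⟨x, rfl⟩ := hK.2 x
  by_cases hx : x = 0
  · refine Or.inl ⟨0, ?_⟩
    rw [hx, map_zero, map_zero]
  rcases ValuationRing.isInteger_or_isInteger R (show K from x) with ⟨a, ha⟩ | ⟨a, ha⟩
  · refine Or.inl ⟨(Scheme.ΓSpecIso (.of R)).inv a, ?_⟩
    rw [specMap_appTop_apply, ha]
  · refine Or.inr ⟨(Scheme.ΓSpecIso (.of R)).inv a, ?_⟩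
    rw [specMap_appTop_apply, ha, ← map_mul]
    refine (congrArg _ ?_).trans (map_one (Scheme.ΓSpecIso (.of K)).inv.hom)
    exact inv_mul_cancel₀ (G₀ := K) hx

end

/-! ### The resolution is smooth and proper -/

theorem Base.isLocallyNoetherian {k : Type u} [Field k] {n : ℕ} (S : Base k n) :
    IsLocallyNoetherian S.B := by
  have := S.smooth
  have : Smooth S.str := SmoothOfRelativeDimension.smooth n S.str
  exact LocallyOfFiniteType.isLocallyNoetherian S.str

namespace TransversalSection

variable {k : Type u} [Field k] {n : ℕ} {S : Base k n} {E : TransversalSection S}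
  {X' : Scheme.{u}} {f : X' ⟶ S.B} {W : S.I × Bool → X'.Opens} {t : ∀ j, Γ(X', W j)}

theorem smooth_resolution (h2 : (2 : k) ≠ 0) (N : IsModel (E.atlas 2 1 one_mul_two) f W t) :
    Smooth (f ≫ S.str) := by
  have := S.smooth
  have : Smooth S.str := SmoothOfRelativeDimension.smooth n S.str
  refine smooth_of_constants_smooth _ W (fun j ↦ (N.chart j).affine) N.cover fun j ↦ ?_
  refine (N.chart j).constants_smooth S.str (S.affine j.1) ?_
  intro Q _ hQ
  let _ := sectionsAlgebra S.str (S.U j.1)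
  obtain ⟨i, κ⟩ := j
  have h1 : S.σ i ∈ Q.comap Polynomial.C → _ := fun h ↦
    (S.σ_smooth i (Q.comap Polynomial.C) (fun j ↦ by fin_cases j; exact h)).2
  have h3 : E.a i ∈ Q.comap Polynomial.C → _ := fun h ↦
    (E.smooth i (Q.comap Polynomial.C) (fun j ↦ by fin_cases j; exact h)).2
  have h4 : S.σ i ∈ Q.comap Polynomial.C → E.a i ∈ Q.comap Polynomial.C → _ := fun h h' ↦
    (E.transversal i (Q.comap Polynomial.C) (fun j ↦ by fin_cases j; exacts [h, h'])).2
  cases κ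
  · exact differential_chart₁_ne_zero h2 h1 h3 h4 hQ
  · exact differential_chart₀_ne_zero h2 h1 h3 h4 hQ

section

variable {e : ℕ} {p : ℤ} {h : p * e = 2} (N : IsModel (E.atlas e p h) f W t)

include N in
theorem preimage_eq_sup (i : S.I) : f ⁻¹ᵁ S.U i = W (i, true) ⊔ W (i, false) := by
  refine le_antisymm (fun x hx ↦ ?_) (sup_le (le_preimage N (i, true)) (le_preimage N (i, false)))
  obtain ⟨j, hj⟩ := N.cover x
  have := N.overlap j (i, j.2) x hj hx (Or.inl rfl)
  obtain ⟨j, κ⟩ := j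
  cases κ
  · exact Or.inr this
  · exact Or.inl this

include N in
theorem quasiCompact : QuasiCompact f := by
  refine @HasAffineProperty.of_iSup_eq_top @QuasiCompact _
    instHasAffinePropertyQuasiCompactCompactSpaceCarrierCarrierCommRingCat _ _ f _
    (fun i ↦ ⟨S.U i, S.affine i⟩) S.covers fun i ↦ (?_ : CompactSpace (f ⁻¹ᵁ S.U i))
  rw [preimage_eq_sup N]
  refine isCompact_iff_compactSpace.mp ?_
  exact (N.chart (i, true)).affine.isCompact.union (N.chart (i, false)).affine.isCompact

include N in
/-- The coordinates near `0` and `∞` are inverse to each other. -/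
theorem appLE_mul_appLE {T : Scheme.{u}} (φ : T ⟶ X') (i : S.I) (κ : Bool) {O : T.Opens}
    (e₁ : O ≤ φ ⁻¹ᵁ W (i, κ)) (e₂ : O ≤ φ ⁻¹ᵁ W (i, !κ)) :
    φ.appLE _ _ e₁ (t (i, κ)) * φ.appLE _ _ e₂ (t (i, !κ)) = 1 := by
  have e₃ : O ≤ φ ⁻¹ᵁ (W (i, κ) ⊓ W (i, !κ)) := le_inf e₁ e₂
  have h1 := (linked N (i, κ) (i, !κ) (N.le_inf _ _)).map (φ.appLE _ _ e₃).hom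
  have h3 := (S.L.zpowMul S.D p (-p)).tr_self i
  dsimp only at h1
  rw [h3, map_one, map_one] at h1
  have h4 := appLE_res φ inf_le_left e₃ e₁ (t (i, κ))
  have h5 := appLE_res φ inf_le_right e₃ e₂ (t (i, !κ))
  rw [← h4, ← h5]
  cases κ
  · simpa [Linked] using h1
  · simpa [Linked] using h1

include N in
-- Over a single `U i` the generic point has a coordinate in `K`. Either it lies in the valuation
-- ring, or its inverse does, and then the chart of the other kind is used. The equation holds in
-- `R` because it holds in `K`.
theorem existence : ValuativeCriterion.Existence f := by
  rintro ⟨R, K, i₁, i₂, ⟨w⟩⟩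
  have hi₂ : ∃ i, i₂ (IsLocalRing.closedPoint R) ∈ S.U i := by
    have : i₂ (IsLocalRing.closedPoint R) ∈ ⨆ i, S.U i := by rw [S.covers]; trivial
    exact Opens.mem_iSup.mp this
  obtain ⟨i, hi⟩ := hi₂
  have hU := top_le_preimage_of_closedPoint i₂ hi
  let φ := Spec.map (CommRingCat.ofHom (algebraMap R K))
  have hbase : ∀ x, f (i₁ x) ∈ S.U i := fun x ↦ by
    have : f (i₁ x) = i₂ (φ x) := by
      rw [← Scheme.Hom.comp_apply, w]; rfl
    rw [this]
    exact hU trivial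
  have key : ∀ (κ : Bool) (e₁ : ⊤ ≤ i₁ ⁻¹ᵁ W (i, κ)) (a : Γ(Spec (.of R), ⊤)),
      φ.appTop a = i₁.appLE _ _ e₁ (t (i, κ)) → ∃ l : Spec (.of R) ⟶ X', φ ≫ l = i₁ ∧ l ≫ f = i₂ := by
    intro κ e₁ a ha
    have hroot := isRatioRoot N (i, κ)
    have hφ : ∀ s : Γ(S.B, S.U i), φ.appTop (i₂.appLE _ _ hU s) =
        i₁.appLE _ _ e₁ (f.appLE _ _ (le_preimage N (i, κ)) s) := fun s ↦ by
      have e₃ : ⊤ ≤ (i₁ ≫ f) ⁻¹ᵁ S.U i := fun x _ ↦ hbase x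
      have e₄ : ⊤ ≤ (φ ≫ i₂) ⁻¹ᵁ S.U i := fun x _ ↦ hU trivial
      have h1 := appLE_comp i₁ f (le_preimage N (i, κ)) e₁ e₃ s
      have h2 := appLE_comp φ i₂ hU (top_le_preimage φ) e₄ s
      rw [← h1, appLE_congr_hom w e₃ e₄, h2, Scheme.Hom.appTop, Scheme.Hom.app_eq_appLE]
      rfl
    have hP : IsRatioRoot κ e (i₂.appLE _ _ hU (S.σ i)) (i₂.appLE _ _ hU (E.a i)) a := by
      have hinj := specMap_appTop_injective R K
      dsimp only at hroot
      cases κ <;> simp only [IsRatioRoot] at hroot ⊢ <;> apply hinj <;>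
        change φ.appTop _ = φ.appTop _ <;> rw [map_mul, map_pow, ha, hφ, hφ, ← map_pow, ← map_mul, hroot]
    obtain ⟨l, e', hl, ht⟩ := (N.chart (i, κ)).exists_hom (S.affine i) i₂ hU a
      (eval₂_rootPoly_eq_zero.mpr hP)
    refine ⟨l, (N.chart (i, κ)).hom_ext (fun x _ ↦ e' trivial) e₁ ?_ ?_, hl⟩
    · rw [Category.assoc, hl, ← w]
    · have := appLE_comp φ l e' (top_le_preimage φ) (fun x _ ↦ e' trivial) (t (i, κ))
      rw [this, ht, ← ha, Scheme.Hom.appTop, Scheme.Hom.app_eq_appLE]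
      rfl
  have hex : ∃ l : Spec (.of R) ⟶ X', φ ≫ l = i₁ ∧ l ≫ f = i₂ := by
    obtain ⟨j, hj⟩ := N.cover (i₁ (IsLocalRing.closedPoint K))
    have hj' := N.overlap j (i, j.2) _ hj (hbase _) (Or.inl rfl)
    generalize j.2 = κ at hj'
    have e₁ := top_le_preimage_of_closedPoint i₁ hj'
    rcases mem_range_specMap_appTop_or R K (i₁.appLE _ _ e₁ (t (i, κ))) with ⟨a, ha⟩ | ⟨a, ha⟩
    · exact key κ e₁ a ha
    · have hu : IsUnit (i₁.appLE _ _ e₁ (t (i, κ))) := .of_mul_eq_one _ ((mul_comm _ _).trans ha)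
      have e₂ : ⊤ ≤ i₁ ⁻¹ᵁ W (i, !κ) := fun x hx ↦
        N.overlap (i, κ) (i, !κ) _ (e₁ hx) (hbase _) (Or.inr (top_le_preimage_basicOpen i₁ e₁ hu hx))
      refine key (!κ) e₂ a ?_
      have h1 := appLE_mul_appLE N i₁ i κ e₁ e₂
      exact hu.mul_left_cancel ((mul_comm _ _).trans (ha.trans h1.symm))
  obtain ⟨l, h1, h2⟩ := hex
  exact ⟨⟨⟨l, h1, h2⟩⟩⟩

include N in
-- If the closed points land in charts of different kinds, the two coordinates multiply to `1` over
-- `K`, hence over `R`. Then both are units and `l₁` lies in the chart of `l₂` as well. Within one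
-- chart, equality over `K` of the coordinates gives equality over `R`.
theorem eq_of_specMap_comp_eq {R K : Type u} [CommRing R] [IsDomain R] [ValuationRing R] [Field K]
    [Algebra R K] [IsFractionRing R K] {l₁ l₂ : Spec (.of R) ⟶ X'} (hf : l₁ ≫ f = l₂ ≫ f)
    (hl : Spec.map (CommRingCat.ofHom (algebraMap R K)) ≫ l₁ =
      Spec.map (CommRingCat.ofHom (algebraMap R K)) ≫ l₂) : l₁ = l₂ := by
  let φ := Spec.map (CommRingCat.ofHom (algebraMap R K))
  have key : ∀ (i : S.I) (κ : Bool) (e₁ : ⊤ ≤ l₁ ⁻¹ᵁ W (i, κ)) (e₂ : ⊤ ≤ l₂ ⁻¹ᵁ W (i, κ)), l₁ = l₂ := by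
    intro i κ e₁ e₂
    refine (N.chart (i, κ)).hom_ext e₁ e₂ hf ?_
    apply specMap_appTop_injective R K
    rw [Scheme.Hom.appTop, Scheme.Hom.app_eq_appLE]
    have h3 := appLE_comp φ l₁ e₁ (top_le_preimage φ) (fun x _ ↦ e₁ trivial) (t (i, κ))
    have h4 := appLE_comp φ l₂ e₂ (top_le_preimage φ) (fun x _ ↦ e₂ trivial) (t (i, κ))
    exact h3.symm.trans ((appLE_congr_hom hl _ _ _).trans h4)
  obtain ⟨j, hj⟩ := N.cover (l₁ (IsLocalRing.closedPoint R))
  obtain ⟨j', hj'⟩ := N.cover (l₂ (IsLocalRing.closedPoint R))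
  have hb : ∀ x, f (l₁ x) = f (l₂ x) := fun x ↦ by
    rw [← Scheme.Hom.comp_apply, ← Scheme.Hom.comp_apply, hf]
  have hbase : f (l₂ (IsLocalRing.closedPoint R)) ∈ S.U j.1 := by
    have h1 : f (l₁ (IsLocalRing.closedPoint R)) ∈ S.U j.1 := le_preimage N j hj
    exact (hb _) ▸ h1
  have hj2 := N.overlap j' (j.1, j'.2) _ hj' hbase (Or.inl rfl)
  obtain ⟨i, κ⟩ := j
  obtain ⟨i', κ'⟩ := j'
  dsimp only at hj2 hbase
  have e₁ := top_le_preimage_of_closedPoint l₁ hj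
  have e₂ := top_le_preimage_of_closedPoint l₂ hj2
  by_cases hκ : κ' = κ
  · subst hκ
    exact key i κ' e₁ e₂
  · obtain rfl : κ' = !κ := by cases κ <;> cases κ' <;> simp_all
    have e₃ : ⊤ ≤ (φ ≫ l₁) ⁻¹ᵁ W (i, κ) := fun x _ ↦ e₁ trivial
    have e₅ : ⊤ ≤ (φ ≫ l₂) ⁻¹ᵁ W (i, !κ) := fun x _ ↦ e₂ trivial
    have e₄ : ⊤ ≤ (φ ≫ l₁) ⁻¹ᵁ W (i, !κ) := by
      rw [show φ ≫ l₁ = φ ≫ l₂ from hl]; exact e₅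
    have h3 := appLE_mul_appLE N (φ ≫ l₁) i κ e₃ e₄
    rw [appLE_congr_hom hl e₄ e₅, appLE_comp φ l₁ e₁ (top_le_preimage φ),
      appLE_comp φ l₂ e₂ (top_le_preimage φ), ← map_mul] at h3
    have h4 : φ.appTop (l₁.appLE _ _ e₁ (t (i, κ)) * l₂.appLE _ _ e₂ (t (i, !κ))) = φ.appTop 1 := by
      rw [map_one, Scheme.Hom.appTop, Scheme.Hom.app_eq_appLE]
      exact h3
    have hu : IsUnit (l₁.appLE _ _ e₁ (t (i, κ))) := .of_mul_eq_one _ (specMap_appTop_injective R K h4)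
    refine key i (!κ) (fun x hx ↦ ?_) e₂
    exact N.overlap (i, κ) (i, !κ) _ (e₁ hx) (le_preimage N (i, κ) (e₁ hx))
      (Or.inr (top_le_preimage_basicOpen l₁ e₁ hu hx))

include N in
theorem uniqueness : ValuativeCriterion.Uniqueness f := by
  rintro ⟨R, K, i₁, i₂, ⟨w⟩⟩
  refine ⟨fun ⟨l₁, h₁, h₁'⟩ ⟨l₂, h₂, h₂'⟩ ↦ ?_⟩
  suffices l₁ = l₂ by subst this; rfl
  exact eq_of_specMap_comp_eq (R := R) (K := K) N (h₁'.trans h₂'.symm) (h₁.trans h₂.symm)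

end

theorem isProper (h2 : (2 : k) ≠ 0) (N : IsModel (E.atlas 2 1 one_mul_two) f W t) : IsProper f := by
  have := smooth_resolution h2 N
  have : LocallyOfFiniteType f := locallyOfFiniteType_of_comp f S.str
  have := S.isLocallyNoetherian
  have := LocallyOfFiniteType.isLocallyNoetherian f
  -- The source is of finite type locally over a locally Noetherian base, hence locally Noetherian,
  -- and so quasi-separated.
  have : QuasiSeparated f := QuasiSeparated.of_quasiSeparatedSpace f
  have := quasiCompact N
  exact IsProper.of_valuativeCriterion f (ValuativeCriterion.iff.mpr ⟨existence N, uniqueness N⟩)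

end TransversalSection

/-! ### The blow-up -/

/-- Coordinates given by the ratio of the cofactors of two sections correspond. -/
theorem Linked.of_isRatioRoot {R : Type*} [CommRing R] {κ κ' : Bool} {g d w w' s s' b b' x y : R}
    (hd : IsUnit d) (hw : ∀ c, w * c = 0 → c = 0) (hw' : ∀ c, w' * c = 0 → c = 0)
    (hs : w * s = d * (w' * s')) (hb : w * b = d * g * (w' * b'))
    (hx : IsRatioRoot κ 1 s b x) (hy : IsRatioRoot κ' 1 s' b' y)
    (hu : IsUnit (exceptional κ s b)) (hu' : IsUnit (exceptional κ' s' b')) :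
    Linked κ κ' g x y := by
  have hc : ∀ c, w' * (d * (exceptional κ' s' b' * c)) = 0 → c = 0 := fun c hc ↦
    (hu'.mul_right_eq_zero).mp ((hd.mul_right_eq_zero).mp (hw' _ hc))
  cases κ <;> cases κ' <;> simp only [Linked, IsRatioRoot, exceptional, pow_one] at * <;>
    rw [← sub_eq_zero]
  · refine hc _ ?_
    subst hx hy
    linear_combination x * hb - hs
  · refine hc _ ?_
    subst hx hy
    linear_combination hs - x * hb
  · refine hc _ ?_
    subst hx hy
    linear_combination hb - x * hs
  · refine (hu.mul_right_eq_zero).mp (hw _ ?_)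
    subst hx hy
    linear_combination hb - g * y * hs

/-- If `s` and `b` generate the unit ideal and one is a multiple of the other, then the other is a
unit. -/
theorem isUnit_exceptional {R : Type*} [CommRing R] {κ : Bool} {s b x c d : R}
    (h : c * s + d * b = 1) (hx : IsRatioRoot κ 1 s b x) : IsUnit (exceptional κ s b) := by
  cases κ <;> simp only [IsRatioRoot, exceptional, pow_one] at *
  · exact .of_mul_eq_one (c * x + d) (by rw [← h, hx]; ring)
  · exact .of_mul_eq_one (c + d * x) (by rw [← h, ← hx]; ring)

theorem IsRatioRoot.of_mul {R : Type*} [CommRing R] {κ : Bool} {w s b x : R}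
    (hw : ∀ c, w * c = 0 → c = 0) (hx : IsRatioRoot κ 1 (w * s) (w * b) x) : IsRatioRoot κ 1 s b x := by
  cases κ <;> simp only [IsRatioRoot, pow_one] at * <;> rw [← sub_eq_zero] <;> refine hw _ ?_ <;>
    linear_combination hx

theorem IsRatioRoot.mul {R : Type*} [CommRing R] {κ : Bool} {s b x : R} (w : R)
    (hx : IsRatioRoot κ 1 s b x) : IsRatioRoot κ 1 (w * s) (w * b) x := by
  cases κ <;> simp only [IsRatioRoot, pow_one] at * <;> linear_combination w * hx

theorem IsRatioRoot.map {R S : Type*} [CommRing R] [CommRing S] (φ : R →+* S) {κ : Bool} {e : ℕ}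
    {s b x : R} (hx : IsRatioRoot κ e s b x) : IsRatioRoot κ e (φ s) (φ b) (φ x) := by
  cases κ <;> simp only [IsRatioRoot] at * <;> rw [← map_pow, ← map_mul, hx]

theorem IsRatioRoot.exists_of_isUnit {R : Type*} [CommRing R] {κ : Bool} {s b : R}
    (h : IsUnit (exceptional κ s b)) : ∃ x, IsRatioRoot κ 1 s b x := by
  obtain ⟨v, hv⟩ := h.exists_right_inv
  cases κ <;> simp only [IsRatioRoot, exceptional, pow_one] at *
  · exact ⟨v * s, by rw [← mul_assoc, hv, one_mul]⟩
  · exact ⟨v * b, by rw [← mul_assoc, hv, one_mul]⟩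

/-- Non-zero-divisors on an affine open subset restrict to non-zero-divisors. -/
theorem res_mul_eq_zero {X : Scheme.{u}} {V : X.Opens} (hV : IsAffineOpen V) {w : Γ(X, V)}
    (hw : w ∈ nonZeroDivisors Γ(X, V)) {O : X.Opens} (h : O ≤ V) (c : Γ(X, O))
    (hc : res h w * c = 0) : c = 0 := by
  refine TopCat.Presheaf.section_ext X.sheaf O c 0 fun x hx ↦ ?_
  have hst := hV.isLocalization_stalk ⟨x, h hx⟩
  have := hV.primeIdealOf ⟨x, h hx⟩ |>.2
  have h1 : X.presheaf.germ V x (h hx) w ∈ nonZeroDivisors (X.presheaf.stalk x) := by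
    let _ := X.presheaf.algebra_section_stalk (⟨x, h hx⟩ : V)
    exact IsLocalization.map_nonZeroDivisors_le
      (hV.primeIdealOf ⟨x, h hx⟩).asIdeal.primeCompl (X.presheaf.stalk x) ⟨w, hw, rfl⟩
  have h2 := congrArg (X.presheaf.germ O x hx).hom hc
  rw [map_mul, map_zero] at h2
  have h3 := X.presheaf.germ_res_apply (homOfLE h) x hx w
  have h4 : X.presheaf.germ V x (h hx) w * X.presheaf.germ O x hx c = 0 := by
    rw [← h3]; exact h2
  have h5 := (mem_nonZeroDivisors_iff.mp h1).1 _ h4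
  refine h5.trans ?_
  exact (map_zero (X.presheaf.germ O x hx).hom).symm

/-- Local generators of the inverse image ideal. -/
theorem exists_cofactors {R S : Type*} [CommRing R] [CommRing S] (φ : R →+* S) {σ a : R} {w : S}
    (hw : w ∈ nonZeroDivisors S) (h : (Ideal.span {σ, a}).map φ = Ideal.span {w}) :
    ∃ s b c d, φ σ = w * s ∧ φ a = w * b ∧ c * s + d * b = 1 := by
  rw [Ideal.map_span, Set.image_pair] at h
  have h1 : φ σ ∈ Ideal.span {w} := h ▸ Ideal.subset_span (Or.inl rfl)
  have h2 : φ a ∈ Ideal.span {w} := h ▸ Ideal.subset_span (Or.inr rfl)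
  have h3 : w ∈ Ideal.span {φ σ, φ a} := h ▸ Ideal.mem_span_singleton_self w
  obtain ⟨s, hs⟩ := Ideal.mem_span_singleton'.mp h1
  obtain ⟨b, hb⟩ := Ideal.mem_span_singleton'.mp h2
  obtain ⟨c, d, hcd⟩ := Ideal.mem_span_pair.mp h3
  refine ⟨s, b, c, d, by rw [← hs, mul_comm], by rw [← hb, mul_comm], ?_⟩
  rw [← sub_eq_zero]
  refine (mem_nonZeroDivisors_iff.mp hw).1 _ ?_
  linear_combination hcd + c * hs + d * hb

theorem mem_basicOpen_or {X : Scheme.{u}} {V : X.Opens} {s b c d : Γ(X, V)} (h : c * s + d * b = 1)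
    {x : X} (hx : x ∈ V) : x ∈ X.basicOpen s ∨ x ∈ X.basicOpen b := by
  rw [Scheme.mem_basicOpen _ _ _ hx, Scheme.mem_basicOpen _ _ _ hx]
  have h1 := congrArg (X.presheaf.germ V x hx).hom h
  rw [map_add, map_mul, map_mul, map_one] at h1
  rcases IsLocalRing.isUnit_or_isUnit_of_add_one h1 with h2 | h2
  · exact Or.inl (isUnit_of_mul_isUnit_right h2)
  · exact Or.inr (isUnit_of_mul_isUnit_right h2)

namespace TransversalSection

variable {k : Type u} [Field k] {n : ℕ} {S : Base k n} {E : TransversalSection S}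
  {B' : Scheme.{u}} {π : B' ⟶ S.B} {V : S.I × Bool → B'.Opens} {r : ∀ j, Γ(B', V j)}
  (M : IsModel (E.atlas 1 2 two_mul_one) π V r)

include M in
-- Near `0` one has `a = σr`, so the ideal becomes `(σ)`; near `∞` it becomes `(a)`. Both are
-- nonzero in a domain.
theorem invertsIdeal : InvertsIdeal (fun i ↦ Ideal.span {S.σ i, E.a i}) π := by
  intro b
  obtain ⟨j, hj⟩ := M.cover b
  have hint := E.isIntegral_of_isModel M
  have hne : (S.U j.1 : Set S.B).Nonempty := ⟨π b, (le_preimage M j) hj⟩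
  have : Nonempty (V j) := ⟨⟨b, hj⟩⟩
  refine ⟨j.1, V j, le_preimage M j, hj, (M.chart j).affine,
    π.appLE (S.U j.1) (V j) (le_preimage M j) (exceptional j.2 (S.σ j.1) (E.a j.1)),
    mem_nonZeroDivisors_of_ne_zero (map_ne_zero M j (exceptional_ne_zero j hne)), ?_⟩
  have hroot := isRatioRoot M j
  rw [Ideal.map_span, Set.image_pair]
  obtain ⟨i, κ⟩ := j
  cases κ <;> simp only [IsRatioRoot, exceptional, pow_one] at hroot ⊢
  · refine le_antisymm (Ideal.span_le.mpr ?_) (Ideal.span_mono (Set.singleton_subset_iff.mpr (Or.inr rfl)))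
    rintro _ (rfl | rfl)
    · exact Ideal.mem_span_singleton'.mpr ⟨r (i, false), by rw [mul_comm]; exact hroot.symm⟩
    · exact Ideal.mem_span_singleton_self _
  · refine le_antisymm (Ideal.span_le.mpr ?_) (Ideal.span_mono (Set.singleton_subset_iff.mpr (Or.inl rfl)))
    rintro _ (rfl | rfl)
    · exact Ideal.mem_span_singleton_self _
    · exact Ideal.mem_span_singleton'.mpr ⟨r (i, true), by rw [mul_comm]; exact hroot⟩

include M in
-- Where `(σ, a)` becomes `(w)`, write `σ = ws` and `a = wb`; then `s, b` generate the unit ideal,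
-- and the coordinate is `b/s` or `s/b`. Since `w` is not a zero divisor it can be cancelled. Thus
-- the ratios from different choices correspond under the transition functions, and any other lift
-- has the same coordinates.
theorem existsUnique_of_invertsIdeal {T : Scheme.{u}} (q : T ⟶ S.B)
    (hq : InvertsIdeal (fun i ↦ Ideal.span {S.σ i, E.a i}) q) : ∃! g : T ⟶ B', g ≫ π = q := by
  -- Cancellation of `w` is recorded on every smaller open subset, because the coordinates are
  -- compared on overlaps that need not be affine.
  have H : ∀ x : T, ∃ (i : S.I) (O : T.Opens) (e : O ≤ q ⁻¹ᵁ S.U i) (w s b c d : Γ(T, O)), x ∈ O ∧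
      (∀ (O' : T.Opens) (h : O' ≤ O) (c : Γ(T, O')), res h w * c = 0 → c = 0) ∧
      q.appLE _ _ e (S.σ i) = w * s ∧ q.appLE _ _ e (E.a i) = w * b ∧ c * s + d * b = 1 := by
    intro x
    obtain ⟨i, O, e, hx, hO, w, hw, h⟩ := hq x
    obtain ⟨s, b, c, d, h1, h2, h3⟩ := exists_cofactors _ hw h
    exact ⟨i, O, e, w, s, b, c, d, hx, fun O' h c ↦ res_mul_eq_zero hO hw h c, h1, h2, h3⟩
  choose i O e w s b c d hx hw hσ ha hcd using H
  have hunit : ∀ k : T × Bool, IsUnit (exceptional k.2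
      (res (T.basicOpen_le (exceptional k.2 (s k.1) (b k.1))) (s k.1))
      (res (T.basicOpen_le (exceptional k.2 (s k.1) (b k.1))) (b k.1))) := fun ⟨x, κ⟩ ↦ by
    rw [← map_exceptional]
    exact (RingedSpace.isUnit_res_basicOpen T.toRingedSpace _ :)
  choose τ hτ using fun k ↦ IsRatioRoot.exists_of_isUnit (hunit k)
  have hex := exists_hom M q (K := T × Bool) (fun k ↦ (i k.1, k.2))
    (fun k ↦ T.basicOpen (exceptional k.2 (s k.1) (b k.1)))
    (fun k ↦ (T.basicOpen_le _).trans (e k.1)) (fun x ↦ ?_) τ (fun k ↦ ?_) fun k l e' ↦ ?_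
  · obtain ⟨g, hg, -⟩ := hex
    refine ⟨g, hg, fun g' hg' ↦ ?_⟩
    dsimp only at hg'
    refine M.hom_ext (hg'.trans hg.symm) fun x ↦ ?_
    have hb : ∀ g : T ⟶ B', g ≫ π = q → π (g x) ∈ S.U (i x) := fun g hg ↦ by
      have h1 : q x ∈ S.U (i x) := e x (hx x)
      rw [← hg] at h1
      exact h1
    have hmem : ∀ g : T ⟶ B', g ≫ π = q → ∃ κ, g x ∈ V (i x, κ) := fun g hg ↦ by
      obtain ⟨j, hj⟩ := M.cover (g x)
      exact ⟨j.2, M.overlap j (i x, j.2) _ hj (hb g hg) (Or.inl rfl)⟩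
    have key : ∀ κ κ', g' x ∈ V (i x, κ) → g x ∈ V (i x, κ') → ∃ (O' : T.Opens)
        (e₁ : O' ≤ g' ⁻¹ᵁ V (i x, κ)) (e₂ : O' ≤ g ⁻¹ᵁ V (i x, κ')), x ∈ O' ∧
        Linked κ κ' 1 (g'.appLE _ _ e₁ (r (i x, κ))) (g.appLE _ _ e₂ (r (i x, κ'))) := by
      intro κ κ' hκ hκ'
      have e₁ : O x ⊓ (g' ⁻¹ᵁ V (i x, κ) ⊓ g ⁻¹ᵁ V (i x, κ')) ≤ g' ⁻¹ᵁ V (i x, κ) :=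
        inf_le_right.trans inf_le_left
      have e₂ : O x ⊓ (g' ⁻¹ᵁ V (i x, κ) ⊓ g ⁻¹ᵁ V (i x, κ')) ≤ g ⁻¹ᵁ V (i x, κ') :=
        inf_le_right.trans inf_le_right
      have hx' : ∀ (g : T ⟶ B') (_ : g ≫ π = q) (κ : Bool) (O' : T.Opens) (h : O' ≤ O x)
          (e₁ : O' ≤ g ⁻¹ᵁ V (i x, κ)), IsRatioRoot κ 1 (res h (s x)) (res h (b x))
            (g.appLE _ _ e₁ (r (i x, κ))) := by
        intro g hg κ O' h e₁
        have h1 := (isRatioRoot M (i x, κ)).map (g.appLE _ _ e₁).hom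
        have h2 := appLE_appLE_of_comp_eq hg (le_preimage M (i x, κ)) e₁ (h.trans (e x)) (S.σ (i x))
        have h3 := appLE_appLE_of_comp_eq hg (le_preimage M (i x, κ)) e₁ (h.trans (e x)) (E.a (i x))
        rw [← res_appLE q h (e x), hσ, map_mul] at h2
        rw [← res_appLE q h (e x), ha, map_mul] at h3
        dsimp only at h1
        rw [show (g.appLE _ _ e₁).hom _ = _ from h2, show (g.appLE _ _ e₁).hom _ = _ from h3] at h1
        exact h1.of_mul (hw x _ h)
      have hcd' : ∀ (O' : T.Opens) (h : O' ≤ O x), res h (c x) * res h (s x) + res h (d x) * res h (b x) = 1 :=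
        fun O' h ↦ by rw [← map_mul, ← map_mul, ← map_add, hcd, map_one]
      have r1 := hx' g' hg' κ _ inf_le_left e₁
      have r2 := hx' g hg κ' _ inf_le_left e₂
      refine ⟨_, e₁, e₂, ⟨hx x, hκ, hκ'⟩, ?_⟩
      refine Linked.of_isRatioRoot isUnit_one (hw x _ inf_le_left) (hw x _ inf_le_left) ?_ ?_ r1 r2
        (isUnit_exceptional (hcd' _ inf_le_left) r1) (isUnit_exceptional (hcd' _ inf_le_left) r2)
      · rw [one_mul]
      · rw [one_mul, one_mul]
    obtain ⟨κ, hκ⟩ := hmem g' hg'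
    obtain ⟨κ', hκ'⟩ := hmem g hg
    have hκ₂ : g' x ∈ V (i x, κ') := by
      by_cases hne : κ = κ'
      · exact hne ▸ hκ
      · obtain ⟨O', e₁, e₂, hxO, hl⟩ := key κ κ' hκ hκ'
        have hu := (hl.isUnit_of_ne isUnit_one hne).1
        refine M.overlap (i x, κ) (i x, κ') _ hκ (hb g' hg') (Or.inr ?_)
        have h3 := T.basicOpen_of_isUnit hu
        rw [Scheme.basicOpen_appLE] at h3
        exact (h3.symm.le hxO).2
    obtain ⟨O', e₁, e₂, hxO, hl⟩ := key κ' κ' hκ₂ hκ'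
    exact ⟨O', (i x, κ'), e₁, e₂, hxO, hl.eq_of_self⟩
  · rcases mem_basicOpen_or (hcd x) (hx x) with h | h
    · exact ⟨(x, true), h⟩
    · exact ⟨(x, false), h⟩
  · have h1 := (hτ k).mul (res (T.basicOpen_le _) (w k.1))
    rw [← map_mul, ← map_mul, ← hσ, ← ha, res_appLE q _ _ ((T.basicOpen_le _).trans (e k.1)),
      res_appLE q _ _ ((T.basicOpen_le _).trans (e k.1))] at h1
    exact h1
  · have hk := (inf_le_left.trans (T.basicOpen_le _) :
      T.basicOpen (exceptional k.2 (s k.1) (b k.1)) ⊓ T.basicOpen (exceptional l.2 (s l.1) (b l.1)) ≤ O k.1)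
    have hl := (inf_le_right.trans (T.basicOpen_le _) :
      T.basicOpen (exceptional k.2 (s k.1) (b k.1)) ⊓ T.basicOpen (exceptional l.2 (s l.1) (b l.1)) ≤ O l.1)
    have hsec := congrArg (q.appLE _ _ e') (S.σ_section (i k.1) (i l.1))
    have hseca := congrArg (q.appLE _ _ e') (E.isSection (i k.1) (i l.1))
    rw [zpow_zero, one_mul, zpow_one] at hsec
    have hg : S.L.tr (i k.1) (i l.1) ^ (2 : ℤ) * S.D.tr (i k.1) (i l.1) ^ (-1 : ℤ) =
        S.D.tr (i k.1) (i l.1) * (S.L.zpowMul S.D 2 (-2)).tr (i k.1) (i l.1) := by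
      simp only [Cocycle.zpowMul]
      rw [mul_left_comm, ← zpow_one_add]
      norm_num
    rw [hg, Units.val_mul] at hseca
    rw [map_mul, appLE_res q _ _ (hk.trans (e k.1)), appLE_res q _ _ (hl.trans (e l.1)),
      ← res_appLE q hk (e k.1), ← res_appLE q hl (e l.1), hσ, hσ, map_mul, map_mul] at hsec
    rw [map_mul, map_mul, appLE_res q _ _ (hk.trans (e k.1)), appLE_res q _ _ (hl.trans (e l.1)),
      ← res_appLE q hk (e k.1), ← res_appLE q hl (e l.1), ha, ha, map_mul, map_mul] at hseca
    have r1 := (hτ k).map (res (inf_le_left : T.basicOpen (exceptional k.2 (s k.1) (b k.1)) ⊓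
      T.basicOpen (exceptional l.2 (s l.1) (b l.1)) ≤ _))
    have r2 := (hτ l).map (res (inf_le_right : T.basicOpen (exceptional k.2 (s k.1) (b k.1)) ⊓
      T.basicOpen (exceptional l.2 (s l.1) (b l.1)) ≤ _))
    rw [res_res, res_res] at r1 r2
    have hcd' : ∀ (x : T) (O' : T.Opens) (h : O' ≤ O x),
        res h (c x) * res h (s x) + res h (d x) * res h (b x) = 1 :=
      fun x O' h ↦ by rw [← map_mul, ← map_mul, ← map_add, hcd, map_one]
    exact Linked.of_isRatioRoot ((S.D.tr _ _).isUnit.map (q.appLE _ _ e').hom) (hw _ _ hk) (hw _ _ hl)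
      hsec hseca r1 r2 (isUnit_exceptional (hcd' k.1 _ hk) r1) (isUnit_exceptional (hcd' l.1 _ hl) r2)

include M in
theorem isBlowup : IsBlowup (fun i ↦ Ideal.span {S.σ i, E.a i}) π :=
  ⟨invertsIdeal M, fun _ q hq ↦ existsUnique_of_invertsIdeal M q hq⟩

end TransversalSection

/-! ### The resolution is an isomorphism where the branch divisor is smooth -/

theorem IsSection.mem_basicOpen_of_mem {B : Scheme.{u}} {I : Type u} {U : I → B.Opens} {L M : Cocycle U}
    {p q : ℤ} {s : ∀ i, Γ(B, U i)} (h : IsSection L M p q s) {i j : I} {x : B} (hj : x ∈ U j)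
    (hx : x ∈ B.basicOpen (s i)) : x ∈ B.basicOpen (s j) := by
  have hi := B.basicOpen_le _ hx
  have h1 : x ∈ B.basicOpen (res (inf_le_left : U i ⊓ U j ≤ U i) (s i)) := by
    change x ∈ B.basicOpen (B.presheaf.map _ (s i))
    rw [Scheme.basicOpen_res]
    exact ⟨⟨hi, hj⟩, hx⟩
  rw [h i j, Scheme.basicOpen_mul] at h1
  have h2 := h1.2
  change x ∈ B.basicOpen (B.presheaf.map _ (s j)) at h2
  rw [Scheme.basicOpen_res] at h2
  exact h2.2

theorem isIso_morphismRestrict {X Y : Scheme.{u}} (μ : X ⟶ Y) (W : Y.Opens) (ν : (W : Scheme.{u}) ⟶ X)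
    (h₁ : ν ≫ μ = W.ι) (h₂ : (μ ∣_ W) ≫ ν = (μ ⁻¹ᵁ W).ι) : IsIso (μ ∣_ W) := by
  have hr : Set.range ν ⊆ Set.range (μ ⁻¹ᵁ W).ι := by
    rintro _ ⟨x, rfl⟩
    rw [Scheme.Opens.range_ι]
    change μ (ν x) ∈ W
    have : μ (ν x) = W.ι x := by rw [← h₁]; rfl
    rw [this]
    exact x.2
  refine ⟨IsOpenImmersion.lift (μ ⁻¹ᵁ W).ι ν hr, ?_, ?_⟩
  · rw [← cancel_mono (μ ⁻¹ᵁ W).ι, Category.assoc, IsOpenImmersion.lift_fac, h₂, Category.id_comp]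
  · rw [← cancel_mono W.ι, Category.assoc, morphismRestrict_ι, IsOpenImmersion.lift_fac_assoc, h₁,
      Category.id_comp]

/-- Coordinates of the resolution, from the coordinate of the double cover. -/
theorem Linked.of_doubleCover {R : Type*} [CommRing R] {κ κ' : Bool} {g d ℓ s s' b b' x y z z' : R}
    (h2 : IsUnit (2 : R)) (hd : IsUnit d) (hg : IsUnit g)
    (hs : s = d * s') (hb : b = d * g ^ 2 * b') (hℓ : ℓ = d * g) (hz : z = ℓ * z')
    (hz' : z' ^ 2 = 4 * s' * b') (hu : IsUnit (exceptional κ s b)) (hu' : IsUnit (exceptional κ' s' b'))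
    (hx : 2 * exceptional κ s b * x = z) (hy : 2 * exceptional κ' s' b' * y = z') :
    Linked κ κ' g x y := by
  subst hs hb hℓ
  cases κ <;> cases κ' <;> simp only [Linked, exceptional] at * <;> rw [← sub_eq_zero]
  · refine (h2.mul_right_eq_zero).mp ((hd.mul_right_eq_zero).mp ((hg.mul_right_eq_zero).mp
      ((hu'.mul_right_eq_zero).mp ?_)))
    linear_combination d * g * hy - hx - hz
  · refine (h2.mul_right_eq_zero).mp ((h2.mul_right_eq_zero).mp ((hu'.mul_right_eq_zero).mp
      ((hg.mul_right_eq_zero).mp ((hd.mul_right_eq_zero).mp (((isUnit_of_mul_isUnit_right hu)).mul_right_eq_zero.mp ?_)))))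
    linear_combination 2 * s' * y * hx + z * hy + z' * hz + d * g * hz'
  · refine (h2.mul_right_eq_zero).mp ((h2.mul_right_eq_zero).mp ((hu.mul_right_eq_zero).mp
      ((hu'.mul_right_eq_zero).mp ?_)))
    linear_combination 2 * b' * y * hx + z * hy + z' * hz + d * g * hz'
  · refine (h2.mul_right_eq_zero).mp ((hu.mul_right_eq_zero).mp ?_)
    linear_combination hx + hz - d * g * hy

theorem IsRatioRoot.of_doubleCover {R : Type*} [CommRing R] {κ : Bool} {s b x z : R}
    (h2 : IsUnit (2 : R)) (hz : z ^ 2 = 4 * s * b) (hu : IsUnit (exceptional κ s b))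
    (hx : 2 * exceptional κ s b * x = z) : IsRatioRoot κ 2 s b x := by
  subst hx
  cases κ <;> simp only [IsRatioRoot, exceptional] at * <;> rw [← sub_eq_zero] <;>
    refine (h2.mul_right_eq_zero).mp ((h2.mul_right_eq_zero).mp ((hu.mul_right_eq_zero).mp ?_))
  · linear_combination -hz
  · linear_combination hz

theorem IsRatioRoot.isUnit {R : Type*} [CommRing R] {κ : Bool} {e : ℕ} {s b x : R} (he : e ≠ 0)
    (hx : IsRatioRoot κ e s b x) (hu : IsUnit (exceptional (!κ) s b)) : IsUnit x := by
  cases κ <;> simp only [IsRatioRoot, exceptional, Bool.not_true, Bool.not_false] at * <;> subst hx <;>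
    exact (isUnit_pow_iff he).mp (isUnit_of_mul_isUnit_right hu)

namespace TransversalSection

variable {k : Type u} [Field k] {n : ℕ} {S : Base k n}

section

variable (E : TransversalSection S)

/-- The complement of the locus `σ = a = 0`. -/
def regularLocus : S.B.Opens :=
  ⨆ j : S.I × Bool, S.B.basicOpen (exceptional j.2 (S.σ j.1) (E.a j.1))

variable {E}

theorem mem_basicOpen_exceptional {i j : S.I} {κ : Bool} {x : S.B} (hj : x ∈ S.U j)
    (hx : x ∈ S.B.basicOpen (exceptional κ (S.σ i) (E.a i))) :
    x ∈ S.B.basicOpen (exceptional κ (S.σ j) (E.a j)) := by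
  cases κ
  · exact E.isSection.mem_basicOpen_of_mem hj hx
  · exact S.σ_section.mem_basicOpen_of_mem hj hx

theorem mem_regularLocus {i : S.I} {x : S.B} (hx : x ∈ S.U i) :
    x ∈ E.regularLocus ↔ x ∈ S.B.basicOpen (S.σ i) ∨ x ∈ S.B.basicOpen (E.a i) := by
  constructor
  · intro h
    obtain ⟨⟨j, κ⟩, hj⟩ := Opens.mem_iSup.mp h
    have := mem_basicOpen_exceptional hx hj
    cases κ
    · exact Or.inr this
    · exact Or.inl this
  · rintro (h | h)
    · exact Opens.mem_iSup.mpr ⟨(i, true), h⟩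
    · exact Opens.mem_iSup.mpr ⟨(i, false), h⟩

end

variable {E : TransversalSection S} {X' : Scheme.{u}} {f : X' ⟶ S.B} {W : S.I × Bool → X'.Opens}
  {t : ∀ j, Γ(X', W j)}

theorem isUnit_exceptional {T : Scheme.{u}} (q : T ⟶ S.B) {j : S.I × Bool} {O : T.Opens}
    (hO : O ≤ q ⁻¹ᵁ S.B.basicOpen (exceptional j.2 (S.σ j.1) (E.a j.1))) :
    ∃ e : O ≤ q ⁻¹ᵁ S.U j.1,
      IsUnit (exceptional j.2 (q.appLE _ _ e (S.σ j.1)) (q.appLE _ _ e (E.a j.1))) := by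
  have e := hO.trans (q.preimage_mono (S.B.basicOpen_le _))
  refine ⟨e, ?_⟩
  have h1 := map_exceptional (q.appLE _ _ e).hom j.2 (S.σ j.1) (E.a j.1)
  rw [← h1]
  refine isUnit_of_le_basicOpen ?_
  rw [show (q.appLE _ _ e).hom _ = q.appLE _ _ e _ from rfl, Scheme.basicOpen_appLE]
  exact le_inf le_rfl hO

/-- Where `σ` is invertible the root of `a/σ` is finite, so the point lies in the chart near `0`;
where `a` is invertible, it lies in the chart near `∞`. -/
theorem mem_of_mem_basicOpen {e : ℕ} {p : ℤ} {h : p * e = 2} (N : IsModel (E.atlas e p h) f W t)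
    {j : S.I × Bool} {x : X'} (hx : f x ∈ S.B.basicOpen (exceptional j.2 (S.σ j.1) (E.a j.1))) :
    x ∈ W j := by
  have he : e ≠ 0 := by rintro rfl; simp at h
  have hU : f x ∈ S.U j.1 := S.B.basicOpen_le _ hx
  obtain ⟨j₀, hj₀⟩ := N.cover x
  have hj₁ := N.overlap j₀ (j.1, j₀.2) x hj₀ hU (Or.inl rfl)
  obtain ⟨i, κ⟩ := j
  obtain ⟨i₀, κ₀⟩ := j₀
  dsimp only at *
  by_cases hκ : κ₀ = κ
  · exact hκ ▸ hj₁
  · obtain rfl : κ = !κ₀ := by cases κ <;> cases κ₀ <;> simp_all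
    refine N.overlap (i, κ₀) (i, !κ₀) x hj₁ hU (Or.inr ?_)
    have h1 := (isRatioRoot N (i, κ₀)).map (X'.presheaf.germ (W (i, κ₀)) x hj₁).hom
    rw [Scheme.mem_basicOpen _ _ _ hj₁]
    refine h1.isUnit he ?_
    dsimp only
    have h2 : x ∈ X'.basicOpen (f.appLE (S.U i) (W (i, κ₀)) (le_preimage N (i, κ₀))
        (exceptional (!κ₀) (S.σ i) (E.a i))) := by
      rw [Scheme.basicOpen_appLE]
      exact ⟨hj₁, hx⟩
    rw [Scheme.mem_basicOpen _ _ _ hj₁] at h2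
    have h3 := map_exceptional ((X'.presheaf.germ (W (i, κ₀)) x hj₁).hom.comp
      (f.appLE (S.U i) (W (i, κ₀)) (le_preimage N (i, κ₀))).hom) (!κ₀) (S.σ i) (E.a i)
    exact h3 ▸ h2

variable (N : IsModel (E.atlas 2 1 one_mul_two) f W t) (C : DoubleCover S (fun i ↦ 4 * S.σ i * E.a i))
  {μ : X' ⟶ C.X} (hμρ : μ ≫ C.ρ = f)
  (hμ : ∀ j, ∃ e : W j ≤ μ ⁻¹ᵁ (C.ρ ⁻¹ᵁ S.U j.1), μ.appLE _ _ e (C.ξ j.1) =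
    2 * f.appLE _ _ (le_preimage N j) (exceptional j.2 (S.σ j.1) (E.a j.1)) * t j)

include hμρ hμ in
theorem appLE_resolution {T : Scheme.{u}} (φ : T ⟶ X') {q : T ⟶ C.X} (hq : φ ≫ μ = q) {j : S.I × Bool}
    {O : T.Opens} (e : O ≤ φ ⁻¹ᵁ W j) (e' : O ≤ (q ≫ C.ρ) ⁻¹ᵁ S.U j.1)
    (e'' : O ≤ q ⁻¹ᵁ (C.ρ ⁻¹ᵁ S.U j.1)) :
    2 * exceptional j.2 ((q ≫ C.ρ).appLE _ _ e' (S.σ j.1)) ((q ≫ C.ρ).appLE _ _ e' (E.a j.1)) *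
      φ.appLE _ _ e (t j) = q.appLE _ _ e'' (C.ξ j.1) := by
  obtain ⟨e₁, h⟩ := hμ j
  have h1 := congrArg (φ.appLE _ _ e) h
  rw [appLE_appLE_of_comp_eq hq e₁ e e'', map_mul, map_mul, map_ofNat] at h1
  have hq' : φ ≫ f = q ≫ C.ρ := by rw [← hμρ, ← hq, Category.assoc]
  rw [appLE_appLE_of_comp_eq hq' (le_preimage N j) e e'] at h1
  rw [h1]
  congr 2
  exact (map_exceptional ((q ≫ C.ρ).appLE _ _ e').hom _ _ _).symm

include hμρ hμ in
/-- Away from `σ = a = 0`, morphisms to the resolution are determined by those to the double cover. -/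
theorem eq_of_comp_eq (h2 : (2 : k) ≠ 0) {T : Scheme.{u}} {φ ψ : T ⟶ X'} (h : φ ≫ μ = ψ ≫ μ)
    (hφ : ∀ x, f (φ x) ∈ E.regularLocus) : φ = ψ := by
  have hf : φ ≫ f = ψ ≫ f := by rw [← hμρ, reassoc_of% h]
  refine N.hom_ext hf fun x ↦ ?_
  obtain ⟨j, hj⟩ := Opens.mem_iSup.mp (hφ x)
  let O : T.Opens := (φ ≫ f) ⁻¹ᵁ S.B.basicOpen (exceptional j.2 (S.σ j.1) (E.a j.1))
  have e₁ : O ≤ φ ⁻¹ᵁ W j := fun y hy ↦ mem_of_mem_basicOpen N hy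
  have e₂ : O ≤ ψ ⁻¹ᵁ W j := fun y hy ↦ by
    refine mem_of_mem_basicOpen N ?_
    have h3 : (φ ≫ f) y ∈ S.B.basicOpen (exceptional j.2 (S.σ j.1) (E.a j.1)) := hy
    rw [hf] at h3
    exact h3
  have hb : (ψ ≫ μ) ≫ C.ρ = φ ≫ f := by rw [← h, Category.assoc, hμρ]
  have e₃ : O ≤ ((ψ ≫ μ) ≫ C.ρ) ⁻¹ᵁ S.B.basicOpen (exceptional j.2 (S.σ j.1) (E.a j.1)) := by rw [hb]
  obtain ⟨e, hu⟩ := isUnit_exceptional ((ψ ≫ μ) ≫ C.ρ) e₃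
  have h3 := appLE_resolution N C hμρ hμ φ h e₁ e e
  have h4 := appLE_resolution N C hμρ hμ ψ rfl e₂ e e
  exact ⟨O, j, e₁, e₂, hj, ((isUnit_two h2 ((φ ≫ f) ≫ S.str) O).mul hu).mul_left_cancel (h3.trans h4.symm)⟩

include hμρ hμ in
/-- Away from `σ = a = 0`, morphisms to the double cover lift to the resolution. -/
theorem exists_lift (h2 : (2 : k) ≠ 0) {T : Scheme.{u}} (q : T ⟶ C.X)
    (hq : ∀ x, C.ρ (q x) ∈ E.regularLocus) : ∃ ν : T ⟶ X', ν ≫ μ = q := by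
  let O : S.I × Bool → T.Opens := fun j ↦
    (q ≫ C.ρ) ⁻¹ᵁ S.B.basicOpen (exceptional j.2 (S.σ j.1) (E.a j.1))
  have hpre : ∀ {O : T.Opens} {U : S.B.Opens}, O ≤ (q ≫ C.ρ) ⁻¹ᵁ U → O ≤ q ⁻¹ᵁ (C.ρ ⁻¹ᵁ U) := fun h ↦ h
  have hcov : ∀ x, ∃ j, x ∈ O j := fun x ↦ by
    obtain ⟨j, hj⟩ := Opens.mem_iSup.mp (hq x)
    exact ⟨j, hj⟩
  choose e hu using fun j ↦ isUnit_exceptional (q ≫ C.ρ) (le_refl (O j))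
  -- The coordinate is recovered as `ξ/2σ` or `ξ/2a`, according to which of the two functions is
  -- invertible.
  have hτ : ∀ j, ∃ τ, 2 * exceptional j.2 ((q ≫ C.ρ).appLE _ _ (e j) (S.σ j.1))
      ((q ≫ C.ρ).appLE _ _ (e j) (E.a j.1)) * τ =
      q.appLE (C.ρ ⁻¹ᵁ S.U j.1) (O j) (hpre (e j)) (C.ξ j.1) := fun j ↦ by
    obtain ⟨v, hv⟩ := ((isUnit_two h2 ((q ≫ C.ρ) ≫ S.str) (O j)).mul (hu j)).exists_right_inv
    exact ⟨v * _, by rw [← mul_assoc, hv, one_mul]⟩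
  choose τ hτ using hτ
  have hξ : ∀ (i : S.I) (O : T.Opens) (e : O ≤ (q ≫ C.ρ) ⁻¹ᵁ S.U i),
      q.appLE (C.ρ ⁻¹ᵁ S.U i) O (hpre e) (C.ξ i) ^ 2 = 4 * (q ≫ C.ρ).appLE _ _ e (S.σ i) *
        (q ≫ C.ρ).appLE _ _ e (E.a i) := fun i O e ↦ by
    have h1 := congrArg (q.appLE (C.ρ ⁻¹ᵁ S.U i) O (hpre e)) (C.isLocal i).2.2.1
    rw [map_pow, Scheme.Hom.app_eq_appLE, appLE_appLE_of_comp_eq (rfl : q ≫ C.ρ = _) le_rfl (hpre e) e] at h1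
    rw [h1, map_mul, map_mul, map_ofNat]
  obtain ⟨ν, hν, hντ⟩ := exists_hom N (q ≫ C.ρ) (fun j ↦ j) O e hcov τ
    (fun j ↦ IsRatioRoot.of_doubleCover (isUnit_two h2 ((q ≫ C.ρ) ≫ S.str) (O j)) (hξ _ _ _) (hu j) (hτ j))
    (fun i j e' ↦ by
      have hi : O i ⊓ O j ≤ (q ≫ C.ρ) ⁻¹ᵁ S.U i.1 := inf_le_left.trans (e i)
      have hj : O i ⊓ O j ≤ (q ≫ C.ρ) ⁻¹ᵁ S.U j.1 := inf_le_right.trans (e j)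
      have hσ := congrArg ((q ≫ C.ρ).appLE _ _ e') (S.σ_section i.1 j.1)
      have ha := congrArg ((q ≫ C.ρ).appLE _ _ e') (E.isSection i.1 j.1)
      rw [zpow_zero, one_mul, zpow_one] at hσ
      rw [map_mul, appLE_res _ _ _ hi, appLE_res _ _ _ hj] at hσ ha
      have hℓ : S.L.tr i.1 j.1 = S.D.tr i.1 j.1 * (S.L.zpowMul S.D 1 (-1)).tr i.1 j.1 := by
        simp [Cocycle.zpowMul]
      have hb : S.L.tr i.1 j.1 ^ (2 : ℤ) * S.D.tr i.1 j.1 ^ (-1 : ℤ) =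
          S.D.tr i.1 j.1 * (S.L.zpowMul S.D 1 (-1)).tr i.1 j.1 ^ 2 := by
        simp only [Cocycle.zpowMul]
        rw [← zpow_natCast, mul_zpow, ← zpow_mul, ← zpow_mul, mul_left_comm, ← zpow_one_add]
        norm_num
      rw [hb, Units.val_mul, Units.val_pow_eq_pow_val, map_mul, map_pow] at ha
      have hz := congrArg (q.appLE (C.ρ ⁻¹ᵁ (S.U i.1 ⊓ S.U j.1)) (O i ⊓ O j) (hpre e')) (C.glue i.1 j.1)
      rw [map_mul, appLE_res _ _ _ (hpre hi), appLE_res _ _ _ (hpre hj), Scheme.Hom.app_eq_appLE,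
        appLE_appLE_of_comp_eq (rfl : q ≫ C.ρ = _) le_rfl (hpre e') e'] at hz
      have hui := (hu i).map (res (inf_le_left : O i ⊓ O j ≤ O i))
      have huj := (hu j).map (res (inf_le_right : O i ⊓ O j ≤ O j))
      have hτi := congrArg (res (inf_le_left : O i ⊓ O j ≤ O i)) (hτ i)
      have hτj := congrArg (res (inf_le_right : O i ⊓ O j ≤ O j)) (hτ j)
      rw [map_exceptional, res_appLE _ _ _ hi, res_appLE _ _ _ hi] at hui
      rw [map_exceptional, res_appLE _ _ _ hj, res_appLE _ _ _ hj] at huj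
      rw [map_mul, map_mul, map_exceptional, map_ofNat, res_appLE _ _ _ hi, res_appLE _ _ _ hi,
        res_appLE _ _ _ (hpre hi)] at hτi
      rw [map_mul, map_mul, map_exceptional, map_ofNat, res_appLE _ _ _ hj, res_appLE _ _ _ hj,
        res_appLE _ _ _ (hpre hj)] at hτj
      exact Linked.of_doubleCover (isUnit_two h2 ((q ≫ C.ρ) ≫ S.str) _)
        ((S.D.tr _ _).isUnit.map ((q ≫ C.ρ).appLE _ _ e').hom)
        (((S.L.zpowMul S.D 1 (-1)).tr _ _).isUnit.map ((q ≫ C.ρ).appLE _ _ e').hom)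
        hσ ha (congrArg (fun u : (Γ(S.B, S.U i.1 ⊓ S.U j.1))ˣ ↦
            (q ≫ C.ρ).appLE _ _ e' (u : Γ(S.B, S.U i.1 ⊓ S.U j.1))) hℓ |>.trans
          (by simp only [Units.val_mul, map_mul])) hz (hξ _ _ _) hui huj hτi hτj)
  refine ⟨ν, (DoubleCover.isModel S isSection_four_mul C).hom_ext
    (by rw [Category.assoc, hμρ, hν]) fun x ↦ ?_⟩
  obtain ⟨j, hj⟩ := hcov x
  obtain ⟨eν, hντj⟩ := hντ j
  obtain ⟨eμ, -⟩ := hμ j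
  have e₁ : O j ≤ (ν ≫ μ) ⁻¹ᵁ (C.ρ ⁻¹ᵁ S.U j.1) := eν.trans (ν.preimage_mono eμ)
  have hb : (ν ≫ μ) ≫ C.ρ = q ≫ C.ρ := by rw [Category.assoc, hμρ, hν]
  have h3 := appLE_resolution N C hμρ hμ ν rfl eν e₁ e₁
  refine ⟨O j, j.1, e₁, hpre (e j), hj, ?_⟩
  refine h3.symm.trans (Eq.trans ?_ (hτ j))
  rw [hντj, appLE_congr_hom hb e₁ (e j), appLE_congr_hom hb e₁ (e j)]

include hμρ hμ in
theorem isIso_restrict (h2 : (2 : k) ≠ 0) : IsIso (μ ∣_ (C.ρ ⁻¹ᵁ E.regularLocus)) := by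
  obtain ⟨ν, hν⟩ := exists_lift N C hμρ hμ h2 (C.ρ ⁻¹ᵁ E.regularLocus).ι fun x ↦ x.2
  refine isIso_morphismRestrict μ _ ν hν ?_
  refine eq_of_comp_eq N C hμρ hμ h2 ?_ fun x ↦ ?_
  · rw [Category.assoc, hν, morphismRestrict_ι]
  · have h3 : f (((μ ∣_ (C.ρ ⁻¹ᵁ E.regularLocus)) ≫ ν) x) =
        C.ρ ((C.ρ ⁻¹ᵁ E.regularLocus).ι ((μ ∣_ (C.ρ ⁻¹ᵁ E.regularLocus)) x)) := by
      rw [← hν, ← hμρ]; rfl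
    rw [h3]
    exact ((μ ∣_ (C.ρ ⁻¹ᵁ E.regularLocus)) x).2

include N hμρ hμ in
theorem smoothAt_of_mem (h2 : (2 : k) ≠ 0) {x : C.X} (hx : C.ρ x ∈ E.regularLocus) :
    SmoothAt C.str x := by
  refine ⟨C.ρ ⁻¹ᵁ E.regularLocus, hx, ?_⟩
  have := isIso_restrict N C hμρ hμ h2
  have := smooth_resolution h2 N
  have h3 : (C.ρ ⁻¹ᵁ E.regularLocus).ι ≫ C.str = inv (μ ∣_ (C.ρ ⁻¹ᵁ E.regularLocus)) ≫
      (μ ⁻¹ᵁ (C.ρ ⁻¹ᵁ E.regularLocus)).ι ≫ f ≫ S.str := by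
    rw [IsIso.eq_inv_comp, ← hμρ, Category.assoc, ← morphismRestrict_ι_assoc]
    rfl
  rw [h3]
  infer_instance

end TransversalSection

/-! ### Singular points of hypersurfaces -/

/-- Where the differential of its equation vanishes, a hypersurface is not smooth. -/
theorem not_formallySmooth_of_differential_mem {k S R Rp : Type*} [CommRing k] [CommRing S] [IsDomain S]
    [CommRing R] [CommRing Rp] [Algebra k S] [Algebra k R] [Algebra S R] [IsScalarTower k S R]
    [Algebra k Rp] [Algebra R Rp] [IsScalarTower k R Rp] [Algebra.FormallySmooth k S]
    (hsurj : Function.Surjective (algebraMap S R)) {F : S} (hF0 : F ≠ 0)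
    (hker : RingHom.ker (algebraMap S R) = Ideal.span {F}) (p : Ideal R) [p.IsPrime]
    [IsLocalization.AtPrime Rp p] (hF : KaehlerDifferential.D k S F ∈
      p.comap (algebraMap S R) • (⊤ : Submodule S Ω[S⁄k])) :
    ¬ Algebra.FormallySmooth k Rp := by
  intro hRp
  -- Localizing at `Q` presents `Rp` as the quotient by `F` of the domain `L`, formally smooth over
  -- `k`. The vanishing of `dF` at the closed point yields `w` outside the maximal ideal with `wF =
  -- 0`; as `w` is a unit, `F = 0`.
  let Q := p.comap (algebraMap S R)
  let L := Localization.AtPrime Q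
  have hmap : Q.primeCompl.map (algebraMap S R) = p.primeCompl := by
    ext r
    constructor
    · rintro ⟨s, hs, rfl⟩
      exact hs
    · intro hr
      obtain ⟨s, rfl⟩ := hsurj r
      exact ⟨s, hr, rfl⟩
  have hloc : IsLocalization (Q.primeCompl.map (algebraMap S R)) Rp := by rw [hmap]; infer_instance
  let g : L →+* Rp := IsLocalization.map Rp (algebraMap S R) Q.primeCompl.le_comap_map
  have hg : ∀ s, g (algebraMap S L s) = algebraMap R Rp (algebraMap S R s) := fun s ↦
    IsLocalization.map_eq _ s
  let _ := g.toAlgebra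
  have htower : IsScalarTower k L Rp := IsScalarTower.of_algebraMap_eq fun c ↦ by
    change _ = g _
    rw [IsScalarTower.algebraMap_apply k S L, hg, ← IsScalarTower.algebraMap_apply k S R,
      ← IsScalarTower.algebraMap_apply k R Rp]
  have hL : Algebra.FormallySmooth k L := by
    have : Algebra.FormallySmooth S L := Algebra.FormallySmooth.of_isLocalization Q.primeCompl
    exact Algebra.FormallySmooth.comp k S L
  have hFQ : F ∈ Q := by
    have h1 : F ∈ RingHom.ker (algebraMap S R) := hker ▸ Ideal.mem_span_singleton_self F
    change algebraMap S R F ∈ p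
    rw [h1]
    exact p.zero_mem
  have hgs : Function.Surjective g := IsLocalization.map_surjective_of_surjective _ _ _ hsurj
  have hgk : RingHom.ker g = Ideal.span {algebraMap S L F} := by
    have h1 := IsLocalization.ker_map (S := L) Rp (T := Q.primeCompl.map (algebraMap S R))
      (g := algebraMap S R) rfl
    rw [show RingHom.ker g = _ from h1, hker, Ideal.map_span, Set.image_singleton]
  have hmax : ∀ s ∈ Q, algebraMap S L s ∈ IsLocalRing.maximalIdeal L := fun s hs ↦
    (IsLocalization.AtPrime.to_map_mem_maximal_iff L Q s).mpr hs
  have hD : KaehlerDifferential.D k L (algebraMap S L F) ∈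
      IsLocalRing.maximalIdeal L • (⊤ : Submodule L Ω[L⁄k]) := by
    have h1 : ∀ ω ∈ Q • (⊤ : Submodule S Ω[S⁄k]), KaehlerDifferential.map k k S L ω ∈
        IsLocalRing.maximalIdeal L • (⊤ : Submodule L Ω[L⁄k]) := fun ω hω ↦ by
      refine Submodule.smul_induction_on hω (fun s hs η _ ↦ ?_) fun x y hx hy ↦ ?_
      · rw [map_smul, ← algebraMap_smul L s]
        exact Submodule.smul_mem_smul (hmax s hs) trivial
      · rw [map_add]
        exact Submodule.add_mem _ hx hy
    have h2 := h1 _ hF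
    rwa [KaehlerDifferential.map_D] at h2
  obtain ⟨w, hw, hwF⟩ := exists_mul_eq_zero_of_smooth (k := k) (S := L) (R := Rp) hgs
    (algebraMap S L F) hgk (IsLocalRing.maximalIdeal L) (hmax F hFQ) hD
  have hwu : IsUnit w := by simpa using hw
  have h0 := (hwu.mul_right_eq_zero).mp hwF
  have hinj : Function.Injective (algebraMap S L) :=
    IsLocalization.injective L Q.primeCompl_le_nonZeroDivisors
  exact hF0 (hinj (h0.trans (map_zero _).symm))

section

variable {k : Type u} [Field k] {X : Scheme.{u}} (f : X ⟶ Spec (.of k))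

/-- The constants in a stalk. -/
def stalkConstants (x : X) : k →+* X.presheaf.stalk x :=
  (X.presheaf.germ ⊤ x trivial).hom.comp (constants f ⊤)

theorem germ_comp_constants {V : X.Opens} {x : X} (hx : x ∈ V) :
    (X.presheaf.germ V x hx).hom.comp (constants f V) = stalkConstants f x := by
  ext c
  have h1 := X.presheaf.germ_res_apply (homOfLE (le_top : V ≤ ⊤)) x hx (constants f ⊤ c)
  have h2 : X.presheaf.map (homOfLE (le_top : V ≤ ⊤)).op (constants f ⊤ c) = constants f V c :=
    res_constants f le_top c
  rw [h2] at h1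
  exact h1

variable {f}

theorem constants_smooth_of_le {V V' : X.Opens} (hV : Smooth (V.ι ≫ f)) (h : V' ≤ V)
    (hV' : IsAffineOpen V') : (constants f V').Smooth := by
  have : Smooth (V'.ι ≫ f) := by
    rw [← X.homOfLE_ι h, Category.assoc]
    infer_instance
  have haff : IsAffine V' := hV'
  have e : (⊤ : (V' : Scheme.{u}).Opens) ≤ V'.ι ⁻¹ᵁ V' := by rw [Scheme.Opens.ι_preimage_self]
  have h1 := WeakCoupling.constants_smooth (V'.ι ≫ f) (isAffineOpen_top (V' : Scheme.{u}))
  rw [constants_comp V'.ι f e] at h1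
  have hiso := isIso_ι_appLE V'
  have h2 := RingHom.Smooth.respectsIso.1 _ (asIso (V'.ι.appLE V' ⊤ e)).symm.commRingCatIsoToRingEquiv h1
  convert h2 using 1
  ext c
  have h3 : inv (V'.ι.appLE V' ⊤ e) (V'.ι.appLE V' ⊤ e (constants f V' c)) = constants f V' c := by
    rw [← CommRingCat.comp_apply, IsIso.hom_inv_id]; rfl
  exact h3.symm

theorem SmoothAt.formallySmooth {x : X} (h : SmoothAt f x) : (stalkConstants f x).FormallySmooth := by
  obtain ⟨V, hx, hV⟩ := h
  obtain ⟨V', hV', hxV', hle⟩ := exists_isAffineOpen_mem_and_subset hx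
  have h1 : (constants f V').Smooth := constants_smooth_of_le hV hle hV'
  rw [← germ_comp_constants f hxV']
  let _ := sectionsAlgebra f V'
  let _ := X.presheaf.algebra_section_stalk (⟨x, hxV'⟩ : V')
  let _ := ((X.presheaf.germ V' x hxV').hom.comp (constants f V')).toAlgebra
  have : IsScalarTower k Γ(X, V') (X.presheaf.stalk x) := IsScalarTower.of_algebraMap_eq' rfl
  have hst := hV'.isLocalization_stalk ⟨x, hxV'⟩
  have : Algebra.Smooth k Γ(X, V') := h1
  have : Algebra.FormallySmooth Γ(X, V') (X.presheaf.stalk x) :=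
    Algebra.FormallySmooth.of_isLocalization (hV'.primeIdealOf ⟨x, hxV'⟩).asIdeal.primeCompl
  exact Algebra.FormallySmooth.comp k Γ(X, V') (X.presheaf.stalk x)

theorem mem_primeIdealOf_iff {V : X.Opens} (hV : IsAffineOpen V) {x : X} (hx : x ∈ V) (s : Γ(X, V)) :
    s ∈ (hV.primeIdealOf ⟨x, hx⟩).asIdeal ↔ x ∉ X.basicOpen s := by
  have h1 : x ∈ X.basicOpen s ↔ hV.primeIdealOf ⟨x, hx⟩ ∈ hV.fromSpec ⁻¹ᵁ X.basicOpen s := by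
    change _ ↔ hV.fromSpec (hV.primeIdealOf ⟨x, hx⟩) ∈ X.basicOpen s
    rw [hV.fromSpec_primeIdealOf]
  rw [h1, hV.fromSpec_preimage_basicOpen]
  exact (not_not (a := s ∈ (hV.primeIdealOf ⟨x, hx⟩).asIdeal)).symm

end

namespace IsChart

open Polynomial

variable {k : Type u} [Field k] {Y B : Scheme.{u}} {f : Y ⟶ B} {U : B.Opens} {W : Y.Opens}
  {P : Γ(B, U)[X]} {t : Γ(Y, W)} (hc : IsChart f U W P t) {x : Y} (hx : x ∈ W)

theorem C_mem_iff (s : Γ(B, U)) : C s ∈ ((hc.affine.primeIdealOf ⟨x, hx⟩).asIdeal.comap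
    (chartMap f U W hc.le t)) ↔ f x ∉ B.basicOpen s := by
  rw [Ideal.mem_comap, mem_primeIdealOf_iff, chartMap, coe_eval₂RingHom, eval₂_C]
  change x ∉ Y.basicOpen (f.appLE U W hc.le s) ↔ _
  rw [Scheme.basicOpen_appLE]
  exact not_congr ⟨fun h ↦ h.2, fun h ↦ ⟨hx, h⟩⟩

theorem equation_mem : P ∈ ((hc.affine.primeIdealOf ⟨x, hx⟩).asIdeal.comap
    (chartMap f U W hc.le t)) := by
  have : P ∈ RingHom.ker (chartMap f U W hc.le t) := by
    rw [hc.ker]; exact Ideal.mem_span_singleton_self P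
  rw [Ideal.mem_comap, this]
  exact Ideal.zero_mem _

theorem hasHypersurfaceForm (str : B ⟶ Spec (.of k)) [Smooth str] (hU : IsAffineOpen U) {m : ℕ}
    {eqn : ∀ (S : Type u) [CommRing S], (Fin m → S) → S} (s : Fin m → Γ(B, U)[X])
    (hP : P = eqn _ s)
    (hs : letI := sectionsAlgebra str U
      IsPartOfCoordinates k ((hc.affine.primeIdealOf ⟨x, hx⟩).asIdeal.comap
        (chartMap f U W hc.le t)) s) : HasHypersurfaceForm (f ≫ str) x eqn := by
  let _ := sectionsAlgebra str U
  have : Algebra.Smooth k Γ(B, U) := WeakCoupling.constants_smooth str hU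
  exact ⟨W, hc.affine, hx, Γ(B, U)[X], inferInstance, inferInstance, chartMap f U W hc.le t, s,
    smooth_polynomial k _, chartMap_comp_algebraMap f str hc.le t, hc.surjective, hP ▸ hc.ker, hs⟩

theorem not_smoothAt (str : B ⟶ Spec (.of k)) [Smooth str] (hU : IsAffineOpen U)
    [IsDomain Γ(B, U)] (hP0 : P ≠ 0) (hP : letI := sectionsAlgebra str U
      KaehlerDifferential.D k Γ(B, U)[X] P ∈ ((hc.affine.primeIdealOf ⟨x, hx⟩).asIdeal.comap
        (chartMap f U W hc.le t)) • (⊤ : Submodule Γ(B, U)[X] Ω[Γ(B, U)[X]⁄k])) :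
    ¬ SmoothAt (f ≫ str) x := by
  intro h
  have h1 := h.formallySmooth
  rw [← germ_comp_constants (f ≫ str) hx] at h1
  let _ := sectionsAlgebra str U
  let _ := sectionsAlgebra (f ≫ str) W
  let _ := Y.presheaf.algebra_section_stalk (⟨x, hx⟩ : W)
  let _ := ((Y.presheaf.germ W x hx).hom.comp (constants (f ≫ str) W)).toAlgebra
  have : IsScalarTower k Γ(Y, W) (Y.presheaf.stalk x) := IsScalarTower.of_algebraMap_eq' rfl
  let _ := (chartMap f U W hc.le t).toAlgebra
  have : IsScalarTower k Γ(B, U)[X] Γ(Y, W) :=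
    IsScalarTower.of_algebraMap_eq' (chartMap_comp_algebraMap f str hc.le t).symm
  have hst := hc.affine.isLocalization_stalk ⟨x, hx⟩
  have : Algebra.Smooth k Γ(B, U) := WeakCoupling.constants_smooth str hU
  have := smooth_polynomial k Γ(B, U)
  exact not_formallySmooth_of_differential_mem (R := Γ(Y, W)) hc.surjective hP0 hc.ker
    (hc.affine.primeIdealOf ⟨x, hx⟩).asIdeal hP h1

end IsChart

open Polynomial in
/-- Coordinates on a smooth base, rescaled, together with the coordinate of the affine line. -/
theorem linearIndependent_coordinates {k A : Type u} [Field k] [CommRing A] [Algebra k A] {Q : Ideal A[X]}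
    [Q.IsPrime] {m : ℕ} {f : Fin m → A} {c : Fin m → k} (hc : ∀ j, c j ≠ 0)
    (hf : LinearIndependent (Q.comap C).ResidueField (fun j ↦
      (1 : (Q.comap C).ResidueField) ⊗ₜ[A] (KaehlerDifferential.D k A (f j) : Ω[A⁄k]))) :
    LinearIndependent Q.ResidueField (fun j ↦ (1 : Q.ResidueField) ⊗ₜ[A[X]]
      (KaehlerDifferential.D k A[X] ((Fin.cons X (fun j ↦ C (c j • f j)) : Fin (m + 1) → A[X]) j) :
        Ω[A[X]⁄k])) := by
  refine linearIndependent_polynomial_differentials ?_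
  have h1 := hf.units_smul (fun j ↦ Units.map
    ((algebraMap A (Q.comap (C (R := A))).ResidueField).comp (algebraMap k A)).toMonoidHom (Units.mk0 (c j) (hc j)))
  convert h1 using 2 with j
  rw [Derivation.map_smul, ← algebraMap_smul A (c j), tmul_smul_residueField]
  rfl

open Polynomial in
theorem X_mem_of_X_sq_sub_mem {A : Type*} [CommRing A] {Q : Ideal A[X]} [Q.IsPrime] {h : A}
    (hF : X ^ 2 - C h ∈ Q) (hh : C h ∈ Q) : X ∈ Q := by
  have h1 := Q.add_mem hF hh
  rw [sub_add_cancel] at h1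
  exact Ideal.IsPrime.mem_of_pow_mem inferInstance 2 h1

theorem four_ne_zero_of_two {k : Type*} [Field k] (h2 : (2 : k) ≠ 0) : (4 : k) ≠ 0 := by
  rw [show (4 : k) = 2 * 2 by norm_num]
  exact mul_ne_zero h2 h2

section

open Polynomial

variable {k A : Type u} [Field k] [CommRing A] [Algebra k A] {Q : Ideal A[X]} [Q.IsPrime] {b s a : A}

theorem algebraMap_four_smul (s : A) : (4 : k) • s = 4 * s := by
  rw [Algebra.smul_def, map_ofNat]

/-- On the hypersurface the vanishing of `b, s, a` forces that of `X`. The new coordinate is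
independent of those of the base, and the factor `4` is a nonzero constant that may be absorbed in
`s`. -/
theorem isPartOfCoordinates_conifold (h2 : (2 : k) ≠ 0) (hF : X ^ 2 - Polynomial.C (b ^ 2 + 4 * s * a) ∈ Q)
    (hb : C b ∈ Q) (hs : C s ∈ Q) (ha : C a ∈ Q) (h : IsPartOfCoordinates k (Q.comap C) ![b, s, a]) :
    IsPartOfCoordinates k Q ![X, C b, C (4 * s), C a] := by
  have h4 : C (4 * s) ∈ Q := by rw [C_mul]; exact Q.mul_mem_left _ hs
  have hX : X ∈ Q := X_mem_of_X_sq_sub_mem hF (by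
    rw [C_add, C_mul (a := 4 * s), C_pow]
    exact Q.add_mem (Ideal.pow_mem_of_mem _ hb 2 two_pos) (Q.mul_mem_right _ h4))
  refine ⟨fun j ↦ ?_, ?_⟩
  · fin_cases j
    exacts [hX, hb, h4, ha]
  · have h5 := linearIndependent_coordinates (c := ![(1 : k), 4, 1]) (fun j ↦ by
      fin_cases j
      exacts [one_ne_zero, four_ne_zero_of_two h2, one_ne_zero]) h.2
    have hv : ![X, C b, C (4 * s), C a] =
        (Fin.cons X fun j ↦ C (![(1 : k), 4, 1] j • ![b, s, a] j) : Fin 4 → A[X]) := by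
      funext j
      fin_cases j
      exacts [rfl, (congrArg C (one_smul k b)).symm, (congrArg C (algebraMap_four_smul (k := k) s)).symm,
        (congrArg C (one_smul k a)).symm]
    rw [hv]
    exact h5

theorem isPartOfCoordinates_cone (h2 : (2 : k) ≠ 0) (hF : X ^ 2 - Polynomial.C (4 * s * a) ∈ Q)
    (hs : C s ∈ Q) (ha : C a ∈ Q) (h : IsPartOfCoordinates k (Q.comap C) ![s, a]) :
    IsPartOfCoordinates k Q ![X, C (4 * s), C a] := by
  have h4 : C (4 * s) ∈ Q := by rw [C_mul]; exact Q.mul_mem_left _ hs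
  have hX : X ∈ Q := X_mem_of_X_sq_sub_mem hF (by
    rw [C_mul (a := 4 * s)]
    exact Q.mul_mem_right _ h4)
  refine ⟨fun j ↦ ?_, ?_⟩
  · fin_cases j
    exacts [hX, h4, ha]
  · have h5 := linearIndependent_coordinates (c := ![(4 : k), 1]) (fun j ↦ by
      fin_cases j
      exacts [four_ne_zero_of_two h2, one_ne_zero]) h.2
    have hv : ![X, C (4 * s), C a] = (Fin.cons X fun j ↦ C (![(4 : k), 1] j • ![s, a] j) : Fin 3 → A[X]) := by
      funext j
      fin_cases j
      exacts [rfl, (congrArg C (algebraMap_four_smul (k := k) s)).symm, (congrArg C (one_smul k a)).symm]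
    rw [hv]
    exact h5

end

/-! ### Singular points of the two double covers -/

section

open Polynomial

variable {k : Type u} [Field k] {n : ℕ} {S : Base k n}

/-- The conifold points of a double cover `ξ ^ 2 = b ^ 2 + 4 σ a`. -/
theorem isConifold_of_isTransversal (h2 : (2 : k) ≠ 0) {b a : ∀ i, Γ(S.B, S.U i)}
    (C : DoubleCover S (fun i ↦ b i ^ 2 + 4 * S.σ i * a i)) {i : S.I}
    (ht : IsTransversal S.str (S.U i) ![b i, S.σ i, a i]) {x : C.X} (hx : C.ρ x ∈ S.U i)
    (hb : C.ρ x ∉ S.B.basicOpen (b i)) (hσ : C.ρ x ∉ S.B.basicOpen (S.σ i))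
    (ha : C.ρ x ∉ S.B.basicOpen (a i)) : IsConifold C.str x := by
  have := S.smooth
  have : Smooth S.str := SmoothOfRelativeDimension.smooth n S.str
  have hc := (isLocalDoubleCover_iff.mp (C.isLocal i)).2
  refine hc.hasHypersurfaceForm hx S.str (S.affine i)
    ![X, Polynomial.C (b i), Polynomial.C (4 * S.σ i), Polynomial.C (a i)] ?_ ?_
  · change X ^ 2 - Polynomial.C (b i ^ 2 + 4 * S.σ i * a i) = X ^ 2 -
      (Polynomial.C (b i) ^ 2 + Polynomial.C (4 * S.σ i) * Polynomial.C (a i))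
    simp only [C_add, C_mul, C_pow]
  let _ := sectionsAlgebra S.str (S.U i)
  have hb' := (hc.C_mem_iff hx _).mpr hb
  have hσ' := (hc.C_mem_iff hx _).mpr hσ
  have ha' := (hc.C_mem_iff hx _).mpr ha
  exact isPartOfCoordinates_conifold h2 (hc.equation_mem hx) hb' hσ' ha' (ht _ fun j ↦ by
    fin_cases j
    exacts [hb', hσ', ha'])

namespace TransversalSection

variable {E : TransversalSection S} (C : DoubleCover S (fun i ↦ 4 * S.σ i * E.a i))

/-- The orthogonal double cover is integral. -/
theorem isIntegral_doubleCover (h2 : (2 : k) ≠ 0) : IsIntegral C.X := by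
  have := S.integral
  have hP : ∀ i, (S.U i : Set S.B).Nonempty → Prime (X ^ 2 - Polynomial.C (4 * S.σ i * E.a i)) := by
    intro i hi
    have : Nonempty (S.U i) := hi.to_subtype
    have h1 := prime_quadratic (A := Γ(S.B, S.U i)) (α := 1) (β := 4 * S.σ i * E.a i) one_ne_zero
      (fun c _ ↦ one_dvd c) fun x y hy hxy ↦ by
        have h20 : (2 : Γ(S.B, S.U i)) ≠ 0 := (isUnit_two h2 S.str (S.U i)).ne_zero
        -- An equation `x² = 4σay²` is `x² = σa(2y)²`, which `sq_ne` excludes.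
        refine E.sq_ne i hi (x := x) (y := 2 * y) (mul_ne_zero h20 hy) ?_
        rw [hxy]
        ring
    rwa [C_1, one_mul] at h1
  refine (DoubleCover.isModel S isSection_four_mul C).isIntegral hP (fun i c hc ↦ ?_) (fun i hi ↦ ?_) ?_
  · have hi : (S.U i : Set S.B).Nonempty := by
      by_contra hemp
      rw [Set.not_nonempty_iff_eq_empty] at hemp
      have hbot : S.U i = ⊥ := Opens.ext hemp
      have : Subsingleton Γ(S.B, S.U i) :=
        CommRingCat.subsingleton_of_isTerminal (S.B.sheaf.isTerminalOfEqEmpty hbot)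
      exact hc (Subsingleton.elim (α := Γ(S.B, S.U i)) _ _)
    have : Nonempty (S.U i) := hi.to_subtype
    have h1 := not_dvd_C (A := Γ(S.B, S.U i)) (α := 1) (β := 4 * S.σ i * E.a i) two_ne_zero one_ne_zero hc
    rwa [C_1, one_mul] at h1
  · have : Nonempty (S.U i) := Set.Nonempty.to_subtype hi
    refine not_dvd_X_of_prime (A := Γ(S.B, S.U i)) (hP i hi) ?_
    have h40 : (4 : Γ(S.B, S.U i)) ≠ 0 := by
      have h20 : (2 : Γ(S.B, S.U i)) ≠ 0 := (isUnit_two h2 S.str (S.U i)).ne_zero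
      rw [show (4 : Γ(S.B, S.U i)) = 2 * 2 by norm_num]
      exact mul_ne_zero h20 h20
    change (X ^ 2 - Polynomial.C (4 * S.σ i * E.a i)).coeff 0 ≠ 0
    rw [coeff_sub, coeff_X_pow, if_neg (by decide), coeff_C_zero, zero_sub, neg_ne_zero]
    exact mul_ne_zero (mul_ne_zero h40 (S.σ_ne_zero i hi)) (E.a_ne_zero i hi)
  · obtain ⟨j, q, hq, -⟩ := S.σ_nonempty
    exact ⟨j, q, hq⟩

variable {i : S.I} {x : C.X} (hx : C.ρ x ∈ S.U i) (hσ : C.ρ x ∉ S.B.basicOpen (S.σ i))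
  (ha : C.ρ x ∉ S.B.basicOpen (E.a i))

include hx hσ ha

theorem isQuadricCone (h2 : (2 : k) ≠ 0) : IsQuadricCone C.str x := by
  have := S.smooth
  have : Smooth S.str := SmoothOfRelativeDimension.smooth n S.str
  have hc := (isLocalDoubleCover_iff.mp (C.isLocal i)).2
  refine hc.hasHypersurfaceForm hx S.str (S.affine i)
    ![X, Polynomial.C (4 * S.σ i), Polynomial.C (E.a i)] ?_ ?_
  · change X ^ 2 - Polynomial.C (4 * S.σ i * E.a i) = X ^ 2 -
      Polynomial.C (4 * S.σ i) * Polynomial.C (E.a i)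
    rw [← C_mul]
  let _ := sectionsAlgebra S.str (S.U i)
  have hσ' := (hc.C_mem_iff hx _).mpr hσ
  have ha' := (hc.C_mem_iff hx _).mpr ha
  exact isPartOfCoordinates_cone h2 (hc.equation_mem hx) hσ' ha' (E.transversal i _ fun j ↦ by
    fin_cases j
    exacts [hσ', ha'])

/-- Where `σ = a = 0` also `ξ = 0`, and every coefficient of the differential of `ξ² - 4σa`
vanishes. -/
theorem not_smoothAt : ¬ SmoothAt C.str x := by
  have := S.smooth
  have : Smooth S.str := SmoothOfRelativeDimension.smooth n S.str
  have := S.integral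
  have : Nonempty (S.U i) := ⟨⟨_, hx⟩⟩
  have hc := (isLocalDoubleCover_iff.mp (C.isLocal i)).2
  have hF0 : (X ^ 2 - Polynomial.C (4 * S.σ i * E.a i) : Γ(S.B, S.U i)[X]) ≠ 0 :=
    X_pow_sub_C_ne_zero two_pos _
  refine hc.not_smoothAt hx S.str (S.affine i) hF0 ?_
  let _ := sectionsAlgebra S.str (S.U i)
  have hF := hc.equation_mem hx
  have hσ' := (hc.C_mem_iff hx _).mpr hσ
  have ha' := (hc.C_mem_iff hx _).mpr ha
  generalize hQ : (hc.affine.primeIdealOf ⟨x, hx⟩).asIdeal.comap (chartMap C.ρ (S.U i) _ hc.le (C.ξ i)) = Q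
    at hF hσ' ha'
  have hQp : Q.IsPrime := hQ ▸ inferInstance
  have h4 : Polynomial.C (4 * S.σ i) ∈ Q := by rw [C_mul]; exact Q.mul_mem_left _ hσ'
  have hX : X ∈ Q := X_mem_of_X_sq_sub_mem hF (by rw [C_mul]; exact Q.mul_mem_right _ h4)
  rw [C_mul, map_sub, pow_two, Derivation.leibniz, Derivation.leibniz]
  exact Submodule.sub_mem _
    (Submodule.add_mem _ (Submodule.smul_mem_smul hX trivial) (Submodule.smul_mem_smul hX trivial))
    (Submodule.add_mem _ (Submodule.smul_mem_smul h4 trivial) (Submodule.smul_mem_smul ha' trivial))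

end TransversalSection

end

/-! ### Finiteness and flatness of double covers -/

theorem map_eqToHom_surjective {X : Scheme.{u}} {U V : X.Opens} (h : U = V) :
    Function.Surjective (X.presheaf.map (eqToHom h).op) := by
  subst h
  exact fun s ↦ ⟨s, by simp⟩

namespace IsLocalDoubleCover

variable {X B : Scheme.{u}} {ρ : X ⟶ B} {V : B.Opens} {h : Γ(B, V)} {ξ : Γ(X, ρ ⁻¹ᵁ V)}

theorem exists_linearEquiv (hd : IsLocalDoubleCover ρ V h ξ) :
    letI := (ρ.app V).hom.toAlgebra
    Nonempty ((Γ(B, V) × Γ(B, V)) ≃ₗ[Γ(B, V)] Γ(X, ρ ⁻¹ᵁ V)) := by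
  let _ := (ρ.app V).hom.toAlgebra
  let l : (Γ(B, V) × Γ(B, V)) →ₗ[Γ(B, V)] Γ(X, ρ ⁻¹ᵁ V) :=
    { toFun := fun p ↦ ρ.app V p.1 + ρ.app V p.2 * ξ
      map_add' := fun p q ↦ by
        simp only [Prod.fst_add, Prod.snd_add, map_add]
        ring
      map_smul' := fun c p ↦ by
        simp only [Prod.smul_fst, Prod.smul_snd, smul_eq_mul, map_mul, RingHom.id_apply]
        rw [Algebra.smul_def]
        change _ = ρ.app V c * _
        ring }
  refine ⟨LinearEquiv.ofBijective l ⟨fun p q hpq ↦ ?_, fun y ↦ ?_⟩⟩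
  · exact (hd.2.2.2 (l p)).unique rfl hpq
  · obtain ⟨p, hp, -⟩ := hd.2.2.2 y
    exact ⟨p, hp.symm⟩

theorem finite (hd : IsLocalDoubleCover ρ V h ξ) : (ρ.app V).hom.Finite := by
  let _ := (ρ.app V).hom.toAlgebra
  obtain ⟨e⟩ := hd.exists_linearEquiv
  exact Module.Finite.equiv e

theorem flat (hd : IsLocalDoubleCover ρ V h ξ) : (ρ.app V).hom.Flat := by
  let _ := (ρ.app V).hom.toAlgebra
  obtain ⟨e⟩ := hd.exists_linearEquiv
  exact Module.Flat.of_linearEquiv e.symm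

end IsLocalDoubleCover

section

variable {X B : Scheme.{u}} {ρ : X ⟶ B} {J : Type*} {V : J → B.Opens} {h : ∀ j, Γ(B, V j)}
  {ξ : ∀ j, Γ(X, ρ ⁻¹ᵁ V j)} (hd : ∀ j, IsLocalDoubleCover ρ (V j) (h j) (ξ j))
  (hcov : ∀ b, ∃ j, b ∈ V j)

include hd hcov

theorem isFinite_of_isLocalDoubleCover : IsFinite ρ := by
  refine @HasAffineProperty.of_iSup_eq_top @IsFinite _
    IsFinite.instHasAffinePropertyAndIsAffineFiniteCarrierObjOppositeOpensCarrierCarrierCommRingCatPresheafOpOpensTopHomAppTop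
    _ _ ρ _ (fun j ↦ ⟨V j, (hd j).1⟩) ?_ fun j ↦ ⟨(hd j).2.1, ?_⟩
  · rw [eq_top_iff]
    intro x _
    obtain ⟨j, hj⟩ := hcov x
    exact Opens.mem_iSup.mpr ⟨j, hj⟩
  · have h1 : ∀ O, O = V j → (ρ.app O).hom.Finite := by
      rintro _ rfl
      exact (hd j).finite
    rw [morphismRestrict_appTop]
    refine RingHom.Finite.comp ?_ (h1 _ (Scheme.Opens.ι_image_top _))
    exact RingHom.Finite.of_surjective _ (map_eqToHom_surjective _)

theorem flat_of_isLocalDoubleCover : Flat ρ := by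
  refine (HasRingHomProperty.iff_exists_appLE (P := @Flat)
    (RingHom.Flat.stableUnderComposition.stableUnderCompositionWithLocalizationAway
      RingHom.Flat.holdsForLocalizationAway).1).mpr fun x ↦ ?_
  obtain ⟨j, hj⟩ := hcov (ρ x)
  refine ⟨⟨V j, (hd j).1⟩, ⟨ρ ⁻¹ᵁ V j, (hd j).2.1⟩, hj, le_rfl, ?_⟩
  have := (hd j).flat
  rwa [Scheme.Hom.app_eq_appLE] at this

end

namespace DoubleCover

variable {k : Type u} [Field k] {n : ℕ} {S : Base k n} {h : ∀ i, Γ(S.B, S.U i)} (C : DoubleCover S h)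

theorem isFinite : IsFinite C.ρ :=
  isFinite_of_isLocalDoubleCover C.isLocal fun b ↦ by
    have : b ∈ ⨆ i, S.U i := by rw [S.covers]; trivial
    exact Opens.mem_iSup.mp this

theorem flat : Flat C.ρ :=
  flat_of_isLocalDoubleCover C.isLocal fun b ↦ by
    have : b ∈ ⨆ i, S.U i := by rw [S.covers]; trivial
    exact Opens.mem_iSup.mp this

end DoubleCover

/-- Generizations lift along flat morphisms: every point of `X` has a generization over the generic
point of `Y`, and that one lies over `O`. -/
theorem dense_preimage_of_flat {X Y : Scheme.{u}} (f : X ⟶ Y) [Flat f] [IrreducibleSpace Y] {O : Y.Opens}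
    (hO : (O : Set Y).Nonempty) : Dense (f ⁻¹ᵁ O : Set X) := by
  intro x
  obtain ⟨x', hx', he⟩ := Flat.generalizingMap f (genericPoint_specializes (f x))
  have h1 : x' ∈ f ⁻¹ᵁ O := by
    change f x' ∈ O
    rw [he]
    exact (genericPoint_spec Y).mem_open_set_iff O.isOpen |>.mpr (by simpa using hO)
  exact closure_mono (Set.singleton_subset_iff.mpr h1) (specializes_iff_mem_closure.mp hx')

/-! ### The resolution of the orthogonal double cover -/

namespace TransversalSection

variable {k : Type u} [Field k] {n : ℕ} {S : Base k n} {E : TransversalSection S}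
  {B' X' : Scheme.{u}} {π : B' ⟶ S.B} {f : X' ⟶ S.B}
  {V : S.I × Bool → B'.Opens} {W : S.I × Bool → X'.Opens}
  {r : ∀ j, Γ(B', V j)} {t : ∀ j, Γ(X', W j)}

theorem regularLocus_nonempty : (E.regularLocus : Set S.B).Nonempty := by
  have := S.integral
  obtain ⟨i, p, hp, -⟩ := S.σ_nonempty
  have h1 : S.B.basicOpen (S.σ i) ≠ ⊥ := fun h ↦
    S.σ_ne_zero i ⟨p, hp⟩ ((basicOpen_eq_bot_iff _).mp h)
  obtain ⟨x, hx⟩ := (Opens.ne_bot_iff_nonempty _).mp h1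
  exact ⟨x, (mem_regularLocus (S.B.basicOpen_le _ hx)).mpr (Or.inl hx)⟩

theorem preimage_regularLocus_nonempty {e : ℕ} {p : ℤ} {h : p * e = 2} (M : IsModel (E.atlas e p h) f W t) :
    (f ⁻¹ᵁ E.regularLocus : Set X').Nonempty := by
  have := E.isIntegral_of_isModel M
  obtain ⟨j, hj⟩ := M.cover (genericPoint X')
  have hne : (S.U j.1 : Set S.B).Nonempty := ⟨_, (le_preimage M j) hj⟩
  have h0 := map_ne_zero M j (exceptional_ne_zero (E := E) j hne)
  have h1 : X'.basicOpen (f.appLE (S.U j.1) (W j) (le_preimage M j)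
      (exceptional j.2 (S.σ j.1) (E.a j.1))) ≠ ⊥ := fun h ↦ h0 ((basicOpen_eq_bot_iff _).mp h)
  obtain ⟨x, hx⟩ := (Opens.ne_bot_iff_nonempty _).mp h1
  rw [Scheme.basicOpen_appLE] at hx
  exact ⟨x, Opens.mem_iSup.mpr ⟨j, hx.2⟩⟩

theorem invertsIdeal_of_mem_regularLocus {T : Scheme.{u}} (q : T ⟶ S.B) (hq : ∀ x, q x ∈ E.regularLocus) :
    InvertsIdeal (fun i ↦ Ideal.span {S.σ i, E.a i}) q := by
  intro x
  obtain ⟨j, hj⟩ := Opens.mem_iSup.mp (hq x)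
  obtain ⟨O, hO, hx, hle⟩ := exists_isAffineOpen_mem_and_subset
    (U := q ⁻¹ᵁ S.B.basicOpen (exceptional j.2 (S.σ j.1) (E.a j.1))) hj
  obtain ⟨e, hu⟩ := isUnit_exceptional q hle
  refine ⟨j.1, O, e, hx, hO, 1, one_mem _, ?_⟩
  rw [Ideal.span_singleton_one]
  refine Ideal.eq_top_of_isUnit_mem _ (Ideal.mem_map_of_mem _ ?_)
    (show IsUnit ((q.appLE _ _ e).hom (exceptional j.2 (S.σ j.1) (E.a j.1))) by rwa [map_exceptional])
  generalize j.2 = κ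
  cases κ
  · exact Ideal.subset_span (Or.inr rfl)
  · exact Ideal.subset_span (Or.inl rfl)

variable (M : IsModel (E.atlas 1 2 two_mul_one) π V r) (N : IsModel (E.atlas 2 1 one_mul_two) f W t)
  (C : DoubleCover S (fun i ↦ 4 * S.σ i * E.a i)) {μ : X' ⟶ C.X} (hμρ : μ ≫ C.ρ = f)
  (hμ : ∀ j, ∃ e : W j ≤ μ ⁻¹ᵁ (C.ρ ⁻¹ᵁ S.U j.1), μ.appLE _ _ e (C.ξ j.1) =
    2 * f.appLE _ _ (le_preimage N j) (exceptional j.2 (S.σ j.1) (E.a j.1)) * t j)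

include N hμρ hμ in
theorem smoothAt_iff (h2 : (2 : k) ≠ 0) {x : C.X} : SmoothAt C.str x ↔ C.ρ x ∈ E.regularLocus := by
  refine ⟨fun h ↦ ?_, smoothAt_of_mem N C hμρ hμ h2⟩
  have : C.ρ x ∈ ⨆ i, S.U i := by rw [S.covers]; trivial
  obtain ⟨i, hi⟩ := Opens.mem_iSup.mp this
  rw [mem_regularLocus hi]
  by_contra hne
  rw [not_or] at hne
  exact not_smoothAt C hi hne.1 hne.2 h

/-- The smooth locus of the orthogonal double cover. -/
theorem smoothAt_iff_mem_regularLocus (h2 : (2 : k) ≠ 0) {x : C.X} :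
    SmoothAt C.str x ↔ C.ρ x ∈ E.regularLocus := by
  obtain ⟨X', f, W, t, N⟩ := exists_model (E.atlas 2 1 one_mul_two)
  obtain ⟨μ, hμρ, hμ⟩ := exists_resolution N C
  exact smoothAt_iff N C hμρ hμ h2

include N hμρ hμ in
theorem isResolution (h2 : (2 : k) ≠ 0) : IsResolution C.str μ := by
  have := C.isFinite
  have := C.flat
  have := S.integral
  have hp : IsProper (μ ≫ C.ρ) := by rw [hμρ]; exact isProper h2 N
  refine ⟨IsProper.of_comp μ C.ρ, ?_, C.ρ ⁻¹ᵁ E.regularLocus, fun x ↦ (smoothAt_iff N C hμρ hμ h2).symm,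
    dense_preimage_of_flat C.ρ regularLocus_nonempty, isIso_restrict N C hμρ hμ h2⟩
  rw [DoubleCover.str, ← Category.assoc, hμρ]
  exact smooth_resolution h2 N

variable {ρ' : X' ⟶ B'} (hρ : ρ' ≫ π = f) (hr : ∀ j, ∃ e : W j ≤ ρ' ⁻¹ᵁ V j, ρ'.appLE _ _ e (r j) = t j ^ 2)

include M N hρ hr in
theorem isFinite_cover : IsFinite ρ' :=
  isFinite_of_isLocalDoubleCover (fun j ↦ (isChart_cover M N hρ hr j).isLocalDoubleCover
    (M.chart j).affine (preimage_cover M N hρ hr j)) M.cover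

include M N hρ hr in
theorem isFinite_lift (sq : μ ≫ C.ρ = ρ' ≫ π) : IsFinite (pullback.lift μ ρ' sq) := by
  have := C.isFinite
  have : IsFinite (pullback.lift μ ρ' sq ≫ pullback.snd C.ρ π) := by
    rw [pullback.lift_snd]
    exact isFinite_cover M N hρ hr
  exact IsFinite.of_comp _ (pullback.snd C.ρ π)

include M N hμρ hμ in
-- Away from `σ = a = 0` the first projection of the fibre product lifts to the resolution, which
-- gives the inverse. Its compatibility with the second projection is the uniqueness in the
-- universal property of the blow-up. The open set is dense since the second projection is flat over
-- the integral scheme `B'`.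
theorem isIso_lift_restrict (h2 : (2 : k) ≠ 0) (sq : μ ≫ C.ρ = ρ' ≫ π) :
    ∃ O : (pullback C.ρ π).Opens, Dense (O : Set ↥(pullback C.ρ π)) ∧ IsIso (pullback.lift μ ρ' sq ∣_ O) := by
  have := E.isIntegral_of_isModel M
  have := C.flat
  have hO : pullback.fst C.ρ π ⁻¹ᵁ (C.ρ ⁻¹ᵁ E.regularLocus) =
      pullback.snd C.ρ π ⁻¹ᵁ (π ⁻¹ᵁ E.regularLocus) := by
    rw [← Scheme.Hom.comp_preimage, ← Scheme.Hom.comp_preimage, pullback.condition]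
  refine ⟨pullback.fst C.ρ π ⁻¹ᵁ (C.ρ ⁻¹ᵁ E.regularLocus), ?_, ?_⟩
  · rw [hO]
    exact dense_preimage_of_flat _ (preimage_regularLocus_nonempty M)
  · obtain ⟨ν, hν⟩ := exists_lift N C hμρ hμ h2
      ((pullback.fst C.ρ π ⁻¹ᵁ (C.ρ ⁻¹ᵁ E.regularLocus)).ι ≫ pullback.fst C.ρ π) fun x ↦ x.2
    refine isIso_morphismRestrict _ _ ν (pullback.hom_ext ?_ ?_) ?_
    · rw [Category.assoc, pullback.lift_fst, hν]
    · rw [Category.assoc, pullback.lift_snd]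
      refine ((isBlowup M).2 _ ((pullback.fst C.ρ π ⁻¹ᵁ (C.ρ ⁻¹ᵁ E.regularLocus)).ι ≫
        pullback.fst C.ρ π ≫ C.ρ) (invertsIdeal_of_mem_regularLocus _ fun x ↦ x.2)).unique ?_ ?_
      · rw [Category.assoc, ← sq, reassoc_of% hν]
      · rw [Category.assoc, pullback.condition]
    · refine eq_of_comp_eq N C hμρ hμ h2 ?_ fun x ↦ ?_
      · rw [Category.assoc, hν, morphismRestrict_ι_assoc, pullback.lift_fst]
      · have h3 : ∀ y, f (ν y) ∈ E.regularLocus := fun y ↦ by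
          have : f (ν y) = C.ρ ((ν ≫ μ) y) := by rw [← hμρ]; rfl
          rw [this, hν]
          exact y.2
        exact h3 _

end TransversalSection

/-! ### Lattices of differential forms -/

section

variable {K M N : Type*} [CommRing K] [AddCommGroup M] [AddCommGroup N] [Module K M] [Module K N]

/-- Alternating maps and determinants. -/
theorem _root_.AlternatingMap.map_sum_smul_eq_det_smul {n : ℕ} (f : M [⋀^Fin n]→ₗ[K] N)
    (A : Matrix (Fin n) (Fin n) K) (v : Fin n → M) :
    f (fun j ↦ ∑ l, A j l • v l) = A.det • f v := by
  let L : (Fin n → K) →ₗ[K] M := Fintype.linearCombination K v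
  have h : f.compLinearMap L =
      (LinearMap.toSpanSingleton K N (f v)).compAlternatingMap (Pi.basisFun K (Fin n)).det := by
    refine Module.Basis.ext_alternating (Pi.basisFun K (Fin n)) fun σ hσ ↦ ?_
    obtain ⟨τ, rfl⟩ : ∃ τ : Equiv.Perm (Fin n), σ = τ :=
      ⟨Equiv.ofBijective σ (Finite.injective_iff_bijective.mp hσ), rfl⟩
    have h1 : ∀ i, L (Pi.basisFun K (Fin n) i) = v i := fun i ↦ by
      simp [L, Fintype.linearCombination_apply, Pi.single_apply]
    have h2 : (f.compLinearMap L) (fun i ↦ Pi.basisFun K (Fin n) (τ i)) = f (fun i ↦ v (τ i)) := by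
      rw [AlternatingMap.compLinearMap_apply]
      simp only [h1]
    rw [h2]
    have h3 := f.map_perm v τ
    have h4 := (Pi.basisFun K (Fin n)).det.map_perm (Pi.basisFun K (Fin n)) τ
    rw [LinearMap.compAlternatingMap_apply, LinearMap.toSpanSingleton_apply]
    rw [show (fun i ↦ Pi.basisFun K (Fin n) (τ i)) = Pi.basisFun K (Fin n) ∘ τ from rfl, h4,
      show (fun i ↦ v (τ i)) = v ∘ τ from rfl, h3, Module.Basis.det_self]
    simp only [Units.smul_def, zsmul_eq_mul, mul_one, Int.cast_smul_eq_zsmul]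
  have h5 : f (fun j ↦ L (A j)) = (Pi.basisFun K (Fin n)).det (fun j ↦ A j) • f v :=
    DFunLike.congr_fun h (fun j ↦ A j)
  rw [Pi.basisFun_det_apply] at h5
  exact h5

theorem _root_.AlternatingMap.map_vecCons_vecCons_left {r : ℕ} (f : M [⋀^Fin (r + 2)]→ₗ[K] N) (x : Fin r → M)
    (c d : K) (u w : M) : f (Matrix.vecCons (c • w + d • u) (Matrix.vecCons w x)) =
      d • f (Matrix.vecCons u (Matrix.vecCons w x)) := by
  rw [AlternatingMap.map_vecCons_add, AlternatingMap.map_vecCons_smul, AlternatingMap.map_vecCons_smul,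
    f.map_eq_zero_of_eq (i := 0) (j := 1) _ rfl (by simp), smul_zero, zero_add]

theorem _root_.AlternatingMap.map_vecCons_vecCons_right {r : ℕ} (f : M [⋀^Fin (r + 2)]→ₗ[K] N) (x : Fin r → M)
    (c d : K) (u w : M) : f (Matrix.vecCons u (Matrix.vecCons (c • u + d • w) x)) =
      d • f (Matrix.vecCons u (Matrix.vecCons w x)) := by
  have h := fun y ↦ AlternatingMap.curryLeft_apply_apply f u (Matrix.vecCons y x)
  rw [← h, ← h, AlternatingMap.map_vecCons_add, AlternatingMap.map_vecCons_smul, AlternatingMap.map_vecCons_smul,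
    h u, f.map_eq_zero_of_eq (i := 0) (j := 1) _ rfl (by simp), smul_zero, zero_add]

end

section

variable {k K : Type*} [Field k] [Field K] [Algebra k K] {O : Subring K}

/-- If all differentials of elements of `O` are combinations of `n` of them, then the `n`-forms over `O` are the
multiples of one form. -/
theorem mem_span_forms_iff {n : ℕ} {e : Fin n → K} (he : ∀ j, e j ∈ O)
    (h : ∀ α ∈ O, (KaehlerDifferential.D k K α : Ω[K⁄k]) ∈
      Submodule.span O (Set.range fun j ↦ (KaehlerDifferential.D k K (e j) : Ω[K⁄k])))
    (ω : ⋀[K]^n Ω[K⁄k]) :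
    ω ∈ Submodule.span O {ω : ⋀[K]^n Ω[K⁄k] | ∃ a : Fin n → K, (∀ j, a j ∈ O) ∧
      ω = exteriorPower.ιMulti K n (fun j ↦ (KaehlerDifferential.D k K (a j) : Ω[K⁄k]))} ↔
    ∃ c ∈ O, ω = c • exteriorPower.ιMulti K n (fun j ↦ (KaehlerDifferential.D k K (e j) : Ω[K⁄k])) := by
  constructor
  · intro hω
    induction hω using Submodule.span_induction with
    | mem ω hω =>
      obtain ⟨a, ha, rfl⟩ := hω
      choose c hc using fun j ↦ (Submodule.mem_span_range_iff_exists_fun O).mp (h (a j) (ha j))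
      refine ⟨(Matrix.of fun j l ↦ (c j l : K)).det, ?_, ?_⟩
      · have : (Matrix.of fun j l ↦ (c j l : K)) = O.subtype.mapMatrix (Matrix.of c) := rfl
        rw [this, ← RingHom.map_det]
        exact ((Matrix.of c).det).2
      · rw [← AlternatingMap.map_sum_smul_eq_det_smul]
        congr 1
        funext j
        exact (hc j).symm
    | zero => exact ⟨0, O.zero_mem, (zero_smul _ _).symm⟩
    | add x y _ _ hx hy =>
      obtain ⟨c, hc, rfl⟩ := hx
      obtain ⟨d, hd, rfl⟩ := hy
      exact ⟨c + d, O.add_mem hc hd, (add_smul _ _ _).symm⟩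
    | smul r x _ hx =>
      obtain ⟨c, hc, rfl⟩ := hx
      exact ⟨r * c, O.mul_mem r.2 hc, (mul_smul (r : K) c _).symm⟩
  · rintro ⟨c, hc, rfl⟩
    exact Submodule.smul_mem _ (⟨c, hc⟩ : O) (Submodule.subset_span ⟨e, he, rfl⟩)

variable {N : Submodule O Ω[K⁄k]}

theorem smul_mem_of_mem {c : K} (hc : c ∈ O) {ω : Ω[K⁄k]} (hω : ω ∈ N) : c • ω ∈ N :=
  N.smul_mem (⟨c, hc⟩ : O) hω

theorem D_mul_mem {x y : K} (hx : x ∈ O) (hy : y ∈ O) (hDx : KaehlerDifferential.D k K x ∈ N)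
    (hDy : KaehlerDifferential.D k K y ∈ N) : KaehlerDifferential.D k K (x * y) ∈ N := by
  rw [Derivation.leibniz]
  exact N.add_mem (smul_mem_of_mem hx hDy) (smul_mem_of_mem hy hDx)

/-- Differentials of quotients. -/
theorem D_mem_of_mul_eq {s α r : K} (hs : s ≠ 0) (hs' : s⁻¹ ∈ O) (hα : α ∈ O) (h : s * α = r)
    (hDs : KaehlerDifferential.D k K s ∈ N) (hDr : KaehlerDifferential.D k K r ∈ N) :
    KaehlerDifferential.D k K α ∈ N := by
  have h1 := congrArg (KaehlerDifferential.D k K) h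
  rw [Derivation.leibniz] at h1
  have h2 : KaehlerDifferential.D k K α =
      s⁻¹ • (KaehlerDifferential.D k K r - α • KaehlerDifferential.D k K s) := by
    rw [← h1, add_sub_cancel_right, smul_smul, inv_mul_cancel₀ hs, one_smul]
  rw [h2]
  exact smul_mem_of_mem hs' (N.sub_mem hDr (smul_mem_of_mem hα hDs))

theorem D_mem_of_smul_mem_span {S : Type*} [CommRing S] [Algebra k S] (φ : S →ₐ[k] K) (hφ : ∀ s, φ s ∈ O)
    {T : Set S} (hT : ∀ τ ∈ T, KaehlerDifferential.D k K (φ τ) ∈ N) {s v : S} (hv : φ v ≠ 0)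
    (hv' : (φ v)⁻¹ ∈ O)
    (h : v • (KaehlerDifferential.D k S s : Ω[S⁄k]) ∈ Submodule.span S (KaehlerDifferential.D k S '' T)) :
    KaehlerDifferential.D k K (φ s) ∈ N := by
  let _ := φ.toRingHom.toAlgebra
  have : IsScalarTower k S K := IsScalarTower.of_algebraMap_eq fun c ↦ (φ.commutes c).symm
  have h1 : ∀ ω ∈ Submodule.span S (KaehlerDifferential.D k S '' T),
      KaehlerDifferential.map k k S K ω ∈ N := fun ω hω ↦ by
    induction hω using Submodule.span_induction with
    | mem ω hω =>
      obtain ⟨τ, hτ, rfl⟩ := hω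
      rw [KaehlerDifferential.map_D]
      exact hT τ hτ
    | zero => rw [map_zero]; exact N.zero_mem
    | add x y _ _ hx hy => rw [map_add]; exact N.add_mem hx hy
    | smul r x _ hx =>
      rw [map_smul, ← algebraMap_smul K r]
      exact smul_mem_of_mem (hφ r) hx
  have h2 := h1 _ h
  rw [map_smul, KaehlerDifferential.map_D, ← algebraMap_smul K v] at h2
  have h3 := smul_mem_of_mem hv' h2
  change (φ v)⁻¹ • φ v • _ ∈ N at h3
  rwa [smul_smul, inv_mul_cancel₀ hv, one_smul] at h3

open Polynomial in
theorem D_mem_of_polynomial {A : Type*} [CommRing A] [Algebra k A] (φ : A[X] →ₐ[k] K) (hφ : ∀ p, φ p ∈ O)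
    (hC : ∀ a, KaehlerDifferential.D k K (φ (C a)) ∈ N) (hX : KaehlerDifferential.D k K (φ X) ∈ N) (p : A[X]) :
    KaehlerDifferential.D k K (φ p) ∈ N := by
  induction p using Polynomial.induction_on with
  | C a => exact hC a
  | add p q hp hq => rw [map_add, map_add]; exact N.add_mem hp hq
  | monomial m a h =>
    rw [pow_succ, ← mul_assoc, map_mul]
    exact D_mul_mem (hφ _) (hφ _) h hX

end

/-! ### Denominators -/

theorem pow_dvd_of_pow_dvd_mul {R : Type*} [CommRing R] [IsDomain R] {σ a : R} (hσ : σ ≠ 0)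
    (h : ∀ r, σ ∣ a * r → σ ∣ r) (m l : ℕ) {r : R} (hr : σ ^ m ∣ a ^ l * r) : σ ^ m ∣ r := by
  have h1 : ∀ (l : ℕ) (r : R), σ ∣ a ^ l * r → σ ∣ r := fun l ↦ by
    induction l with
    | zero => intro r hr; simpa using hr
    | succ l ih => intro r hr; exact ih r (h _ (by rwa [← mul_assoc, ← pow_succ']))
  induction m generalizing r with
  | zero => simp
  | succ m ih =>
    obtain ⟨c, rfl⟩ := ih ((pow_dvd_pow σ m.le_succ).trans hr)
    rw [mul_left_comm, pow_succ] at hr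
    rw [pow_succ]
    exact mul_dvd_mul_left _ (h1 l c ((mul_dvd_mul_iff_left (pow_ne_zero m hσ)).mp hr))

/-- An element of a field containing the domain `R` that is regular at all generizations of `P` where `σ` or `a`
does not vanish is regular at `P`, if `σ, a` is a regular sequence. -/
theorem exists_mul_eq_of_forall_le {R K : Type*} [CommRing R] [IsDomain R] [Field K] {ι : R →+* K}
    (hι : Function.Injective ι) {σ a : R} (hσ : σ ≠ 0) (h : ∀ r, σ ∣ a * r → σ ∣ r) (P : Ideal R) [P.IsPrime]
    {g : K} (hg : ∀ (Q : Ideal R) [Q.IsPrime], Q ≤ P → (σ ∉ Q ∨ a ∉ Q) → ∃ r, ∃ s ∉ Q, ι s * g = ι r) :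
    ∃ r, ∃ s ∉ P, ι s * g = ι r := by
  let D : Ideal R :=
    -- The ideal of denominators of `g`.
    { carrier := {s | ∃ r, ι s * g = ι r}
      add_mem' := by
        rintro s s' ⟨r, hr⟩ ⟨r', hr'⟩
        exact ⟨r + r', by rw [map_add, map_add, add_mul, hr, hr']⟩
      zero_mem' := ⟨0, by rw [map_zero, zero_mul]⟩
      smul_mem' := by
        rintro c s ⟨r, hr⟩
        exact ⟨c * r, by rw [smul_eq_mul, map_mul, map_mul, mul_assoc, hr]⟩ }
  -- If no product of an element outside `P` and a power of `x` is a denominator, some prime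
  -- contains all denominators but lies in `P` and omits `x`; regularity of `g` at that prime is a
  -- contradiction.
  have key : ∀ x : R, (∀ (Q : Ideal R) [Q.IsPrime], Q ≤ P → x ∉ Q → ∃ r, ∃ s ∉ Q, ι s * g = ι r) →
      ∃ s ∉ P, ∃ m : ℕ, s * x ^ m ∈ D := fun x hx ↦ by
    by_contra! hne
    have hdisj : Disjoint (D : Set R) (P.primeCompl ⊔ Submonoid.powers x : Submonoid R) := by
      rw [Set.disjoint_left]
      intro y hyD hy
      obtain ⟨s, hs, z, ⟨m, rfl⟩, rfl⟩ := Submonoid.mem_sup.mp hy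
      exact hne s hs m hyD
    obtain ⟨Q, hQ, hDQ, hQd⟩ := Ideal.exists_le_prime_disjoint D _ hdisj
    have hQP : Q ≤ P := fun y hy ↦ by
      by_contra hyP
      exact Set.disjoint_left.mp hQd hy ((le_sup_left : P.primeCompl ≤ _) hyP)
    have hxQ : x ∉ Q := fun hxQ ↦
      Set.disjoint_left.mp hQd hxQ ((le_sup_right : Submonoid.powers x ≤ _) (Submonoid.mem_powers x))
    obtain ⟨r, s, hs, hr⟩ := hx Q hQP hxQ
    exact hs (hDQ ⟨r, hr⟩)
  obtain ⟨s, hs, m, r, hr⟩ := key σ fun Q _ hQ hx ↦ hg Q hQ (Or.inl hx)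
  obtain ⟨s', hs', m', r', hr'⟩ := key a fun Q _ hQ hx ↦ hg Q hQ (Or.inr hx)
  -- Two expressions `r/(sσ^m)` and `r'/(s'a^m')` of `g` are compared. Regularity of the sequence
  -- makes `s'r` divisible by `σ^m`, which removes `σ` from the denominator.
  have h1 : a ^ m' * (s' * r) = σ ^ m * (s * r') := hι (by
    simp only [map_mul] at hr hr' ⊢
    rw [← hr, ← hr']
    ring)
  obtain ⟨w, hw⟩ := pow_dvd_of_pow_dvd_mul hσ h m m' ⟨_, h1⟩
  refine ⟨w, s * s', fun hmem ↦ ((inferInstance : P.IsPrime).mem_or_mem hmem).elim hs hs', ?_⟩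
  have h2 : ι (σ ^ m) ≠ 0 := fun h0 ↦ pow_ne_zero m hσ (hι (h0.trans (map_zero ι).symm))
  refine mul_left_cancel₀ h2 ?_
  have h3 := congrArg ι hw
  simp only [map_mul] at h3 hr ⊢
  rw [← h3, ← hr]
  ring

/-! ### Local rings in the function field -/

theorem exists_of_mem_of_morphismRestrict {X Y : Scheme.{u}} {μ : Y ⟶ X} {W : X.Opens} [IsIso (μ ∣_ W)] {z : X} (hz : z ∈ W) :
    ∃ y, μ y = z := by
  obtain ⟨y, hy⟩ := (μ ∣_ W).surjective ⟨z, hz⟩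
  refine ⟨y.1, ?_⟩
  have h1 := morphismRestrict_base_coe μ W y
  rw [← h1, hy]

theorem isIso_stalkMap_of_morphismRestrict {X Y : Scheme.{u}} {μ : Y ⟶ X} {W : X.Opens} [IsIso (μ ∣_ W)] {y : Y} (hy : μ y ∈ W) :
    IsIso (μ.stalkMap y) := by
  have e := morphismRestrictStalkMap μ W ⟨y, hy⟩
  have h1 : ∀ y, IsIso ((μ ∣_ W).stalkMap y) := fun y ↦ inferInstance
  exact ((MorphismProperty.isomorphisms CommRingCat).arrow_mk_iso_iff e).mp (h1 _)

section

variable {X Y : Scheme.{u}} [IsIntegral Y] (μ : Y ⟶ X)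

/-- The pull-back of functions to rational functions. -/
def functionAt (W : X.Opens) (h : μ (genericPoint Y) ∈ W) : Γ(X, W) →+* Y.functionField :=
  (Y.presheaf.germ (μ ⁻¹ᵁ W) (genericPoint Y) h).hom.comp (μ.app W).hom

variable {μ}

theorem stalkMap_stalkSpecializes_germ {W : X.Opens} {z : X} (hz : z ∈ W) (h : μ (genericPoint Y) ⤳ z)
    (r : Γ(X, W)) : ((μ.stalkMap (genericPoint Y)).hom.comp (X.presheaf.stalkSpecializes h).hom)
      (X.presheaf.germ W z hz r) = functionAt μ W (h.mem_open W.isOpen hz) r := by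
  have h1 : X.presheaf.stalkSpecializes h (X.presheaf.germ W z hz r) =
      X.presheaf.germ W (μ (genericPoint Y)) (h.mem_open W.isOpen hz) r :=
    ConcreteCategory.congr_hom (X.presheaf.germ_stalkSpecializes hz h) r
  refine (congrArg (μ.stalkMap (genericPoint Y)) h1).trans ?_
  exact Scheme.Hom.germ_stalkMap_apply μ W (genericPoint Y) _ r

theorem functionAt_ne_zero {W : X.Opens} (h : μ (genericPoint Y) ∈ W) {s : Γ(X, W)}
    (hs : μ (genericPoint Y) ∈ X.basicOpen s) : functionAt μ W h s ≠ 0 := by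
  have h1 := (X.mem_basicOpen s _ h).mp hs
  have h2 := h1.map (μ.stalkMap (genericPoint Y)).hom
  have h3 : μ.stalkMap (genericPoint Y) (X.presheaf.germ W _ h s) = functionAt μ W h s :=
    Scheme.Hom.germ_stalkMap_apply μ W (genericPoint Y) _ s
  exact h3 ▸ h2.ne_zero

/-- The local ring as a ring of fractions. -/
theorem mem_localRingIn_iff {W : X.Opens} (hW : IsAffineOpen W) {z : X} (hz : z ∈ W)
    (h : μ (genericPoint Y) ⤳ z) {c : Y.functionField} : c ∈ localRingIn μ z h ↔
      ∃ r s : Γ(X, W), z ∈ X.basicOpen s ∧ functionAt μ W (h.mem_open W.isOpen hz) s * c =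
        functionAt μ W (h.mem_open W.isOpen hz) r := by
  constructor
  · rintro ⟨x, rfl⟩
    let _ := X.presheaf.algebra_section_stalk (⟨z, hz⟩ : W)
    have hst := hW.isLocalization_stalk ⟨z, hz⟩
    obtain ⟨⟨r, s⟩, hrs⟩ := IsLocalization.surj (hW.primeIdealOf ⟨z, hz⟩).asIdeal.primeCompl x
    have hs : z ∈ X.basicOpen (s : Γ(X, W)) := by
      have := s.2
      by_contra hne
      exact this ((mem_primeIdealOf_iff hW hz _).mpr hne)
    refine ⟨r, s, hs, ?_⟩
    rw [← stalkMap_stalkSpecializes_germ hz h, ← stalkMap_stalkSpecializes_germ hz h, ← map_mul, mul_comm]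
    exact congrArg _ hrs
  · rintro ⟨r, s, hs, hc⟩
    obtain ⟨v, hv⟩ := ((X.mem_basicOpen s z hz).mp hs).exists_right_inv
    refine ⟨v * X.presheaf.germ W z hz r, ?_⟩
    have h0 := functionAt_ne_zero (h.mem_open W.isOpen hz) (h.mem_open (X.basicOpen s).isOpen hs)
    refine mul_left_cancel₀ h0 ?_
    rw [hc, ← stalkMap_stalkSpecializes_germ hz h, ← stalkMap_stalkSpecializes_germ hz h, ← map_mul, ← mul_assoc,
      hv, one_mul]

theorem functionAt_mem_localRingIn {W : X.Opens} {z : X} (hz : z ∈ W) (h : μ (genericPoint Y) ⤳ z)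
    (r : Γ(X, W)) : functionAt μ W (h.mem_open W.isOpen hz) r ∈ localRingIn μ z h :=
  ⟨_, stalkMap_stalkSpecializes_germ hz h r⟩

theorem inv_functionAt_mem_localRingIn {W : X.Opens} {z : X} (hz : z ∈ W) (h : μ (genericPoint Y) ⤳ z)
    {s : Γ(X, W)} (hs : z ∈ X.basicOpen s) :
    (functionAt μ W (h.mem_open W.isOpen hz) s)⁻¹ ∈ localRingIn μ z h := by
  obtain ⟨v, hv⟩ := ((X.mem_basicOpen s z hz).mp hs).exists_right_inv
  refine ⟨v, ?_⟩
  refine eq_inv_of_mul_eq_one_right ?_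
  rw [← stalkMap_stalkSpecializes_germ hz h, ← map_mul, hv, map_one]

theorem localRingIn_mono {z z' : X} (h : z ⤳ z') (hz : μ (genericPoint Y) ⤳ z) :
    localRingIn μ z' (hz.trans h) ≤ localRingIn μ z hz := by
  rintro _ ⟨x, rfl⟩
  refine ⟨X.presheaf.stalkSpecializes h x, ?_⟩
  refine congrArg (μ.stalkMap (genericPoint Y)) ?_
  exact ConcreteCategory.congr_hom (X.presheaf.stalkSpecializes_comp hz h) x

theorem localRingIn_eq_range {y : Y} [IsIso (μ.stalkMap y)] (h : μ (genericPoint Y) ⤳ μ y) :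
    localRingIn μ (μ y) h = (Y.presheaf.stalkSpecializes (genericPoint_specializes y)).hom.range := by
  have h1 := μ.stalkSpecializes_stalkMap _ _ (genericPoint_specializes y)
  ext c
  constructor
  · rintro ⟨x, rfl⟩
    exact ⟨μ.stalkMap y x, (ConcreteCategory.congr_hom h1 x).symm⟩
  · rintro ⟨x, rfl⟩
    obtain ⟨x, rfl⟩ := (ConcreteCategory.bijective_of_isIso (μ.stalkMap y)).2 x
    exact ⟨x, ConcreteCategory.congr_hom h1 x⟩

theorem localRingIn_eq_of_isIso {y : Y} [IsIso (μ.stalkMap y)] (h : μ (genericPoint Y) ⤳ μ y) :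
    localRingIn μ (μ y) h = localRingIn (𝟙 Y) y (genericPoint_specializes y) :=
  (localRingIn_eq_range h).trans (localRingIn_eq_range (μ := 𝟙 Y) (genericPoint_specializes y)).symm

/-- The open set contains the generic point of `X`, which is therefore in the image; the generic
point of `Y` maps to a generization of it. -/
theorem specializes_of_morphismRestrict [IrreducibleSpace X] {W : X.Opens} [IsIso (μ ∣_ W)]
    (hW : (W : Set X).Nonempty) (z : X) : μ (genericPoint Y) ⤳ z := by
  have h1 : genericPoint X ∈ W := (genericPoint_spec X).mem_open_set_iff W.isOpen |>.mpr (by simpa using hW)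
  obtain ⟨y, hy⟩ := exists_of_mem_of_morphismRestrict (μ := μ) h1
  have h2 := (genericPoint_specializes y).map μ.continuous
  rw [hy] at h2
  exact h2.trans (genericPoint_specializes z)

theorem formLattice_mono {k : Type u} [Field k] {n : ℕ} {f : Y ⟶ Spec (.of k)} {O O' : Subring Y.functionField}
    (h : O ≤ O') {ω : RationalForms n f} (hω : ω ∈ formLattice n f O) : ω ∈ formLattice n f O' := by
  let _ := functionFieldAlgebra f
  induction hω using Submodule.span_induction with
  | mem ω hω =>
    obtain ⟨a, ha, rfl⟩ := hω
    exact Submodule.subset_span ⟨a, fun j ↦ h (ha j), rfl⟩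
  | zero => exact Submodule.zero_mem _
  | add x y _ _ hx hy => exact Submodule.add_mem _ hx hy
  | smul r x _ hx => exact Submodule.smul_mem _ (⟨r, h r.2⟩ : O') hx

theorem functionAt_injective [IsReduced X] (hμ : ∀ z, μ (genericPoint Y) ⤳ z) {W : X.Opens}
    (h : μ (genericPoint Y) ∈ W) : Function.Injective (functionAt μ W h) := by
  rw [injective_iff_map_eq_zero]
  intro r hr
  by_contra hne
  obtain ⟨z, hz⟩ := (Opens.ne_bot_iff_nonempty _).mp (fun hb ↦ hne ((basicOpen_eq_bot_iff r).mp hb))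
  exact functionAt_ne_zero h ((hμ z).mem_open (X.basicOpen r).isOpen hz) hr

theorem id_specializes (y : Y) : (𝟙 Y : Y ⟶ Y) (genericPoint Y) ⤳ y := genericPoint_specializes y

theorem functionAt_id {W : Y.Opens} (h : (𝟙 Y : Y ⟶ Y) (genericPoint Y) ∈ W) (s : Γ(Y, W)) :
    functionAt (𝟙 Y) W h s = Y.presheaf.germ W (genericPoint Y) h s := by
  have h1 : (𝟙 Y : Y ⟶ Y).app W s = s := by
    rw [Scheme.Hom.id_app]
    rfl
  exact congrArg (Y.presheaf.germ W (genericPoint Y) h) h1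

end

namespace IsChart

open Polynomial

variable {k : Type u} [Field k] {Y B : Scheme.{u}} [IsIntegral Y] {f : Y ⟶ B} {U : B.Opens} {W : Y.Opens}
  {P : Γ(B, U)[X]} {t : Γ(Y, W)} (hc : IsChart f U W P t) (hη : genericPoint Y ∈ W)

/-- Polynomials in the coordinate of a chart as rational functions. -/
def toFunctionField : Γ(B, U)[X] →+* Y.functionField :=
  (Y.presheaf.germ W (genericPoint Y) hη).hom.comp (chartMap f U W hc.le t)

theorem toFunctionField_C (s : Γ(B, U)) :
    hc.toFunctionField hη (C s) = functionAt f U (hc.le hη) s := by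
  have h1 : chartMap f U W hc.le t (C s) = f.appLE U W hc.le s := by simp [chartMap]
  rw [toFunctionField, RingHom.comp_apply, h1]
  exact Y.presheaf.germ_res_apply (homOfLE hc.le) (genericPoint Y) hη (f.app U s)

theorem toFunctionField_X : hc.toFunctionField hη X = Y.presheaf.germ W (genericPoint Y) hη t := by
  rw [toFunctionField, RingHom.comp_apply, chartMap, coe_eval₂RingHom, eval₂_X]

theorem toFunctionField_algebraMap {str : B ⟶ Spec (.of k)} {g : Y ⟶ Spec (.of k)} (hg : g = f ≫ str) (c : k) :
    hc.toFunctionField hη (C (constants str U c)) = stalkConstants g (genericPoint Y) c := by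
  subst hg
  rw [← germ_comp_constants _ hη, ← chartMap_comp_algebraMap f str hc.le t]
  rfl

variable {y : Y} (hy : y ∈ W)

include hy

theorem toFunctionField_mem (p : Γ(B, U)[X]) :
    hc.toFunctionField hη p ∈ localRingIn (𝟙 Y) y (genericPoint_specializes y) := by
  have h1 := functionAt_mem_localRingIn (μ := 𝟙 Y) hy (id_specializes y) (chartMap f U W hc.le t p)
  rw [functionAt_id] at h1
  exact h1

theorem toFunctionField_inv {p : Γ(B, U)[X]} (hp : p ∉ (hc.affine.primeIdealOf ⟨y, hy⟩).asIdeal.comap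
    (chartMap f U W hc.le t)) : hc.toFunctionField hη p ≠ 0 ∧
      (hc.toFunctionField hη p)⁻¹ ∈ localRingIn (𝟙 Y) y (genericPoint_specializes y) := by
  rw [Ideal.mem_comap, mem_primeIdealOf_iff, not_not] at hp
  have h1 := inv_functionAt_mem_localRingIn (μ := 𝟙 Y) hy (id_specializes y) hp
  have h2 := functionAt_ne_zero (μ := 𝟙 Y) ((id_specializes y).mem_open W.isOpen hy)
    ((id_specializes y).mem_open (Y.basicOpen _).isOpen hp)
  rw [functionAt_id] at h1 h2
  exact ⟨h2, h1⟩

theorem exists_toFunctionField {α : Y.functionField}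
    (hα : α ∈ localRingIn (𝟙 Y) y (genericPoint_specializes y)) :
    ∃ r, ∃ s ∉ (hc.affine.primeIdealOf ⟨y, hy⟩).asIdeal.comap (chartMap f U W hc.le t),
      hc.toFunctionField hη s * α = hc.toFunctionField hη r := by
  obtain ⟨r, s, hs, h⟩ := (mem_localRingIn_iff hc.affine hy (id_specializes y)).mp hα
  obtain ⟨r, rfl⟩ := hc.surjective r
  obtain ⟨s, rfl⟩ := hc.surjective s
  rw [functionAt_id, functionAt_id] at h
  refine ⟨r, s, ?_, h⟩
  rw [Ideal.mem_comap, mem_primeIdealOf_iff, not_not]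
  exact hs

/-- Generators of the forms at a point of a chart. -/
theorem mem_formLattice_iff {n : ℕ} (g : Y ⟶ Spec (.of k)) {e : Fin n → Γ(B, U)[X]}
    (h : letI := functionFieldAlgebra g
      ∀ p, (KaehlerDifferential.D k Y.functionField (hc.toFunctionField hη p) : Ω[Y.functionField⁄k]) ∈
        Submodule.span (localRingIn (𝟙 Y) y (genericPoint_specializes y)) (Set.range fun j ↦
          (KaehlerDifferential.D k Y.functionField (hc.toFunctionField hη (e j)) : Ω[Y.functionField⁄k])))
    (ω : RationalForms n g) :
    letI := functionFieldAlgebra g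
    ω ∈ formLattice n g (localRingIn (𝟙 Y) y (genericPoint_specializes y)) ↔
      ∃ c ∈ localRingIn (𝟙 Y) y (genericPoint_specializes y), ω = c • exteriorPower.ιMulti Y.functionField n
        (fun j ↦ (KaehlerDifferential.D k Y.functionField (hc.toFunctionField hη (e j)) : Ω[Y.functionField⁄k])) := by
  let _ := functionFieldAlgebra g
  refine mem_span_forms_iff (fun j ↦ hc.toFunctionField_mem hη hy _) (fun α hα ↦ ?_) ω
  obtain ⟨r, s, hs, hrs⟩ := hc.exists_toFunctionField hη hy hα
  obtain ⟨h0, h1⟩ := hc.toFunctionField_inv hη hy hs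
  exact D_mem_of_mul_eq h0 h1 hα hrs (h s) (h r)

end IsChart

/-! ### Generators of the lattices of forms -/

section

variable {k K : Type*} [Field k] [Field K] [Algebra k K]

/-- From `da = t² dσ + 2σt dt` and `dσ ∧ dσ = 0` one gets `dσ ∧ da = 2σt dσ ∧ dt`, and `2σt` is the
coordinate `ξ` of the double cover. -/
theorem inv_smul_ιMulti_vecCons_right {r : ℕ} {σ a t : K} (h2 : (2 : K) ≠ 0) (hσ : σ ≠ 0) (ht : t ≠ 0)
    (h : a = σ * t ^ 2) (x : Fin r → Ω[K⁄k]) :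
    (2 * σ * t)⁻¹ • exteriorPower.ιMulti K (r + 2) (Matrix.vecCons (KaehlerDifferential.D k K σ)
      (Matrix.vecCons (KaehlerDifferential.D k K a) x)) =
    exteriorPower.ιMulti K (r + 2) (Matrix.vecCons (KaehlerDifferential.D k K σ)
      (Matrix.vecCons (KaehlerDifferential.D k K t) x)) := by
  have h1 : KaehlerDifferential.D k K a =
      t ^ 2 • KaehlerDifferential.D k K σ + (2 * σ * t) • KaehlerDifferential.D k K t := by
    rw [h, Derivation.leibniz, pow_two, Derivation.leibniz]
    module
  rw [h1, AlternatingMap.map_vecCons_vecCons_right, smul_smul,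
    inv_mul_cancel₀ (mul_ne_zero (mul_ne_zero h2 hσ) ht), one_smul]

theorem inv_smul_ιMulti_vecCons_left {r : ℕ} {σ a t : K} (h2 : (2 : K) ≠ 0) (ha : a ≠ 0) (ht : t ≠ 0)
    (h : σ = a * t ^ 2) (x : Fin r → Ω[K⁄k]) :
    (2 * a * t)⁻¹ • exteriorPower.ιMulti K (r + 2) (Matrix.vecCons (KaehlerDifferential.D k K σ)
      (Matrix.vecCons (KaehlerDifferential.D k K a) x)) =
    exteriorPower.ιMulti K (r + 2) (Matrix.vecCons (KaehlerDifferential.D k K t)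
      (Matrix.vecCons (KaehlerDifferential.D k K a) x)) := by
  have h1 : KaehlerDifferential.D k K σ =
      t ^ 2 • KaehlerDifferential.D k K a + (2 * a * t) • KaehlerDifferential.D k K t := by
    rw [h, Derivation.leibniz, pow_two, Derivation.leibniz]
    module
  rw [h1, AlternatingMap.map_vecCons_vecCons_left, smul_smul,
    inv_mul_cancel₀ (mul_ne_zero (mul_ne_zero h2 ha) ht), one_smul]

end

namespace IsChart

open Polynomial

variable {k : Type u} [Field k] {Y B : Scheme.{u}} [IsIntegral Y] {f : Y ⟶ B} {U : B.Opens} {W : Y.Opens}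
  {P : Γ(B, U)[X]} {t : Γ(Y, W)} (hc : IsChart f U W P t) (hη : genericPoint Y ∈ W)
  {str : B ⟶ Spec (.of k)} {g : Y ⟶ Spec (.of k)} (hg : g = f ≫ str)

/-- `toFunctionField` as a morphism of `k`-algebras. -/
def toFunctionFieldAlgHom :
    letI := sectionsAlgebra str U
    letI := functionFieldAlgebra g
    Γ(B, U)[X] →ₐ[k] Y.functionField :=
  letI := sectionsAlgebra str U
  letI := functionFieldAlgebra g
  { hc.toFunctionField hη with
    commutes' := fun c ↦ (hc.toFunctionField_algebraMap hη hg c).trans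
      (RingHom.congr_fun (germ_comp_constants g (V := ⊤) (x := genericPoint Y) trivial) c).symm }

theorem toFunctionField_equation : hc.toFunctionField hη P = 0 := by
  have : P ∈ RingHom.ker (chartMap f U W hc.le t) := by
    rw [hc.ker]; exact Ideal.mem_span_singleton_self P
  rw [toFunctionField, RingHom.comp_apply, this, map_zero]

variable {y : Y} (hy : y ∈ W)

include hc hg hy in
-- The differentials of `A[X]` have rank `n + 1` and `dP` is part of a generating system. On the
-- chart `dP` becomes zero, so the remaining `n` differentials generate.
theorem exists_generator {n : ℕ} [SmoothOfRelativeDimension n str] (hU : IsAffineOpen U)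
    (hP : letI := sectionsAlgebra str U
      ∀ (Q : Ideal Γ(B, U)[X]) [Q.IsPrime], P ∈ Q → (1 : Q.ResidueField) ⊗ₜ[Γ(B, U)[X]]
        (KaehlerDifferential.D k Γ(B, U)[X] P : Ω[Γ(B, U)[X]⁄k]) ≠ 0) :
    letI := functionFieldAlgebra g
    ∃ θ : RationalForms n g, ∀ ω, ω ∈ formLattice n g (localRingIn (𝟙 Y) y (genericPoint_specializes y)) ↔
      ∃ c ∈ localRingIn (𝟙 Y) y (genericPoint_specializes y), ω = c • θ := by
  have := SmoothOfRelativeDimension.smooth n str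
  let _ := sectionsAlgebra str U
  let _ := functionFieldAlgebra g
  have hη : genericPoint Y ∈ W := (genericPoint_specializes y).mem_open W.isOpen hy
  have : Algebra.Smooth k Γ(B, U) := WeakCoupling.constants_smooth str hU
  have := smooth_polynomial k Γ(B, U)
  have hF := hP _ (hc.equation_mem hy)
  have hrank := finrank_polynomial_differentials (k := k) (A := Γ(B, U)) (n := n)
    (Q := (hc.affine.primeIdealOf ⟨y, hy⟩).asIdeal.comap (chartMap f U W hc.le t))
    (finrank_differentials_of_locally (WeakCoupling.constants_locally str hU) _)
  obtain ⟨r, hr, e, he⟩ := exists_generating_differentials (k := k) (S := Γ(B, U)[X]) _ hrank ![P] (by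
    rw [linearIndependent_unique_iff]
    exact hF)
  obtain rfl : r = n := by omega
  refine ⟨_, hc.mem_formLattice_iff hη hy g (e := e) fun p ↦ ?_⟩
  obtain ⟨v, hv, h⟩ := he p
  obtain ⟨h0, h1⟩ := hc.toFunctionField_inv hη hy hv
  refine D_mem_of_smul_mem_span (hc.toFunctionFieldAlgHom hη hg) (hc.toFunctionField_mem hη hy)
    (T := {P} ∪ Set.range e) ?_ h0 h1 ?_
  · rintro τ (rfl | ⟨j, rfl⟩)
    · have h2 : hc.toFunctionFieldAlgHom hη hg τ = 0 := hc.toFunctionField_equation hη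
      rw [h2, map_zero]
      exact Submodule.zero_mem _
    · exact Submodule.subset_span ⟨j, rfl⟩
  · convert h using 2
    rw [Set.image_union, Set.image_singleton, ← Set.range_comp]
    congr 1
    ext ω
    simp

end IsChart

namespace IsChart

open Polynomial

variable {k : Type u} [Field k] {Y B : Scheme.{u}} [IsIntegral Y] {f : Y ⟶ B} {U : B.Opens} {W : Y.Opens}
  {P : Γ(B, U)[X]} {t : Γ(Y, W)} (hc : IsChart f U W P t) (hη : genericPoint Y ∈ W)
  {str : B ⟶ Spec (.of k)} {g : Y ⟶ Spec (.of k)} (hg : g = f ≫ str) {y : Y} (hy : y ∈ W)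
  {b : B} (hU : IsAffineOpen U) (hb : b ∈ U) (hyb : f y ⤳ b)

include hg hy hyb

/-- Differentials that generate at a point of the base, together with that of the coordinate of a chart, generate at
all points of the chart above generizations. -/
theorem D_toFunctionField_mem {T : Set Γ(B, U)}
    (hT : letI := sectionsAlgebra str U
      ∀ s : Γ(B, U), ∃ v ∉ (hU.primeIdealOf ⟨b, hb⟩).asIdeal,
      v • (KaehlerDifferential.D k Γ(B, U) s : Ω[Γ(B, U)⁄k]) ∈
        Submodule.span Γ(B, U) (KaehlerDifferential.D k Γ(B, U) '' T))
    (p : Γ(B, U)[X]) :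
    letI := functionFieldAlgebra g
    ∀ (N : Submodule (localRingIn (𝟙 Y) y (genericPoint_specializes y)) Ω[Y.functionField⁄k]),
    (∀ τ ∈ T, KaehlerDifferential.D k Y.functionField (functionAt f U (hc.le hη) τ) ∈ N) →
    KaehlerDifferential.D k Y.functionField (hc.toFunctionField hη X) ∈ N →
    KaehlerDifferential.D k Y.functionField (hc.toFunctionField hη p) ∈ N := by
  let _ := sectionsAlgebra str U
  let _ := functionFieldAlgebra g
  intro N hN hX
  refine D_mem_of_polynomial (hc.toFunctionFieldAlgHom hη hg) (hc.toFunctionField_mem hη hy) (fun s ↦ ?_) hX p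
  obtain ⟨v, hv, h⟩ := hT s
  rw [mem_primeIdealOf_iff, not_not] at hv
  have hv' : C v ∉ (hc.affine.primeIdealOf ⟨y, hy⟩).asIdeal.comap (chartMap f U W hc.le t) := by
    rw [hc.C_mem_iff hy, not_not]
    exact hyb.mem_open (B.basicOpen v).isOpen hv
  obtain ⟨h0, h1⟩ := hc.toFunctionField_inv hη hy hv'
  refine D_mem_of_smul_mem_span ((hc.toFunctionFieldAlgHom hη hg).comp CAlgHom)
    (fun s ↦ hc.toFunctionField_mem hη hy _) (T := T) (fun τ hτ ↦ ?_) h0 h1 h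
  have := hN τ hτ
  rwa [← hc.toFunctionField_C hη] at this

end IsChart

namespace TransversalSection

open Polynomial

variable {k : Type u} [Field k] {n : ℕ} {S : Base k n} {E : TransversalSection S}
  {X' : Scheme.{u}} {f : X' ⟶ S.B} {W : S.I × Bool → X'.Opens} {t : ∀ j, Γ(X', W j)}
  (N : IsModel (E.atlas 2 1 one_mul_two) f W t)

include N

theorem functionAt_ne_zero [IsIntegral X'] {i : S.I} (hη : f (genericPoint X') ∈ S.U i) {c : Γ(S.B, S.U i)} (hc : c ≠ 0) :
    functionAt f (S.U i) hη c ≠ 0 := by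
  obtain ⟨j, hj⟩ := N.cover (genericPoint X')
  have hj' := N.overlap j (i, j.2) _ hj hη (Or.inl rfl)
  have : Nonempty (W (i, j.2)) := ⟨⟨_, hj'⟩⟩
  have h1 := map_ne_zero N (i, j.2) hc
  intro h
  refine h1 (X'.germToFunctionField_injective (W (i, j.2)) ?_)
  rw [map_zero]
  refine Eq.trans ?_ h
  exact X'.presheaf.germ_res_apply (homOfLE (le_preimage N (i, j.2))) (genericPoint X') hj' (f.app (S.U i) c)

variable (C : DoubleCover S (fun i ↦ 4 * S.σ i * E.a i)) {μ : X' ⟶ C.X} (hμρ : μ ≫ C.ρ = f)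
  (hμ : ∀ j, ∃ e : W j ≤ μ ⁻¹ᵁ (C.ρ ⁻¹ᵁ S.U j.1), μ.appLE _ _ e (C.ξ j.1) =
    2 * f.appLE _ _ (le_preimage N j) (exceptional j.2 (S.σ j.1) (E.a j.1)) * t j)

theorem functionAt_ξ [IsIntegral X'] (j : S.I × Bool) (hη : genericPoint X' ∈ W j) (hη' : μ (genericPoint X') ∈ C.ρ ⁻¹ᵁ S.U j.1)
    (hμ : ∃ e : W j ≤ μ ⁻¹ᵁ (C.ρ ⁻¹ᵁ S.U j.1), μ.appLE _ _ e (C.ξ j.1) =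
      2 * f.appLE _ _ (le_preimage N j) (exceptional j.2 (S.σ j.1) (E.a j.1)) * t j) :
    functionAt μ (C.ρ ⁻¹ᵁ S.U j.1) hη' (C.ξ j.1) =
      2 * functionAt f (S.U j.1) ((le_preimage N j) hη) (exceptional j.2 (S.σ j.1) (E.a j.1)) *
        (N.chart j).toFunctionField hη X := by
  obtain ⟨e, he⟩ := hμ
  have h1 : functionAt μ (C.ρ ⁻¹ᵁ S.U j.1) hη' (C.ξ j.1) =
      X'.presheaf.germ (W j) (genericPoint X') hη (μ.appLE _ _ e (C.ξ j.1)) :=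
    (X'.presheaf.germ_res_apply (homOfLE e) (genericPoint X') hη (μ.app _ (C.ξ j.1))).symm
  rw [h1, he, map_mul, map_mul, map_ofNat, IsChart.toFunctionField_X]
  congr 2
  exact X'.presheaf.germ_res_apply (homOfLE (le_preimage N j)) (genericPoint X') hη (f.app (S.U j.1) _)

include hμ in
-- With `σ, a, x₁, …` local coordinates of the base at `b`, take `θ = ξ⁻¹ dσ ∧ da ∧ dx₁ ∧ …`. It
-- equals `dσ ∧ dt ∧ dx₁ ∧ …` near `0` and `dt ∧ da ∧ dx₁ ∧ …` near `∞`, and these differentials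
-- generate in the respective chart. The same `θ` serves all points over generizations of `b`, as
-- the passage to the canonical sheaf of `X` requires.
theorem exists_generator_of_singular [IsIntegral X'] (h2 : (2 : k) ≠ 0) {g : X' ⟶ Spec (.of k)}
    (hg : g = f ≫ S.str) {b : S.B} {i : S.I} (hb : b ∈ S.U i) (hσ : b ∉ S.B.basicOpen (S.σ i))
    (ha : b ∉ S.B.basicOpen (E.a i)) :
    letI := functionFieldAlgebra g
    ∃ θ : RationalForms n g, ∀ y, f y ⤳ b → ∀ ω,
      ω ∈ formLattice n g (localRingIn (𝟙 X') y (genericPoint_specializes y)) ↔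
        ∃ c ∈ localRingIn (𝟙 X') y (genericPoint_specializes y), ω = c • θ := by
  let _ := functionFieldAlgebra g
  -- If the image of the generic point does not specialize to `b`, no point `y` satisfies `f y ⤳ b`.
  by_cases hfη : f (genericPoint X') ⤳ b
  swap
  · exact ⟨0, fun y hy ↦ absurd (((genericPoint_specializes y).map f.continuous).trans hy) hfη⟩
  have hηU : f (genericPoint X') ∈ S.U i := hfη.mem_open (S.U i).isOpen hb
  obtain ⟨j₀, hj₀⟩ := N.cover (genericPoint X')
  have hηξ : μ (genericPoint X') ∈ C.ρ ⁻¹ᵁ S.U i :=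
    (hμ (i, j₀.2)).1 (N.overlap j₀ (i, j₀.2) _ hj₀ hηU (Or.inl rfl))
  have := S.smooth
  have := SmoothOfRelativeDimension.smooth n S.str
  have hne : (S.U i : Set S.B).Nonempty := ⟨b, hb⟩
  have h2K : (2 : X'.functionField) ≠ 0 := by
    have := (_root_.map_ne_zero (algebraMap k X'.functionField)).mpr h2
    rwa [map_ofNat] at this
  have hσ0 := functionAt_ne_zero N hηU (S.σ_ne_zero i hne)
  have ha0 := functionAt_ne_zero N hηU (E.a_ne_zero i hne)
  let _ := sectionsAlgebra S.str (S.U i)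
  have : Algebra.Smooth k Γ(S.B, S.U i) := constants_smooth S.str (S.affine i)
  have hrank := finrank_differentials_of_locally (k := k) (A := Γ(S.B, S.U i)) (n := n)
    (constants_locally S.str (S.affine i)) ((S.affine i).primeIdealOf ⟨b, hb⟩).asIdeal
  obtain ⟨r, hr, x, hx⟩ := exists_generating_differentials (k := k) (S := Γ(S.B, S.U i)) _ hrank ![S.σ i, E.a i]
    (E.transversal i _ (fun j ↦ by
      rw [mem_primeIdealOf_iff]
      fin_cases j
      exacts [hσ, ha])).2
  have hx' : ∀ s : Γ(S.B, S.U i), ∃ v ∉ ((S.affine i).primeIdealOf ⟨b, hb⟩).asIdeal,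
      v • (KaehlerDifferential.D k Γ(S.B, S.U i) s : Ω[Γ(S.B, S.U i)⁄k]) ∈ Submodule.span Γ(S.B, S.U i)
        (KaehlerDifferential.D k Γ(S.B, S.U i) '' ({S.σ i, E.a i} ∪ Set.range x)) := fun s ↦ by
    obtain ⟨v, hv, h⟩ := hx s
    refine ⟨v, hv, ?_⟩
    convert h using 2
    rw [Set.image_union, Set.image_pair, ← Set.range_comp]
    congr 1
    ext ω
    simp [eq_comm]
  obtain rfl : n = r + 2 := by omega
  let D : X'.functionField → Ω[X'.functionField⁄k] := KaehlerDifferential.D k X'.functionField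
  let ψ := functionAt f (S.U i) hηU
  refine ⟨(functionAt μ _ hηξ (C.ξ i))⁻¹ • exteriorPower.ιMulti X'.functionField (r + 2)
    (Matrix.vecCons (D (ψ (S.σ i))) (Matrix.vecCons (D (ψ (E.a i))) fun l ↦ D (ψ (x l)))), fun y hy ω ↦ ?_⟩
  obtain ⟨j, hj⟩ := N.cover y
  have hyj : y ∈ W (i, j.2) := N.overlap j (i, j.2) _ hj (hy.mem_open (S.U i).isOpen hb) (Or.inl rfl)
  generalize j.2 = κ at hyj
  have hη : genericPoint X' ∈ W (i, κ) := (genericPoint_specializes y).mem_open (W (i, κ)).isOpen hyj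
  have hξ := functionAt_ξ N C (i, κ) hη hηξ (hμ (i, κ))
  have hP := (N.chart (i, κ)).toFunctionField_equation hη
  have hgen := (N.chart (i, κ)).D_toFunctionField_mem hη hg hyj (S.affine i) hb hy hx'
  let Φ : Γ(S.B, S.U i)[X] →+* X'.functionField := (N.chart (i, κ)).toFunctionField hη
  have hΦ : ∀ s, Φ (Polynomial.C s) = ψ s := (N.chart (i, κ)).toFunctionField_C hη
  have hmem : ∀ s, ψ s ∈ localRingIn (𝟙 X') y (genericPoint_specializes y) := fun s ↦
    hΦ s ▸ (N.chart (i, κ)).toFunctionField_mem hη hyj (Polynomial.C s)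
  have hX : Φ X ∈ localRingIn (𝟙 X') y (genericPoint_specializes y) :=
    (N.chart (i, κ)).toFunctionField_mem hη hyj X
  have hcons : ∀ p q, (fun j ↦ D (Φ ((Matrix.vecCons p (Matrix.vecCons q fun l ↦ Polynomial.C (x l)) :
      Fin (r + 2) → Γ(S.B, S.U i)[X]) j))) =
      Matrix.vecCons (D (Φ p)) (Matrix.vecCons (D (Φ q)) fun l ↦ D (ψ (x l))) := fun p q ↦ by
    funext j
    refine Fin.cases rfl (fun j ↦ Fin.cases rfl (fun l ↦ ?_) j) j
    exact congrArg D (hΦ (x l))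
  -- The pair `p, q` replaces `σ, a` in the chart: `(t, a)` near `∞` and `(σ, t)` near `0`. What is
  -- needed is the equality of the two forms, and that `dp`, `dq` generate `dσ`, `da` and `dt`.
  have key : ∀ p q, (functionAt μ _ hηξ (C.ξ i))⁻¹ • exteriorPower.ιMulti X'.functionField (r + 2)
      (Matrix.vecCons (D (ψ (S.σ i))) (Matrix.vecCons (D (ψ (E.a i))) fun l ↦ D (ψ (x l)))) =
      exteriorPower.ιMulti X'.functionField (r + 2)
      (Matrix.vecCons (D (Φ p)) (Matrix.vecCons (D (Φ q)) fun l ↦ D (ψ (x l)))) →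
      (∀ L : Submodule (localRingIn (𝟙 X') y (genericPoint_specializes y)) Ω[X'.functionField⁄k],
        D (Φ p) ∈ L → D (Φ q) ∈ L → D (ψ (S.σ i)) ∈ L ∧ D (ψ (E.a i)) ∈ L ∧ D (Φ X) ∈ L) →
      (ω ∈ formLattice (r + 2) g (localRingIn (𝟙 X') y (genericPoint_specializes y)) ↔
        ∃ c ∈ localRingIn (𝟙 X') y (genericPoint_specializes y), ω = c •
          (functionAt μ _ hηξ (C.ξ i))⁻¹ • exteriorPower.ιMulti X'.functionField (r + 2)
      (Matrix.vecCons (D (ψ (S.σ i))) (Matrix.vecCons (D (ψ (E.a i))) fun l ↦ D (ψ (x l))))) := by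
    intro p q h1 h3
    rw [h1, ← hcons]
    refine (N.chart (i, κ)).mem_formLattice_iff hη hyj g (fun s ↦ ?_) ω
    obtain ⟨h4, h5, h6⟩ := h3 (Submodule.span _ (Set.range fun j ↦ D (Φ ((Matrix.vecCons p (Matrix.vecCons q
      fun l ↦ Polynomial.C (x l)) : Fin (r + 2) → Γ(S.B, S.U i)[X]) j))))
      (Submodule.subset_span ⟨0, rfl⟩) (Submodule.subset_span ⟨1, rfl⟩)
    refine hgen s _ ?_ h6
    rintro τ ((rfl | rfl) | ⟨l, rfl⟩)
    · exact h4
    · exact h5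
    · exact Submodule.subset_span ⟨l.succ.succ, congrArg D (hΦ (x l))⟩
  cases κ
  · have h3 : ψ (S.σ i) = ψ (E.a i) * Φ X ^ 2 := by
      have h4 : Φ (Polynomial.C (S.σ i) - Polynomial.C (E.a i) * X ^ 2) = 0 := hP
      rwa [map_sub, map_mul, map_pow, hΦ, hΦ, sub_eq_zero] at h4
    have hX0 : Φ X ≠ 0 := fun h ↦ hσ0 (h3.trans (by rw [h]; ring))
    refine key X (Polynomial.C (E.a i)) ?_ fun L hL hL' ↦ ?_
    · rw [hξ, hΦ]
      exact inv_smul_ιMulti_vecCons_left h2K ha0 hX0 h3 _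
    · rw [hΦ] at hL'
      refine ⟨?_, hL', hL⟩
      rw [h3, pow_two]
      exact D_mul_mem (hmem _) (mul_mem hX hX) hL' (D_mul_mem hX hX hL hL)
  · have h3 : ψ (E.a i) = ψ (S.σ i) * Φ X ^ 2 := by
      have h4 : Φ (Polynomial.C (S.σ i) * X ^ 2 - Polynomial.C (E.a i)) = 0 := hP
      rw [map_sub, map_mul, map_pow, hΦ, hΦ, sub_eq_zero] at h4
      exact h4.symm
    have hX0 : Φ X ≠ 0 := fun h ↦ ha0 (h3.trans (by rw [h]; ring))
    refine key (Polynomial.C (S.σ i)) X ?_ fun L hL hL' ↦ ?_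
    · rw [hξ, hΦ]
      exact inv_smul_ιMulti_vecCons_right h2K hσ0 hX0 h3 _
    · rw [hΦ] at hL
      refine ⟨hL, ?_, hL'⟩
      rw [h3, pow_two]
      exact D_mul_mem (hmem _) (mul_mem hX hX) hL (D_mul_mem hX hX hL' hL')

end TransversalSection

/-! ### The resolution is crepant -/

/-- The form `θ` generates the forms over `O`. -/
def IsFormGenerator {k : Type u} [Field k] (n : ℕ) {Y : Scheme.{u}} [IsIntegral Y] (g : Y ⟶ Spec (.of k))
    (O : Subring Y.functionField) (θ : RationalForms n g) : Prop :=
  letI := functionFieldAlgebra g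
  ∀ ω, ω ∈ formLattice n g O ↔ ∃ c ∈ O, ω = c • θ

theorem _root_.AlgebraicGeometry.IsAffineOpen.exists_specializes {X : Scheme.{u}} {W : X.Opens} (hW : IsAffineOpen W) {x : X}
    (hx : x ∈ W) (Q : Ideal Γ(X, W)) [hQ : Q.IsPrime] (h : Q ≤ (hW.primeIdealOf ⟨x, hx⟩).asIdeal) :
    ∃ z ∈ W, z ⤳ x ∧ ∀ s, z ∈ X.basicOpen s ↔ s ∉ Q := by
  let q : PrimeSpectrum Γ(X, W) := ⟨Q, hQ⟩
  have h1 : q ⤳ hW.primeIdealOf ⟨x, hx⟩ := (PrimeSpectrum.le_iff_specializes _ _).mp h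
  refine ⟨hW.fromSpec q, ?_, ?_, fun s ↦ ?_⟩
  · have : hW.fromSpec q ∈ Set.range hW.fromSpec := ⟨q, rfl⟩
    rwa [hW.range_fromSpec] at this
  · have h2 := h1.map hW.fromSpec.continuous
    rwa [hW.fromSpec_primeIdealOf] at h2
  · have h3 : hW.fromSpec q ∈ X.basicOpen s ↔ q ∈ hW.fromSpec ⁻¹ᵁ X.basicOpen s := Iff.rfl
    rw [h3, hW.fromSpec_preimage_basicOpen]
    rfl

namespace IsLocalDoubleCover

variable {X B : Scheme.{u}} {ρ : X ⟶ B} {V : B.Opens} {h : Γ(B, V)} {ξ : Γ(X, ρ ⁻¹ᵁ V)}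
  (hd : IsLocalDoubleCover ρ V h ξ)

include hd

theorem eq_of_add_eq {p q p' q' : Γ(B, V)} (he : ρ.app V p + ρ.app V q * ξ = ρ.app V p' + ρ.app V q' * ξ) :
    p = p' ∧ q = q' := by
  have := (hd.2.2.2 (ρ.app V p + ρ.app V q * ξ)).unique (y₁ := (p, q)) (y₂ := (p', q')) rfl he
  exact Prod.mk.inj this

theorem app_injective : Function.Injective (ρ.app V) := fun p q hpq ↦
  (hd.eq_of_add_eq (p := p) (q := 0) (p' := q) (q' := 0) (by rw [hpq])).1

/-- The functions upstairs are free over the base with basis `1, ξ`, so the regularity of `σ, a` can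
be checked on the two components. -/
theorem app_dvd_of_dvd_mul {σ a : Γ(B, V)} (hσ : ∀ c, σ ∣ a * c → σ ∣ c) {r : Γ(X, ρ ⁻¹ᵁ V)}
    (hr : ρ.app V σ ∣ ρ.app V a * r) : ρ.app V σ ∣ r := by
  obtain ⟨c, hc⟩ := hr
  obtain ⟨⟨p, q⟩, rfl, -⟩ := hd.2.2.2 r
  obtain ⟨⟨p', q'⟩, rfl, -⟩ := hd.2.2.2 c
  obtain ⟨h1, h2⟩ := hd.eq_of_add_eq (p := a * p) (q := a * q) (p' := σ * p') (q' := σ * q') (by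
    simp only [map_mul]
    linear_combination hc)
  obtain ⟨u, rfl⟩ := hσ p ⟨_, h1⟩
  obtain ⟨v, rfl⟩ := hσ q ⟨_, h2⟩
  exact ⟨ρ.app V u + ρ.app V v * ξ, by simp only [map_mul]; ring⟩

end IsLocalDoubleCover

namespace TransversalSection

variable {k : Type u} [Field k] {n : ℕ} {S : Base k n} {E : TransversalSection S}
  (C : DoubleCover S (fun i ↦ 4 * S.σ i * E.a i))

/-- Extension over the locus `σ = a = 0`, on which the regular sequence `σ, a` vanishes:
`exists_mul_eq_of_forall_le`, with the primes below that of `x` read as generizations of `x`. -/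
theorem mem_localRingIn_of_forall (h2 : (2 : k) ≠ 0) {X' : Scheme.{u}} [IsIntegral X'] {μ : X' ⟶ C.X}
    (hμ : ∀ z, μ (genericPoint X') ⤳ z) {x : C.X} {c : X'.functionField}
    (h : ∀ z, z ⤳ x → C.ρ z ∈ E.regularLocus → c ∈ localRingIn μ z (hμ z)) : c ∈ localRingIn μ x (hμ x) := by
  have := isIntegral_doubleCover C h2
  have hx : C.ρ x ∈ ⨆ i, S.U i := by rw [S.covers]; trivial
  obtain ⟨i, hi⟩ := Opens.mem_iSup.mp hx
  have hd := C.isLocal i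
  have hxW : x ∈ C.ρ ⁻¹ᵁ S.U i := hi
  have : Nonempty (C.ρ ⁻¹ᵁ S.U i) := ⟨⟨x, hxW⟩⟩
  have : IsDomain Γ(C.X, C.ρ ⁻¹ᵁ S.U i) := inferInstance
  have hσ : C.ρ.app (S.U i) (S.σ i) ≠ 0 := fun h0 ↦
    S.σ_ne_zero i ⟨_, hi⟩ (hd.app_injective (h0.trans (map_zero _).symm))
  have hbasic : ∀ {z : C.X} (hz : z ∈ C.ρ ⁻¹ᵁ S.U i) {s : Γ(S.B, S.U i)},
      z ∈ C.X.basicOpen (C.ρ.app (S.U i) s) → C.ρ z ∈ S.B.basicOpen s := fun hz s hs ↦ by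
    rw [← Scheme.preimage_basicOpen] at hs
    exact hs
  obtain ⟨r, s, hs, hrs⟩ := exists_mul_eq_of_forall_le
    (functionAt_injective hμ ((hμ x).mem_open (C.ρ ⁻¹ᵁ S.U i).isOpen hxW)) hσ
    (fun r ↦ hd.app_dvd_of_dvd_mul (a := E.a i) fun c ↦ E.σ_dvd_of_dvd_mul i)
    (hd.2.1.primeIdealOf ⟨x, hxW⟩).asIdeal (g := c) fun Q _ hQ hQ' ↦ by
      obtain ⟨z, hz, hzx, hzQ⟩ := hd.2.1.exists_specializes hxW Q hQ
      have hreg : C.ρ z ∈ E.regularLocus := by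
        rw [mem_regularLocus (i := i) hz]
        exact hQ'.imp (fun h ↦ hbasic hz ((hzQ _).mpr h)) (fun h ↦ hbasic hz ((hzQ _).mpr h))
      obtain ⟨r, s, hs, hrs⟩ := (mem_localRingIn_iff hd.2.1 hz (hμ z)).mp (h z hzx hreg)
      exact ⟨r, s, (hzQ s).mp hs, hrs⟩
  refine (mem_localRingIn_iff hd.2.1 hxW (hμ x)).mpr ⟨r, s, ?_, hrs⟩
  rwa [mem_primeIdealOf_iff, not_not] at hs

/-- A form that generates the forms at the smooth generizations of `x` generates the canonical sheaf at `x`. -/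
theorem mem_canonicalStalk_iff (h2 : (2 : k) ≠ 0) {X' : Scheme.{u}} [IsIntegral X'] {μ : X' ⟶ C.X}
    (hμ : ∀ z, μ (genericPoint X') ⤳ z) {x : C.X} {θ : RationalForms n (μ ≫ C.str)}
    (h : ∀ z, z ⤳ x → C.ρ z ∈ E.regularLocus → IsFormGenerator n (μ ≫ C.str) (localRingIn μ z (hμ z)) θ)
    (ω : RationalForms n (μ ≫ C.str)) :
    letI := functionFieldAlgebra (μ ≫ C.str)
    ω ∈ canonicalStalk n C.str μ hμ x ↔ ∃ c ∈ localRingIn μ x (hμ x), ω = c • θ := by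
  let _ := functionFieldAlgebra (μ ≫ C.str)
  have := S.integral
  have := C.flat
  have : Nonempty C.X := ⟨x⟩
  have hη : C.ρ (μ (genericPoint X')) ∈ E.regularLocus :=
    (hμ _).mem_open (C.ρ ⁻¹ᵁ E.regularLocus).isOpen
      (dense_preimage_of_flat C.ρ regularLocus_nonempty).nonempty.choose_spec
  constructor
  · intro hω
    have h' : ∀ z, z ⤳ x → C.ρ z ∈ E.regularLocus → ∃ c ∈ localRingIn μ z (hμ z), ω = c • θ :=
      fun z hz hzR ↦ (h z hz hzR ω).mp (hω z hz ((smoothAt_iff_mem_regularLocus C h2).mpr hzR))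
    -- The coefficient of `ω` is found at the image of the generic point. If `θ ≠ 0`, the
    -- coefficients at all smooth generizations equal it, so it is regular at each of them and
    -- extends to `x`.
    obtain ⟨c, -, hc⟩ := h' (μ (genericPoint X')) (hμ x) hη
    by_cases h0 : θ = 0
    · exact ⟨0, zero_mem _, by rw [hc, h0, smul_zero, smul_zero]⟩
    · refine ⟨c, mem_localRingIn_of_forall C h2 hμ fun z hz hzR ↦ ?_, hc⟩
      obtain ⟨d, hd, hd'⟩ := h' z hz hzR
      have h1 : c = d := smul_left_injective X'.functionField h0 (hc.symm.trans hd')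
      rwa [h1]
  · rintro ⟨c, hc, rfl⟩ z hz hzs
    exact (h z hz ((smoothAt_iff_mem_regularLocus C h2).mp hzs) _).mpr ⟨c, localRingIn_mono hz (hμ z) hc, rfl⟩

variable {X' : Scheme.{u}} {f : X' ⟶ S.B} {W : S.I × Bool → X'.Opens} {t : ∀ j, Γ(X', W j)}
  (N : IsModel (E.atlas 2 1 one_mul_two) f W t)

include N in
theorem exists_generator [IsIntegral X'] (h2 : (2 : k) ≠ 0) {g : X' ⟶ Spec (.of k)} (hg : g = f ≫ S.str) (y : X') :
    ∃ θ, IsFormGenerator n g (localRingIn (𝟙 X') y (genericPoint_specializes y)) θ := by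
  have := S.smooth
  obtain ⟨⟨i, κ⟩, hj⟩ := N.cover y
  have hc : IsChart f (S.U i) (W (i, κ)) (rootPoly κ 2 (S.σ i) (E.a i)) (t (i, κ)) := N.chart (i, κ)
  refine hc.exists_generator hg hj (str := S.str) (S.affine i) ?_
  intro Q _ hQ
  let _ := sectionsAlgebra S.str (S.U i)
  have h1 : S.σ i ∈ Q.comap Polynomial.C → _ := fun h ↦
    (S.σ_smooth i (Q.comap Polynomial.C) (fun j ↦ by fin_cases j; exact h)).2
  have h3 : E.a i ∈ Q.comap Polynomial.C → _ := fun h ↦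
    (E.smooth i (Q.comap Polynomial.C) (fun j ↦ by fin_cases j; exact h)).2
  have h4 : S.σ i ∈ Q.comap Polynomial.C → E.a i ∈ Q.comap Polynomial.C → _ := fun h h' ↦
    (E.transversal i (Q.comap Polynomial.C) (fun j ↦ by fin_cases j; exacts [h, h'])).2
  cases κ
  · exact differential_chart₁_ne_zero h2 h1 h3 h4 hQ
  · exact differential_chart₀_ne_zero h2 h1 h3 h4 hQ

variable {μ : X' ⟶ C.X} (hμρ : μ ≫ C.ρ = f)
  (hμ : ∀ j, ∃ e : W j ≤ μ ⁻¹ᵁ (C.ρ ⁻¹ᵁ S.U j.1), μ.appLE _ _ e (C.ξ j.1) =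
    2 * f.appLE _ _ (le_preimage N j) (exceptional j.2 (S.σ j.1) (E.a j.1)) * t j)

include N hμρ hμ in
-- Over the smooth locus `μ` identifies the local rings, and any local generator serves. Over a
-- singular point the form of `exists_generator_of_singular` generates both at the points upstairs
-- and, through the isomorphism, at all smooth generizations downstairs.
theorem isCrepant [IsIntegral X'] (h2 : (2 : k) ≠ 0) : IsCrepant n C.str μ := by
  have := isIntegral_doubleCover C h2
  have := isIso_restrict N C hμρ hμ h2
  have := C.flat
  have hg : μ ≫ C.str = f ≫ S.str := by rw [← hμρ, Category.assoc]; rfl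
  have hsm := smooth_resolution h2 N
  let R := C.ρ ⁻¹ᵁ E.regularLocus
  have := S.integral
  have hgen : ∀ z, μ (genericPoint X') ⤳ z :=
    specializes_of_morphismRestrict (W := R) (dense_preimage_of_flat C.ρ regularLocus_nonempty).nonempty
  have hsmooth : ∀ z : X', SmoothAt (μ ≫ C.str) z := fun z ↦ by
    refine ⟨⊤, trivial, ?_⟩
    rw [hg]
    infer_instance
  let _ := functionFieldAlgebra (μ ≫ C.str)
  have hf : ∀ z, f z = C.ρ (μ z) := fun z ↦ by rw [← hμρ]; rfl
  have hlocal : ∀ z, C.ρ (μ z) ∈ E.regularLocus →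
      localRingIn μ (μ z) (hgen _) = localRingIn (𝟙 X') z (genericPoint_specializes z) := fun z hz ↦ by
    have := isIso_stalkMap_of_morphismRestrict (μ := μ) (W := R) (y := z) hz
    exact localRingIn_eq_of_isIso _
  -- All points upstairs are smooth and the lattices grow under generization, so regularity at every
  -- generization of `y` is regularity at `y`.
  have hforms : ∀ (y : X') (θ : RationalForms n (μ ≫ C.str)),
      IsFormGenerator n (μ ≫ C.str) (localRingIn (𝟙 X') y (genericPoint_specializes y)) θ →
      ∀ ω : RationalForms n (μ ≫ C.str),
        (∀ z : X', z ⤳ y → SmoothAt (μ ≫ C.str) z →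
          ω ∈ formLattice n (μ ≫ C.str) (localRingIn (𝟙 X') z (genericPoint_specializes z))) ↔
        ∃ c ∈ localRingIn (𝟙 X') y (genericPoint_specializes y), ω = c • θ := by
    intro y θ hθ ω
    refine Iff.trans ⟨fun h ↦ h y specializes_rfl (hsmooth y), fun h z hz _ ↦ formLattice_mono ?_ h⟩ (hθ ω)
    exact localRingIn_mono (μ := 𝟙 X') hz (id_specializes z)
  refine ⟨hgen, fun y ↦ ?_⟩
  by_cases hy : C.ρ (μ y) ∈ E.regularLocus
  · obtain ⟨θ, hθ⟩ := exists_generator N h2 hg y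
    have hθ' : IsFormGenerator n (μ ≫ C.str) (localRingIn μ (μ y) (hgen (μ y))) θ := by
      rwa [hlocal y hy]
    refine ⟨θ, fun ω ↦ Iff.trans ?_ (hθ' ω), hforms y θ hθ⟩
    refine ⟨fun h ↦ h _ specializes_rfl ((smoothAt_iff N C hμρ hμ h2).mpr hy), fun h z hz _ ↦ ?_⟩
    exact formLattice_mono (localRingIn_mono hz (hgen z)) h
  · have hb : C.ρ (μ y) ∈ ⨆ i, S.U i := by rw [S.covers]; trivial
    obtain ⟨i, hi⟩ := Opens.mem_iSup.mp hb
    have hy' := hy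
    rw [mem_regularLocus hi, not_or] at hy'
    obtain ⟨θ, hθ⟩ := exists_generator_of_singular N C hμ h2 hg hi hy'.1 hy'.2
    have hθ' : ∀ z, z ⤳ μ y → C.ρ z ∈ E.regularLocus →
        IsFormGenerator n (μ ≫ C.str) (localRingIn μ z (hgen z)) θ := by
      intro z hz hzR
      obtain ⟨z, rfl⟩ := exists_of_mem_of_morphismRestrict (μ := μ) (W := R) (z := z) hzR
      rw [hlocal z hzR]
      refine hθ z ?_
      rw [hf]
      exact hz.map C.ρ.continuous
    exact ⟨θ, mem_canonicalStalk_iff C h2 hgen hθ', hforms y θ (hθ y (by rw [hf]))⟩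

end TransversalSection

/-! ### Unitary Tate forms -/

theorem TransversalSection.hasAdmissibleCrepantResolution {k : Type u} [Field k] (h2 : (2 : k) ≠ 0) {n : ℕ}
    {S : Base k n} (E : TransversalSection S) (C : DoubleCover S (fun i ↦ 4 * S.σ i * E.a i)) :
    HasAdmissibleCrepantResolution S E.a C := by
  obtain ⟨B', π, V, r, M⟩ := exists_model (E.atlas 1 2 two_mul_one)
  obtain ⟨X', f, W, t, N⟩ := exists_model (E.atlas 2 1 one_mul_two)
  obtain ⟨ρ', hρ, hr⟩ := exists_cover M N
  obtain ⟨inv, hinv, hι⟩ := exists_involution N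
  obtain ⟨μ, hμρ, hμ⟩ := exists_resolution N C
  have sq : μ ≫ C.ρ = ρ' ≫ π := by rw [hμρ, hρ]
  have hX' := E.isIntegral_of_isModel N
  obtain ⟨hinv₂, hinvμ⟩ := involution_comp N C hμρ hμ hinv hι
  -- The coordinate of the blow-up pulls back to `t²`, which is unchanged by `t ↦ -t`.
  have hinvρ : inv ≫ ρ' = ρ' := by
    refine M.hom_ext (by rw [Category.assoc, hρ, hinv]) fun x ↦ ?_
    obtain ⟨j, hj⟩ := N.cover x
    obtain ⟨e, he⟩ := hr j
    obtain ⟨eι, hιt⟩ := hι j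
    refine ⟨W j, j, eι.trans (inv.preimage_mono e), e, hj, ?_⟩
    have h1 := appLE_comp inv ρ' e eι (eι.trans (inv.preimage_mono e)) (r j)
    refine h1.trans ?_
    rw [he, map_pow, hιt, neg_sq]
  exact ⟨B', X', π, μ, ρ', inv, hX', sq, isBlowup M, isResolution N C hμρ hμ h2,
    isCrepant C N hμρ hμ h2, hinv₂, hinvμ, hinvρ, exists_local_cover M N C h2 hρ hr hμ hι,
    isFinite_lift M N C hρ hr sq, isIso_lift_restrict M N C hμρ hμ h2 sq⟩

namespace TateForm

variable {k : Type u} [Field k] {n : ℕ} {S : Base k n} {T : TateType} (F : TateForm S T) (hT : T.IsUnitary)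

include hT

theorem isSection_c2 : IsSection S.L S.D 2 (-1) F.c2 := by
  have := F.sec2
  rwa [hT.mult_eq.2.1] at this

theorem isSection_c1 : IsSection S.L S.D 1 0 F.c1 := by
  have := F.sec1
  rwa [hT.mult_eq.1] at this

theorem a1_eq (i : S.I) : F.a1 i = F.c1 i := by
  rw [a1, hT.mult_eq.1, pow_zero, one_mul]

theorem a2_eq (i : S.I) : F.a2 i = S.σ i * F.c2 i := by
  rw [a2, hT.mult_eq.2.1, pow_one]

theorem isSection_four_mul_c2 : IsSection S.L S.D 2 0 (fun i ↦ 4 * S.σ i * F.c2 i) := by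
  have h := ((S.σ_section.mul (F.isSection_c2 hT)).const_mul S.str 4).congr (zero_add 2) (add_neg_cancel 1)
  simpa only [map_ofNat, ← mul_assoc] using h

theorem isSection_branch : IsSection S.L S.D 2 0 (fun i ↦ F.a1 i ^ 2 + 4 * S.σ i * F.c2 i) := by
  have h := (((F.isSection_c1 hT).pow 2).congr (p' := 2) (q' := 0) (by norm_num) (by norm_num)).add
    (F.isSection_four_mul_c2 hT)
  simpa only [F.a1_eq hT] using h

/-- The section `a_{2,1}` of a unitary Tate form. -/
def transversalSection (h₁ : ∀ i, IsTransversal S.str (S.U i) ![F.c2 i])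
    (h₂ : ∀ i, IsTransversal S.str (S.U i) ![S.σ i, F.c2 i]) : TransversalSection S where
  a := F.c2
  isSection := F.isSection_c2 hT
  smooth := h₁
  transversal := h₂

end TateForm

end WeakCoupling

end

/-! ### Assembly of the theorem -/

theorem mainTheorem5 {k : Type u} [Field k] (h2 : (2 : k) ≠ 0) {n : ℕ}
    (S : WeakCoupling.Base k n) :
    -- the two limits for an arbitrary Tate form
    (∀ (T : WeakCoupling.TateType) (F : WeakCoupling.TateForm S T),
      (∀ i,
        WeakCoupling.IsSenLimit (F.dwFamily i) (F.a1 i ^ 2 + 4 * F.a2 i)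
          (F.a1 i * F.a3 i + 2 * F.a4 i) (F.a3 i ^ 2 + 4 * F.a6 i) ∧
        WeakCoupling.IsSenLimit (F.orthFamily i) (4 * F.a2 i)
          (2 * F.a4 i) (F.a3 i ^ 2 + 4 * F.a6 i) ∧
        (F.orthFamily i).Δ.coeff 0 = 0 ∧ (F.orthFamily i).Δ.coeff 1 = 0 ∧
        4 * (F.orthFamily i).Δ.coeff 2 = -((4 * F.a2 i) ^ 2 *
          (4 * F.a2 i * (F.a3 i ^ 2 + 4 * F.a6 i) - (2 * F.a4 i) ^ 2))) ∧
      -- every orthogonal limit is a Donagi–Wijnholt limit of the same type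
      (∃ F' : WeakCoupling.TateForm S T,
        WeakCoupling.SameLimit (F'.dwFamily) (F.orthFamily)) ∧
      -- conversely, except when the form is unitary and `σ` does not divide `a₁`
      ((∃ F' : WeakCoupling.TateForm S T,
        WeakCoupling.SameLimit (F'.orthFamily) (F.dwFamily)) ↔
        ¬ (T.IsUnitary ∧ ¬ ∀ i, S.σ i ∣ F.a1 i))) ∧
    -- the table: `a₂` but not `a₁` is required to vanish on `σ = 0` exactly for the unitary forms
    (∀ T : WeakCoupling.TateType, (T.mult.m1 = 0 ∧ 1 ≤ T.mult.m2) ↔ T.IsUnitary) ∧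
    -- the unitary Tate forms, with `F.c2` the section `a_{2,1}`
    (∀ (T : WeakCoupling.TateType) (F : WeakCoupling.TateForm S T), T.IsUnitary →
      -- the branch sections are `a₁² + 4 σ a_{2,1}` and `4 σ a_{2,1}`, and the covers exist
      (∀ i, (F.dwFamily i).b₂.coeff 0 = F.a1 i ^ 2 + 4 * S.σ i * F.c2 i ∧
        (F.orthFamily i).b₂.coeff 0 = 4 * S.σ i * F.c2 i) ∧
      ((∀ i, S.σ i ∣ (F.dwFamily i).b₂.coeff 0) ↔ ∀ i, S.σ i ∣ F.a1 i) ∧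
      Nonempty (WeakCoupling.DoubleCover S (fun i => F.a1 i ^ 2 + 4 * S.σ i * F.c2 i)) ∧
      Nonempty (WeakCoupling.DoubleCover S (fun i => 4 * S.σ i * F.c2 i)) ∧
      -- conifold points of the Donagi–Wijnholt double cover
      (∀ C : WeakCoupling.DoubleCover S (fun i => F.a1 i ^ 2 + 4 * S.σ i * F.c2 i),
        (∀ i, WeakCoupling.IsTransversal S.str (S.U i) ![F.a1 i, S.σ i, F.c2 i]) →
        ∀ (i : S.I) (x : C.X), C.ρ x ∈ S.U i →
          C.ρ x ∉ S.B.basicOpen (F.a1 i) → C.ρ x ∉ S.B.basicOpen (S.σ i) →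
          C.ρ x ∉ S.B.basicOpen (F.c2 i) →
          WeakCoupling.IsConifold C.str x) ∧
      -- the orthogonal double cover: quadric cones and their resolution
      (∀ C : WeakCoupling.DoubleCover S (fun i => 4 * S.σ i * F.c2 i),
        (∀ i, WeakCoupling.IsTransversal S.str (S.U i) ![F.c2 i]) →
        (∀ i, WeakCoupling.IsTransversal S.str (S.U i) ![S.σ i, F.c2 i]) →
        AlgebraicGeometry.IsIntegral C.X ∧
        (∀ (i : S.I) (x : C.X), C.ρ x ∈ S.U i →
          ((¬ WeakCoupling.SmoothAt C.str x ↔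
            C.ρ x ∉ S.B.basicOpen (S.σ i) ∧ C.ρ x ∉ S.B.basicOpen (F.c2 i)) ∧
          (¬ WeakCoupling.SmoothAt C.str x → WeakCoupling.IsQuadricCone C.str x))) ∧
        WeakCoupling.HasAdmissibleCrepantResolution S F.c2 C)) := by
  refine ⟨fun T F ↦ ⟨fun i ↦ ?_, F.exists_sameLimit_orth, F.exists_sameLimit_dw_iff h2⟩,
    WeakCoupling.TateType.isUnitary_iff, fun T F hT ↦ ⟨fun i ↦ ⟨?_, ?_⟩, F.dvd_b₂_iff hT,
      WeakCoupling.nonempty_doubleCover S (F.isSection_branch hT),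
      WeakCoupling.nonempty_doubleCover S (F.isSection_four_mul_c2 hT), fun C ht i x hx h₁ h₂ h₃ ↦
        WeakCoupling.isConifold_of_isTransversal h2 C (ht i) hx h₁ h₂ h₃, fun C h₁ h₂ ↦ ?_⟩⟩
  · obtain ⟨h₀, h₁, h₂⟩ := F.orthFamily_discriminant i
    exact ⟨F.dwFamily_isSenLimit i, F.orthFamily_isSenLimit i, h₀, h₁, h₂⟩
  · rw [(F.dwFamily_isSenLimit i).1, F.a2_eq hT, mul_assoc]
  · rw [(F.orthFamily_isSenLimit i).1, F.a2_eq hT, mul_assoc]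
  · let E := F.transversalSection hT h₁ h₂
    have hsing : ∀ (i : S.I) (x : C.X), C.ρ x ∈ S.U i → (¬ WeakCoupling.SmoothAt C.str x ↔
        C.ρ x ∉ S.B.basicOpen (S.σ i) ∧ C.ρ x ∉ S.B.basicOpen (F.c2 i)) := fun i x hx ↦ by
      refine (not_congr ((WeakCoupling.TransversalSection.smoothAt_iff_mem_regularLocus (E := E) C h2).trans
        (WeakCoupling.TransversalSection.mem_regularLocus hx))).trans ?_
      rw [not_or]
      rfl
    refine ⟨WeakCoupling.TransversalSection.isIntegral_doubleCover (E := E) C h2, fun i x hx ↦ ⟨hsing i x hx, fun hs ↦ ?_⟩,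
      E.hasAdmissibleCrepantResolution h2 C⟩
    obtain ⟨hσ, ha⟩ := (hsing i x hx).mp hs
    exact WeakCoupling.TransversalSection.isQuadricCone (E := E) C hx hσ ha h2
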